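/- Let $X$ be a compact complex manifold with $\bar\partial$-Dolbeault algebra $(\mathcal A^{0,\bullet},\bar\partial)$, and let $\{U_i\}_{i\in I}$ be a locally finite open cover of $X$. **Conventions.** For an open set $U\subseteq X$ let $\mathcal A(U)=\varinjlim_{V\supseteq\overline U}(\mathcal A^{0,\bullet}(V),\bar\partial)$, the colimit over the open sets $V$ containing the closure of $U$; this is a presheaf of differential graded algebras, $\mathcal A^0(U)$ is its degree zero part, and $\mathcal A(X)=\mathcal A^{0,\bullet}(X)$. Write $U_{i_0\dots i_p}=U_{i_0}\cap\dots\cap U_{i_p}$. *Modules.* A quasi-cohesive module over $\mathcal A(U)$ is a $\mathbb Z$-graded $\mathcal A^0(U)$-module $E^\bullet$ with a map $\mathbb E$ of total degree $1$ on $E^\bullet\otimes_{\mathcal A^0(U)}\mathcal A(U)$ such that $\mathbb E(e\otimes\omega)=\mathbb E(e\otimes1)\,\omega+(-1)^{|e|}e\otimes\bar\partial\omega$ and $\mathbb E\circ\mathbb E=0$. It is cohesive if $E^\bullet$ is bounded and every $E^n$ is finitely generated projective. Morphisms of degree $k$ are the right $\mathcal A(U)$-linear maps $E^\bullet\otimes\mathcal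 A(U)\to F^\bullet\otimes\mathcal A(U)$ of total degree $k$, with differential $d\phi=\mathbb F\phi-(-1)^k\phi\,\mathbb E$. Let $\mathcal C_{\mathcal A(U)}$ and $\mathcal P_{\mathcal A(U)}$ be the differential graded categories of quasi-cohesive and of cohesive modules. A closed morphism of degree zero is a quasi-isomorphism if the induced map of complexes $(E^\bullet,\mathbb E^0)\to(F^\bullet,\mathbb F^0)$ is a quasi-isomorphism, $\mathbb E^0$ being the component $E^\bullet\to E^{\bullet+1}$ of $\mathbb E$. *Twisted complexes.* A twisted complex $\mathcal F\in\mathrm{Tw}(X,\mathcal P_{\mathcal A},U_i)$ consists of cohesive modules $\mathcal F_i$ over $\mathcal A(U_i)$ and $a=\sum_{p\ge0}a^{p,1-p}$, where $a^{0,1}_i$ is the connection of $\mathcal F_i$ and, for $p\ge1$, $a^{p,1-p}_{i_0\dots i_p}$ is a morphism of degree $1-p$ from $\mathcal F_{i_p}$ to $\mathcal F_{i_0}$ over $U_{i_0\dots i_p}$, such that $\delta a+a\cdot a=0$ and every $a^{1,0}_{ii}$ is invertible up to homotopy. Here $(\delta u)_{i_0\dots i_{p+1}}=\sum_{k=1}^{p}(-1)^ku_{i_0\dots\widehat{i_k}\dots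 i_{p+1}}$, and $(u\cdot v)_{i_0\dots i_{p+r}}=(-1)^{qr}u^{p,q}_{i_0\dots i_p}\,v^{r,s}_{i_p\dots i_{p+r}}$. Morphisms $\phi:(\mathcal F,a)\to(\mathcal G,b)$ of degree $n$ are families $\phi=\sum_{p\ge0}\phi^{p,n-p}$ of morphisms $\phi^{p,n-p}_{i_0\dots i_p}:\mathcal F_{i_p}\to\mathcal G_{i_0}$ over $U_{i_0\dots i_p}$ of degree $n-p$, with differential $d\phi=\delta\phi+b\cdot\phi-(-1)^n\phi\cdot a$ and composition $\cdot$. *Functors.* The twisting functor $\mathcal T$ sends a module $\mathcal E$ over $\mathcal A(X)$ to the restrictions $\mathcal E|_{U_i}$, with $a^{1,0}_{ij}$ the identity and $a^{p,1-p}=0$ for $p\ge2$; on morphisms, $\mathcal T(\phi)^{0}_i=\phi|_{U_i}$ and $\mathcal T(\phi)^p=0$ for $p\geq1$. The sheafification functor $\mathcal S$ sends $(\mathcal F,a)$ to the quasi-cohesive $\mathcal A(X)$-module with $$\mathcal S(\mathcal F)^n=\prod_{p+q=n}\ \prod_{i_0,\dots,i_p}F^{q}_{i_0}|_{U_{i_0\dots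 i_p}}$$ and connection $\delta+a$, where on cochains $(\delta c)_{i_0\dots i_{p+1}}=\sum_{k=1}^{p+1}(-1)^kc_{i_0\dots\widehat{i_k}\dots i_{p+1}}$ and $a$ acts by $a\cdot c$ as above. The counit $\eta_{\mathcal F}:\mathcal T(\mathcal S(\mathcal F))\to\mathcal F$ has as its component at $(i_0,\dots,i_p)$ the projection of $\mathcal S(\mathcal F)$ onto the factor $F_{i_0}|_{U_{i_0\dots i_p}}$. **Statement.** For every twisted complex $\mathcal F\in\mathrm{Tw}(X,\mathcal P_{\mathcal A},U_i)$ there are a cohesive module $\mathcal E\in\mathcal P_{\mathcal A(X)}$ and a quasi-isomorphism $\phi:\mathcal E\to\mathcal S(\mathcal F)$ in $\mathcal C_{\mathcal A(X)}$. Moreover, the corresponding morphism $\eta_{\mathcal F}\circ\mathcal T(\phi):\mathcal T(\mathcal E)\to\mathcal F$ is a homotopy equivalence in $\mathrm{Tw}(X,\mathcal P_{\mathcal A},U_i)$, i.e. it is closed of degree zero and has a closed inverse of degree zero up to differentials of morphisms of degree $-1$. -/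

import Mathlib

open scoped TensorProduct DirectSum

universe u v w v' w' v''

set_option linter.unusedVariables false
set_option linter.unusedSectionVars false

namespace Cohesive

/-- The sign `(-1)^m`. -/
def sgn (m : ℤ) : ℤ := (m.negOnePow : ℤ)

theorem sgn_add (a b : ℤ) : sgn (a + b) = sgn a * sgn b := by
  simp [sgn, Int.negOnePow_add]

theorem sgn_zero : sgn 0 = 1 := by simp [sgn]

theorem sgn_one : sgn 1 = -1 := by simp [sgn]

theorem sgn_mul_self (a : ℤ) : sgn a * sgn a = 1 := by
  rw [← sgn_add]; simp [sgn, Int.negOnePow_even _ (Even.add_self a)]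

theorem sgn_congr {a b : ℤ} (h : Even (a - b)) : sgn a = sgn b := by
  have h1 : sgn a = sgn (a - b) * sgn b := by rw [← sgn_add]; congr 1; ring
  rw [h1]; simp [sgn, Int.negOnePow_even _ h]

theorem sgn_congr_odd {a b : ℤ} (h : Even (a - b - 1)) : sgn a = - sgn b := by
  rw [sgn_congr (b := b + 1) (by convert h using 1; ring), sgn_add, sgn_one]; ring

/-- A presheaf of differential graded algebras on a preordered set `α` (in practice the open
subsets of a space).  `A U` is the algebra, `gr U j` its part of degree `j`, `d` its differential,
`A0 U` its degree zero part, which is commutative and central, and `ε` the projection onto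
degree zero. -/
structure DGPresheaf (α : Type w) [Preorder α] where
  A0 : α → Type u
  A : α → Type u
  [commRing : ∀ U, CommRing (A0 U)]
  [ring : ∀ U, Ring (A U)]
  [algebra : ∀ U, Algebra (A0 U) (A U)]
  gr : ∀ U, ℕ → Submodule (A0 U) (A U)
  d : ∀ U, A U →+ A U
  ε : ∀ U, A U →ₐ[A0 U] A0 U
  res0 : ∀ {U V}, V ≤ U → A0 U →+* A0 V
  res : ∀ {U V}, V ≤ U → A U →+* A V
  mem_gr_zero : ∀ U (a : A U), a ∈ gr U 0 ↔ ∃ r, algebraMap (A0 U) (A U) r = a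
  mul_mem_gr : ∀ U (i j : ℕ) (a b : A U), a ∈ gr U i → b ∈ gr U j → a * b ∈ gr U (i + j)
  d_mem_gr : ∀ U (j : ℕ) (a : A U), a ∈ gr U j → d U a ∈ gr U (j + 1)
  d_mul : ∀ U (j : ℕ) (a b : A U), a ∈ gr U j →
    d U (a * b) = d U a * b + sgn j • (a * d U b)
  d_d : ∀ U (a : A U), d U (d U a) = 0
  ε_gr : ∀ U (j : ℕ) (a : A U), 0 < j → a ∈ gr U j → ε U a = 0
  res0_refl : ∀ U (a : A0 U), res0 (le_refl U) a = a
  res_refl : ∀ U (a : A U), res (le_refl U) a = a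
  res0_res0 : ∀ {U V W} (h : V ≤ U) (h' : W ≤ V) (a : A0 U),
    res0 h' (res0 h a) = res0 (h'.trans h) a
  res_res : ∀ {U V W} (h : V ≤ U) (h' : W ≤ V) (a : A U), res h' (res h a) = res (h'.trans h) a
  res_algebraMap : ∀ {U V} (h : V ≤ U) (a : A0 U),
    res h (algebraMap (A0 U) (A U) a) = algebraMap (A0 V) (A V) (res0 h a)
  res_mem_gr : ∀ {U V} (h : V ≤ U) (j : ℕ) (a : A U), a ∈ gr U j → res h a ∈ gr V j
  res_d : ∀ {U V} (h : V ≤ U) (a : A U), res h (d U a) = d V (res h a)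
  res_ε : ∀ {U V} (h : V ≤ U) (a : A U), res0 h (ε U a) = ε V (res h a)

attribute [instance] DGPresheaf.commRing DGPresheaf.ring DGPresheaf.algebra

section Presheaf

variable {α : Type w} [Preorder α] (𝒜 : DGPresheaf.{u} α) {U V W : α}

/-- The degree zero algebra over `V`, regarded as an algebra over the one over `U ⊇ V`. -/
def Sec0 (_h : V ≤ U) : Type u := 𝒜.A0 V

/-- The algebra over `V`, regarded as an algebra over the degree zero algebra over `U ⊇ V`. -/
def Sec (_h : V ≤ U) : Type u := 𝒜.A V

instance (h : V ≤ U) : CommRing (Sec0 𝒜 h) := inferInstanceAs (CommRing (𝒜.A0 V))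

instance (h : V ≤ U) : Algebra (𝒜.A0 U) (Sec0 𝒜 h) :=
  RingHom.toAlgebra (S := Sec0 𝒜 h) (𝒜.res0 h)

instance (h : V ≤ U) : Ring (Sec 𝒜 h) := inferInstanceAs (Ring (𝒜.A V))

instance (h : V ≤ U) : Algebra (𝒜.A0 U) (Sec 𝒜 h) :=
  RingHom.toAlgebra' (S := Sec 𝒜 h) ((algebraMap (𝒜.A0 V) (𝒜.A V)).comp (𝒜.res0 h))
    fun r x => Algebra.commutes (A := 𝒜.A V) (𝒜.res0 h r) x

/-- The image in the algebra over `V` of an element of degree zero over `U ⊇ V`. -/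
def DGPresheaf.inc (h : V ≤ U) (r : 𝒜.A0 U) : 𝒜.A V := algebraMap (𝒜.A0 V) (𝒜.A V) (𝒜.res0 h r)

theorem sec_smul (h : V ≤ U) (r : 𝒜.A0 U) (b : Sec 𝒜 h) :
    r • b = (𝒜.inc h r * (show 𝒜.A V from b) : 𝒜.A V) := rfl

theorem sec0_smul (h : V ≤ U) (r : 𝒜.A0 U) (b : Sec0 𝒜 h) :
    r • b = (𝒜.res0 h r * (show 𝒜.A0 V from b) : 𝒜.A0 V) := rfl

theorem inc_mem (h : V ≤ U) (r : 𝒜.A0 U) : 𝒜.inc h r ∈ 𝒜.gr V 0 :=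
  (𝒜.mem_gr_zero V _).2 ⟨_, rfl⟩

theorem inc_comm (h : V ≤ U) (r : 𝒜.A0 U) (b : 𝒜.A V) : 𝒜.inc h r * b = b * 𝒜.inc h r :=
  Algebra.commutes (A := 𝒜.A V) (𝒜.res0 h r) b

theorem one_mem_gr : (1 : 𝒜.A V) ∈ 𝒜.gr V 0 :=
  (𝒜.mem_gr_zero V _).2 ⟨1, map_one _⟩

theorem res_inc (h : V ≤ U) (h' : W ≤ V) (r : 𝒜.A0 U) :
    𝒜.res h' (𝒜.inc h r) = 𝒜.inc (h'.trans h) r := by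
  simp [DGPresheaf.inc, 𝒜.res_algebraMap, 𝒜.res0_res0]

theorem inc_res0 (h : V ≤ U) (h' : W ≤ V) (r : 𝒜.A0 U) :
    𝒜.inc h' (𝒜.res0 h r) = 𝒜.inc (h'.trans h) r := by
  simp [DGPresheaf.inc, 𝒜.res0_res0]

theorem inc_mul (h : V ≤ U) (r s : 𝒜.A0 U) : 𝒜.inc h (r * s) = 𝒜.inc h r * 𝒜.inc h s := by
  simp [DGPresheaf.inc]

theorem inc_one (h : V ≤ U) : 𝒜.inc h 1 = 1 := by simp [DGPresheaf.inc]

theorem inc_add (h : V ≤ U) (r s : 𝒜.A0 U) : 𝒜.inc h (r + s) = 𝒜.inc h r + 𝒜.inc h s := by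
  simp [DGPresheaf.inc]

theorem d_one : 𝒜.d V 1 = 0 := by
  have h := 𝒜.d_mul V 0 1 1 (one_mem_gr 𝒜)
  simpa [sgn_zero] using h

/-- A graded module over the degree zero algebra of `U`. -/
structure GMod (U : α) where
  Q : ℤ → Type v
  [addCommGroup : ∀ n, AddCommGroup (Q n)]
  [module : ∀ n, Module (𝒜.A0 U) (Q n)]

attribute [instance] GMod.addCommGroup GMod.module

/-! ### The total module -/

section Tot

variable {𝒜}
variable (M : GMod.{u, v} 𝒜 U)

/-- The module `Q ⊗ A(V)` over the algebra of `V`, for a graded module `Q = M.Q` over the degree zero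
algebra of `U ⊇ V`; the tensor product is over the degree zero algebra of `U`. -/
def Tot (h : V ≤ U) : Type (max u v) := ⨁ n, (M.Q n ⊗[𝒜.A0 U] Sec 𝒜 h)

noncomputable instance (h : V ≤ U) : AddCommGroup (Tot M h) :=
  inferInstanceAs (AddCommGroup (⨁ n, (M.Q n ⊗[𝒜.A0 U] Sec 𝒜 h)))

variable {M}

namespace Tot

/-- The element `e ⊗ b` of `Q ⊗ A(V)`. -/
noncomputable def mk (h : V ≤ U) (n : ℤ) (e : M.Q n) (b : 𝒜.A V) : Tot M h :=
  DirectSum.of (fun n => M.Q n ⊗[𝒜.A0 U] Sec 𝒜 h) n (e ⊗ₜ[𝒜.A0 U] (show Sec 𝒜 h from b))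

variable {h : V ≤ U}

theorem mk_add_left (n : ℤ) (e e' : M.Q n) (b : 𝒜.A V) :
    mk h n (e + e') b = mk h n e b + mk h n e' b := by
  unfold mk; rw [TensorProduct.add_tmul]; exact map_add _ _ _

theorem mk_add_right (n : ℤ) (e : M.Q n) (b b' : 𝒜.A V) :
    mk h n e (b + b') = mk h n e b + mk h n e b' := by
  unfold mk
  exact (congrArg _ (TensorProduct.tmul_add e (show Sec 𝒜 h from b) (show Sec 𝒜 h from b'))).trans
    (map_add _ _ _)

/-- `mk` as a biadditive map. -/
noncomputable def mkHom (h : V ≤ U) (n : ℤ) : M.Q n →+ 𝒜.A V →+ Tot M h :=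
  AddMonoidHom.mk' (fun e => AddMonoidHom.mk' (fun b => mk h n e b) (mk_add_right n e))
    (fun e e' => by ext b; exact mk_add_left n e e' b)

@[simp] theorem mkHom_apply (n : ℤ) (e : M.Q n) (b : 𝒜.A V) : mkHom h n e b = mk h n e b := rfl

@[simp] theorem mk_zero_left (n : ℤ) (b : 𝒜.A V) : mk h n (0 : M.Q n) b = 0 := by
  rw [← mkHom_apply, map_zero, AddMonoidHom.zero_apply]

@[simp] theorem mk_zero_right (n : ℤ) (e : M.Q n) : mk h n e (0 : 𝒜.A V) = 0 := by
  rw [← mkHom_apply, map_zero]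

theorem mk_zsmul_right (n : ℤ) (e : M.Q n) (k : ℤ) (b : 𝒜.A V) :
    mk h n e (k • b) = k • mk h n e b := by
  simp only [← mkHom_apply, map_zsmul]

theorem mk_sum_right {ι : Type*} (s : Finset ι) (n : ℤ) (e : M.Q n) (b : ι → 𝒜.A V) :
    mk h n e (∑ i ∈ s, b i) = ∑ i ∈ s, mk h n e (b i) := by
  simp only [← mkHom_apply, map_sum]

theorem mk_smul (n : ℤ) (r : 𝒜.A0 U) (e : M.Q n) (b : 𝒜.A V) :
    mk h n (r • e) b = mk h n e (𝒜.inc h r * b) := by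
  unfold mk
  exact congrArg _ (TensorProduct.smul_tmul r e (show Sec 𝒜 h from b))

/-- A balanced biadditive map on the generators extends to `Q ⊗ A(V)`. -/
noncomputable def lift {P : Type*} [AddCommGroup P] (f : ∀ n, M.Q n → 𝒜.A V → P)
    (h1 : ∀ n e e' b, f n (e + e') b = f n e b + f n e' b)
    (h2 : ∀ n e b b', f n e (b + b') = f n e b + f n e b')
    (h3 : ∀ n (r : 𝒜.A0 U) e b, f n (r • e) b = f n e (𝒜.inc h r * b)) : Tot M h →+ P :=
  DirectSum.toAddMonoid (β := fun n => M.Q n ⊗[𝒜.A0 U] Sec 𝒜 h) fun n =>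
    TensorProduct.liftAddHom (N := Sec 𝒜 h)
      (AddMonoidHom.mk' (fun e => AddMonoidHom.mk' (fun b => f n e b) (h2 n e))
        (fun e e' => by ext b; exact h1 n e e' b))
      (fun r e b => h3 n r e b)

theorem lift_mk {P : Type*} [AddCommGroup P] (f : ∀ n, M.Q n → 𝒜.A V → P) (h1) (h2) (h3)
    (n : ℤ) (e : M.Q n) (b : 𝒜.A V) : lift (h := h) f h1 h2 h3 (mk h n e b) = f n e b := by
  exact (DirectSum.toAddMonoid_of (β := fun n => M.Q n ⊗[𝒜.A0 U] Sec 𝒜 h) _ n _).trans rfl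

theorem induction {p : Tot M h → Prop} (x : Tot M h) (h0 : p 0)
    (hmk : ∀ n e b, p (mk h n e b)) (hadd : ∀ x y, p x → p y → p (x + y)) : p x := by
  refine DirectSum.induction_on (β := fun n => M.Q n ⊗[𝒜.A0 U] Sec 𝒜 h) x h0 (fun n y => ?_) hadd
  refine TensorProduct.induction_on y ?_ (fun e b => hmk n e b) (fun a b ha hb => ?_)
  · rw [map_zero]; exact h0
  · rw [map_add]; exact hadd _ _ ha hb

theorem ext_apply {P : Type*} [AddCommGroup P] {f g : Tot M h →+ P}
    (hfg : ∀ n e b, f (mk h n e b) = g (mk h n e b)) (x : Tot M h) : f x = g x :=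
  induction (p := fun x => f x = g x) x (by rw [map_zero, map_zero]) hfg
    (fun x y hx hy => by rw [map_add, map_add, hx, hy])

theorem hom_ext {P : Type*} [AddCommGroup P] {f g : Tot M h →+ P}
    (hfg : ∀ n e b, f (mk h n e b) = g (mk h n e b)) : f = g :=
  AddMonoidHom.ext (ext_apply hfg)

/-- Right multiplication by an element of `A(V)`. -/
noncomputable def rmul (b : 𝒜.A V) : Tot M h →+ Tot M h :=
  lift (fun n e b' => mk h n e (b' * b)) (fun n e e' b' => mk_add_left n e e' _)
    (fun n e b b' => by rw [add_mul, mk_add_right])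
    (fun n r e b' => by rw [mk_smul, mul_assoc])

@[simp] theorem rmul_mk (b : 𝒜.A V) (n : ℤ) (e : M.Q n) (b' : 𝒜.A V) :
    rmul b (mk h n e b') = mk h n e (b' * b) := lift_mk ..

theorem rmul_rmul (b b' : 𝒜.A V) (x : Tot M h) : rmul b (rmul b' x) = rmul (b' * b) x :=
  ext_apply (f := (rmul b).comp (rmul b')) (g := rmul (b' * b)) (by simp [mul_assoc]) x

theorem rmul_one (x : Tot M h) : rmul 1 x = x :=
  ext_apply (f := rmul 1) (g := AddMonoidHom.id _) (by simp) x

theorem rmul_add (b b' : 𝒜.A V) (x : Tot M h) : rmul (b + b') x = rmul b x + rmul b' x :=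
  ext_apply (f := rmul (b + b')) (g := rmul b + rmul b') (by simp [mul_add, mk_add_right]) x

/-- Restriction of the coefficients from `V` to `W`. -/
noncomputable def res (h : V ≤ U) (h' : W ≤ V) : Tot M h →+ Tot M (h'.trans h) :=
  lift (fun n e b => mk _ n e (𝒜.res h' b)) (fun n e e' b' => mk_add_left n e e' _)
    (fun n e b b' => by rw [map_add, mk_add_right])
    (fun n r e b => by rw [mk_smul, map_mul, res_inc])

@[simp] theorem res_mk (h : V ≤ U) (h' : W ≤ V) (n : ℤ) (e : M.Q n) (b : 𝒜.A V) :
    res h h' (mk h n e b) = mk (h'.trans h) n e (𝒜.res h' b) := lift_mk ..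

theorem res_rmul (h : V ≤ U) (h' : W ≤ V) (b : 𝒜.A V) (x : Tot M h) :
    res h h' (rmul b x) = rmul (𝒜.res h' b) (res h h' x) :=
  ext_apply (f := (res h h').comp (rmul b)) (g := (rmul (𝒜.res h' b)).comp (res h h')) (by simp) x

theorem res_res {W' : α} (h : V ≤ U) (h' : W ≤ V) (h'' : W' ≤ W) (x : Tot M h) :
    res (h'.trans h) h'' (res h h' x) = res h (h''.trans h') x :=
  ext_apply (f := (res (h'.trans h) h'').comp (res h h')) (g := res h (h''.trans h'))
    (by simp [𝒜.res_res]) x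

theorem res_refl (h : V ≤ U) (x : Tot M h) : res h (le_refl V) x = x :=
  ext_apply (f := res h (le_refl V)) (g := AddMonoidHom.id _) (by simp [𝒜.res_refl]) x

/-- The part of `Q ⊗ A(V)` of total degree `m`. -/
noncomputable def deg (M : GMod.{u, v} 𝒜 U) (h : V ≤ U) (m : ℤ) : AddSubgroup (Tot M h) :=
  AddSubgroup.closure {x | ∃ (n : ℤ) (j : ℕ) (e : M.Q n) (b : 𝒜.A V),
    b ∈ 𝒜.gr V j ∧ n + j = m ∧ x = mk h n e b}

theorem mk_mem_deg {n : ℤ} {j : ℕ} {m : ℤ} (e : M.Q n) {b : 𝒜.A V} (hb : b ∈ 𝒜.gr V j)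
    (hm : n + j = m) : mk h n e b ∈ deg M h m :=
  AddSubgroup.subset_closure ⟨n, j, e, b, hb, hm, rfl⟩

theorem deg_induction {m : ℤ} {p : Tot M h → Prop} {x : Tot M h} (hx : x ∈ deg M h m)
    (h0 : p 0) (hadd : ∀ x y, p x → p y → p (x + y)) (hneg : ∀ x, p x → p (-x))
    (hmk : ∀ (n : ℤ) (j : ℕ) (e : M.Q n) (b : 𝒜.A V), b ∈ 𝒜.gr V j → n + j = m →
      p (mk h n e b)) : p x := by
  refine AddSubgroup.closure_induction (p := fun x _ => p x) ?_ h0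
    (fun x y _ _ hx hy => hadd x y hx hy) (fun x _ hx => hneg x hx) hx
  rintro x ⟨n, j, e, b, hb, hm, rfl⟩
  exact hmk n j e b hb hm

/-- An additive map sends `deg m` into the subgroup `S` if it does so on generators. -/
theorem map_deg {P : Type*} [AddCommGroup P] (f : Tot M h →+ P) {m : ℤ} (S : AddSubgroup P)
    (hmk : ∀ (n : ℤ) (j : ℕ) (e : M.Q n) (b : 𝒜.A V), b ∈ 𝒜.gr V j → n + j = m →
      f (mk h n e b) ∈ S) {x : Tot M h} (hx : x ∈ deg M h m) : f x ∈ S :=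
  deg_induction (p := fun x => f x ∈ S) hx (by rw [map_zero]; exact S.zero_mem) (fun x y hx hy => by rw [map_add]; exact S.add_mem hx hy)
    (fun x hx => by rw [map_neg]; exact S.neg_mem hx) hmk

theorem rmul_mem_deg {m m' : ℤ} {j : ℕ} {b : 𝒜.A V} (hb : b ∈ 𝒜.gr V j) (hm : m + j = m')
    {x : Tot M h} (hx : x ∈ deg M h m) : rmul b x ∈ deg M h m' := by
  refine map_deg (rmul b) _ (fun n i e b' hb' hn => ?_) hx
  rw [rmul_mk]
  exact mk_mem_deg e (𝒜.mul_mem_gr V _ _ _ _ hb' hb) (by push_cast; omega)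

theorem res_mem_deg (h : V ≤ U) (h' : W ≤ V) {m : ℤ} {x : Tot M h} (hx : x ∈ deg M h m) :
    res h h' x ∈ deg M (h'.trans h) m := by
  refine map_deg (res h h') _ (fun n i e b' hb' hn => ?_) hx
  rw [res_mk]
  exact mk_mem_deg e (𝒜.res_mem_gr h' _ _ hb') hn

/-- The projection `Q ⊗ A(U) → Q ⊗ A⁰(U) = Q`, in degree `m`. -/
noncomputable def sym (M : GMod.{u, v} 𝒜 U) (m : ℤ) : Tot M (le_refl U) →+ M.Q m :=
  (DFinsupp.evalAddMonoidHom m : (⨁ n, M.Q n) →+ M.Q m).comp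
    (lift (fun n e b => DirectSum.of M.Q n (𝒜.ε U b • e)) (fun n e e' b => by rw [smul_add, map_add])
      (fun n e b b' => by rw [map_add, add_smul, map_add])
      (fun n r e b => by
        rw [map_mul, smul_smul, mul_comm]; simp [DGPresheaf.inc, 𝒜.res0_refl]))

end Tot

end Tot

end Presheaf

section Presheaf

variable {α : Type w} [Preorder α] (𝒜 : DGPresheaf.{u} α) {U V W : α}

/-! ### Quasi-cohesive modules -/

/-- A quasi-cohesive module over the differential graded algebra of `U`: a graded module over the
degree zero part together with a flat `ℤ`-connection. -/
structure QCoh (U : α) extends GMod.{u, v} 𝒜 U where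
  conn : Tot toGMod (le_refl U) →+ Tot toGMod (le_refl U)
  leibniz : ∀ (n : ℤ) (e : toGMod.Q n) (b : 𝒜.A U),
    conn (Tot.mk _ n e b) = Tot.rmul b (conn (Tot.mk _ n e 1)) + sgn n • Tot.mk _ n e (𝒜.d U b)
  conn_deg : ∀ (m : ℤ) (x : Tot toGMod (le_refl U)), x ∈ Tot.deg toGMod (le_refl U) m →
    conn x ∈ Tot.deg toGMod (le_refl U) (m + 1)
  conn_conn : ∀ x, conn (conn x) = 0

variable {𝒜}

namespace QCoh

/-- A quasi-cohesive module is cohesive if it is bounded in both directions and finitely generated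
projective in each degree. -/
def IsCohesive (E : QCoh.{u, v} 𝒜 U) : Prop :=
  (∃ N : ℤ, ∀ n, N < |n| → Subsingleton (E.Q n)) ∧
    ∀ n, Module.Finite (𝒜.A0 U) (E.Q n) ∧ Module.Projective (𝒜.A0 U) (E.Q n)

variable (E : QCoh.{u, v} 𝒜 U)

/-- The connection induced on the restriction of `E` to `V`. -/
noncomputable def connOn (h : V ≤ U) : Tot E.toGMod h →+ Tot E.toGMod h :=
  Tot.lift (fun n e b => Tot.rmul b (Tot.res (le_refl U) h (E.conn (Tot.mk _ n e 1))) +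
      sgn n • Tot.mk h n e (𝒜.d V b))
    (fun n e e' b => by
      simp only [Tot.mk_add_left, map_add, smul_add]; abel)
    (fun n e b b' => by
      simp only [Tot.mk_add_right, map_add, smul_add, Tot.rmul_add]; abel)
    (fun n r e b => by
      have h1 := E.leibniz n e (𝒜.inc (le_refl U) r)
      rw [Tot.mk_smul, mul_one, h1, 𝒜.d_mul V 0 _ _ (inc_mem 𝒜 h r), map_add, map_add, map_zsmul,
        map_zsmul, Tot.res_rmul, Tot.rmul_rmul, Tot.res_mk, Tot.rmul_mk, Tot.mk_smul, 𝒜.res_d,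
        res_inc, Tot.mk_add_right]
      simp only [Nat.cast_zero, sgn_zero, one_smul, smul_add]
      abel)

theorem connOn_mk (h : V ≤ U) (n : ℤ) (e : E.Q n) (b : 𝒜.A V) :
    E.connOn h (Tot.mk h n e b) =
      Tot.rmul b (Tot.res (le_refl U) h (E.conn (Tot.mk _ n e 1))) +
        sgn n • Tot.mk h n e (𝒜.d V b) := Tot.lift_mk ..

theorem connOn_refl (x : Tot E.toGMod (le_refl U)) : E.connOn (le_refl U) x = E.conn x :=
  Tot.ext_apply (f := E.connOn (le_refl U)) (g := E.conn) (fun n e b => by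
    rw [connOn_mk, E.leibniz n e b, Tot.res_refl]) x

theorem connOn_res (h : V ≤ U) (h' : W ≤ V) (x : Tot E.toGMod h) :
    E.connOn (h'.trans h) (Tot.res h h' x) = Tot.res h h' (E.connOn h x) :=
  Tot.ext_apply (f := (E.connOn (h'.trans h)).comp (Tot.res h h'))
    (g := (Tot.res h h').comp (E.connOn h)) (fun n e b => by
      simp only [AddMonoidHom.comp_apply, Tot.res_mk, connOn_mk, map_add, map_zsmul, Tot.res_rmul,
        𝒜.res_d, Tot.res_res]) x

theorem connOn_rmul (h : V ≤ U) (m : ℤ) (x : Tot E.toGMod h) (hx : x ∈ Tot.deg _ h m)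
    (b : 𝒜.A V) :
    E.connOn h (Tot.rmul b x) = Tot.rmul b (E.connOn h x) + sgn m • Tot.rmul (𝒜.d V b) x := by
  refine Tot.deg_induction (p := fun x => E.connOn h (Tot.rmul b x) =
    Tot.rmul b (E.connOn h x) + sgn m • Tot.rmul (𝒜.d V b) x) hx (by simp) ?_ ?_ ?_
  · intro x y hx hy
    simp only [map_add, hx, hy, smul_add]; abel
  · intro x hx
    simp only [map_neg, hx, smul_neg]; abel
  · intro n j e b' hb' hn
    rw [Tot.rmul_mk, connOn_mk, connOn_mk, 𝒜.d_mul V j _ _ hb', ← hn, sgn_add]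
    simp only [map_add, map_zsmul, Tot.rmul_mk, Tot.rmul_rmul, Tot.mk_add_right,
      Tot.mk_zsmul_right, smul_add, mul_smul]
    abel

theorem conn_mk_one_mem (n : ℤ) (e : E.Q n) :
    E.conn (Tot.mk _ n e 1) ∈ Tot.deg E.toGMod (le_refl U) (n + 1) :=
  E.conn_deg n _ (Tot.mk_mem_deg e (one_mem_gr 𝒜) (by simp))

theorem connOn_deg (h : V ≤ U) (m : ℤ) (x : Tot E.toGMod h) (hx : x ∈ Tot.deg _ h m) :
    E.connOn h x ∈ Tot.deg _ h (m + 1) := by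
  refine Tot.map_deg (E.connOn h) _ (fun n j e b hb hn => ?_) hx
  rw [connOn_mk]
  refine AddSubgroup.add_mem _ ?_ (AddSubgroup.zsmul_mem _ ?_ _)
  · exact Tot.rmul_mem_deg hb (by omega) (Tot.res_mem_deg _ h (E.conn_mk_one_mem n e))
  · exact Tot.mk_mem_deg e (𝒜.d_mem_gr V j b hb) (by push_cast; omega)

theorem connOn_connOn (h : V ≤ U) (x : Tot E.toGMod h) : E.connOn h (E.connOn h x) = 0 :=
  Tot.ext_apply (f := (E.connOn h).comp (E.connOn h)) (g := 0) (fun n e b => by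
    have h1 := E.connOn_rmul h (n + 1) _ (Tot.res_mem_deg _ h (E.conn_mk_one_mem n e)) b
    have h2 : E.connOn h (Tot.res (le_refl U) h (E.conn (Tot.mk _ n e 1))) = 0 := by
      rw [connOn_res, connOn_refl, E.conn_conn, map_zero]
    simp only [AddMonoidHom.comp_apply, connOn_mk, map_add, map_zsmul, h1, h2, 𝒜.d_d, sgn_add,
      sgn_one, Tot.mk_zero_right, smul_zero, map_zero, AddMonoidHom.zero_apply]
    simp) x

end QCoh

/-! ### Morphisms -/

section Mor

variable {U₁ U₂ U₃ : α}

/-- A map of total modules over `V` is linear over the algebra of `V`. -/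
def IsLin {M : GMod.{u, v} 𝒜 U₁} {M' : GMod.{u, v'} 𝒜 U₂} {h₁ : V ≤ U₁} {h₂ : V ≤ U₂}
    (f : Tot M h₁ →+ Tot M' h₂) : Prop := ∀ b x, f (Tot.rmul b x) = Tot.rmul b (f x)

/-- The morphisms over `V` between (the restrictions to `V` of) two modules, given over `U₁` and
`U₂`: the maps of total modules that are linear over the algebra of `V`. -/
structure Mor (M : GMod.{u, v} 𝒜 U₁) (M' : GMod.{u, v'} 𝒜 U₂) (h₁ : V ≤ U₁) (h₂ : V ≤ U₂) where
  val : Tot M h₁ →+ Tot M' h₂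
  lin : IsLin val

/-- A map of total modules is of degree `k` if it raises the total degree by `k`. -/
def IsDeg {M : GMod.{u, v} 𝒜 U₁} {M' : GMod.{u, v'} 𝒜 U₂} {h₁ : V ≤ U₁} {h₂ : V ≤ U₂} (k : ℤ)
    (f : Tot M h₁ →+ Tot M' h₂) : Prop :=
  ∀ m x, x ∈ Tot.deg M h₁ m → f x ∈ Tot.deg M' h₂ (m + k)

variable {M : GMod.{u, v} 𝒜 U₁} {M' : GMod.{u, v'} 𝒜 U₂} {h₁ : V ≤ U₁} {h₂ : V ≤ U₂}

theorem Tot.lift_lin (f : ∀ n, M.Q n → 𝒜.A V → Tot M' h₂) (h1) (h2) (h3)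
    (hf : ∀ n e b b', f n e (b * b') = Tot.rmul b' (f n e b)) :
    IsLin (Tot.lift (h := h₁) f h1 h2 h3) := fun b x => Tot.ext_apply
    (f := (Tot.lift (h := h₁) f h1 h2 h3).comp (Tot.rmul b))
    (g := (Tot.rmul b).comp (Tot.lift (h := h₁) f h1 h2 h3)) (fun n e b' => by
      simp only [AddMonoidHom.comp_apply, Tot.rmul_mk, Tot.lift_mk, hf]) x

theorem IsLin.add {f g : Tot M h₁ →+ Tot M' h₂} (hf : IsLin f) (hg : IsLin g) :
    IsLin (f + g) := fun b x => by simp [hf b x, hg b x]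

theorem IsLin.zero : IsLin (0 : Tot M h₁ →+ Tot M' h₂) := fun b x => by simp

theorem IsLin.zsmul {f : Tot M h₁ →+ Tot M' h₂} (hf : IsLin f) (k : ℤ) : IsLin (k • f) :=
  fun b x => by simp [hf b x]

theorem IsLin.sum {κ : Type*} (s : Finset κ) (f : κ → Tot M h₁ →+ Tot M' h₂)
    (hf : ∀ k, IsLin (f k)) : IsLin (∑ k ∈ s, f k) :=
  fun b x => by simp [AddMonoidHom.finsetSum_apply, hf _ b x]

theorem IsLin.comp {M'' : GMod.{u, w'} 𝒜 U₃} {h₃ : V ≤ U₃} {g : Tot M' h₂ →+ Tot M'' h₃}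
    {f : Tot M h₁ →+ Tot M' h₂} (hg : IsLin g) (hf : IsLin f) : IsLin (g.comp f) :=
  fun b x => by simp [hf b x, hg b]

theorem Mor.map_mk (f : Mor M M' h₁ h₂) (n : ℤ) (e : M.Q n) (b : 𝒜.A V) :
    f.1 (Tot.mk h₁ n e b) = Tot.rmul b (f.1 (Tot.mk h₁ n e 1)) := by
  rw [← f.2 b, Tot.rmul_mk, one_mul]

/-- The restriction to `W ⊆ V` of a morphism over `V`. -/
noncomputable def Mor.restrict (f : Mor M M' h₁ h₂) (h : W ≤ V) :
    Mor M M' (h.trans h₁) (h.trans h₂) where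
  val := Tot.lift (fun n e b => Tot.rmul b (Tot.res h₂ h (f.1 (Tot.mk h₁ n e 1))))
    (fun n e e' b => by simp only [Tot.mk_add_left, map_add])
    (fun n e b b' => by simp only [Tot.rmul_add])
    (fun n r e b => by
      rw [Tot.mk_smul, mul_one, f.map_mk, Tot.res_rmul, Tot.rmul_rmul, res_inc])
  lin := Tot.lift_lin _ _ _ _ fun n e b b' => by rw [Tot.rmul_rmul]

theorem Mor.restrict_mk (f : Mor M M' h₁ h₂) (h : W ≤ V) (n : ℤ) (e : M.Q n) (b : 𝒜.A W) :
    (f.restrict h).1 (Tot.mk _ n e b) = Tot.rmul b (Tot.res h₂ h (f.1 (Tot.mk h₁ n e 1))) := by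
  simp only [Mor.restrict, Tot.lift_mk]

theorem Mor.restrict_res (f : Mor M M' h₁ h₂) (h : W ≤ V) (x : Tot M h₁) :
    (f.restrict h).1 (Tot.res h₁ h x) = Tot.res h₂ h (f.1 x) :=
  Tot.ext_apply (f := (f.restrict h).1.comp (Tot.res h₁ h)) (g := (Tot.res h₂ h).comp f.1)
    (fun n e b => by
      simp only [AddMonoidHom.comp_apply, Tot.res_mk]
      rw [f.restrict_mk, f.map_mk n e b, Tot.res_rmul]) x

theorem Mor.restrict_restrict {W' : α} (f : Mor M M' h₁ h₂) (h : W ≤ V) (h' : W' ≤ W)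
    (x : Tot M ((h'.trans h).trans h₁)) :
    ((f.restrict h).restrict h').1 x = (f.restrict (h'.trans h)).1 x :=
  Tot.ext_apply (f := ((f.restrict h).restrict h').1) (g := (f.restrict (h'.trans h)).1)
    (fun n e b => by
      rw [Mor.restrict_mk, f.restrict_mk, Mor.restrict_mk, Tot.rmul_one, Tot.res_res]) x

theorem Mor.restrict_refl (f : Mor M M' h₁ h₂) : (f.restrict (le_refl V)).1 = f.1 :=
  Tot.hom_ext fun n e b => by
    rw [f.restrict_mk, Tot.res_refl, ← f.map_mk]

theorem Mor.isDeg_of_mk {k : ℤ} (f : Mor M M' h₁ h₂)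
    (hf : ∀ n e, f.1 (Tot.mk h₁ n e 1) ∈ Tot.deg M' h₂ (n + k)) : IsDeg k f.1 := by
  intro m x hx
  refine Tot.map_deg f.1 _ (fun n j e b hb hn => ?_) hx
  rw [f.map_mk]
  exact Tot.rmul_mem_deg hb (by omega) (hf n e)

theorem Mor.restrict_isDeg {k : ℤ} (f : Mor M M' h₁ h₂) (hf : IsDeg k f.1) (h : W ≤ V) :
    IsDeg k (f.restrict h).1 := by
  refine Mor.isDeg_of_mk _ fun n e => ?_
  rw [f.restrict_mk, Tot.rmul_one]
  exact Tot.res_mem_deg _ _ (hf n _ (Tot.mk_mem_deg e (one_mem_gr 𝒜) (by simp)))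

end Mor

namespace QCoh

variable {U₁ U₂ : α}

/-- The differential of a morphism `f` of degree `k` over `V`. -/
noncomputable def dMor (E : QCoh.{u, v} 𝒜 U₁) (F : QCoh.{u, v'} 𝒜 U₂) {h₁ : V ≤ U₁} {h₂ : V ≤ U₂}
    (k : ℤ) (f : Mor E.toGMod F.toGMod h₁ h₂) : Tot E.toGMod h₁ →+ Tot F.toGMod h₂ :=
  (F.connOn h₂).comp f.1 - sgn k • f.1.comp (E.connOn h₁)

/-- The component `E^m → E^n` of the differential `𝔼⁰` of the underlying complex. -/
noncomputable def d0 (E : QCoh.{u, v} 𝒜 U) (m n : ℤ) (e : E.Q m) : E.Q n :=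
  Tot.sym E.toGMod n (E.conn (Tot.mk _ m e 1))

/-- The map of underlying complexes of a degree zero morphism, in degree `n`. -/
noncomputable def map0 {E : QCoh.{u, v} 𝒜 U} {F : QCoh.{u, v'} 𝒜 U}
    (f : Mor E.toGMod F.toGMod (le_refl U) (le_refl U)) (n : ℤ) (e : E.Q n) : F.Q n :=
  Tot.sym F.toGMod n (f.1 (Tot.mk _ n e 1))

/-- A degree zero closed morphism of quasi-cohesive modules is a quasi-isomorphism if the map of
underlying complexes of modules is injective and surjective on cohomology in each degree. -/
structure IsQuasiIso {E : QCoh.{u, v} 𝒜 U} {F : QCoh.{u, v'} 𝒜 U}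
    (f : Mor E.toGMod F.toGMod (le_refl U) (le_refl U)) : Prop where
  isDeg : IsDeg 0 f.1
  closed : dMor E F 0 f = 0
  inj : ∀ (n : ℤ) (e : E.Q n), E.d0 n (n + 1) e = 0 →
    (∃ y : F.Q (n - 1), F.d0 (n - 1) n y = map0 f n e) → ∃ x : E.Q (n - 1), E.d0 (n - 1) n x = e
  surj : ∀ (n : ℤ) (y : F.Q n), F.d0 n (n + 1) y = 0 →
    ∃ e : E.Q n, E.d0 n (n + 1) e = 0 ∧ ∃ z : F.Q (n - 1), F.d0 (n - 1) n z = y - map0 f n e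

end QCoh

/-! ### Restriction of modules -/

section Restrict

/-- The restriction `E|_V` of a graded module: the base change to the degree zero algebra
of `V`. -/
noncomputable def GMod.restrict (M : GMod.{u, v} 𝒜 U) (h : V ≤ U) : GMod.{u, max u v} 𝒜 V where
  Q n := Sec0 𝒜 h ⊗[𝒜.A0 U] M.Q n
  addCommGroup _ := inferInstance
  module n := inferInstanceAs (Module (Sec0 𝒜 h) (Sec0 𝒜 h ⊗[𝒜.A0 U] M.Q n))

/-- The element `g ⊗ e` of `E|_V`. -/
noncomputable def GMod.tmul (M : GMod.{u, v} 𝒜 U) (h : V ≤ U) {n : ℤ} (g : 𝒜.A0 V) (e : M.Q n) :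
    (M.restrict h).Q n :=
  (show Sec0 𝒜 h from g) ⊗ₜ[𝒜.A0 U] e

variable {M : GMod.{u, v} 𝒜 U} {h : V ≤ U}

theorem GMod.smul_tmul {n : ℤ} (r g : 𝒜.A0 V) (e : M.Q n) :
    r • M.tmul h g e = M.tmul h (r * g) e := rfl

theorem GMod.tmul_add {n : ℤ} (g : 𝒜.A0 V) (e e' : M.Q n) :
    M.tmul h g (e + e') = M.tmul h g e + M.tmul h g e' := TensorProduct.tmul_add ..

theorem GMod.tmul_smul {n : ℤ} (r : 𝒜.A0 U) (g : 𝒜.A0 V) (e : M.Q n) :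
    M.tmul h g (r • e) = 𝒜.res0 h r • M.tmul h g e :=
  (TensorProduct.tmul_smul r (show Sec0 𝒜 h from g) e).trans rfl

theorem GMod.restrict_induction {n : ℤ} {p : (M.restrict h).Q n → Prop} (q : (M.restrict h).Q n)
    (h0 : p 0) (ht : ∀ g e, p (M.tmul h g e)) (ha : ∀ x y, p x → p y → p (x + y)) : p q :=
  TensorProduct.induction_on (motive := p) q h0 ht ha

/-- An additive map out of `E|_V`. -/
noncomputable def GMod.restrictLift {n : ℤ} {P : Type*} [AddCommGroup P]
    (f : 𝒜.A0 V → M.Q n → P)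
    (h1 : ∀ g g' e, f (g + g') e = f g e + f g' e)
    (h2 : ∀ g e e', f g (e + e') = f g e + f g e')
    (h3 : ∀ r g e, f (𝒜.res0 h r * g) e = f g (r • e)) : (M.restrict h).Q n →+ P :=
  TensorProduct.liftAddHom (R := 𝒜.A0 U) (M := Sec0 𝒜 h) (N := M.Q n)
    (AddMonoidHom.mk' (fun g => AddMonoidHom.mk' (fun e => f g e) (h2 g))
      (fun g g' => by ext e; exact h1 g g' e))
    (fun r g e => h3 r g e)

theorem GMod.restrictLift_tmul {n : ℤ} {P : Type*} [AddCommGroup P]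
    (f : 𝒜.A0 V → M.Q n → P) (h1) (h2) (h3) (g : 𝒜.A0 V) (e : M.Q n) :
    GMod.restrictLift (h := h) f h1 h2 h3 (M.tmul h g e) = f g e := rfl

/-- The component `E|_V → E ⊗ A(W)`, `g ⊗ e ↦ e ⊗ g|_W b`. -/
noncomputable def Tot.collapse (M : GMod.{u, v} 𝒜 U) (h : V ≤ U) (h' : W ≤ V) (n : ℤ)
    (q : (M.restrict h).Q n) (b : 𝒜.A W) : Tot M (h'.trans h) :=
  GMod.restrictLift (fun g e => Tot.mk (h'.trans h) n e (𝒜.inc h' g * b))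
    (fun g g' e => by rw [inc_add, add_mul, Tot.mk_add_right])
    (fun g e e' => Tot.mk_add_left ..)
    (fun r g e => by rw [Tot.mk_smul, inc_mul, inc_res0, mul_assoc]) q

theorem Tot.collapse_tmul (h' : W ≤ V) (n : ℤ) (g : 𝒜.A0 V) (e : M.Q n) (b : 𝒜.A W) :
    Tot.collapse M h h' n (M.tmul h g e) b = Tot.mk (h'.trans h) n e (𝒜.inc h' g * b) := rfl

theorem Tot.collapse_add_left (h' : W ≤ V) (n : ℤ) (q q' : (M.restrict h).Q n) (b : 𝒜.A W) :
    Tot.collapse M h h' n (q + q') b = Tot.collapse M h h' n q b + Tot.collapse M h h' n q' b :=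
  map_add _ _ _

theorem Tot.collapse_zero_left (h' : W ≤ V) (n : ℤ) (b : 𝒜.A W) :
    Tot.collapse M h h' n 0 b = 0 := map_zero _

theorem Tot.collapse_rmul (h' : W ≤ V) (n : ℤ) (q : (M.restrict h).Q n) (b b' : 𝒜.A W) :
    Tot.collapse M h h' n q (b * b') = Tot.rmul b' (Tot.collapse M h h' n q b) := by
  refine GMod.restrict_induction (p := fun q => Tot.collapse M h h' n q (b * b') =
    Tot.rmul b' (Tot.collapse M h h' n q b)) q ?_ ?_ ?_
  · simp only [Tot.collapse_zero_left, map_zero]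
  · intro g e; rw [Tot.collapse_tmul, Tot.collapse_tmul, Tot.rmul_mk, mul_assoc]
  · intro x y hx hy; simp only [Tot.collapse_add_left, map_add, hx, hy]

theorem Tot.collapse_smul (h' : W ≤ V) (n : ℤ) (r : 𝒜.A0 V) (q : (M.restrict h).Q n) (b : 𝒜.A W) :
    Tot.collapse M h h' n (r • q) b = Tot.collapse M h h' n q (𝒜.inc h' r * b) := by
  refine GMod.restrict_induction (p := fun q => Tot.collapse M h h' n (r • q) b =
    Tot.collapse M h h' n q (𝒜.inc h' r * b)) q ?_ ?_ ?_
  · simp only [Tot.collapse_zero_left, smul_zero]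
  · intro g e
    rw [GMod.smul_tmul, Tot.collapse_tmul, Tot.collapse_tmul, inc_mul, inc_comm, mul_assoc]
  · intro x y hx hy; simp only [Tot.collapse_add_left, smul_add, hx, hy]

theorem Tot.collapse_mem_deg (h' : W ≤ V) {n : ℤ} {j : ℕ} {m : ℤ} (q : (M.restrict h).Q n)
    {b : 𝒜.A W} (hb : b ∈ 𝒜.gr W j) (hm : n + j = m) :
    Tot.collapse M h h' n q b ∈ Tot.deg M (h'.trans h) m := by
  refine GMod.restrict_induction (p := fun q => Tot.collapse M h h' n q b ∈ Tot.deg M _ m) q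
    ?_ ?_ ?_
  · rw [Tot.collapse_zero_left]; exact AddSubgroup.zero_mem _
  · intro g e; rw [Tot.collapse_tmul]
    exact Tot.mk_mem_deg e (𝒜.mul_mem_gr W _ _ _ _ (inc_mem 𝒜 h' g) hb) (by push_cast; omega)
  · intro x y hx hy; rw [Tot.collapse_add_left]; exact AddSubgroup.add_mem _ hx hy

theorem Tot.collapse_res {W' : α} (h' : W ≤ V) (h'' : W' ≤ W) (n : ℤ) (q : (M.restrict h).Q n)
    (b : 𝒜.A W) : Tot.res (h'.trans h) h'' (Tot.collapse M h h' n q b) =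
      Tot.collapse M h (h''.trans h') n q (𝒜.res h'' b) := by
  refine GMod.restrict_induction (p := fun q => Tot.res (h'.trans h) h''
    (Tot.collapse M h h' n q b) = Tot.collapse M h (h''.trans h') n q (𝒜.res h'' b)) q ?_ ?_ ?_
  · simp only [Tot.collapse_zero_left, map_zero]
  · intro g e
    rw [Tot.collapse_tmul, Tot.collapse_tmul, Tot.res_mk, map_mul, res_inc]
  · intro x y hx hy; simp only [Tot.collapse_add_left, map_add, hx, hy]

theorem Tot.collapse_add_right (h' : W ≤ V) (n : ℤ) (q : (M.restrict h).Q n) (b b' : 𝒜.A W) :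
    Tot.collapse M h h' n q (b + b') = Tot.collapse M h h' n q b + Tot.collapse M h h' n q b' := by
  have := fun b => Tot.collapse_rmul h' n q 1 b
  simp only [one_mul] at this
  rw [this, this b, this b', Tot.rmul_add]

/-- The identification of `E|_V ⊗ A(W)` with `E ⊗ A(W)`. -/
noncomputable def Tot.down (M : GMod.{u, v} 𝒜 U) (h : V ≤ U) (h' : W ≤ V) :
    Mor (M.restrict h) M h' (h'.trans h) where
  val := Tot.lift (fun n q b => Tot.collapse M h h' n q b)
    (fun n q q' b => Tot.collapse_add_left ..) (fun n q b b' => Tot.collapse_add_right ..)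
    (fun n r q b => Tot.collapse_smul ..)
  lin := Tot.lift_lin _ _ _ _ fun n q b b' => Tot.collapse_rmul ..

/-- The identification of `E ⊗ A(W)` with `E|_V ⊗ A(W)`. -/
noncomputable def Tot.up (M : GMod.{u, v} 𝒜 U) (h : V ≤ U) (h' : W ≤ V) :
    Mor M (M.restrict h) (h'.trans h) h' where
  val := Tot.lift (fun n e b => Tot.mk h' n (M.tmul h 1 e) b)
    (fun n e e' b => by rw [GMod.tmul_add, Tot.mk_add_left])
    (fun n e b b' => Tot.mk_add_right ..)
    (fun n r e b => by rw [GMod.tmul_smul, Tot.mk_smul, inc_res0])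
  lin := Tot.lift_lin _ _ _ _ fun n e b b' => by rw [Tot.rmul_mk]

theorem Tot.down_mk (h' : W ≤ V) (n : ℤ) (q : (M.restrict h).Q n) (b : 𝒜.A W) :
    (Tot.down M h h').1 (Tot.mk h' n q b) = Tot.collapse M h h' n q b := by
  simp only [Tot.down, Tot.lift_mk]

theorem Tot.up_mk (h' : W ≤ V) (n : ℤ) (e : M.Q n) (b : 𝒜.A W) :
    (Tot.up M h h').1 (Tot.mk _ n e b) = Tot.mk h' n (M.tmul h 1 e) b := by
  simp only [Tot.up, Tot.lift_mk]

theorem Tot.down_up (h' : W ≤ V) (x : Tot M (h'.trans h)) :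
    (Tot.down M h h').1 ((Tot.up M h h').1 x) = x :=
  Tot.ext_apply (f := (Tot.down M h h').1.comp (Tot.up M h h').1) (g := AddMonoidHom.id _)
    (fun n e b => by
      rw [AddMonoidHom.comp_apply, Tot.up_mk, Tot.down_mk, Tot.collapse_tmul, inc_one, one_mul]
      rfl) x

theorem Tot.up_down (h' : W ≤ V) (x : Tot (M.restrict h) h') :
    (Tot.up M h h').1 ((Tot.down M h h').1 x) = x :=
  Tot.ext_apply (f := (Tot.up M h h').1.comp (Tot.down M h h').1) (g := AddMonoidHom.id _)
    (fun n q b => by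
      rw [AddMonoidHom.comp_apply, Tot.down_mk, AddMonoidHom.id_apply]
      refine GMod.restrict_induction (p := fun q => (Tot.up M h h').1
        (Tot.collapse M h h' n q b) = Tot.mk h' n q b) q ?_ ?_ ?_
      · rw [Tot.collapse_zero_left, map_zero, Tot.mk_zero_left]
      · intro g e
        rw [Tot.collapse_tmul, Tot.up_mk, ← Tot.mk_smul, GMod.smul_tmul, mul_one]
      · intro x y hx hy
        rw [Tot.collapse_add_left, map_add, hx, hy, Tot.mk_add_left]) x

theorem Tot.down_isDeg (h' : W ≤ V) : IsDeg 0 (Tot.down M h h').1 :=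
  Mor.isDeg_of_mk _ fun n q => by
    rw [Tot.down_mk]; exact Tot.collapse_mem_deg h' q (one_mem_gr 𝒜) (by simp)

theorem Tot.up_isDeg (h' : W ≤ V) : IsDeg 0 (Tot.up M h h').1 :=
  Mor.isDeg_of_mk _ fun n e => by
    rw [Tot.up_mk]; exact Tot.mk_mem_deg _ (one_mem_gr 𝒜) (by simp)

theorem Tot.down_res {W' : α} (h' : W ≤ V) (h'' : W' ≤ W) (x : Tot (M.restrict h) h') :
    (Tot.down M h (h''.trans h')).1 (Tot.res h' h'' x) =
      Tot.res (h'.trans h) h'' ((Tot.down M h h').1 x) :=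
  Tot.ext_apply (f := (Tot.down M h (h''.trans h')).1.comp (Tot.res h' h''))
    (g := (Tot.res (h'.trans h) h'').comp (Tot.down M h h').1) (fun n q b => by
      simp only [AddMonoidHom.comp_apply, Tot.res_mk, Tot.down_mk, Tot.collapse_res]) x

theorem Tot.up_res {W' : α} (h' : W ≤ V) (h'' : W' ≤ W) (x : Tot M (h'.trans h)) :
    (Tot.up M h (h''.trans h')).1 (Tot.res (h'.trans h) h'' x) =
      Tot.res h' h'' ((Tot.up M h h').1 x) :=
  Tot.ext_apply (f := (Tot.up M h (h''.trans h')).1.comp (Tot.res (h'.trans h) h''))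
    (g := (Tot.res h' h'').comp (Tot.up M h h').1) (fun n q b => by
      simp only [AddMonoidHom.comp_apply, Tot.res_mk, Tot.up_mk]) x

/-- The restriction `E|_V` of a quasi-cohesive module. -/
noncomputable abbrev QCoh.restrict (E : QCoh.{u, v} 𝒜 U) (h : V ≤ U) : QCoh.{u, max u v} 𝒜 V where
  toGMod := E.toGMod.restrict h
  conn := ((Tot.up E.toGMod h (le_refl V)).1.comp (E.connOn h)).comp
    (Tot.down E.toGMod h (le_refl V)).1
  leibniz n q b := by
    have h1 : (Tot.down E.toGMod h (le_refl V)).1 (Tot.mk (le_refl V) n q 1) ∈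
        Tot.deg E.toGMod h n := by
      rw [Tot.down_mk]; exact Tot.collapse_mem_deg _ q (one_mem_gr 𝒜) (by simp)
    simp only [AddMonoidHom.comp_apply]
    rw [Mor.map_mk, E.connOn_rmul h n _ h1, map_add, map_zsmul, (Tot.up E.toGMod h _).2,
      (Tot.up E.toGMod h _).2, Tot.up_down, Tot.rmul_mk, one_mul]
  conn_deg m x hx := by
    have h1 := Tot.down_isDeg (M := E.toGMod) (h := h) (le_refl V) m x hx
    have h2 := E.connOn_deg h _ _ h1
    have h3 := Tot.up_isDeg (M := E.toGMod) (h := h) (le_refl V) _ _ h2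
    simpa using h3
  conn_conn x := by
    simp only [AddMonoidHom.comp_apply]
    rw [Tot.down_up, E.connOn_connOn, map_zero]

theorem QCoh.restrict_connOn (E : QCoh.{u, v} 𝒜 U) (h : V ≤ U) (h' : W ≤ V)
    (x : Tot (E.restrict h).toGMod h') :
    (E.restrict h).connOn h' x = (Tot.up E.toGMod h h').1
      (E.connOn (h'.trans h) ((Tot.down E.toGMod h h').1 x)) :=
  Tot.ext_apply (f := (E.restrict h).connOn h') (g := ((Tot.up E.toGMod h h').1.comp
    (E.connOn (h'.trans h))).comp (Tot.down E.toGMod h h').1) (fun n q b => by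
      have h1 : (Tot.down E.toGMod h h').1 (Tot.mk h' n q 1) ∈
          Tot.deg E.toGMod (h'.trans h) n := by
        rw [Tot.down_mk]; exact Tot.collapse_mem_deg _ q (one_mem_gr 𝒜) (by simp)
      have h2 : (Tot.down E.toGMod h h').1 (Tot.mk h' n q 1) = Tot.res h h'
          ((Tot.down E.toGMod h (le_refl V)).1 (Tot.mk (le_refl V) n q 1)) := by
        rw [Tot.down_mk, Tot.down_mk, Tot.collapse_res, map_one]
      simp only [AddMonoidHom.comp_apply]
      rw [QCoh.connOn_mk, Mor.map_mk, E.connOn_rmul _ n _ h1, map_add, map_zsmul,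
        (Tot.up E.toGMod h _).2, (Tot.up E.toGMod h _).2, Tot.up_down, Tot.rmul_mk, one_mul, h2,
        E.connOn_res, Tot.up_res]
      rfl) x

end Restrict

end Presheaf

section Comp

variable {α : Type w} [Preorder α] {𝒜 : DGPresheaf.{u} α} {V W : α} {U₁ U₂ U₃ : α}
variable {M : GMod.{u, v} 𝒜 U₁} {M' : GMod.{u, v'} 𝒜 U₂} {M'' : GMod.{u, v''} 𝒜 U₃}
  {h₁ : V ≤ U₁} {h₂ : V ≤ U₂} {h₃ : V ≤ U₃}

/-- Composition of morphisms over `V`. -/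
noncomputable def Mor.comp (g : Mor M' M'' h₂ h₃) (f : Mor M M' h₁ h₂) : Mor M M'' h₁ h₃ :=
  ⟨g.1.comp f.1, g.2.comp f.2⟩

/-- The identity morphism. -/
noncomputable def Mor.id (M : GMod.{u, v} 𝒜 U₁) (h₁ : V ≤ U₁) : Mor M M h₁ h₁ :=
  ⟨AddMonoidHom.id _, fun _ _ => rfl⟩

/-- The zero morphism. -/
noncomputable def Mor.zero (M : GMod.{u, v} 𝒜 U₁) (M' : GMod.{u, v'} 𝒜 U₂) (h₁ : V ≤ U₁)
    (h₂ : V ≤ U₂) : Mor M M' h₁ h₂ := ⟨0, IsLin.zero⟩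

theorem Mor.restrict_eq (f : Mor M M' h₁ h₂) (h : W ≤ V)
    (g : Tot M (h.trans h₁) →+ Tot M' (h.trans h₂)) (hg : IsLin g)
    (hfg : ∀ x, g (Tot.res h₁ h x) = Tot.res h₂ h (f.1 x)) : (f.restrict h).1 = g :=
  Tot.hom_ext fun n e b => by
    rw [f.restrict_mk, ← hfg, ← hg, Tot.res_mk, Tot.rmul_mk, map_one, one_mul]

theorem Mor.zero_restrict (h : W ≤ V) : ((Mor.zero M M' h₁ h₂).restrict h).1 = 0 :=
  Mor.restrict_eq _ _ _ IsLin.zero fun x => by simp [Mor.zero]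

theorem Mor.comp_restrict (g : Mor M' M'' h₂ h₃) (f : Mor M M' h₁ h₂) (h : W ≤ V) :
    ((g.comp f).restrict h).1 = (g.restrict h).1.comp (f.restrict h).1 :=
  Mor.restrict_eq _ _ _ ((g.restrict h).2.comp (f.restrict h).2) fun x => by
    simp only [AddMonoidHom.comp_apply, Mor.restrict_res, Mor.comp]

theorem Tot.down_restrict {U : α} {W' : α} (M : GMod.{u, v} 𝒜 U) (h : V ≤ U) (h' : W ≤ V)
    (h'' : W' ≤ W) : ((Tot.down M h h').restrict h'').1 = (Tot.down M h (h''.trans h')).1 :=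
  Mor.restrict_eq _ _ _ (Tot.down M h (h''.trans h')).2 fun x => Tot.down_res ..

theorem Tot.up_restrict {U : α} {W' : α} (M : GMod.{u, v} 𝒜 U) (h : V ≤ U) (h' : W ≤ V)
    (h'' : W' ≤ W) : ((Tot.up M h h').restrict h'').1 = (Tot.up M h (h''.trans h')).1 :=
  Mor.restrict_eq _ _ _ (Tot.up M h (h''.trans h')).2 fun x => Tot.up_res ..

theorem IsDeg.comp {k k' : ℤ} {g : Tot M' h₂ →+ Tot M'' h₃} {f : Tot M h₁ →+ Tot M' h₂}
    (hg : IsDeg k g) (hf : IsDeg k' f) : IsDeg (k + k') (g.comp f) := fun m x hx => by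
  have := hg _ _ (hf m x hx)
  rwa [add_assoc, add_comm k' k] at this

/-- A degree zero morphism over `V` is invertible up to homotopy. -/
def QCoh.IsHtpyInvertible (E : QCoh.{u, v} 𝒜 U₁) (F : QCoh.{u, v'} 𝒜 U₂) {h₁ : V ≤ U₁}
    {h₂ : V ≤ U₂} (f : Mor E.toGMod F.toGMod h₁ h₂) : Prop :=
  ∃ g : Mor F.toGMod E.toGMod h₂ h₁, IsDeg 0 g.1 ∧ QCoh.dMor F E 0 g = 0 ∧
    (∃ s : Mor E.toGMod E.toGMod h₁ h₁, IsDeg (-1) s.1 ∧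
      g.1.comp f.1 - AddMonoidHom.id _ = QCoh.dMor E E (-1) s) ∧
    ∃ t : Mor F.toGMod F.toGMod h₂ h₂, IsDeg (-1) t.1 ∧
      f.1.comp g.1 - AddMonoidHom.id _ = QCoh.dMor F F (-1) t

end Comp

section Cover

variable {α : Type w} [SemilatticeInf α] {ι : Type w'}

/-- The intersection `U_{i₀ … i_p}`, where the list is `[i₁, …, i_p]`. -/
def cap (U : ι → α) : ι → List ι → α
  | i, [] => U i
  | i, j :: l => U i ⊓ cap U j l

theorem le_cap {U : ι → α} {W : α} {i : ι} {l : List ι} :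
    W ≤ cap U i l ↔ ∀ j ∈ i :: l, W ≤ U j := by
  induction l generalizing i with
  | nil => simp [cap]
  | cons j l ih => simp [cap, ih]

theorem cap_le_mem {U : ι → α} {i j : ι} {l : List ι} (h : j ∈ i :: l) : cap U i l ≤ U j :=
  le_cap.1 le_rfl j h

theorem cap_le_head (U : ι → α) (i : ι) (l : List ι) : cap U i l ≤ U i :=
  cap_le_mem (by simp)

theorem cap_le_last (U : ι → α) (i : ι) (l : List ι) (j : ι) : cap U i (l ++ [j]) ≤ U j :=
  cap_le_mem (by simp)

theorem cap_le_cap {U : ι → α} {i i' : ι} {l l' : List ι} (h : ∀ j ∈ i' :: l', j ∈ i :: l) :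
    cap U i l ≤ cap U i' l' :=
  le_cap.2 fun j hj => cap_le_mem (h j hj)

theorem cap_erase (U : ι → α) (i : ι) (l : List ι) (k : ℕ) :
    cap U i l ≤ cap U i (l.eraseIdx k) := cap_le_cap fun j hj => by
  rcases List.mem_cons.1 hj with rfl | hj
  · simp
  · exact List.mem_cons_of_mem _ (List.eraseIdx_subset hj)

theorem cap_erase' (U : ι → α) (i : ι) (l : List ι) (j : ι) (k : ℕ) :
    cap U i (l ++ [j]) ≤ cap U i (l.eraseIdx k ++ [j]) := cap_le_cap fun m hm => by
  have := @List.eraseIdx_subset ι l k m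
  simp only [List.mem_cons, List.mem_append, List.not_mem_nil, or_false] at hm ⊢
  tauto

theorem cap_take (U : ι → α) (i : ι) (l : List ι) (k : Fin l.length) :
    cap U i l ≤ cap U i (l.take k ++ [l.get k]) := cap_le_cap fun m hm => by
  have h1 := @List.take_subset ι k l m
  have h2 : l.get k ∈ l := List.get_mem ..
  simp only [List.mem_cons, List.mem_append, List.not_mem_nil, or_false] at hm ⊢
  rcases hm with hm | hm | hm
  · exact Or.inl hm
  · exact Or.inr (h1 hm)
  · exact Or.inr (hm ▸ h2)

theorem cap_drop (U : ι → α) (i : ι) (l : List ι) (k : Fin l.length) :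
    cap U i l ≤ cap U (l.get k) (l.drop (k + 1)) := cap_le_cap fun m hm => by
  have h1 := @List.drop_subset ι (k + 1) l m
  have h2 : l.get k ∈ l := List.get_mem ..
  rcases List.mem_cons.1 hm with hm | hm
  · exact List.mem_cons_of_mem _ (hm ▸ h2)
  · exact List.mem_cons_of_mem _ (h1 hm)

theorem cap_take' (U : ι → α) (i : ι) (l : List ι) (j : ι) (k : Fin l.length) :
    cap U i (l ++ [j]) ≤ cap U i (l.take k ++ [l.get k]) :=
  (cap_le_cap fun m hm => by
    simp only [List.mem_cons, List.mem_append, List.not_mem_nil, or_false] at hm ⊢; tauto).trans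
    (cap_take U i l k)

theorem cap_drop' (U : ι → α) (i : ι) (l : List ι) (j : ι) (k : Fin l.length) :
    cap U i (l ++ [j]) ≤ cap U (l.get k) (l.drop (k + 1) ++ [j]) := cap_le_cap fun m hm => by
  have h1 := @List.drop_subset ι (k + 1) l m
  have h2 : l.get k ∈ l := List.get_mem ..
  simp only [List.mem_cons, List.mem_append, List.not_mem_nil, or_false] at hm ⊢
  rcases hm with hm | hm | hm
  · exact Or.inr (Or.inl (hm ▸ h2))
  · exact Or.inr (Or.inl (h1 hm))
  · exact Or.inr (Or.inr hm)

/-! ### Čech cochains of operators -/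

variable {𝒜 : DGPresheaf.{u} α} (U : ι → α)

/-- A Čech cochain of operators from the family `E` to the family `F`.  The component of Čech degree
zero at `i` is `zero i`; the component of Čech degree `p ≥ 1` at `(i₀, …, i_p)` is `pos i₀ l i_p`
with `l = [i₁, …, i_{p-1}]`, a map from `E_{i_p}` to `F_{i₀}`.  Each component is given together
with its restrictions to all smaller open sets `W`. -/
structure Raw (E : ∀ i, GMod.{u, v} 𝒜 (U i)) (F : ∀ i, GMod.{u, v'} 𝒜 (U i)) where
  zero : ∀ (i : ι) (W : α) (h : W ≤ U i), Tot (E i) h →+ Tot (F i) h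
  pos : ∀ (i : ι) (l : List ι) (j : ι) (W : α) (h : W ≤ cap U i (l ++ [j])),
    Tot (E j) (h.trans (cap_le_last U i l j)) →+ Tot (F i) (h.trans (cap_le_head U i _))

variable {U}

/-- The product `u · v` of Čech cochains of operators, where `u` is of total degree `m`: on
components of bidegrees `(p, q)` and `(r, s)` it is `(-1)^{q r}` times the composition. -/
noncomputable def Raw.mul {E : ∀ i, GMod.{u, v} 𝒜 (U i)} {F : ∀ i, GMod.{u, v'} 𝒜 (U i)}
    {G : ∀ i, GMod.{u, v''} 𝒜 (U i)} (m : ℤ) (f : Raw U F G) (g : Raw U E F) : Raw U E G where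
  zero i W h := (f.zero i W h).comp (g.zero i W h)
  pos i l j W h :=
    sgn (m * (l.length + 1)) • (f.zero i W (h.trans (cap_le_head U i _))).comp (g.pos i l j W h) +
    (f.pos i l j W h).comp (g.zero j W (h.trans (cap_le_last U i l j))) +
    ∑ k : Fin l.length, sgn ((m - (k + 1)) * (l.length - k)) •
      (f.pos i (l.take k) (l.get k) W (h.trans (cap_take' U i l j k))).comp
        (g.pos (l.get k) (l.drop (k + 1)) j W (h.trans (cap_drop' U i l j k)))

/-- The Čech differential `(δ u)_{i₀ … i_{p+1}} = ∑_{k=1}^{p} (-1)^k u_{i₀ … î_k … i_{p+1}}`. -/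
noncomputable def Raw.delta {E : ∀ i, GMod.{u, v} 𝒜 (U i)} {F : ∀ i, GMod.{u, v'} 𝒜 (U i)}
    (f : Raw U E F) : Raw U E F where
  zero i W h := 0
  pos i l j W h := ∑ k : Fin l.length, sgn (k + 1) •
    f.pos i (l.eraseIdx k) j W (h.trans (cap_erase' U i l j k))

variable (U)

/-- A Čech cochain of morphisms from the family `E` to the family `F`, i.e. an element of
`∏_p C^p(𝒰, Mor(E, F))`; the components are indexed as in `Raw`. -/
structure Coch (E : ∀ i, GMod.{u, v} 𝒜 (U i)) (F : ∀ i, GMod.{u, v'} 𝒜 (U i)) where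
  zero : ∀ i, Mor (E i) (F i) (le_refl (U i)) (le_refl (U i))
  pos : ∀ (i : ι) (l : List ι) (j : ι), Mor (E j) (F i) (cap_le_last U i l j) (cap_le_head U i _)

variable {U}

namespace Coch

/-- The operators defined by a cochain of morphisms. -/
noncomputable def raw {E : ∀ i, GMod.{u, v} 𝒜 (U i)} {F : ∀ i, GMod.{u, v'} 𝒜 (U i)}
    (f : Coch U E F) : Raw U E F where
  zero i W h := ((f.zero i).restrict h).1
  pos i l j W h := ((f.pos i l j).restrict h).1

/-- A cochain of morphisms is of total degree `n`. -/
def HasDeg {E : ∀ i, GMod.{u, v} 𝒜 (U i)} {F : ∀ i, GMod.{u, v'} 𝒜 (U i)} (n : ℤ)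
    (f : Coch U E F) : Prop :=
  (∀ i, IsDeg n (f.zero i).1) ∧ ∀ i l j, IsDeg (n - (l.length + 1)) (f.pos i l j).1

/-- The composition of cochains of morphisms, the first one being of total degree `m`. -/
noncomputable def comp {E : ∀ i, GMod.{u, v} 𝒜 (U i)} {F : ∀ i, GMod.{u, v'} 𝒜 (U i)}
    {G : ∀ i, GMod.{u, v''} 𝒜 (U i)} (m : ℤ) (f : Coch U F G) (g : Coch U E F) : Coch U E G where
  zero i := ⟨(f.raw.mul m g.raw).zero i (U i) le_rfl,
    ((f.zero i).restrict _).2.comp ((g.zero i).restrict _).2⟩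
  pos i l j := ⟨(f.raw.mul m g.raw).pos i l j _ le_rfl, by
    refine IsLin.add (IsLin.add (IsLin.zsmul (IsLin.comp ?_ ?_) _) (IsLin.comp ?_ ?_))
      (IsLin.sum _ _ fun k => IsLin.zsmul (IsLin.comp ?_ ?_) _) <;> exact Mor.lin _⟩

/-- The identity cochain. -/
noncomputable def id (E : ∀ i, GMod.{u, v} 𝒜 (U i)) : Coch U E E where
  zero i := Mor.id _ _
  pos i l j := Mor.zero ..

end Coch

/-! ### Twisted complexes -/

variable (𝒜 U)

/-- The operators of a twisting cochain: the connections in Čech degree zero, and the given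
morphisms in positive Čech degree. -/
noncomputable def twRaw {𝒜 : DGPresheaf.{u} α} {U : ι → α} (E : ∀ i, QCoh.{u, v} 𝒜 (U i))
    (a : ∀ (i : ι) (l : List ι) (j : ι),
      Mor (E j).toGMod (E i).toGMod (cap_le_last U i l j) (cap_le_head U i _)) :
    Raw U (fun i => (E i).toGMod) (fun i => (E i).toGMod) where
  zero i W h := (E i).connOn h
  pos i l j W h := ((a i l j).restrict h).1

/-- A twisted complex of quasi-cohesive modules with respect to the family `U`.  Its component
`a^{0,1}_i` is the connection of `obj i`; the component `a^{p,1-p}` at `(i₀, …, i_p)`, `p ≥ 1`, is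
`a i₀ [i₁, …, i_{p-1}] i_p`.  In Čech degree zero the Maurer-Cartan equation `δ a + a · a = 0`
is the flatness of the connections. -/
structure Tw where
  obj : ∀ i, QCoh.{u, v} 𝒜 (U i)
  a : ∀ (i : ι) (l : List ι) (j : ι),
    Mor (obj j).toGMod (obj i).toGMod (cap_le_last U i l j) (cap_le_head U i _)
  a_deg : ∀ i l j, IsDeg (-(l.length : ℤ)) (a i l j).1
  mc : ∀ i l j, (twRaw obj a).delta.pos i l j _ le_rfl +
    ((twRaw obj a).mul 1 (twRaw obj a)).pos i l j _ le_rfl = 0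
  inv : ∀ i, QCoh.IsHtpyInvertible (obj i) (obj i) (a i [] i)

variable {𝒜 U}

namespace Tw

/-- The family of graded modules of a twisted complex. -/
abbrev gmod (E : Tw.{u, v} 𝒜 U) (i : ι) : GMod.{u, v} 𝒜 (U i) := (E.obj i).toGMod

/-- The operators `a` of a twisted complex. -/
noncomputable abbrev raw (E : Tw.{u, v} 𝒜 U) : Raw U E.gmod E.gmod := twRaw E.obj E.a

/-- A twisted complex of cohesive modules. -/
def IsCohesive (E : Tw.{u, v} 𝒜 U) : Prop := ∀ i, (E.obj i).IsCohesive

/-- A cochain of operators vanishes. -/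
def _root_.Cohesive.Raw.IsZero {E : ∀ i, GMod.{u, v} 𝒜 (U i)} {F : ∀ i, GMod.{u, v'} 𝒜 (U i)}
    (f : Raw U E F) : Prop :=
  (∀ i, f.zero i (U i) le_rfl = 0) ∧ ∀ i l j, f.pos i l j _ le_rfl = 0

/-- Sums and differences of cochains of operators. -/
noncomputable def _root_.Cohesive.Raw.add {E : ∀ i, GMod.{u, v} 𝒜 (U i)}
    {F : ∀ i, GMod.{u, v'} 𝒜 (U i)} (f g : Raw U E F) : Raw U E F where
  zero i W h := f.zero i W h + g.zero i W h
  pos i l j W h := f.pos i l j W h + g.pos i l j W h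

/-- Integer multiples of cochains of operators. -/
noncomputable def _root_.Cohesive.Raw.zsmul {E : ∀ i, GMod.{u, v} 𝒜 (U i)}
    {F : ∀ i, GMod.{u, v'} 𝒜 (U i)} (n : ℤ) (f : Raw U E F) : Raw U E F where
  zero i W h := n • f.zero i W h
  pos i l j W h := n • f.pos i l j W h

/-- The differential `d φ = δ φ + b · φ - (-1)^n φ · a` of a morphism of degree `n`. -/
noncomputable def dHom (E : Tw.{u, v} 𝒜 U) (F : Tw.{u, v'} 𝒜 U) (n : ℤ)
    (φ : Coch U E.gmod F.gmod) : Raw U E.gmod F.gmod :=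
  (φ.raw.delta.add (F.raw.mul 1 φ.raw)).add ((φ.raw.mul n E.raw).zsmul (-sgn n))

/-- A closed morphism of degree zero. -/
def IsClosed {E : Tw.{u, v} 𝒜 U} {F : Tw.{u, v'} 𝒜 U} (φ : Coch U E.gmod F.gmod) : Prop :=
  φ.HasDeg 0 ∧ (dHom E F 0 φ).IsZero

/-- Two degree zero morphisms are homotopic: their difference is the differential of a morphism
of degree `-1`. -/
def Homotopic {E : Tw.{u, v} 𝒜 U} {F : Tw.{u, v'} 𝒜 U} (φ ψ : Coch U E.gmod F.gmod) : Prop :=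
  ∃ s : Coch U E.gmod F.gmod, s.HasDeg (-1) ∧
    ((φ.raw.add (ψ.raw.zsmul (-1))).add ((dHom E F (-1) s).zsmul (-1))).IsZero

/-- Homotopy equivalences in the differential graded category of twisted complexes. -/
def IsHomotopyEquiv {E : Tw.{u, v} 𝒜 U} {F : Tw.{u, v'} 𝒜 U} (φ : Coch U E.gmod F.gmod) : Prop :=
  IsClosed (E := E) (F := F) φ ∧ ∃ ψ : Coch U F.gmod E.gmod, IsClosed (E := F) (F := E) ψ ∧
    Homotopic (E := E) (F := E) (ψ.comp 0 φ) (Coch.id E.gmod) ∧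
    Homotopic (E := F) (F := F) (φ.comp 0 ψ) (Coch.id F.gmod)

end Tw

/-! ### The twisting functor -/

section Twist

variable [OrderTop α]

/-- The twisting cochain of the restrictions of a global module: the identifications
`E|_{U_j} = E|_{U_i}` in Čech degree one, and zero in higher Čech degree. -/
noncomputable def twistCochain (U : ι → α) (M : GMod.{u, v} 𝒜 (⊤ : α)) (i : ι) : ∀ (l : List ι) (j : ι),
    Mor (M.restrict (le_top : U j ≤ ⊤)) (M.restrict (le_top : U i ≤ ⊤))
      (cap_le_last U i l j) (cap_le_head U i (l ++ [j]))
  | [], j => (Tot.up M le_top (cap_le_head U i [j])).comp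
      (Tot.down M le_top (cap_le_last U i [] j))
  | _ :: _, _ => Mor.zero ..

theorem twistCochain_nil (U : ι → α) (M : GMod.{u, v} 𝒜 (⊤ : α)) (i j : ι) {W : α}
    (h : W ≤ cap U i ([] ++ [j])) : ((twistCochain U M i [] j).restrict h).1 =
      (Tot.up M le_top (h.trans (cap_le_head U i [j]))).1.comp
      (Tot.down M le_top (h.trans (cap_le_last U i [] j))).1 := by
  unfold twistCochain
  rw [Mor.comp_restrict, Tot.up_restrict, Tot.down_restrict]

theorem twistCochain_ne_nil (U : ι → α) (M : GMod.{u, v} 𝒜 (⊤ : α)) (i j : ι) (l : List ι)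
    (hl : l ≠ []) {W : α}
    (h : W ≤ cap U i (l ++ [j])) : ((twistCochain U M i l j).restrict h).1 = 0 := by
  cases l with
  | nil => exact absurd rfl hl
  | cons m l => exact Mor.zero_restrict ..

variable (U)

/-- The twisting functor on objects. -/
noncomputable def twist (E : QCoh.{u, v} 𝒜 (⊤ : α)) : Tw.{u, max u v} 𝒜 U where
  obj i := E.restrict le_top
  a := twistCochain U E.toGMod
  a_deg i l j := by
    cases l with
    | nil =>
      have := (Tot.up_isDeg (M := E.toGMod) (h := le_top) (cap_le_head U i [j])).comp
        (Tot.down_isDeg (M := E.toGMod) (h := le_top) (cap_le_last U i [] j))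
      simpa [twistCochain, Mor.comp] using this
    | cons m l => exact fun n x _ => AddSubgroup.zero_mem _
  mc i l j := by
    match l with
    | [] =>
      ext x
      simp only [Raw.delta, Raw.mul, twRaw, twistCochain_nil, List.length_nil,
        Finset.univ_eq_empty, Finset.sum_empty, AddMonoidHom.add_apply, AddMonoidHom.comp_apply,
        AddMonoidHom.zero_apply, AddMonoidHom.smul_apply, sgn_one, Nat.cast_zero, zero_add,
        mul_one, add_zero]
      rw [QCoh.restrict_connOn, QCoh.restrict_connOn, Tot.down_up, Tot.down_up]
      simp
    | [m] =>
      simp only [Raw.delta, Raw.mul, twRaw]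
      rw [twistCochain_ne_nil U E.toGMod i j [m] (by simp)]
      have h1 := twistCochain_nil U E.toGMod i j (W := cap U i ([m] ++ [j]))
        (cap_erase' U i [m] j 0)
      have h2 := twistCochain_nil U E.toGMod i m (W := cap U i ([m] ++ [j]))
        (cap_take' U i [m] j 0)
      have h3 := twistCochain_nil U E.toGMod m j (W := cap U i ([m] ++ [j]))
        (cap_drop' U i [m] j 0)
      have : Subsingleton (Fin [m].length) := inferInstanceAs (Subsingleton (Fin 1))
      rw [Fintype.sum_subsingleton _ (0 : Fin [m].length),
        Fintype.sum_subsingleton _ (0 : Fin [m].length)]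
      ext x
      have h4 : ∀ y, (Tot.down E.toGMod le_top ((cap_take' U i [m] j 0).trans
          (cap_le_last U i [] m))).1 ((Tot.up E.toGMod (le_top : U m ≤ ⊤)
          ((cap_drop' U i [m] j 0).trans (cap_le_head U m [j]))).1 y) = y :=
        fun y => Tot.down_up _ y
      change (sgn 1 • ((twistCochain U E.toGMod i [] j).restrict (W := cap U i ([m] ++ [j]))
        (cap_erase' U i [m] j 0)).1 + (sgn _ • ((E.restrict le_top).connOn _).comp 0 +
        AddMonoidHom.comp 0 _ + sgn 0 • ((twistCochain U E.toGMod i [] m).restrict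
          (W := cap U i ([m] ++ [j])) (cap_take' U i [m] j 0)).1.comp
        ((twistCochain U E.toGMod m [] j).restrict
          (W := cap U i ([m] ++ [j])) (cap_drop' U i [m] j 0)).1) :
        Tot (E.restrict (le_top : U j ≤ ⊤)).toGMod _ →+
          Tot (E.restrict (le_top : U i ≤ ⊤)).toGMod _) x = 0
      rw [h1, h2, h3]
      simp only [AddMonoidHom.add_apply, AddMonoidHom.smul_apply, AddMonoidHom.comp_apply,
        AddMonoidHom.zero_apply, map_zero, h4, sgn_zero, sgn_one]
      simp
    | m :: m' :: l =>
      simp only [Raw.delta, Raw.mul, twRaw]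
      rw [twistCochain_ne_nil U E.toGMod i j (m :: m' :: l) (by simp)]
      rw [Finset.sum_eq_zero, Finset.sum_eq_zero]
      · simp
      · intro k _
        rcases Nat.eq_zero_or_pos (k : ℕ) with hk | hk
        · rw [twistCochain_ne_nil U E.toGMod _ j (List.drop _ _) (by simp [hk])]
          simp
        · rw [twistCochain_ne_nil U E.toGMod i _ (List.take _ _) (fun h => by
            rcases List.take_eq_nil_iff.1 h with h | h
            · omega
            · simp at h)]
          simp
      · intro k _
        rw [twistCochain_ne_nil, smul_zero]
        intro h
        have := congrArg List.length h
        rw [List.length_eraseIdx_of_lt k.2] at this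
        simp at this
  inv i := by
    have h1 : (twistCochain U E.toGMod i [] i).1 = AddMonoidHom.id _ := by
      ext x; exact Tot.up_down ..
    refine ⟨Mor.id _ _, fun m x hx => by simpa [Mor.id] using hx, ?_, ⟨Mor.zero .., ?_, ?_⟩,
      ⟨Mor.zero .., ?_, ?_⟩⟩
    · ext x; simp [QCoh.dMor, Mor.id, sgn_zero]
    · exact fun n x _ => AddSubgroup.zero_mem _
    · ext x; rw [h1]; simp [QCoh.dMor, Mor.id, Mor.zero]
    · exact fun n x _ => AddSubgroup.zero_mem _
    · ext x; rw [h1]; simp [QCoh.dMor, Mor.id, Mor.zero]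

end Twist

end Cover

/-! ### Sums over the splittings of a list -/

section SSum

variable {β : Type*} {G : Type*} [AddCommGroup G]

/-- The sum of `f p x q` over all ways to write a list as `p ++ x :: q`. -/
def ssum (f : List β → β → List β → G) : List β → G
  | [] => 0
  | a :: l => f [] a l + ssum (fun p x q => f (a :: p) x q) l

theorem ssum_congr {f g : List β → β → List β → G} {l : List β}
    (h : ∀ p x q, l = p ++ x :: q → f p x q = g p x q) : ssum f l = ssum g l := by
  induction l generalizing f g with
  | nil => rfl
  | cons a l ih =>
    simp only [ssum]
    rw [h [] a l rfl, ih fun p x q hl => h (a :: p) x q (by simp [hl])]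

theorem ssum_add (f g : List β → β → List β → G) (l : List β) :
    ssum (fun p x q => f p x q + g p x q) l = ssum f l + ssum g l := by
  induction l generalizing f g with
  | nil => simp [ssum]
  | cons a l ih => simp only [ssum, ih]; abel

theorem ssum_zero (l : List β) : ssum (fun _ _ _ => (0 : G)) l = 0 := by
  induction l with
  | nil => rfl
  | cons a l ih => simp [ssum, ih]

theorem map_ssum {H : Type*} [AddCommGroup H] (φ : G →+ H) (f : List β → β → List β → G)
    (l : List β) : φ (ssum f l) = ssum (fun p x q => φ (f p x q)) l := by
  induction l generalizing f with
  | nil => simp [ssum]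
  | cons a l ih => simp [ssum, ih]

theorem zsmul_ssum (k : ℤ) (f : List β → β → List β → G) (l : List β) :
    k • ssum f l = ssum (fun p x q => k • f p x q) l :=
  map_ssum (zsmulAddGroupHom k : G →+ G) f l

theorem ssum_append (f : List β → β → List β → G) (p q : List β) :
    ssum f (p ++ q) = ssum (fun p' x q' => f p' x (q' ++ q)) p +
      ssum (fun p' x q' => f (p ++ p') x q') q := by
  induction p generalizing f with
  | nil => simp [ssum]
  | cons a p ih => simp only [List.cons_append, ssum, ih]; abel

theorem ssum_assoc (F : List β → β → List β → β → List β → G) (l : List β) :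
    ssum (fun p x q => ssum (fun q₁ x' q₂ => F p x q₁ x' q₂) q) l =
      ssum (fun p x q => ssum (fun p₁ x' p₂ => F p₁ x' p₂ x q) p) l := by
  induction l generalizing F with
  | nil => rfl
  | cons a l ih =>
    simp only [ssum, ssum_add, zero_add, ih]

theorem sum_fin_eq_ssum {ι : Type*} (φ : β → ι) (l : List β) (l₀ : List ι) (hl : l₀ = l.map φ)
    (g : Fin l₀.length → G) (f : List β → β → List β → G)
    (H : ∀ p x q, l = p ++ x :: q → ∀ k : Fin l₀.length, (k : ℕ) = p.length → g k = f p x q) :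
    ∑ k, g k = ssum f l := by
  subst hl
  induction l generalizing f with
  | nil => exact Finset.sum_empty
  | cons a l ih =>
    simp only [ssum]
    have h0 : ∑ k, g k = g ⟨0, Nat.succ_pos _⟩ + ∑ k : Fin (l.map φ).length,
        g ⟨k + 1, Nat.succ_lt_succ k.2⟩ :=
      Fin.sum_univ_succ (n := (l.map φ).length) g
    rw [h0, H [] a l rfl ⟨0, Nat.succ_pos _⟩ rfl]
    congr 1
    refine ih (fun p x q => f (a :: p) x q) (fun k => g ⟨k + 1, Nat.succ_lt_succ k.2⟩)
      fun p x q hl k hk => ?_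
    exact H (a :: p) x q (by simp [hl]) _ (by simp [hk])

end SSum

/-! ### The sheafification functor -/

section Frame

variable {α : Type w} [PartialOrder α] [OrderTop α] (𝒜 : DGPresheaf.{u} α)

/-- A finite homogeneous frame `θ` of the global algebra, with coordinate functionals that are
compatible with restriction.  It exhibits the algebras as finitely generated projective modules in
such a way that `A⁰(U) ⊗ A(X) = A(U)`. -/
structure Frame where
  κ : Type
  [fintype : Fintype κ]
  θ : κ → 𝒜.A ⊤
  dg : κ → ℕ
  coef : ∀ U, κ → 𝒜.A U → 𝒜.A0 U
  θ_mem : ∀ s, θ s ∈ 𝒜.gr ⊤ (dg s)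
  coef_add : ∀ U s a b, coef U s (a + b) = coef U s a + coef U s b
  coef_smul : ∀ U s (r : 𝒜.A0 U) a, coef U s (r • a) = r * coef U s a
  coef_gr : ∀ U s j a, a ∈ 𝒜.gr U j → j ≠ dg s → coef U s a = 0
  coef_res : ∀ {U V} (h : V ≤ U) s a, coef V s (𝒜.res h a) = 𝒜.res0 h (coef U s a)
  sum_coef : ∀ U a, ∑ s, coef U s a • 𝒜.res (le_top : U ≤ ⊤) (θ s) = a

attribute [instance] Frame.fintype

variable {𝒜} {U V W : α} (fr : Frame 𝒜) {M : GMod.{u, v} 𝒜 U}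

theorem Frame.coef_inc_mul (h : V ≤ U) (s : fr.κ) (r : 𝒜.A0 U) (b : 𝒜.A V) :
    fr.coef V s (𝒜.inc h r * b) = 𝒜.res0 h r * fr.coef V s b := by
  rw [← fr.coef_smul, Algebra.smul_def]; rfl

theorem Frame.sum_coef' (a : 𝒜.A U) :
    ∑ s, 𝒜.inc (le_refl U) (fr.coef U s a) * 𝒜.res (le_top : U ≤ ⊤) (fr.θ s) = a := by
  conv_rhs => rw [← fr.sum_coef U a]
  refine Finset.sum_congr rfl fun s _ => ?_
  rw [Algebra.smul_def, DGPresheaf.inc, 𝒜.res0_refl]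

/-- The coordinate of index `s` of an element of `Q ⊗ A(V)`, in degree `q` of `Q|_V`. -/
noncomputable def Tot.coef (M : GMod.{u, v} 𝒜 U) (h : V ≤ U) (s : fr.κ) (q : ℤ) :
    Tot M h →+ (M.restrict h).Q q :=
  (DFinsupp.evalAddMonoidHom q : (⨁ n, (M.restrict h).Q n) →+ (M.restrict h).Q q).comp
    (Tot.lift (fun n e b => DirectSum.of (M.restrict h).Q n (M.tmul h (fr.coef V s b) e))
      (fun n e e' b => by rw [GMod.tmul_add, map_add])
      (fun n e b b' => by
        rw [fr.coef_add, ← map_add]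
        exact congrArg _ (TensorProduct.add_tmul (R := 𝒜.A0 U) (M := Sec0 𝒜 h) _ _ _))
      (fun n r e b => by rw [GMod.tmul_smul, GMod.smul_tmul, fr.coef_inc_mul]))

theorem Tot.coef_mk (h : V ≤ U) (s : fr.κ) (n : ℤ) (e : M.Q n) (b : 𝒜.A V) :
    Tot.coef fr M h s n (Tot.mk h n e b) = M.tmul h (fr.coef V s b) e := by
  simp only [Tot.coef, AddMonoidHom.comp_apply, Tot.lift_mk]
  exact DirectSum.of_eq_same n _

theorem Tot.coef_mk_ne (h : V ≤ U) (s : fr.κ) (n q : ℤ) (hq : q ≠ n) (e : M.Q n) (b : 𝒜.A V) :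
    Tot.coef fr M h s q (Tot.mk h n e b) = 0 := by
  simp only [Tot.coef, AddMonoidHom.comp_apply, Tot.lift_mk]
  exact DirectSum.of_eq_of_ne n q _ hq

/-- An element of total degree `m` is recovered from its coordinates. -/
theorem Tot.sum_collapse_coef (h : V ≤ U) (m : ℤ) (x : Tot M h) (hx : x ∈ Tot.deg M h m) :
    ∑ s, Tot.collapse M h (le_refl V) (m - fr.dg s) (Tot.coef fr M h s (m - fr.dg s) x)
      (𝒜.res le_top (fr.θ s)) = x := by
  refine Tot.deg_induction (p := fun x => ∑ s, Tot.collapse M h (le_refl V) (m - fr.dg s)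
    (Tot.coef fr M h s (m - fr.dg s) x) (𝒜.res le_top (fr.θ s)) = x) hx ?_ ?_ ?_ ?_
  · simp [Tot.collapse_zero_left]
  · intro x y hx hy
    simp only [map_add, Tot.collapse_add_left, Finset.sum_add_distrib, hx, hy]
  · intro x hx
    have : ∀ n (q : (M.restrict h).Q n) (b : 𝒜.A V), Tot.collapse M h (le_refl V) n (-q) b =
      -Tot.collapse M h (le_refl V) n q b := fun n q b => map_neg _ _
    simp only [map_neg, this, Finset.sum_neg_distrib, hx]
  · intro n j e b hb hn
    conv_rhs => rw [← fr.sum_coef' b, Tot.mk_sum_right]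
    refine Finset.sum_congr rfl fun s _ => ?_
    by_cases hs : j = fr.dg s
    · have : m - fr.dg s = n := by omega
      rw [this, Tot.coef_mk, Tot.collapse_tmul]
    · have h0 := fr.coef_gr V s j b hb hs
      rw [h0, Tot.coef_mk_ne]
      · rw [Tot.collapse_zero_left]; simp [DGPresheaf.inc]
      · omega

end Frame

section Sheafify

variable {α : Type w} [SemilatticeInf α] [OrderTop α] {ι : Type w'} {𝒜 : DGPresheaf.{u} α}
  {U : ι → α} (fr : Frame 𝒜)

/-- The sections in degree `n` of the sheafification of a twisted complex:
`∏_{p+q=n} ∏_{i₀ … i_p} F^q_{i₀}|_{U_{i₀ … i_p}}`.  The component at `(i₀, …, i_p)` has index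
`i₀, [i₁, …, i_p]`. -/
def ShSec (F : Tw.{u, v} 𝒜 U) (n : ℤ) : Type (max u v w') :=
  ∀ (i : ι) (l : List ι), ((F.gmod i).restrict (cap_le_head U i l)).Q (n - l.length)

noncomputable instance (F : Tw.{u, v} 𝒜 U) (n : ℤ) : AddCommGroup (ShSec F n) :=
  inferInstanceAs (AddCommGroup
    (∀ (i : ι) (l : List ι), ((F.gmod i).restrict (cap_le_head U i l)).Q (n - l.length)))

/-- The global algebra acts through restriction. -/
noncomputable instance (F : Tw.{u, v} 𝒜 U) (n : ℤ) : Module (𝒜.A0 ⊤) (ShSec F n) where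
  smul r c := fun i l => 𝒜.res0 (le_top : cap U i l ≤ ⊤) r • c i l
  one_smul c := by
    funext i l; change 𝒜.res0 (le_top : cap U i l ≤ ⊤) 1 • c i l = _; rw [map_one, one_smul]
  mul_smul r s c := by
    funext i l
    change 𝒜.res0 (le_top : cap U i l ≤ ⊤) (r * s) • c i l =
      𝒜.res0 (le_top : cap U i l ≤ ⊤) r • 𝒜.res0 (le_top : cap U i l ≤ ⊤) s • c i l
    rw [map_mul, mul_smul]
  smul_zero r := by funext i l; exact smul_zero (𝒜.res0 (le_top : cap U i l ≤ ⊤) r)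
  smul_add r c c' := by funext i l; exact smul_add (𝒜.res0 (le_top : cap U i l ≤ ⊤) r) _ _
  add_smul r s c := by
    funext i l
    change 𝒜.res0 (le_top : cap U i l ≤ ⊤) (r + s) • c i l =
      𝒜.res0 (le_top : cap U i l ≤ ⊤) r • c i l + 𝒜.res0 (le_top : cap U i l ≤ ⊤) s • c i l
    rw [map_add, add_smul]
  zero_smul c := by
    funext i l; change 𝒜.res0 (le_top : cap U i l ≤ ⊤) 0 • c i l = 0; rw [map_zero, zero_smul]

/-- The graded module of the sheafification of a twisted complex. -/
noncomputable abbrev shGMod (F : Tw.{u, v} 𝒜 U) : GMod.{u, max u v w'} 𝒜 (⊤ : α) where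
  Q := ShSec F

/-- The projection of the sheafification, restricted to `W`, onto its component at
`i₀, [i₁, …, i_p]`, for `W ⊆ U_{i₀ … i_p}`. -/
noncomputable def shProj (F : Tw.{u, v} 𝒜 U) (i : ι) (l : List ι) (W : α) (h : W ≤ cap U i l) :
    Mor (shGMod F) (F.gmod i) (le_top : W ≤ ⊤) (h.trans (cap_le_head U i l)) where
  val := Tot.lift (fun n c b => Tot.collapse (F.gmod i) (cap_le_head U i l) h (n - l.length)
      ((c : ShSec F n) i l) b)
    (fun n c c' b => Tot.collapse_add_left ..)
    (fun n c b b' => Tot.collapse_add_right ..)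
    (fun n r c b => by
      have : 𝒜.inc (le_top : W ≤ ⊤) r = 𝒜.inc h (𝒜.res0 le_top r) := (inc_res0 ..).symm
      rw [this]; exact Tot.collapse_smul ..)
  lin := Tot.lift_lin _ _ _ _ fun n c b b' => Tot.collapse_rmul ..

theorem shProj_mk (F : Tw.{u, v} 𝒜 U) (i : ι) (l : List ι) (W : α) (h : W ≤ cap U i l) (n : ℤ)
    (c : ShSec F n) (b : 𝒜.A W) : (shProj F i l W h).1 (Tot.mk (M := shGMod F) le_top n c b) =
      Tot.collapse (F.gmod i) (cap_le_head U i l) h (n - l.length) (c i l) b := by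
  simp only [shProj]; exact Tot.lift_mk ..

theorem shProj_isDeg (F : Tw.{u, v} 𝒜 U) (i : ι) (l : List ι) (W : α) (h : W ≤ cap U i l) :
    IsDeg (-(l.length : ℤ)) (shProj F i l W h).1 :=
  Mor.isDeg_of_mk _ fun n c => by
    rw [shProj_mk]; exact Tot.collapse_mem_deg _ _ (one_mem_gr 𝒜) (by simp; ring)

/-- Čech cochains with values in the total modules. -/
abbrev ShTot (F : Tw.{u, v} 𝒜 U) : Type (max u v w') :=
  ∀ (i : ι) (l : List ι), Tot (F.gmod i) (cap_le_head U i l)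

/-- The operator `δ + a` on Čech cochains: `δ` is
`(δ c)_{i₀ … i_{p+1}} = ∑_{k=1}^{p+1} (-1)^k c_{i₀ … î_k … i_{p+1}}`, and `a` acts by
`(a · c)_{i₀ … i_{p+r}} = (-1)^{q r} a^{p,q}_{i₀ … i_p} c_{i_p … i_{p+r}}`. -/
noncomputable def shOp (F : Tw.{u, v} 𝒜 U) (y : ShTot F) : ShTot F := fun i l =>
  ∑ k : Fin l.length, sgn (k + 1) •
      Tot.res (cap_le_head U i _) (cap_erase U i l k) (y i (l.eraseIdx k)) +
    sgn l.length • (F.obj i).connOn (cap_le_head U i l) (y i l) +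
    ∑ k : Fin l.length, sgn ((1 - (k + 1)) * (l.length - (k + 1))) •
      F.raw.pos i (l.take k) (l.get k) (cap U i l) (cap_take U i l k)
        (Tot.res (cap_le_head U _ _) (cap_drop U i l k) (y (l.get k) (l.drop (k + 1))))

/-- All components of an element of the total module of the sheafification. -/
noncomputable def shAll (F : Tw.{u, v} 𝒜 U) (x : Tot (shGMod F) (le_refl (⊤ : α))) : ShTot F :=
  fun i l => (shProj F i l _ le_rfl).1 (Tot.res (le_refl ⊤) le_top x)

/-- The section whose components are the coordinates of index `s` of a cochain. -/
noncomputable def shCoef (F : Tw.{u, v} 𝒜 U) (s : fr.κ) (n : ℤ) (y : ShTot F) : ShSec F n :=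
  fun i l => Tot.coef fr (F.gmod i) (cap_le_head U i l) s (n - l.length) (y i l)

/-- The element of the total module of the sheafification with given components of total
degree `m`. -/
noncomputable def shLift (F : Tw.{u, v} 𝒜 U) (m : ℤ) (y : ShTot F) :
    Tot (shGMod F) (le_refl (⊤ : α)) :=
  ∑ s : fr.κ, Tot.mk (M := shGMod F) (le_refl ⊤) (m - fr.dg s)
    (shCoef fr F s (m - fr.dg s) y) (fr.θ s)

theorem shAll_add (F : Tw.{u, v} 𝒜 U) (x x') : shAll F (x + x') = shAll F x + shAll F x' := by
  funext i l; simp [shAll]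

theorem shAll_lift (F : Tw.{u, v} 𝒜 U) (m : ℤ) (y : ShTot F)
    (hy : ∀ i l, y i l ∈ Tot.deg (F.gmod i) (cap_le_head U i l) (m - l.length)) :
    shAll F (shLift fr F m y) = y := by
  funext i l
  conv_rhs => rw [← Tot.sum_collapse_coef fr _ _ _ (hy i l)]
  simp only [shAll, shLift, map_sum, Tot.res_mk]
  refine Finset.sum_congr rfl fun s _ => ?_
  rw [shProj_mk]
  have : ∀ q q' : ℤ, q = q' → Tot.collapse (F.gmod i) (cap_le_head U i l) le_rfl q
      (Tot.coef fr (F.gmod i) (cap_le_head U i l) s q (y i l)) (𝒜.res le_top (fr.θ s)) =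
      Tot.collapse (F.gmod i) (cap_le_head U i l) le_rfl q'
      (Tot.coef fr (F.gmod i) (cap_le_head U i l) s q' (y i l)) (𝒜.res le_top (fr.θ s)) := by
    rintro q _ rfl; rfl
  exact this _ _ (by ring)

theorem shAll_mk (F : Tw.{u, v} 𝒜 U) (n : ℤ) (c : ShSec F n) (b : 𝒜.A ⊤) (i : ι) (l : List ι) :
    shAll F (Tot.mk (M := shGMod F) _ n c b) i l =
      Tot.collapse (F.gmod i) (cap_le_head U i l) le_rfl (n - l.length) (c i l) (𝒜.res le_top b) := by
  simp only [shAll, Tot.res_mk, shProj_mk]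

theorem shCoef_add (F : Tw.{u, v} 𝒜 U) (s : fr.κ) (n : ℤ) (y y' : ShTot F) :
    shCoef fr F s n (y + y') = shCoef fr F s n y + shCoef fr F s n y' := by
  funext i l; exact map_add _ _ _

theorem shCoef_same (F : Tw.{u, v} 𝒜 U) (s : fr.κ) (n : ℤ) (c : ShSec F n) (b : 𝒜.A ⊤) :
    shCoef fr F s n (shAll F (Tot.mk (M := shGMod F) _ n c b)) = fr.coef ⊤ s b • c := by
  funext i l
  change Tot.coef fr (F.gmod i) (cap_le_head U i l) s (n - l.length) _ =
    𝒜.res0 (le_top : cap U i l ≤ ⊤) (fr.coef ⊤ s b) • c i l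
  rw [shAll_mk]
  generalize c i l = z
  refine GMod.restrict_induction (p := fun z => Tot.coef fr (F.gmod i)
    (cap_le_head U i l) s (n - l.length) (Tot.collapse (F.gmod i) (cap_le_head U i l)
      le_rfl (n - l.length) z (𝒜.res le_top b)) =
      𝒜.res0 (le_top : cap U i l ≤ ⊤) (fr.coef ⊤ s b) • z) z ?_ ?_ ?_
  · rw [Tot.collapse_zero_left, map_zero, smul_zero]
  · intro g e
    rw [Tot.collapse_tmul, Tot.coef_mk, fr.coef_inc_mul, fr.coef_res, 𝒜.res0_refl,
      GMod.smul_tmul, mul_comm]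
  · intro z z' hz hz'
    rw [Tot.collapse_add_left, map_add, hz, hz', smul_add]

theorem shCoef_ne (F : Tw.{u, v} 𝒜 U) (s : fr.κ) (n q : ℤ) (hq : q ≠ n) (c : ShSec F n)
    (b : 𝒜.A ⊤) : shCoef fr F s q (shAll F (Tot.mk (M := shGMod F) _ n c b)) = 0 := by
  funext i l
  change Tot.coef fr (F.gmod i) (cap_le_head U i l) s (q - l.length) _ = 0
  rw [shAll_mk]
  generalize c i l = z
  refine GMod.restrict_induction (p := fun z => Tot.coef fr (F.gmod i)
    (cap_le_head U i l) s (q - l.length) (Tot.collapse (F.gmod i) (cap_le_head U i l)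
      le_rfl (n - l.length) z (𝒜.res le_top b)) = 0) z ?_ ?_ ?_
  · rw [Tot.collapse_zero_left, map_zero]
  · intro g e
    rw [Tot.collapse_tmul]; exact Tot.coef_mk_ne _ _ _ _ _ (by omega) _ _
  · intro z z' hz hz'
    rw [Tot.collapse_add_left, map_add, hz, hz', add_zero]

theorem shAll_injective (F : Tw.{u, v} 𝒜 U) (fr : Frame 𝒜) : Function.Injective (shAll F) := by
  let R : Finset ℤ → ShTot F → Tot (shGMod F) (le_refl (⊤ : α)) := fun N y =>
    ∑ n ∈ N, ∑ s : fr.κ, Tot.mk (M := shGMod F) (le_refl ⊤) n (shCoef fr F s n y) (fr.θ s)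
  have hR : ∀ N y y', R N (y + y') = R N y + R N y' := by
    intro N y y'
    simp only [R, ← Finset.sum_add_distrib, shCoef_add]
    exact Finset.sum_congr rfl fun n _ => Finset.sum_congr rfl fun s _ => Tot.mk_add_left ..
  have key : ∀ x, ∃ N₀ : Finset ℤ, ∀ N, N₀ ⊆ N → R N (shAll F x) = x := by
    intro x
    refine Tot.induction (p := fun x => ∃ N₀ : Finset ℤ, ∀ N, N₀ ⊆ N → R N (shAll F x) = x) x
      ⟨∅, fun N _ => ?_⟩ (fun n c b => ⟨{n}, fun N hN => ?_⟩) ?_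
    · have h0 : shAll F 0 = 0 := by funext i l; simp [shAll]
      have := hR N 0 0
      rw [add_zero] at this
      rw [h0]
      simpa using this
    · have hn : n ∈ N := hN (by simp)
      simp only [R]
      rw [Finset.sum_eq_single n]
      · conv_rhs => rw [← fr.sum_coef' b, Tot.mk_sum_right]
        refine Finset.sum_congr rfl fun s _ => ?_
        rw [shCoef_same, 𝒜.res_refl, ← Tot.mk_smul]
      · intro q _ hq
        refine Finset.sum_eq_zero fun s _ => ?_
        rw [shCoef_ne fr F s n q hq]
        exact Tot.mk_zero_left _ _
      · exact fun h => absurd hn h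
    · rintro x y ⟨N₁, h₁⟩ ⟨N₂, h₂⟩
      refine ⟨N₁ ∪ N₂, fun N hN => ?_⟩
      rw [shAll_add, hR, h₁ N (Finset.union_subset_left hN), h₂ N (Finset.union_subset_right hN)]
  intro x y hxy
  obtain ⟨N₁, h₁⟩ := key x
  obtain ⟨N₂, h₂⟩ := key y
  rw [← h₁ _ Finset.subset_union_left, ← h₂ (N₁ ∪ N₂) Finset.subset_union_right, hxy]

end Sheafify

section Abstract

variable {J : Type*} {T : J → Type*} [∀ j, AddCommGroup (T j)]

/-- The operator `δ + a`, over a fixed open set. -/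
def absOp (C : ∀ j, T j →+ T j) (A : ∀ i, List J → ∀ x, T x →+ T i) (Y : ∀ j, List J → T j)
    (i : J) (l : List J) : T i :=
  ssum (fun p x q => sgn (p.length + 1) • Y i (p ++ q)) l + sgn l.length • C i (Y i l) +
    ssum (fun p x q => sgn (-(p.length * q.length)) • A i p x (Y x q)) l

theorem absOp_absOp (C : ∀ j, T j →+ T j) (A : ∀ i, List J → ∀ x, T x →+ T i)
    (hC : ∀ j z, C j (C j z) = 0)
    (hA : ∀ i p x z, ssum (fun p₁ m p₂ => sgn (p₁.length + 1) • A i (p₁ ++ p₂) x z) p +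
      (sgn (p.length + 1) • C i (A i p x z) + A i p x (C x z) +
        ssum (fun p₁ m p₂ => sgn (-(p₁.length * (p₂.length + 1))) • A i p₁ m (A m p₂ x z)) p) = 0)
    (Y : ∀ j, List J → T j) (i : J) (l : List J) : absOp C A (absOp C A Y) i l = 0 := by
  have h1 : ssum (fun p x q => sgn (p.length + 1) •
      ssum (fun p' x' q' => sgn (p'.length + 1) • Y i (p' ++ q')) (p ++ q)) l = 0 := by
    simp only [ssum_append, smul_add, ssum_add, zsmul_ssum]
    rw [ssum_assoc, ← ssum_add]
    rw [← ssum_zero l]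
    refine ssum_congr fun p x q _ => ?_
    rw [← ssum_add, ← ssum_zero p]
    refine ssum_congr fun p₁ y p₂ hp => ?_
    subst hp
    simp only [smul_smul, ← sgn_add, List.append_assoc]
    rw [sgn_congr_odd (a := _ + _) (b := p₁.length + 1 + ((p₁ ++ p₂).length + 1)) ⟨0, by
      simp; ring⟩]
    rw [neg_smul, neg_add_cancel]
  have h2 : ssum (fun p x q => sgn (p.length + 1) • sgn (p ++ q).length • C i (Y i (p ++ q))) l +
      sgn l.length • C i (ssum (fun p x q => sgn (p.length + 1) • Y i (p ++ q)) l) = 0 := by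
    rw [map_ssum, zsmul_ssum, ← ssum_add, ← ssum_zero l]
    refine ssum_congr fun p x q hl => ?_
    subst hl
    rw [map_zsmul, smul_smul, smul_smul, ← add_smul, ← sgn_add, ← sgn_add,
      sgn_congr_odd (a := _ + _) (b := (p ++ x :: q).length + (p.length + 1)) ⟨-1, by
      simp; ring⟩, neg_add_cancel, zero_smul]
  have h4 : ssum (fun p x q => sgn (p.length + 1) • ssum (fun p' x' q' =>
        sgn (-(p'.length * q'.length)) • A i p' x' (Y x' q')) (p ++ q)) l +
      ssum (fun p x q => sgn (-(p.length * q.length)) • A i p x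
        (ssum (fun q₁ x' q₂ => sgn (q₁.length + 1) • Y x (q₁ ++ q₂)) q)) l =
      ssum (fun p x q => (sgn (-(p.length * q.length)) * sgn q.length) •
        ssum (fun p₁ m p₂ => sgn (p₁.length + 1) • A i (p₁ ++ p₂) x (Y x q)) p) l := by
    simp only [ssum_append, smul_add, ssum_add, zsmul_ssum, map_ssum]
    have hI : ssum (fun p x q => ssum (fun p₁ y q₁ => sgn (p.length + 1) •
        sgn (-(p₁.length * (q₁ ++ q).length)) • A i p₁ y (Y y (q₁ ++ q))) p) l =
        ssum (fun p y q => ssum (fun q₁ x q₂ => sgn (p.length + q₁.length + 2) •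
          sgn (-(p.length * (q₁ ++ q₂).length)) • A i p y (Y y (q₁ ++ q₂))) q) l := by
      rw [ssum_assoc]
      refine ssum_congr fun p x q _ => ssum_congr fun p₁ y p₂ hp => ?_
      subst hp
      congr 1
      exact sgn_congr ⟨0, by simp; ring⟩
    rw [hI, add_right_comm, ← ssum_add,
      ssum_congr (g := fun _ _ _ => 0), ssum_zero, zero_add, ssum_assoc]
    · refine ssum_congr fun p x q _ => ssum_congr fun p₁ y p₂ hp => ?_
      subst hp
      simp only [smul_smul, ← sgn_add]
      congr 1
      exact sgn_congr ⟨0, by simp; ring⟩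
    · intro p x q _
      rw [← ssum_add, ← ssum_zero q]
      refine ssum_congr fun p₁ y p₂ hp => ?_
      subst hp
      simp only [map_zsmul, smul_smul, ← sgn_add]
      rw [← add_smul, sgn_congr_odd (a := _ + _) 
        (b := -(p.length * (p₁ ++ y :: p₂).length) + (p₁.length + 1)) ⟨p.length, by simp; ring⟩,
        neg_add_cancel, zero_smul]
  have h8 : ssum (fun p x q => sgn (-(p.length * q.length)) • A i p x
        (ssum (fun q₁ x' q₂ => sgn (-(q₁.length * q₂.length)) • A x q₁ x' (Y x' q₂)) q)) l =
      ssum (fun p x q => (sgn (-(p.length * q.length)) * sgn q.length) •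
        ssum (fun p₁ m p₂ => sgn (-(p₁.length * (p₂.length + 1))) •
          A i p₁ m (A m p₂ x (Y x q))) p) l := by
    simp only [zsmul_ssum, map_ssum]
    trans ssum (fun p x q => ssum (fun q₁ x' q₂ => sgn (-(p.length * (q₁.length + q₂.length + 1))) •
      A i p x (sgn (-(q₁.length * q₂.length)) • A x q₁ x' (Y x' q₂))) q) l
    · refine ssum_congr fun p x q _ => ssum_congr fun p₁ y p₂ hp => ?_
      subst hp
      congr 1
      exact sgn_congr ⟨0, by simp; ring⟩
    rw [ssum_assoc]
    refine ssum_congr fun p x q _ => ssum_congr fun p₁ y p₂ hp => ?_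
    subst hp
    simp only [map_zsmul, smul_smul, ← sgn_add]
    congr 1
    exact sgn_congr ⟨0, by simp; ring⟩
  have h5 : sgn l.length • C i (ssum (fun p x q => sgn (-(p.length * q.length)) •
        A i p x (Y x q)) l) = ssum (fun p x q => (sgn (-(p.length * q.length)) * sgn q.length) •
          sgn (p.length + 1) • C i (A i p x (Y x q))) l := by
    rw [map_ssum, zsmul_ssum]
    refine ssum_congr fun p x q hl => ?_
    subst hl
    simp only [map_zsmul, smul_smul, ← sgn_add]
    congr 1
    exact sgn_congr ⟨0, by simp; ring⟩
  have h7 : ssum (fun p x q => sgn (-(p.length * q.length)) • A i p x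
        (sgn q.length • C x (Y x q))) l =
      ssum (fun p x q => (sgn (-(p.length * q.length)) * sgn q.length) •
          A i p x (C x (Y x q))) l := by
    refine ssum_congr fun p x q hl => ?_
    rw [map_zsmul, smul_smul]
  have h9 : ssum (fun p x q => (sgn (-(p.length * q.length)) * sgn q.length) •
        ssum (fun p₁ m p₂ => sgn (p₁.length + 1) • A i (p₁ ++ p₂) x (Y x q)) p) l +
      (ssum (fun p x q => (sgn (-(p.length * q.length)) * sgn q.length) •
          sgn (p.length + 1) • C i (A i p x (Y x q))) l +
        ssum (fun p x q => (sgn (-(p.length * q.length)) * sgn q.length) •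
          A i p x (C x (Y x q))) l +
        ssum (fun p x q => (sgn (-(p.length * q.length)) * sgn q.length) •
        ssum (fun p₁ m p₂ => sgn (-(p₁.length * (p₂.length + 1))) •
          A i p₁ m (A m p₂ x (Y x q))) p) l) = 0 := by
    simp only [← ssum_add, ← smul_add, hA, smul_zero, ssum_zero]
  rw [← h4, ← h5, ← h7, ← h8] at h9
  unfold absOp
  have hC' : ∀ (k : ℤ) j z, C j (k • C j z) = 0 := fun k j z => by rw [map_zsmul, hC, smul_zero]
  simp only [smul_add, map_add, ssum_add, hC', smul_zero]
  rw [h1]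
  refine Eq.trans ?_ ((congrArg₂ (· + ·) h2 h9).trans (add_zero _))
  abel

end Abstract

section SquareZero

variable {α : Type w} [SemilatticeInf α] {ι : Type w'} {𝒜 : DGPresheaf.{u} α} {U : ι → α}

theorem pos_rmul (F : Tw.{u, v} 𝒜 U) (i : ι) (l : List ι) (j : ι) (W : α)
    (h : W ≤ cap U i (l ++ [j])) (b : 𝒜.A W) (z) :
    F.raw.pos i l j W h (Tot.rmul b z) = Tot.rmul b (F.raw.pos i l j W h z) :=
  ((F.a i l j).restrict h).2 b z

theorem pos_res (F : Tw.{u, v} 𝒜 U) (i : ι) (l : List ι) (j : ι) (V W : α)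
    (h : V ≤ cap U i (l ++ [j])) (h' : W ≤ V) (z) :
    F.raw.pos i l j W (h'.trans h) (Tot.res _ h' z) = Tot.res _ h' (F.raw.pos i l j V h z) := by
  have := Mor.restrict_res ((F.a i l j).restrict h) h' z
  rw [Mor.restrict_restrict] at this
  exact this

theorem pos_deg (F : Tw.{u, v} 𝒜 U) (i : ι) (l : List ι) (j : ι) (W : α)
    (h : W ≤ cap U i (l ++ [j])) : IsDeg (-(l.length : ℤ)) (F.raw.pos i l j W h) :=
  Mor.restrict_isDeg _ (F.a_deg i l j) h

theorem sum_zsmul_apply {κ G H : Type*} [Fintype κ] [AddCommGroup G] [AddCommGroup H]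
    (c : κ → ℤ) (f : κ → G →+ H) (z : G) : (∑ k, c k • f k) z = ∑ k, c k • f k z := by
  simp [AddMonoidHom.finsetSum_apply]

/-- The left hand side of the Maurer-Cartan equation over `W`, at an element. -/
noncomputable def mcVal (F : Tw.{u, v} 𝒜 U) (i : ι) (l : List ι) (j : ι) (W : α)
    (h : W ≤ cap U i (l ++ [j])) (z : Tot (F.gmod j) (h.trans (cap_le_last U i l j))) :
    Tot (F.gmod i) (h.trans (cap_le_head U i _)) :=
  ∑ k : Fin l.length, sgn (k + 1) •
        F.raw.pos i (l.eraseIdx k) j W (h.trans (cap_erase' U i l j k)) z +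
      (sgn (l.length + 1) • (F.obj i).connOn _ (F.raw.pos i l j W h z) +
        F.raw.pos i l j W h ((F.obj j).connOn _ z) +
        ∑ k : Fin l.length, sgn ((1 - (k + 1)) * (l.length - k)) •
          F.raw.pos i (l.take k) (l.get k) W (h.trans (cap_take' U i l j k))
            (F.raw.pos (l.get k) (l.drop (k + 1)) j W (h.trans (cap_drop' U i l j k)) z))

theorem mcVal_add (F : Tw.{u, v} 𝒜 U) (i : ι) (l : List ι) (j : ι) (W : α)
    (h : W ≤ cap U i (l ++ [j])) (z z') :
    mcVal F i l j W h (z + z') = mcVal F i l j W h z + mcVal F i l j W h z' := by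
  simp only [mcVal, map_add, smul_add, Finset.sum_add_distrib]
  abel

theorem Raw.delta_apply {E : ∀ i, GMod.{u, v} 𝒜 (U i)} {F : ∀ i, GMod.{u, v'} 𝒜 (U i)}
    (f : Raw U E F) (i : ι) (l : List ι) (j : ι) (W : α) (h : W ≤ cap U i (l ++ [j]))
    (z : Tot (E j) (h.trans (cap_le_last U i l j))) :
    f.delta.pos i l j W h z = ∑ k : Fin l.length, sgn (k + 1) •
      f.pos i (l.eraseIdx k) j W (h.trans (cap_erase' U i l j k)) z :=
  sum_zsmul_apply (G := Tot (E j) (h.trans (cap_le_last U i l j)))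
    (H := Tot (F i) (h.trans (cap_le_head U i (l ++ [j]))))
    (fun k : Fin l.length => sgn (k + 1))
    (fun k => f.pos i (l.eraseIdx k) j W (h.trans (cap_erase' U i l j k))) z

theorem Raw.mul_apply {E : ∀ i, GMod.{u, v} 𝒜 (U i)} {F : ∀ i, GMod.{u, v'} 𝒜 (U i)}
    {G : ∀ i, GMod.{u, v''} 𝒜 (U i)} (m : ℤ) (f : Raw U F G) (g : Raw U E F)
    (i : ι) (l : List ι) (j : ι) (W : α) (h : W ≤ cap U i (l ++ [j]))
    (z : Tot (E j) (h.trans (cap_le_last U i l j))) :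
    (f.mul m g).pos i l j W h z =
      sgn (m * (l.length + 1)) • f.zero i W (h.trans (cap_le_head U i _)) (g.pos i l j W h z) +
      f.pos i l j W h (g.zero j W (h.trans (cap_le_last U i l j)) z) +
      ∑ k : Fin l.length, sgn ((m - (k + 1)) * (l.length - k)) •
        f.pos i (l.take k) (l.get k) W (h.trans (cap_take' U i l j k))
          (g.pos (l.get k) (l.drop (k + 1)) j W (h.trans (cap_drop' U i l j k)) z) :=
  congrArg₂ (· + ·) rfl (sum_zsmul_apply (G := Tot (E j) (h.trans (cap_le_last U i l j)))
    (H := Tot (G i) (h.trans (cap_le_head U i (l ++ [j]))))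
    (fun k : Fin l.length => sgn ((m - (k + 1)) * (l.length - k)))
    (fun k => (f.pos i (l.take k) (l.get k) W (h.trans (cap_take' U i l j k))).comp
          (g.pos (l.get k) (l.drop (k + 1)) j W (h.trans (cap_drop' U i l j k)))) z)

theorem mcVal_cap (F : Tw.{u, v} 𝒜 U) (i : ι) (l : List ι) (j : ι) (z) :
    mcVal F i l j _ le_rfl z = 0 := by
  have hG := DFunLike.congr_fun (F.mc i l j) z
  rw [AddMonoidHom.add_apply, Raw.delta_apply, Raw.mul_apply, one_mul] at hG
  exact hG

theorem mcVal_res (F : Tw.{u, v} 𝒜 U) (i : ι) (l : List ι) (j : ι) (V W : α)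
    (h : V ≤ cap U i (l ++ [j])) (h' : W ≤ V) (z) :
    mcVal F i l j W (h'.trans h) (Tot.res _ h' z) = Tot.res _ h' (mcVal F i l j V h z) := by
  simp only [mcVal, map_add, map_sum, map_zsmul]
  refine congrArg₂ (· + ·) (Finset.sum_congr rfl fun k _ => congrArg _ (pos_res ..))
    (congrArg₂ (· + ·) (congrArg₂ (· + ·) (congrArg _ ?_) ?_)
      (Finset.sum_congr rfl fun k _ => congrArg _ ?_))
  · rw [← QCoh.connOn_res, ← pos_res]
  · rw [← pos_res, QCoh.connOn_res]
  · have h1 := pos_res F (l.get k) (l.drop (k + 1)) j V W (h.trans (cap_drop' U i l j k)) h' z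
    have h2 := pos_res F i (l.take k) (l.get k) V W (h.trans (cap_take' U i l j k)) h'
      (F.raw.pos (l.get k) (l.drop (k + 1)) j V (h.trans (cap_drop' U i l j k)) z)
    exact (congrArg _ h1).trans h2

theorem mcVal_rmul (F : Tw.{u, v} 𝒜 U) (i : ι) (l : List ι) (j : ι) (W : α)
    (h : W ≤ cap U i (l ++ [j])) (b : 𝒜.A W) (m : ℤ) (z) (hz : z ∈ Tot.deg (F.gmod j) _ m) :
    mcVal F i l j W h (Tot.rmul b z) = Tot.rmul b (mcVal F i l j W h z) := by
  simp only [mcVal, map_add, map_sum, map_zsmul]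
  refine congrArg₂ (· + ·) (Finset.sum_congr rfl fun k _ => congrArg _ (pos_rmul ..))
    (congrArg₂ (· + ·) ?_ (Finset.sum_congr rfl fun k _ => congrArg _ ?_))
  · have h1 := (F.obj j).connOn_rmul _ m z hz b
    have h2 := (F.obj i).connOn_rmul _ _ _ (pos_deg F i l j W h m z hz) b
    rw [h1, map_add, map_zsmul, pos_rmul, pos_rmul, pos_rmul, h2, smul_add, smul_smul, ← sgn_add,
      sgn_congr_odd (a := l.length + 1 + (m + -l.length)) (b := m) ⟨0, by ring⟩, neg_smul]
    abel
  · rw [pos_rmul, pos_rmul]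

/-- The Maurer-Cartan equation holds over all smaller open sets. -/
theorem mcVal_eq_zero (F : Tw.{u, v} 𝒜 U) (i : ι) (l : List ι) (j : ι) (W : α)
    (h : W ≤ cap U i (l ++ [j])) (z) : mcVal F i l j W h z = 0 := by
  refine Tot.induction (p := fun z => mcVal F i l j W h z = 0) z ?_ ?_ ?_
  · simpa using mcVal_add F i l j W h 0 0
  · intro n e b
    have h1 : Tot.mk (M := F.gmod j) (h.trans (cap_le_last U i l j)) n e b =
        Tot.rmul b (Tot.res (cap_le_last U i l j) h (Tot.mk _ n e 1)) := by
      rw [Tot.res_mk, Tot.rmul_mk, map_one, one_mul]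
    rw [h1, mcVal_rmul F i l j W h b n _
      (Tot.res_mem_deg _ h (Tot.mk_mem_deg e (one_mem_gr 𝒜) (by simp)))]
    have h2 := mcVal_res F i l j _ W le_rfl h (Tot.mk _ n e 1)
    rw [mcVal_cap, map_zero] at h2
    rw [h2, map_zero]
  · intro x y hx hy
    rw [mcVal_add, hx, hy, add_zero]

end SquareZero

section Squares

variable {α : Type w} [SemilatticeInf α] [OrderTop α] {ι : Type w'} {𝒜 : DGPresheaf.{u} α}
  {U : ι → α}

theorem le_cap_map {W : α} (i : {j // W ≤ U j}) (l : List {j // W ≤ U j}) :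
    W ≤ cap U i.1 (l.map Subtype.val) :=
  le_cap.2 fun j hj => by
    rcases List.mem_cons.1 hj with rfl | hj
    · exact i.2
    · obtain ⟨x, -, rfl⟩ := List.mem_map.1 hj
      exact x.2

theorem le_cap_map' {W : α} (i : {j // W ≤ U j}) (l : List {j // W ≤ U j}) (x : {j // W ≤ U j}) :
    W ≤ cap U i.1 (l.map Subtype.val ++ [x.1]) := by
  have := le_cap_map i (l ++ [x])
  rwa [List.map_append] at this

/-- The modules of a twisted complex over `W`. -/
abbrev WTot (F : Tw.{u, v} 𝒜 U) (W : α) (j : {j // W ≤ U j}) : Type (max u v) := Tot (F.gmod j.1) j.2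

/-- The operators of a twisted complex over `W`. -/
noncomputable def wPos (F : Tw.{u, v} 𝒜 U) (W : α) (i : {j // W ≤ U j}) (p : List {j // W ≤ U j})
    (x : {j // W ≤ U j}) : WTot F W x →+ WTot F W i :=
  F.raw.pos i.1 (p.map Subtype.val) x.1 W (le_cap_map' i p x)

/-- The restriction of a cochain to `W`. -/
noncomputable def wRes (F : Tw.{u, v} 𝒜 U) (W : α) (y : ShTot F) (i : {j // W ≤ U j})
    (l : List {j // W ≤ U j}) : WTot F W i :=
  Tot.res (cap_le_head U i.1 _) (le_cap_map i l) (y i.1 (l.map Subtype.val))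

theorem wPos_eq (F : Tw.{u, v} 𝒜 U) (W : α) (i : {j // W ≤ U j}) (p : List {j // W ≤ U j})
    (x : {j // W ≤ U j}) {p' : List ι} (hp : p' = p.map Subtype.val)
    (h : W ≤ cap U i.1 (p' ++ [x.1])) (z : WTot F W x) :
    F.raw.pos i.1 p' x.1 W h z = wPos F W i p x z := by
  subst hp; rfl

theorem wRes_eq (F : Tw.{u, v} 𝒜 U) (W : α) (y : ShTot F) (i : {j // W ≤ U j})
    (l : List {j // W ≤ U j}) {l' : List ι} (hl : l' = l.map Subtype.val)
    (h : W ≤ cap U i.1 l') : Tot.res (cap_le_head U i.1 _) h (y i.1 l') = wRes F W y i l := by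
  subst hl; rfl

theorem wPos_wRes_eq (F : Tw.{u, v} 𝒜 U) (W : α) (y : ShTot F) (i : {j // W ≤ U j})
    (p : List {j // W ≤ U j}) (x : {j // W ≤ U j}) (q : List {j // W ≤ U j}) {p' q' : List ι}
    {x' : ι} (hp : p' = p.map Subtype.val) (hx : x' = x.1) (hq : q' = q.map Subtype.val)
    (h : W ≤ cap U i.1 (p' ++ [x'])) (h' : W ≤ cap U x' q') :
    F.raw.pos i.1 p' x' W h (Tot.res (cap_le_head U x' _) h' (y x' q')) =
      wPos F W i p x (wRes F W y x q) := by
  subst hp hx hq; rfl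

theorem wPos_wPos_eq (F : Tw.{u, v} 𝒜 U) (W : α) (i : {j // W ≤ U j})
    (p : List {j // W ≤ U j}) (x : {j // W ≤ U j}) (q : List {j // W ≤ U j}) (j : {j // W ≤ U j})
    (z : WTot F W j) {p' q' : List ι}
    {x' : ι} (hp : p' = p.map Subtype.val) (hx : x' = x.1) (hq : q' = q.map Subtype.val)
    (h : W ≤ cap U i.1 (p' ++ [x'])) (h' : W ≤ cap U x' (q' ++ [j.1])) :
    F.raw.pos i.1 p' x' W h (F.raw.pos x' q' j.1 W h' z) =
      wPos F W i p x (wPos F W x q j z) := by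
  subst hp hx hq; rfl

theorem map_erase {β γ : Type*} (φ : β → γ) (p : List β) (x : β) (q : List β) :
    ((p ++ x :: q).map φ).eraseIdx p.length = (p ++ q).map φ := by
  simp [List.eraseIdx_append]

theorem map_drop {β γ : Type*} (φ : β → γ) (p : List β) (x : β) (q : List β) :
    ((p ++ x :: q).map φ).drop (p.length + 1) = q.map φ := by
  simp [List.drop_append]

theorem wRes_shOp (F : Tw.{u, v} 𝒜 U) (W : α) (y : ShTot F) (i : {j // W ≤ U j})
    (l : List {j // W ≤ U j}) : wRes F W (shOp F y) i l =
      absOp (fun j => (F.obj j.1).connOn j.2) (wPos F W) (wRes F W y) i l := by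
  unfold wRes shOp absOp
  rw [map_add, map_add, map_sum, map_sum, map_zsmul]
  refine congrArg₂ (· + ·) (congrArg₂ (· + ·) ?_ ?_) ?_
  · refine sum_fin_eq_ssum Subtype.val l _ rfl _ _ ?_
    rintro p x q rfl ⟨k, hk⟩ rfl
    rw [map_zsmul, Tot.res_res]
    exact congrArg _ (wRes_eq F W y i (p ++ q) (map_erase ..) _)
  · rw [← QCoh.connOn_res, List.length_map]
  · refine sum_fin_eq_ssum Subtype.val l _ rfl _ _ ?_
    rintro p x q rfl ⟨k, hk⟩ rfl
    rw [map_zsmul, ← pos_res, Tot.res_res]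
    refine congrArg₂ (· • ·) ?_ (wPos_wRes_eq F W y i p x q ?_ ?_ ?_ _ _)
    · congr 1; simp
    · simp
    · simp
    · exact map_drop ..

theorem shOp_shOp (F : Tw.{u, v} 𝒜 U) (y : ShTot F) (i : ι) (l : List ι) :
    shOp F (shOp F y) i l = 0 := by
  let W := cap U i l
  let i' : {j // W ≤ U j} := ⟨i, cap_le_head U i l⟩
  let l' : List {j // W ≤ U j} := l.pmap Subtype.mk fun j hj => cap_le_mem (List.mem_cons_of_mem _ hj)
  have hl : l = l'.map Subtype.val := by simp [l', List.map_pmap]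
  have h1 := wRes_eq F W (shOp F (shOp F y)) i' l' hl le_rfl
  rw [Tot.res_refl] at h1
  rw [h1, wRes_shOp]
  have h2 : wRes F W (shOp F y) = absOp (fun j => (F.obj j.1).connOn j.2) (wPos F W) (wRes F W y) := by
    funext i l; exact wRes_shOp ..
  rw [h2]
  refine absOp_absOp _ _ (fun j z => (F.obj j.1).connOn_connOn _ z) (fun i p x z => ?_) _ _ _
  refine Eq.trans ?_ (mcVal_eq_zero F i.1 (p.map Subtype.val) x.1 W (le_cap_map' i p x) z)
  unfold mcVal
  refine congrArg₂ (· + ·) ?_ (congrArg₂ (· + ·) (congrArg₂ (· + ·) ?_ rfl) ?_)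
  · refine (sum_fin_eq_ssum Subtype.val p _ rfl _ _ ?_).symm
    rintro p₁ m p₂ rfl ⟨k, hk⟩ rfl
    exact congrArg _ (wPos_eq F W i (p₁ ++ p₂) x (map_erase ..) _ z)
  · rw [List.length_map]; rfl
  · refine (sum_fin_eq_ssum Subtype.val p _ rfl _ _ ?_).symm
    rintro p₁ m p₂ rfl ⟨k, hk⟩ rfl
    refine congrArg₂ (· • ·) ?_ (wPos_wPos_eq F W i p₁ m p₂ x z ?_ ?_ ?_ _ _)
    · congr 1; simp
    · simp
    · simp
    · exact map_drop ..

/-! ### The connection of the sheafification -/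

theorem shOp_add (F : Tw.{u, v} 𝒜 U) (y y' : ShTot F) : shOp F (y + y') = shOp F y + shOp F y' := by
  funext i l
  simp only [shOp, Pi.add_apply, map_add, smul_add, Finset.sum_add_distrib]
  abel

/-- Cochains of total degree `m`. -/
def ShTot.HasDeg {F : Tw.{u, v} 𝒜 U} (m : ℤ) (y : ShTot F) : Prop :=
  ∀ i l, y i l ∈ Tot.deg (F.gmod i) (cap_le_head U i l) (m - l.length)

/-- Right multiplication of cochains by a global form. -/
noncomputable def ShTot.rmul {F : Tw.{u, v} 𝒜 U} (b : 𝒜.A ⊤) (y : ShTot F) : ShTot F :=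
  fun i l => Tot.rmul (𝒜.res le_top b) (y i l)

theorem shOp_rmul (F : Tw.{u, v} 𝒜 U) (m : ℤ) (y : ShTot F) (hy : y.HasDeg m) (b : 𝒜.A ⊤) :
    shOp F (ShTot.rmul b y) = ShTot.rmul b (shOp F y) + sgn m • ShTot.rmul (𝒜.d ⊤ b) y := by
  funext i l
  simp only [shOp, ShTot.rmul, Pi.add_apply, Pi.smul_apply, map_add, map_sum, map_zsmul]
  have h1 := (F.obj i).connOn_rmul _ _ _ (hy i l) (𝒜.res le_top b)
  rw [h1, smul_add, smul_smul, ← sgn_add, add_sub_cancel, 𝒜.res_d]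
  have h2 : ∀ k : Fin l.length, Tot.res (cap_le_head U i _) (cap_erase U i l k)
      (Tot.rmul (𝒜.res le_top b) (y i (l.eraseIdx k))) = Tot.rmul (𝒜.res le_top b)
        (Tot.res (cap_le_head U i _) (cap_erase U i l k) (y i (l.eraseIdx k))) := fun k => by
    rw [Tot.res_rmul, 𝒜.res_res]
  have h3 : ∀ k : Fin l.length, F.raw.pos i (l.take k) (l.get k) (cap U i l) (cap_take U i l k)
      (Tot.res (cap_le_head U _ _) (cap_drop U i l k)
        (Tot.rmul (𝒜.res le_top b) (y (l.get k) (l.drop (k + 1))))) = Tot.rmul (𝒜.res le_top b)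
      (F.raw.pos i (l.take k) (l.get k) (cap U i l) (cap_take U i l k)
        (Tot.res (cap_le_head U _ _) (cap_drop U i l k) (y (l.get k) (l.drop (k + 1))))) :=
    fun k => by
      rw [Tot.res_rmul, 𝒜.res_res]; exact pos_rmul ..
  simp only [h2, h3]
  abel

theorem shOp_deg (F : Tw.{u, v} 𝒜 U) (m : ℤ) (y : ShTot F) (hy : y.HasDeg m) :
    (shOp F y).HasDeg (m + 1) := by
  intro i l
  refine AddSubgroup.add_mem _ (AddSubgroup.add_mem _ (AddSubgroup.sum_mem _ fun k _ =>
    AddSubgroup.zsmul_mem _ ?_ _) (AddSubgroup.zsmul_mem _ ?_ _)) (AddSubgroup.sum_mem _ fun k _ =>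
    AddSubgroup.zsmul_mem _ ?_ _)
  · have := Tot.res_mem_deg (cap_le_head U i _) (cap_erase U i l k) (hy i (l.eraseIdx k))
    have hk := k.2
    rw [List.length_eraseIdx_of_lt k.2, Nat.cast_sub (by omega)] at this
    convert this using 2
    push_cast; ring
  · have := (F.obj i).connOn_deg _ _ _ (hy i l)
    convert this using 2
    ring
  · have := pos_deg F i (l.take k) (l.get k) (cap U i l) (cap_take U i l k) _ _
      (Tot.res_mem_deg (cap_le_head U _ _) (cap_drop U i l k) (hy (l.get k) (l.drop (k + 1))))
    have hk := k.2
    rw [List.length_take_of_le (by omega), List.length_drop, Nat.cast_sub (by omega)] at this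
    convert this using 2
    push_cast; ring

theorem shAll_rmul (F : Tw.{u, v} 𝒜 U) (b : 𝒜.A ⊤) (x) :
    shAll F (Tot.rmul b x) = ShTot.rmul b (shAll F x) := by
  funext i l
  simp only [shAll, ShTot.rmul]
  rw [Tot.res_rmul, (shProj F i l _ le_rfl).2]

theorem shAll_deg (F : Tw.{u, v} 𝒜 U) (m : ℤ) (x) (hx : x ∈ Tot.deg (shGMod F) (le_refl ⊤) m) :
    (shAll F x).HasDeg m := by
  intro i l
  exact shProj_isDeg F i l _ le_rfl _ _ (Tot.res_mem_deg _ _ hx)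

theorem shLift_deg (fr : Frame 𝒜) (F : Tw.{u, v} 𝒜 U) (m : ℤ) (y : ShTot F) :
    shLift fr F m y ∈ Tot.deg (shGMod F) (le_refl ⊤) m :=
  AddSubgroup.sum_mem _ fun s _ => Tot.mk_mem_deg _ (fr.θ_mem s) (by ring)

/-- `shAll` as an additive map. -/
noncomputable def shAllHom (F : Tw.{u, v} 𝒜 U) : Tot (shGMod F) (le_refl (⊤ : α)) →+ ShTot F :=
  AddMonoidHom.mk' (shAll F) (shAll_add F)

theorem shAll_zsmul (F : Tw.{u, v} 𝒜 U) (k : ℤ) (x) : shAll F (k • x) = k • shAll F x :=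
  map_zsmul (shAllHom F) k x

/-- The value of the connection of the sheafification on `c ⊗ b`. -/
noncomputable def shConnVal (fr : Frame 𝒜) (F : Tw.{u, v} 𝒜 U) (n : ℤ) (c : ShSec F n)
    (b : 𝒜.A ⊤) : Tot (shGMod F) (le_refl (⊤ : α)) :=
  Tot.rmul b (shLift fr F (n + 1) (shOp F (shAll F (Tot.mk (M := shGMod F) (le_refl ⊤) n c 1)))) +
    sgn n • Tot.mk (M := shGMod F) (le_refl ⊤) n c (𝒜.d ⊤ b)

theorem shMk_deg (F : Tw.{u, v} 𝒜 U) (n : ℤ) (c : ShSec F n) :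
    (shAll F (Tot.mk (M := shGMod F) (le_refl ⊤) n c 1)).HasDeg n :=
  shAll_deg F n _ (Tot.mk_mem_deg (M := shGMod F) c (one_mem_gr 𝒜) (by simp))

theorem shAll_connVal (fr : Frame 𝒜) (F : Tw.{u, v} 𝒜 U) (n : ℤ) (c : ShSec F n) (b : 𝒜.A ⊤) :
    shAll F (shConnVal fr F n c b) = shOp F (shAll F (Tot.mk (M := shGMod F) (le_refl ⊤) n c b)) := by
  have h1 : ∀ b, Tot.mk (M := shGMod F) (le_refl ⊤) n c b =
      Tot.rmul b (Tot.mk (M := shGMod F) (le_refl ⊤) n c 1) := fun b => by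
    rw [Tot.rmul_mk, one_mul]
  rw [shConnVal, h1 b, h1 (𝒜.d ⊤ b), shAll_add, shAll_zsmul, shAll_rmul, shAll_rmul, shAll_rmul,
    shAll_lift fr F _ _ (shOp_deg F n _ (shMk_deg F n c)), shOp_rmul F n _ (shMk_deg F n c)]

/-- The connection of the sheafification.  It corresponds to the operator `δ + a` on cochains. -/
noncomputable def shConn (fr : Frame 𝒜) (F : Tw.{u, v} 𝒜 U) :
    Tot (shGMod F) (le_refl (⊤ : α)) →+ Tot (shGMod F) (le_refl (⊤ : α)) :=
  Tot.lift (shConnVal fr F)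
    (fun n c c' b => shAll_injective F fr (by
      rw [shAll_connVal, Tot.mk_add_left, shAll_add, shOp_add, shAll_add, shAll_connVal,
        shAll_connVal]))
    (fun n c b b' => shAll_injective F fr (by
      rw [shAll_connVal, Tot.mk_add_right, shAll_add, shOp_add, shAll_add, shAll_connVal,
        shAll_connVal]))
    (fun n r c b => shAll_injective F fr (by
      rw [shAll_connVal, shAll_connVal, Tot.mk_smul]))

theorem shAll_conn (fr : Frame 𝒜) (F : Tw.{u, v} 𝒜 U) (x) :
    shAll F (shConn fr F x) = shOp F (shAll F x) :=
  Tot.ext_apply (f := (shAllHom F).comp (shConn fr F))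
    (g := (AddMonoidHom.mk' (shOp F) (shOp_add F)).comp (shAllHom F)) (fun n c b =>
      (congrArg (shAll F) (Tot.lift_mk ..)).trans (shAll_connVal fr F n c b)) x

/-- The sheafification of a twisted complex. -/
noncomputable def sheafify (fr : Frame 𝒜) (F : Tw.{u, v} 𝒜 U) : QCoh.{u, max u v w'} 𝒜 (⊤ : α) where
  toGMod := shGMod F
  conn := shConn fr F
  leibniz n c b := shAll_injective F fr (by
    have h1 := shOp_rmul F n _ (shMk_deg F n c) b
    rw [← shAll_rmul, ← shAll_rmul, Tot.rmul_mk, Tot.rmul_mk, one_mul, one_mul] at h1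
    rw [shAll_conn, h1, shAll_add, shAll_rmul, shAll_conn, shAll_zsmul])
  conn_deg m x hx := by
    have h1 : shConn fr F x = shLift fr F (m + 1) (shOp F (shAll F x)) := shAll_injective F fr (by
      rw [shAll_conn, shAll_lift fr F _ _ (shOp_deg F m _ (shAll_deg F m x hx))])
    rw [h1]
    exact shLift_deg fr F _ _
  conn_conn x := shAll_injective F fr (by
    rw [shAll_conn, shAll_conn]
    funext i l
    rw [shOp_shOp]
    simp [shAll])

/-! ### The functor `T` on morphisms and the counit -/

/-- The twisting functor on morphisms. -/
noncomputable def twistMap (U : ι → α) {M : GMod.{u, v} 𝒜 (⊤ : α)} {M' : GMod.{u, v'} 𝒜 (⊤ : α)}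
    (f : Mor M M' (le_refl ⊤) (le_refl ⊤)) :
    Coch U (fun i => M.restrict (le_top : U i ≤ ⊤)) (fun i => M'.restrict (le_top : U i ≤ ⊤)) where
  zero i := (Tot.up M' le_top le_rfl).comp ((f.restrict le_top).comp (Tot.down M le_top le_rfl))
  pos i l j := Mor.zero ..

/-- The counit of the adjunction between the twisting functor and the sheafification functor: on
the component at `(i₀, …, i_p)` it is the projection of the sheafification onto its component at
`(i₀, …, i_p)`. -/
noncomputable def counit (F : Tw.{u, v} 𝒜 U) :
    Coch U (fun i => (shGMod F).restrict (le_top : U i ≤ ⊤)) F.gmod where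
  zero i := (shProj F i [] (U i) le_rfl).comp (Tot.down (shGMod F) le_top le_rfl)
  pos i l j := (shProj F i (l ++ [j]) _ le_rfl).comp
    (Tot.down (shGMod F) le_top (cap_le_last U i l j))

end Squares

open scoped ContDiff Manifold Topology

/-! ### The exterior algebra of antiholomorphic covectors -/

/-- The coordinate space. -/
abbrev Cn (n : ℕ) : Type := EuclideanSpace ℂ (Fin n)

/-- The exterior algebra over `ℂ` on the generators `dz̄₁, …, dz̄ₙ`. -/
def Forms (n : ℕ) : Type := ExteriorAlgebra ℂ (Fin n → ℂ)

namespace Forms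

variable {n : ℕ}

noncomputable instance : Ring (Forms n) := inferInstanceAs (Ring (ExteriorAlgebra ℂ (Fin n → ℂ)))

noncomputable instance : Algebra ℂ (Forms n) :=
  inferInstanceAs (Algebra ℂ (ExteriorAlgebra ℂ (Fin n → ℂ)))

/-- The covectors `∑ v_k dz̄_k`. -/
noncomputable def ι : (Fin n → ℂ) →ₗ[ℂ] Forms n := ExteriorAlgebra.ι ℂ

/-- The generator `dz̄_k`. -/
noncomputable def dzbar (k : Fin n) : Forms n := ι (Pi.single k 1)

/-- The forms of degree `j`. -/
noncomputable def deg (n j : ℕ) : Submodule ℂ (Forms n) := ⋀[ℂ]^j (Fin n → ℂ)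

/-- The component of degree zero. -/
noncomputable def const : Forms n →ₐ[ℂ] ℂ := ExteriorAlgebra.algebraMapInv

/-- The monomial basis. -/
noncomputable def basis (n : ℕ) : Module.Basis (Finset (Fin n)) ℂ (Forms n) :=
  (Pi.basisFun ℂ (Fin n)).ExteriorAlgebra

/-- The norm given by the coefficients with respect to the monomial basis. -/
noncomputable instance : NormedAddCommGroup (Forms n) :=
  NormedAddCommGroup.induced (Forms n) (Finset (Fin n) → ℂ) (basis n).equivFun
    (basis n).equivFun.injective

noncomputable instance : NormedSpace ℂ (Forms n) where
  norm_smul_le a x := by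
    change ‖(basis n).equivFun (a • x)‖ ≤ ‖a‖ * ‖(basis n).equivFun x‖
    rw [map_smul]; exact norm_smul_le _ _

instance : FiniteDimensional ℂ (Forms n) := Module.Finite.of_basis (basis n)

/-- The product as a continuous bilinear map. -/
noncomputable def mulL : Forms n →L[ℝ] Forms n →L[ℝ] Forms n :=
  ((LinearMap.mul ℂ (Forms n)).restrictScalars₁₂ ℝ ℝ).toContinuousBilinearMap

theorem induction {p : Forms n → Prop} (hc : ∀ c : ℂ, p (algebraMap ℂ _ c)) (hι : ∀ v, p (ι v))
    (hmul : ∀ a b, p a → p b → p (a * b)) (hadd : ∀ a b, p a → p b → p (a + b)) (a : Forms n) :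
    p a := ExteriorAlgebra.induction (C := p) hc hι hmul hadd a

theorem mulL_apply (a b : Forms n) : mulL a b = a * b := rfl

/-- The grading involution. -/
noncomputable def inv : Forms n →ₐ[ℂ] Forms n :=
  CliffordAlgebra.involute (Q := (0 : QuadraticForm ℂ (Fin n → ℂ)))

theorem inv_ι (v : Fin n → ℂ) : inv (ι v) = -ι v := CliffordAlgebra.involute_ι v

theorem ι_mul_swap (v w : Fin n → ℂ) : ι v * ι w = -(ι w * ι v) :=
  eq_neg_of_add_eq_zero_left (ExteriorAlgebra.ι_add_mul_swap v w)

theorem ι_mul (v : Fin n → ℂ) (a : Forms n) : ι v * a = inv a * ι v := by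
  induction a using Forms.induction with
  | hc c => rw [AlgHom.commutes]; exact (Algebra.commutes c _).symm
  | hι w => rw [inv_ι, ι_mul_swap, neg_mul]
  | hmul a b ha hb => rw [map_mul, ← mul_assoc, ha, mul_assoc, hb, mul_assoc]
  | hadd a b ha hb => rw [map_add, mul_add, add_mul, ha, hb]

theorem deg_eq (j : ℕ) : deg n j = LinearMap.range (ι (n := n)) ^ j := rfl

theorem inv_deg {j : ℕ} {a : Forms n} (ha : a ∈ deg n j) : inv a = sgn j • a := by
  rw [deg_eq] at ha
  induction ha using Submodule.pow_induction_on_left' with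
  | algebraMap r => rw [AlgHom.commutes]; simp [sgn_zero]
  | add x y i hx hy h1 h2 => rw [map_add, h1, h2, smul_add]
  | mem_mul m hm i x hx h =>
    obtain ⟨v, rfl⟩ := hm
    rw [map_mul, inv_ι, h]
    push_cast
    rw [sgn_add, sgn_one, mul_smul_comm, mul_neg_one, neg_smul, neg_mul, smul_neg]

theorem mul_mem_deg {i j : ℕ} {a b : Forms n} (ha : a ∈ deg n i) (hb : b ∈ deg n j) :
    a * b ∈ deg n (i + j) := by
  rw [deg_eq, pow_add]; exact Submodule.mul_mem_mul ha hb

theorem ι_mem (v : Fin n → ℂ) : ι v ∈ deg n 1 := by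
  rw [deg_eq, pow_one]; exact ⟨v, rfl⟩

theorem mem_deg_zero {a : Forms n} : a ∈ deg n 0 ↔ algebraMap ℂ _ (const a) = a := by
  rw [deg_eq, pow_zero, Submodule.mem_one]
  constructor
  · rintro ⟨c, rfl⟩
    rw [AlgHom.commutes]; rfl
  · exact fun h => ⟨_, h⟩

theorem const_ι (v : Fin n → ℂ) : const (ι v) = 0 := by
  exact ExteriorAlgebra.lift_ι_apply ℂ (0 : (Fin n → ℂ) →ₗ[ℂ] ℂ) (fun _ => by simp) v

theorem const_deg {j : ℕ} (hj : 0 < j) {a : Forms n} (ha : a ∈ deg n j) : const a = 0 := by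
  obtain ⟨j, rfl⟩ := Nat.exists_eq_succ_of_ne_zero hj.ne'
  rw [deg_eq, pow_succ'] at ha
  refine Submodule.mul_induction_on ha ?_ ?_
  · rintro _ ⟨v, rfl⟩ b _
    rw [map_mul, const_ι, zero_mul]
  · intro a b ha hb; rw [map_add, ha, hb, add_zero]

theorem basis_eq {j : ℕ} (s : Set.powersetCard (Fin n) j) :
    basis n s = ((Pi.basisFun ℂ (Fin n)).exteriorPower j s : ExteriorAlgebra ℂ (Fin n → ℂ)) :=
  ExteriorAlgebra.basis_eq_coe_basis _ _

theorem basis_mem (s : Finset (Fin n)) : basis n s ∈ deg n s.card := by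
  rw [basis_eq (⟨s, rfl⟩ : Set.powersetCard (Fin n) s.card)]
  exact Subtype.property _

theorem exterior_coord {R M I : Type*} [CommRing R] [AddCommGroup M] [Module R M] [LinearOrder I]
    (b : Module.Basis I R M) {j : ℕ} {a : ExteriorAlgebra R M} (ha : a ∈ ⋀[R]^j M)
    (s : Finset I) (hs : s.card ≠ j) : b.ExteriorAlgebra.repr a s = 0 := by
  have hf : b.ExteriorAlgebra.coord s ∘ₗ Submodule.subtype (⋀[R]^j M) = 0 :=
    (b.exteriorPower j).ext fun t => by
      have ht : (t : Finset I) ≠ s := by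
        rintro rfl
        exact hs (Set.powersetCard.card_eq t)
      simp only [LinearMap.comp_apply, Submodule.subtype_apply, LinearMap.zero_apply,
        Module.Basis.coord_apply]
      rw [← ExteriorAlgebra.basis_eq_coe_basis, Module.Basis.repr_self]
      exact Finsupp.single_eq_of_ne ht.symm
  have := LinearMap.congr_fun hf (⟨a, ha⟩ : ⋀[R]^j M)
  rwa [LinearMap.comp_apply, Submodule.subtype_apply, LinearMap.zero_apply,
    Module.Basis.coord_apply] at this

theorem coord_deg {j : ℕ} {a : Forms n} (ha : a ∈ deg n j) (s : Finset (Fin n)) (hs : s.card ≠ j) :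
    (basis n).repr a s = 0 :=
  exterior_coord (Pi.basisFun ℂ (Fin n)) ha s hs

/-- A projection onto the forms of degree `j`. -/
noncomputable def proj (n j : ℕ) : Forms n →ₗ[ℂ] Forms n :=
  (basis n).constr ℂ fun s => if s.card = j then basis n s else 0

theorem proj_mem (j : ℕ) (a : Forms n) : proj n j a ∈ deg n j := by
  rw [proj, Module.Basis.constr_apply_fintype]
  refine Submodule.sum_mem _ fun s _ => Submodule.smul_mem _ _ ?_
  split_ifs with h
  · exact h ▸ basis_mem s
  · exact Submodule.zero_mem _

theorem proj_of_mem {j : ℕ} {a : Forms n} (ha : a ∈ deg n j) : proj n j a = a := by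
  rw [proj, Module.Basis.constr_apply_fintype]
  conv_rhs => rw [← (basis n).sum_repr a]
  refine Finset.sum_congr rfl fun s _ => ?_
  split_ifs with h
  · rfl
  · rw [coord_deg ha s h, zero_smul, smul_zero]

/-- The pullback of covectors by a linear map of the coordinate spaces. -/
noncomputable def pullCo (L : Cn n →L[ℂ] Cn n) : (Fin n → ℂ) →ₗ[ℂ] (Fin n → ℂ) where
  toFun v l := ∑ k, v k * starRingEnd ℂ (L (EuclideanSpace.single l 1) k)
  map_add' v w := by ext l; simp [add_mul, Finset.sum_add_distrib]
  map_smul' c v := by ext l; simp [Finset.mul_sum, mul_assoc]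

/-- The pullback of forms by a linear map of the coordinate spaces: the algebra map with
`dw̄_k ↦ ∑_l conj(∂w_k/∂z_l) dz̄_l`. -/
noncomputable def pull (L : Cn n →L[ℂ] Cn n) : Forms n →ₐ[ℂ] Forms n :=
  ExteriorAlgebra.map (pullCo L)

theorem pull_ι (L : Cn n →L[ℂ] Cn n) (v : Fin n → ℂ) : pull L (ι v) = ι (pullCo L v) :=
  ExteriorAlgebra.map_apply_ι _ _

theorem pullCo_id (v : Fin n → ℂ) : pullCo (ContinuousLinearMap.id ℂ (Cn n)) v = v := by
  ext l
  simp [pullCo, apply_ite]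

theorem pull_id (a : Forms n) : pull (ContinuousLinearMap.id ℂ (Cn n)) a = a := by
  have : pullCo (ContinuousLinearMap.id ℂ (Cn n)) = LinearMap.id := LinearMap.ext pullCo_id
  rw [pull, this, ExteriorAlgebra.map_id]; rfl

theorem apply_eq_sum (L : Cn n →L[ℂ] Cn n) (v : Cn n) (k : Fin n) :
    L v k = ∑ l, v l * L (EuclideanSpace.single l 1) k := by
  have : v = ∑ l, v l • EuclideanSpace.single l (1 : ℂ) := by
    ext k; simp [Pi.single_apply]
  conv_lhs => rw [this]
  simp

theorem pull_comp (L M : Cn n →L[ℂ] Cn n) (a : Forms n) : pull (L.comp M) a = pull M (pull L a) := by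
  have : pullCo (L.comp M) = pullCo M ∘ₗ pullCo L := by
    refine LinearMap.ext fun v => funext fun l => ?_
    simp only [pullCo, LinearMap.coe_mk, AddHom.coe_mk, LinearMap.comp_apply,
      ContinuousLinearMap.comp_apply]
    simp only [apply_eq_sum L (M _), map_sum, map_mul, Finset.mul_sum, Finset.sum_mul]
    rw [Finset.sum_comm]
    exact Finset.sum_congr rfl fun k _ => Finset.sum_congr rfl fun m _ => by ring
  rw [pull, this, ← ExteriorAlgebra.map_comp_map]; rfl

theorem const_pull (L : Cn n →L[ℂ] Cn n) (a : Forms n) : const (pull L a) = const a := by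
  induction a using Forms.induction with
  | hc c => rw [AlgHom.commutes]
  | hι w => rw [pull_ι, const_ι, const_ι]
  | hmul a b ha hb => rw [map_mul, map_mul, map_mul, ha, hb]
  | hadd a b ha hb => rw [map_add, map_add, map_add, ha, hb]

theorem pull_deg (L : Cn n →L[ℂ] Cn n) {j : ℕ} {a : Forms n} (ha : a ∈ deg n j) :
    pull L a ∈ deg n j := by
  rw [deg_eq] at ha
  induction ha using Submodule.pow_induction_on_left' with
  | algebraMap r => rw [AlgHom.commutes, mem_deg_zero, AlgHom.commutes]; rfl
  | add x y i hx hy h1 h2 => rw [map_add]; exact Submodule.add_mem _ h1 h2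
  | mem_mul m hm i x hx h =>
    obtain ⟨v, rfl⟩ := hm
    rw [map_mul, pull_ι, Nat.succ_eq_add_one, add_comm]
    exact mul_mem_deg (ι_mem _) h

end Forms

namespace Forms

variable {n : ℕ}

/-- The standard basis of the coordinate space. -/
noncomputable abbrev stdVec (k : Fin n) : Cn n := EuclideanSpace.single k 1

/-- The part `(D(v) + i D(iv)) / 2` of `D` that is antilinear if `D` is real linear. -/
noncomputable def bar (D : Cn n → Forms n) (v : Cn n) : Forms n :=
  (1 / 2 : ℂ) • (D v + Complex.I • D (Complex.I • v))

/-- The operator `∂̄ f = ∑_k dz̄_k ∂f/∂z̄_k` on an open subset of the coordinate space. -/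
noncomputable def dbarE (f : Cn n → Forms n) (z : Cn n) : Forms n :=
  ∑ k, dzbar k * bar (fderiv ℝ f z) (stdVec k)

theorem bar_add (D D' : Cn n → Forms n) (v : Cn n) :
    bar (fun w => D w + D' w) v = bar D v + bar D' v := by
  simp only [bar, smul_add]; abel

theorem bar_smul (D : Cn n →L[ℝ] Forms n) (c : ℂ) (v : Cn n) :
    bar D (c • v) = starRingEnd ℂ c • bar D v := by
  have h1 : c • v = c.re • v + c.im • (Complex.I • v) := by
    conv_lhs => rw [← Complex.re_add_im c]
    rw [add_smul, mul_smul]; rfl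
  have h2 : Complex.I • c • v = c.re • (Complex.I • v) + (-c.im) • v := by
    ext i; apply Complex.ext <;> simp <;> ring
  have h3 : starRingEnd ℂ c = c.re - c.im * Complex.I := by
    apply Complex.ext <;> simp
  have h4 : ∀ (r : ℝ) (x : Forms n), r • x = (r : ℂ) • x := fun r x => rfl
  simp only [bar]
  rw [h2, h1]
  simp only [map_add, map_smul, h4, h3]
  match_scalars
  · ring_nf
  · ring_nf; simp; ring

theorem bar_eq_sum (D : Cn n →L[ℝ] Forms n) (v : Cn n) :
    bar D v = ∑ m, starRingEnd ℂ (v m) • bar D (stdVec m) := by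
  let B : Cn n →+ Forms n := AddMonoidHom.mk' (bar D) fun v w => by
    simp only [bar, map_add, smul_add]; abel
  have h1 : v = ∑ m, v m • stdVec m := by ext k; simp [Pi.single_apply]
  change B v = _
  conv_lhs => rw [h1]
  rw [map_sum]
  exact Finset.sum_congr rfl fun m _ => bar_smul D _ _

theorem dbarE_congr {f g : Cn n → Forms n} {z : Cn n} (h : f =ᶠ[𝓝 z] g) : dbarE f z = dbarE g z := by
  rw [dbarE, h.fderiv_eq]; rfl

theorem mul_differentiableAt {f h : Cn n → Forms n} {z : Cn n} (hf : DifferentiableAt ℝ f z)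
    (hh : DifferentiableAt ℝ h z) (v : Cn n) : fderiv ℝ (fun z => f z * h z) z v =
      f z * fderiv ℝ h z v + fderiv ℝ f z v * h z := by
  have := (mulL (n := n)).hasFDerivAt_of_bilinear hf.hasFDerivAt hh.hasFDerivAt
  change fderiv ℝ (fun z => mulL (f z) (h z)) z v = _
  rw [this.fderiv]
  rfl

theorem contDiffAt_mul {f h : Cn n → Forms n} {z : Cn n} {m : WithTop ℕ∞} (hf : ContDiffAt ℝ m f z)
    (hh : ContDiffAt ℝ m h z) : ContDiffAt ℝ m (fun z => f z * h z) z :=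
  (mulL (n := n)).isBoundedBilinearMap.contDiff.contDiffAt.comp z (hf.prodMk hh)

theorem dbarE_mul {f h : Cn n → Forms n} {z : Cn n} (hf : DifferentiableAt ℝ f z)
    (hh : DifferentiableAt ℝ h z) :
    dbarE (fun z => f z * h z) z = dbarE f z * h z + inv (f z) * dbarE h z := by
  have h1 : ∀ v, bar (fderiv ℝ (fun z => f z * h z) z) v =
      f z * bar (fderiv ℝ h z) v + bar (fderiv ℝ f z) v * h z := by
    intro v
    simp only [bar, mul_differentiableAt hf hh, smul_add, mul_add, add_mul, mul_smul_comm,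
      smul_mul_assoc]
    abel
  simp only [dbarE, h1, mul_add, Finset.sum_add_distrib, Finset.sum_mul, Finset.mul_sum]
  rw [add_comm]
  refine congrArg₂ (· + ·) (Finset.sum_congr rfl fun k _ => by rw [mul_assoc])
    (Finset.sum_congr rfl fun k _ => ?_)
  rw [← mul_assoc, dzbar, ι_mul, mul_assoc]

theorem dbarE_add {f h : Cn n → Forms n} {z : Cn n} (hf : DifferentiableAt ℝ f z)
    (hh : DifferentiableAt ℝ h z) : dbarE (fun z => f z + h z) z = dbarE f z + dbarE h z := by
  have h1 : fderiv ℝ (fun z => f z + h z) z = fderiv ℝ f z + fderiv ℝ h z := fderiv_add hf hh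
  simp only [dbarE, h1, ← Finset.sum_add_distrib, ← mul_add]
  exact Finset.sum_congr rfl fun k _ => congrArg _ (bar_add ..)

theorem dbarE_const (a : Forms n) (z : Cn n) : dbarE (fun _ => a) z = 0 := by
  have : fderiv ℝ (fun _ : Cn n => a) z = 0 := by simp
  simp [dbarE, this, bar]

theorem sum_antisymm (c : Fin n → Fin n → Forms n) (hc : ∀ k l, c k l = c l k) :
    ∑ k, ∑ l, dzbar k * (dzbar l * c k l) = 0 := by
  have h : ∑ k, ∑ l, dzbar k * (dzbar l * c k l) = -∑ k, ∑ l, dzbar k * (dzbar l * c k l) := by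
    conv_lhs => rw [Finset.sum_comm]
    rw [← Finset.sum_neg_distrib]
    refine Finset.sum_congr rfl fun k _ => ?_
    rw [← Finset.sum_neg_distrib]
    refine Finset.sum_congr rfl fun l _ => ?_
    rw [← mul_assoc, ← mul_assoc, dzbar, dzbar, ι_mul_swap, hc, neg_mul]
  have h2 : (2 : ℂ) • ∑ k, ∑ l, dzbar k * (dzbar l * c k l) = 0 := by
    rw [two_smul]; nth_rewrite 1 [h]; exact neg_add_cancel _
  exact (smul_eq_zero.1 h2).resolve_left two_ne_zero

theorem ι_eq_sum (v : Fin n → ℂ) : ι v = ∑ l, v l • dzbar l := by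
  conv_lhs => rw [← (Pi.basisFun ℂ (Fin n)).sum_repr v]
  simp [dzbar]

/-- `L ↦ ι (pullCo L v)` as a real linear map. -/
noncomputable def pullL (v : Fin n → ℂ) : (Cn n →L[ℂ] Cn n) →L[ℝ] Forms n :=
  LinearMap.toContinuousLinearMap
    { toFun := fun L => ι (pullCo L v)
      map_add' := fun L M => by
        rw [← map_add]; congr 1; ext l; simp [pullCo, mul_add, Finset.sum_add_distrib]
      map_smul' := fun c L => by
        have : pullCo (c • L) v = (c : ℂ) • pullCo L v := by
          ext l; simp [pullCo, Finset.mul_sum]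
          exact Finset.sum_congr rfl fun k _ => by ring
        rw [this, map_smul]; rfl }

theorem pullL_I (v : Fin n → ℂ) (L : Cn n →L[ℂ] Cn n) :
    pullL v (Complex.I • L) = -(Complex.I • pullL v L) := by
  have : pullCo (Complex.I • L) v = -(Complex.I • pullCo L v) := by
    ext l; simp [pullCo, Finset.mul_sum]
    exact Finset.sum_congr rfl fun k _ => by ring
  change ι _ = _
  rw [this, map_neg, map_smul]; rfl

theorem contDiffAt_pull {g : Cn n → Cn n} {z : Cn n} (hg : ContDiffAt ℂ ω g z) (a : Forms n) :
    ContDiffAt ℝ ∞ (fun z => pull (fderiv ℂ g z) a) z := by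
  have h1 : ContDiffAt ℝ ∞ (fderiv ℂ g) z :=
    ((hg.fderiv_right (m := ω) le_rfl).of_le le_top).restrict_scalars ℝ
  induction a using Forms.induction with
  | hc c => simp only [AlgHom.commutes]; exact contDiffAt_const
  | hι v =>
    simp only [pull_ι]
    exact (pullL v).contDiff.contDiffAt.comp z h1
  | hmul a b ha hb => simp only [map_mul]; exact contDiffAt_mul ha hb
  | hadd a b ha hb => simp only [map_add]; exact ha.add hb

theorem dbarE_pull_const {g : Cn n → Cn n} {z : Cn n} (hg : ContDiffAt ℂ ω g z) (a : Forms n) :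
    dbarE (fun z => pull (fderiv ℂ g z) a) z = 0 := by
  have hd : ∀ a, DifferentiableAt ℝ (fun z => pull (fderiv ℂ g z) a) z := fun a =>
    (contDiffAt_pull hg a).differentiableAt (by simp)
  induction a using Forms.induction with
  | hc c => simp only [AlgHom.commutes]; exact dbarE_const _ _
  | hι v =>
    simp only [pull_ι]
    have h1 : HasFDerivAt (fderiv ℂ g) (fderiv ℂ (fderiv ℂ g) z) z :=
      ((hg.fderiv_right (m := ω) le_rfl).differentiableAt (by simp)).hasFDerivAt
    have h2 := (pullL v).hasFDerivAt.comp z (h1.restrictScalars ℝ)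
    have h3 : fderiv ℝ (fun z => ι (pullCo (fderiv ℂ g z) v)) z = _ := h2.fderiv
    have h4 : ∀ k, bar (fderiv ℝ (fun z => ι (pullCo (fderiv ℂ g z) v)) z) (stdVec k) =
        ι (pullCo (fderiv ℂ (fderiv ℂ g) z (stdVec k)) v) := by
      intro k
      rw [h3]
      change (1 / 2 : ℂ) • (pullL v (fderiv ℂ (fderiv ℂ g) z (stdVec k)) + Complex.I •
        pullL v (fderiv ℂ (fderiv ℂ g) z (Complex.I • stdVec k))) = pullL v _
      rw [map_smul, pullL_I]
      match_scalars
      ring_nf; simp; norm_num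
    have h5 := hg.isSymmSndFDerivAt (by simp)
    simp only [dbarE, h4]
    simp only [ι_eq_sum, Finset.mul_sum, mul_smul_comm]
    rw [← sum_antisymm (fun k l => algebraMap ℂ _
      (pullCo (fderiv ℂ (fderiv ℂ g) z (stdVec k)) v l)) fun k l => by
        simp only [pullCo, LinearMap.coe_mk, AddHom.coe_mk, h5.eq (stdVec k) (stdVec l)]]
    refine Finset.sum_congr rfl fun k _ => Finset.sum_congr rfl fun l _ => ?_
    rw [← Algebra.commutes, ← Algebra.smul_def, mul_smul_comm]
  | hmul a b ha hb =>
    simp only [map_mul]; rw [dbarE_mul (hd a) (hd b), ha, hb, zero_mul, mul_zero, add_zero]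
  | hadd a b ha hb =>
    simp only [map_add]; rw [dbarE_add (hd a) (hd b), ha, hb, add_zero]

theorem pull_eq_sum (L : Cn n →L[ℂ] Cn n) (a : Forms n) :
    pull L a = ∑ s, (basis n).coord s a • pull L (basis n s) := by
  calc pull L a = pull L (∑ s, (basis n).repr a s • basis n s) := by rw [(basis n).sum_repr]
    _ = _ := by rw [map_sum]; simp only [map_smul]; rfl

/-- The coordinate functionals as continuous linear maps. -/
noncomputable def coordL (s : Finset (Fin n)) : Forms n →L[ℝ] ℂ :=
  (((basis n).coord s).restrictScalars ℝ).toContinuousLinearMap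

theorem contDiffAt_pull_comp {g : Cn n → Cn n} {z : Cn n} (hg : ContDiffAt ℂ ω g z)
    {h : Cn n → Forms n} (hh : ContDiffAt ℝ ∞ h z) :
    ContDiffAt ℝ ∞ (fun z => pull (fderiv ℂ g z) (h z)) z := by
  simp only [fun z => pull_eq_sum (fderiv ℂ g z) (h z)]
  exact ContDiffAt.sum fun s _ => ((coordL s).contDiff.contDiffAt.comp z hh).smul
    (contDiffAt_pull hg _)

/-- `∂̄` commutes with the pullback by holomorphic maps. -/
theorem dbarE_pull {g : Cn n → Cn n} {z : Cn n} (hg : ContDiffAt ℂ ω g z) {f : Cn n → Forms n}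
    (hf : DifferentiableAt ℝ f (g z)) :
    dbarE (fun z => pull (fderiv ℂ g z) (f (g z))) z = pull (fderiv ℂ g z) (dbarE f (g z)) := by
  set L := fderiv ℂ g z with hL
  have hg' : HasFDerivAt g (L.restrictScalars ℝ) z :=
    ((hg.differentiableAt (by simp)).hasFDerivAt).restrictScalars ℝ
  have hd : ∀ a, HasFDerivAt (fun z => pull (fderiv ℂ g z) a)
      (fderiv ℝ (fun z => pull (fderiv ℂ g z) a) z) z := fun a =>
    ((contDiffAt_pull hg a).differentiableAt (by simp)).hasFDerivAt
  have hh : HasFDerivAt (fun z => f (g z)) ((fderiv ℝ f (g z)).comp (L.restrictScalars ℝ)) z :=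
    hf.hasFDerivAt.comp z hg'
  have h1 := HasFDerivAt.fun_sum (u := Finset.univ) fun s (_ : s ∈ Finset.univ) =>
    ((coordL s).hasFDerivAt.comp z hh).smul (hd (basis n s))
  have h2 : ∀ v, fderiv ℝ (fun z => pull (fderiv ℂ g z) (f (g z))) z v =
      pull L (fderiv ℝ f (g z) (L v)) + ∑ s, (basis n).coord s (f (g z)) •
        fderiv ℝ (fun z => pull (fderiv ℂ g z) (basis n s)) z v := by
    intro v
    have h3 : (fun z => pull (fderiv ℂ g z) (f (g z))) = fun z => ∑ s,
        (coordL s ∘ fun z => f (g z)) z • pull (fderiv ℂ g z) (basis n s) :=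
      funext fun z => pull_eq_sum _ _
    rw [h3, pull_eq_sum L, ← Finset.sum_add_distrib]
    refine (congrArg (fun D => D v) h1.fderiv).trans ?_
    simp only [sum_apply]
    exact Finset.sum_congr rfl fun s _ => add_comm _ _
  have h3 : ∀ v, bar (fderiv ℝ (fun z => pull (fderiv ℂ g z) (f (g z))) z) v =
      pull L (bar (fderiv ℝ f (g z)) (L v)) + ∑ s, (basis n).coord s (f (g z)) •
        bar (fderiv ℝ (fun z => pull (fderiv ℂ g z) (basis n s)) z) v := by
    intro v
    simp only [bar, h2, map_smul, map_add, smul_add, Finset.smul_sum, Finset.sum_add_distrib]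
    simp only [smul_comm ((basis n).coord _ _)]
    abel
  have h4 : ∑ k, dzbar k * ∑ s, (basis n).coord s (f (g z)) •
      bar (fderiv ℝ (fun z => pull (fderiv ℂ g z) (basis n s)) z) (stdVec k) = 0 := by
    simp only [Finset.mul_sum, mul_smul_comm]
    rw [Finset.sum_comm]
    refine Finset.sum_eq_zero fun s _ => ?_
    rw [← Finset.smul_sum]
    exact (congrArg _ (dbarE_pull_const hg (basis n s))).trans (smul_zero _)
  have h5 : ∀ m, pull L (dzbar m) = ∑ k, starRingEnd ℂ (L (stdVec k) m) • dzbar k := by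
    intro m
    rw [dzbar, pull_ι, ι_eq_sum]
    refine Finset.sum_congr rfl fun k _ => congrArg₂ (· • ·) ?_ rfl
    simp [pullCo, Pi.single_apply]
  simp only [dbarE, h3, mul_add, Finset.sum_add_distrib, h4, add_zero, map_sum, map_mul, h5]
  simp only [bar_eq_sum _ (L _), map_sum, map_smul, Finset.mul_sum, Finset.sum_mul, mul_smul_comm,
    smul_mul_assoc]
  exact Finset.sum_comm

/-- `D ↦ bar D v` as a continuous linear map. -/
noncomputable def barL (v : Cn n) : (Cn n →L[ℝ] Forms n) →L[ℝ] Forms n :=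
  (1 / 2 : ℂ) • (ContinuousLinearMap.apply ℝ (Forms n) v +
    Complex.I • ContinuousLinearMap.apply ℝ (Forms n) (Complex.I • v))

/-- The symbol of `∂̄`. -/
noncomputable def symL : (Cn n →L[ℝ] Forms n) →L[ℝ] Forms n :=
  ∑ l, (mulL (dzbar l)).comp (barL (stdVec l))

theorem dbarE_eq (f : Cn n → Forms n) : dbarE f = fun z => symL (fderiv ℝ f z) := by
  funext z
  simp only [symL, sum_apply]
  rfl

theorem contDiffAt_dbarE {f : Cn n → Forms n} {z : Cn n} (hf : ContDiffAt ℝ ∞ f z) :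
    ContDiffAt ℝ ∞ (dbarE f) z := by
  rw [dbarE_eq]
  exact (symL (n := n)).contDiff.contDiffAt.comp z (hf.fderiv_right (m := ∞) (by simp))

/-- `∂̄² = 0`. -/
theorem dbarE_dbarE {f : Cn n → Forms n} {z : Cn n} (hf : ContDiffAt ℝ ∞ f z) :
    dbarE (dbarE f) z = 0 := by
  have h1 : HasFDerivAt (fderiv ℝ f) (fderiv ℝ (fderiv ℝ f) z) z :=
    ((hf.fderiv_right (m := ∞) (by simp)).differentiableAt (by simp)).hasFDerivAt
  have h2 : fderiv ℝ (dbarE f) z = (symL (n := n)).comp (fderiv ℝ (fderiv ℝ f) z) := by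
    rw [dbarE_eq]
    exact ((symL (n := n)).hasFDerivAt.comp z h1).fderiv
  have h3 : IsSymmSndFDerivAt ℝ f z := hf.isSymmSndFDerivAt (by
    rw [minSmoothness_of_isRCLikeNormedField]; exact WithTop.coe_le_coe.2 le_top)
  set D := fderiv ℝ (fderiv ℝ f) z with hD
  have h4 : ∀ v, bar (fderiv ℝ (dbarE f) z) v = ∑ l, dzbar l *
      bar (fun w => bar (D w) (stdVec l)) v := by
    intro v
    rw [h2]
    simp only [symL]
    change (1 / 2 : ℂ) • ((∑ l, (mulL (dzbar l)).comp (barL (stdVec l))) (D v) + Complex.I •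
      (∑ l, (mulL (dzbar l)).comp (barL (stdVec l))) (D (Complex.I • v))) = _
    simp only [sum_apply, Finset.smul_sum, ← Finset.sum_add_distrib]
    refine Finset.sum_congr rfl fun l _ => ?_
    change (1 / 2 : ℂ) • (dzbar l * bar (D v) (stdVec l) + Complex.I •
      (dzbar l * bar (D (Complex.I • v)) (stdVec l))) = dzbar l * ((1 / 2 : ℂ) • (_ + _))
    rw [mul_smul_comm, mul_add, mul_smul_comm]
  rw [dbarE]
  simp only [h4, Finset.mul_sum]
  refine sum_antisymm _ fun k l => ?_
  have h5 : ∀ v w, D v w = D w v := fun v w => h3.eq v w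
  simp only [bar]
  rw [h5 (stdVec k) (stdVec l), h5 (stdVec k), h5 (Complex.I • stdVec k),
    h5 (Complex.I • stdVec k)]
  module

end Forms

/-! ### Antiholomorphic forms on a complex manifold -/

section Manifold

open Forms

variable {n : ℕ} {X : Type u} [TopologicalSpace X] [ChartedSpace (Cn n) X]

/-- A form on `X`, given at each point by its coefficients in the preferred chart at this point,
expressed in the chart `c`. -/
noncomputable def rep (c : OpenPartialHomeomorph X (Cn n)) (a : X → Forms n) (z : Cn n) : Forms n :=
  pull (fderiv ℂ (fun w => chartAt (Cn n) (c.symm z) (c.symm w)) z) (a (c.symm z))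

/-- A form is smooth at `x`: its coefficients in every chart at `x` are smooth. -/
def SmoothAt (a : X → Forms n) (x : X) : Prop :=
  ∀ c ∈ atlas (Cn n) X, x ∈ c.source → ContDiffAt ℝ ∞ (rep c a) (c x)

/-- The operator `∂̄` on forms. -/
noncomputable def dbar (a : X → Forms n) (x : X) : Forms n :=
  dbarE (rep (chartAt (Cn n) x) a) (chartAt (Cn n) x x)

theorem rep_add (c : OpenPartialHomeomorph X (Cn n)) (a b : X → Forms n) :
    rep c (a + b) = fun z => rep c a z + rep c b z := funext fun z => map_add _ _ _

theorem rep_neg (c : OpenPartialHomeomorph X (Cn n)) (a : X → Forms n) :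
    rep c (-a) = fun z => -rep c a z := funext fun z => map_neg _ _

theorem rep_mul (c : OpenPartialHomeomorph X (Cn n)) (a b : X → Forms n) :
    rep c (a * b) = fun z => rep c a z * rep c b z := funext fun z => map_mul _ _ _

theorem rep_algebraMap (c : OpenPartialHomeomorph X (Cn n)) (f : X → ℂ) :
    rep c (fun x => algebraMap ℂ (Forms n) (f x)) = fun z => algebraMap ℂ (Forms n) (f (c.symm z)) :=
  funext fun z => AlgHom.commutes _ _

theorem const_rep (c : OpenPartialHomeomorph X (Cn n)) (a : X → Forms n) (z : Cn n) :
    const (rep c a z) = const (a (c.symm z)) := const_pull _ _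

theorem eventually_symm {c : OpenPartialHomeomorph X (Cn n)} {x : X} (hx : x ∈ c.source)
    {p : X → Prop} (h : ∀ᶠ y in 𝓝 x, p y) :
    ∀ᶠ z in 𝓝 (c x), z ∈ c.target ∧ p (c.symm z) := by
  refine Filter.Eventually.and (c.open_target.mem_nhds (c.map_source hx)) ?_
  have := c.symm.continuousAt (x := c x) (by simpa using c.map_source hx)
  rw [ContinuousAt, c.left_inv hx] at this
  exact this.eventually h

theorem rep_congr {c : OpenPartialHomeomorph X (Cn n)} {x : X} (hx : x ∈ c.source)
    {a b : X → Forms n} (h : a =ᶠ[𝓝 x] b) : rep c a =ᶠ[𝓝 (c x)] rep c b := by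
  filter_upwards [eventually_symm hx h] with z hz
  simp only [rep, hz.2]

theorem SmoothAt.congr {a b : X → Forms n} {x : X} (ha : SmoothAt a x) (h : a =ᶠ[𝓝 x] b) :
    SmoothAt b x := fun c hc hx => (ha c hc hx).congr_of_eventuallyEq (rep_congr hx h.symm)

theorem dbar_congr {a b : X → Forms n} {x : X} (h : a =ᶠ[𝓝 x] b) : dbar a x = dbar b x :=
  dbarE_congr (rep_congr (mem_chart_source _ x) h)

theorem SmoothAt.add {a b : X → Forms n} {x : X} (ha : SmoothAt a x) (hb : SmoothAt b x) :
    SmoothAt (a + b) x := fun c hc hx => by rw [rep_add]; exact (ha c hc hx).add (hb c hc hx)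

theorem SmoothAt.neg {a : X → Forms n} {x : X} (ha : SmoothAt a x) :
    SmoothAt (-a) x := fun c hc hx => by rw [rep_neg]; exact (ha c hc hx).neg

theorem SmoothAt.mul {a b : X → Forms n} {x : X} (ha : SmoothAt a x) (hb : SmoothAt b x) :
    SmoothAt (a * b) x := fun c hc hx => by
  rw [rep_mul]; exact contDiffAt_mul (ha c hc hx) (hb c hc hx)

theorem dbar_add {a b : X → Forms n} {x : X} (ha : SmoothAt a x) (hb : SmoothAt b x) :
    dbar (a + b) x = dbar a x + dbar b x := by
  have hc := chart_mem_atlas (Cn n) x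
  have hx := mem_chart_source (Cn n) x
  rw [dbar, rep_add]
  exact dbarE_add ((ha _ hc hx).differentiableAt (by simp)) ((hb _ hc hx).differentiableAt (by simp))

variable [IsManifold 𝓘(ℂ, Cn n) ω X]

theorem trans_contDiffAt {c c' : OpenPartialHomeomorph X (Cn n)} (hc : c ∈ atlas (Cn n) X)
    (hc' : c' ∈ atlas (Cn n) X) {x : X} (hx : x ∈ c.source) (hx' : x ∈ c'.source) :
    ContDiffAt ℂ ω (fun z => c' (c.symm z)) (c x) := by
  have h := (contDiffGroupoid ω 𝓘(ℂ, Cn n)).compatible hc hc'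
  have h1 := contMDiffOn_iff_contDiffOn.1 (contMDiffOn_of_mem_contDiffGroupoid h)
  refine (h1.contDiffAt ((c.symm.trans c').open_source.mem_nhds ?_))
  simp [hx, hx']

theorem rep_self (a : X → Forms n) (x : X) : rep (chartAt (Cn n) x) a (chartAt (Cn n) x x) = a x := by
  have hx := mem_chart_source (Cn n) x
  have h1 : (chartAt (Cn n) x).symm (chartAt (Cn n) x x) = x := (chartAt (Cn n) x).left_inv hx
  rw [rep, h1]
  have h2 : (fun w => chartAt (Cn n) x ((chartAt (Cn n) x).symm w)) =ᶠ[𝓝 (chartAt (Cn n) x x)] id :=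
    (chartAt (Cn n) x).eventually_right_inverse (mem_chart_target _ x)
  rw [h2.fderiv_eq, fderiv_id, pull_id]

theorem rep_change {c c' : OpenPartialHomeomorph X (Cn n)} (hc : c ∈ atlas (Cn n) X)
    (hc' : c' ∈ atlas (Cn n) X) {x : X} (hx : x ∈ c.source) (hx' : x ∈ c'.source)
    (a : X → Forms n) : rep c a (c x) =
      pull (fderiv ℂ (fun z => c' (c.symm z)) (c x)) (rep c' a (c' x)) := by
  simp only [rep]
  rw [c.left_inv hx, c'.left_inv hx', ← pull_comp]
  have h1 := trans_contDiffAt hc hc' hx hx'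
  have h2 := trans_contDiffAt hc' (chart_mem_atlas (Cn n) x) hx' (mem_chart_source _ x)
  have h3 : (fun w => chartAt (Cn n) x (c.symm w)) =ᶠ[𝓝 (c x)]
      (fun w => chartAt (Cn n) x (c'.symm w)) ∘ fun z => c' (c.symm z) := by
    filter_upwards [eventually_symm hx (c'.open_source.mem_nhds hx')] with z hz
    simp only [Function.comp_apply, c'.left_inv hz.2]
  have h4 : c' (c.symm (c x)) = c' x := by rw [c.left_inv hx]
  rw [h3.fderiv_eq, fderiv_comp]
  · rw [h4]
  · rw [h4]; exact h2.differentiableAt (by simp)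
  · exact h1.differentiableAt (by simp)

theorem rep_change_eventually {c c' : OpenPartialHomeomorph X (Cn n)} (hc : c ∈ atlas (Cn n) X)
    (hc' : c' ∈ atlas (Cn n) X) {x : X} (hx : x ∈ c.source) (hx' : x ∈ c'.source)
    (a : X → Forms n) : rep c a =ᶠ[𝓝 (c x)] fun z =>
      pull (fderiv ℂ (fun z => c' (c.symm z)) z) (rep c' a (c' (c.symm z))) := by
  filter_upwards [eventually_symm hx (c'.open_source.mem_nhds hx')] with z hz
  have := rep_change hc hc' (c.map_target hz.1) hz.2 a
  rwa [c.right_inv hz.1] at this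

theorem smoothAt_of_chart {c : OpenPartialHomeomorph X (Cn n)} (hc : c ∈ atlas (Cn n) X)
    {x : X} (hx : x ∈ c.source) {a : X → Forms n} (ha : ContDiffAt ℝ ∞ (rep c a) (c x)) :
    SmoothAt a x := fun c' hc' hx' => by
  refine ContDiffAt.congr_of_eventuallyEq ?_ (rep_change_eventually hc' hc hx' hx a)
  have h1 := trans_contDiffAt hc' hc hx' hx
  refine contDiffAt_pull_comp h1 ?_
  refine ContDiffAt.comp (g := rep c a) (c' x) ?_ ((h1.of_le le_top).restrict_scalars ℝ)
  rwa [c'.left_inv hx']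

theorem rep_dbar {c : OpenPartialHomeomorph X (Cn n)} (hc : c ∈ atlas (Cn n) X)
    {x : X} (hx : x ∈ c.source) {a : X → Forms n} (ha : SmoothAt a x) :
    rep c (dbar a) (c x) = dbarE (rep c a) (c x) := by
  have hc' := chart_mem_atlas (Cn n) x
  have hx' := mem_chart_source (Cn n) x
  rw [rep_change hc hc' hx hx', rep_self, dbar,
    dbarE_congr (rep_change_eventually hc hc' hx hx' a)]
  have h1 := dbarE_pull (trans_contDiffAt hc hc' hx hx') (f := rep (chartAt (Cn n) x) a) (by
    rw [c.left_inv hx]; exact (ha _ hc' hx').differentiableAt (by simp))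
  rw [h1, c.left_inv hx]

theorem rep_dbar_eventually {c : OpenPartialHomeomorph X (Cn n)} (hc : c ∈ atlas (Cn n) X)
    {x : X} (hx : x ∈ c.source) {a : X → Forms n} (ha : ∀ᶠ y in 𝓝 x, SmoothAt a y) :
    rep c (dbar a) =ᶠ[𝓝 (c x)] dbarE (rep c a) := by
  filter_upwards [eventually_symm hx ha] with z hz
  have := rep_dbar hc (c.map_target hz.1) hz.2
  rwa [c.right_inv hz.1] at this

theorem SmoothAt.dbar {x : X} {a : X → Forms n} (ha : ∀ᶠ y in 𝓝 x, SmoothAt a y) :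
    SmoothAt (dbar a) x := fun c hc hx =>
  (contDiffAt_dbarE (ha.self_of_nhds c hc hx)).congr_of_eventuallyEq (rep_dbar_eventually hc hx ha)

theorem dbar_dbar {x : X} {a : X → Forms n} (ha : ∀ᶠ y in 𝓝 x, SmoothAt a y) :
    dbar (dbar a) x = 0 := by
  have hc := chart_mem_atlas (Cn n) x
  have hx := mem_chart_source (Cn n) x
  rw [Cohesive.dbar, dbarE_congr (rep_dbar_eventually hc hx ha)]
  exact dbarE_dbarE (ha.self_of_nhds _ hc hx)

theorem dbar_mul {a b : X → Forms n} {x : X} (ha : SmoothAt a x) (hb : SmoothAt b x) :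
    dbar (a * b) x = dbar a x * b x + inv (a x) * dbar b x := by
  have hc := chart_mem_atlas (Cn n) x
  have hx := mem_chart_source (Cn n) x
  rw [dbar, rep_mul, dbarE_mul ((ha _ hc hx).differentiableAt (by simp))
    ((hb _ hc hx).differentiableAt (by simp)), rep_self, rep_self]
  rfl

theorem dbar_deg {a : X → Forms n} {x : X} (ha : SmoothAt a x) {j : ℕ}
    (hj : ∀ᶠ y in 𝓝 x, a y ∈ deg n j) : dbar a x ∈ deg n (j + 1) := by
  have hc := chart_mem_atlas (Cn n) x
  have hx := mem_chart_source (Cn n) x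
  let π : Forms n →L[ℝ] Forms n := ((proj n j).restrictScalars ℝ).toContinuousLinearMap
  have h1 : rep (chartAt (Cn n) x) a =ᶠ[𝓝 (chartAt (Cn n) x x)] π ∘ rep (chartAt (Cn n) x) a := by
    filter_upwards [eventually_symm hx hj] with z hz
    exact (proj_of_mem (pull_deg _ hz.2)).symm
  have h2 : ∀ v, fderiv ℝ (rep (chartAt (Cn n) x) a) (chartAt (Cn n) x x) v ∈ deg n j := by
    intro v
    rw [h1.fderiv_eq, (π.hasFDerivAt.comp _
      ((ha _ hc hx).differentiableAt (by simp)).hasFDerivAt).fderiv]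
    exact proj_mem j _
  rw [dbar, dbarE]
  refine Submodule.sum_mem (deg n (j + 1)) fun k _ => ?_
  rw [add_comm]
  exact mul_mem_deg (ι_mem _) (Submodule.smul_mem _ _ (Submodule.add_mem _ (h2 _)
    (Submodule.smul_mem _ _ (h2 _))))

end Manifold

section Dolbeault

open Forms Filter TopologicalSpace

variable (n : ℕ) {X : Type u} [TopologicalSpace X] [ChartedSpace (Cn n) X]

/-- A complex valued function is smooth at `x`. -/
def FunSmoothAt (f : X → ℂ) (x : X) : Prop :=
  ∀ c ∈ atlas (Cn n) X, x ∈ c.source → ContDiffAt ℝ ∞ (fun z => f (c.symm z)) (c x)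

/-- A germ of functions along a filter has a property near the points of the filter. -/
def GermAll {β : Type*} (l : Filter X) (P : (X → β) → X → Prop) (g : Germ l β) : Prop :=
  ∃ f : X → β, (f : Germ l β) = g ∧ ∀ᶠ x in l, P f x

/-- The germs along the closure of `U` of smooth functions, i.e. the colimit of the rings of smooth
functions on the open sets containing the closure of `U`. -/
def smoothGerms (U : Opens X) : Subring (Germ (𝓝ˢ (closure (U : Set X))) ℂ) where
  carrier := {g | GermAll _ (FunSmoothAt n) g}
  mul_mem' := by
    rintro _ _ ⟨f, rfl, hf⟩ ⟨g, rfl, hg⟩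
    exact ⟨f * g, rfl, by
      filter_upwards [hf, hg] with x hf hg c hc hx using (hf c hc hx).mul (hg c hc hx)⟩
  one_mem' := ⟨1, rfl, Eventually.of_forall fun x c hc hx => contDiffAt_const⟩
  add_mem' := by
    rintro _ _ ⟨f, rfl, hf⟩ ⟨g, rfl, hg⟩
    exact ⟨f + g, rfl, by
      filter_upwards [hf, hg] with x hf hg c hc hx using (hf c hc hx).add (hg c hc hx)⟩
  zero_mem' := ⟨0, rfl, Eventually.of_forall fun x c hc hx => contDiffAt_const⟩
  neg_mem' := by
    rintro _ ⟨f, rfl, hf⟩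
    exact ⟨-f, rfl, by filter_upwards [hf] with x hf c hc hx using (hf c hc hx).neg⟩

theorem smoothAt_algebraMap {f : X → ℂ} {x : X} (hf : FunSmoothAt n f x) :
    SmoothAt (fun x => algebraMap ℂ (Forms n) (f x)) x := fun c hc hx => by
  rw [rep_algebraMap]
  exact ((Algebra.linearMap ℂ (Forms n)).restrictScalars ℝ).toContinuousLinearMap.contDiff.contDiffAt.comp
    _ (hf c hc hx)

theorem funSmoothAt_const {a : X → Forms n} {x : X} (ha : SmoothAt a x) :
    FunSmoothAt n (fun x => const (a x)) x := fun c hc hx => by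
  simp only [← const_rep]
  exact (((const (n := n)).toLinearMap.restrictScalars ℝ).toContinuousLinearMap.contDiff.contDiffAt.comp
    _ (ha c hc hx))

/-- The germs along the closure of `U` of smooth antiholomorphic forms, i.e. the colimit of
`A^{0,•}(V)` over the open sets `V` containing the closure of `U`. -/
def formGerms (U : Opens X) : Subring (Germ (𝓝ˢ (closure (U : Set X))) (Forms n)) where
  carrier := {g | GermAll _ SmoothAt g}
  mul_mem' := by
    rintro _ _ ⟨f, rfl, hf⟩ ⟨g, rfl, hg⟩
    exact ⟨f * g, rfl, by filter_upwards [hf, hg] with x hf hg using hf.mul hg⟩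
  one_mem' := ⟨fun x => algebraMap ℂ (Forms n) 1, by simp only [map_one]; rfl,
    Eventually.of_forall fun x => smoothAt_algebraMap n fun c hc hx => contDiffAt_const⟩
  add_mem' := by
    rintro _ _ ⟨f, rfl, hf⟩ ⟨g, rfl, hg⟩
    exact ⟨f + g, rfl, by filter_upwards [hf, hg] with x hf hg using hf.add hg⟩
  zero_mem' := ⟨fun x => algebraMap ℂ (Forms n) 0, by simp only [map_zero]; rfl,
    Eventually.of_forall fun x => smoothAt_algebraMap n fun c hc hx => contDiffAt_const⟩
  neg_mem' := by
    rintro _ ⟨f, rfl, hf⟩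
    exact ⟨-f, rfl, by filter_upwards [hf] with x hf using hf.neg⟩

variable {n}

theorem FunSmoothAt.congr {a b : X → ℂ} {x : X} (ha : FunSmoothAt n a x) (h : a =ᶠ[𝓝 x] b) :
    FunSmoothAt n b x := fun c hc hx => (ha c hc hx).congr_of_eventuallyEq (by
      filter_upwards [eventually_symm hx h] with z hz using hz.2.symm)

theorem eventually_near {K : Set X} {p : X → Prop} (h : ∀ᶠ x in 𝓝ˢ K, p x) :
    ∀ᶠ x in 𝓝ˢ K, ∀ᶠ y in 𝓝 x, p y := h.eventually_nhdsSet

theorem coe_mem_smoothGerms {U : Opens X} {f : X → ℂ} :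
    (f : Germ (𝓝ˢ (closure (U : Set X))) ℂ) ∈ smoothGerms n U ↔
      ∀ᶠ x in 𝓝ˢ (closure (U : Set X)), FunSmoothAt n f x := by
  refine ⟨?_, fun h => ⟨f, rfl, h⟩⟩
  rintro ⟨g, hg, h⟩
  filter_upwards [eventually_near (Germ.coe_eq.1 hg), h] with x h1 h2 using h2.congr h1

theorem coe_mem_formGerms {U : Opens X} {f : X → Forms n} :
    (f : Germ (𝓝ˢ (closure (U : Set X))) (Forms n)) ∈ formGerms n U ↔
      ∀ᶠ x in 𝓝ˢ (closure (U : Set X)), SmoothAt f x := by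
  refine ⟨?_, fun h => ⟨f, rfl, h⟩⟩
  rintro ⟨g, hg, h⟩
  filter_upwards [eventually_near (Germ.coe_eq.1 hg), h] with x h1 h2 using h2.congr h1

/-- The germ of a smooth function. -/
def mkFun {U : Opens X} (f : X → ℂ) (hf : ∀ᶠ x in 𝓝ˢ (closure (U : Set X)), FunSmoothAt n f x) :
    smoothGerms n U := ⟨f, coe_mem_smoothGerms.2 hf⟩

/-- The germ of a smooth form. -/
def mkForm {U : Opens X} (f : X → Forms n) (hf : ∀ᶠ x in 𝓝ˢ (closure (U : Set X)), SmoothAt f x) :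
    formGerms n U := ⟨f, coe_mem_formGerms.2 hf⟩

theorem mkFun_eq {U : Opens X} {f g : X → ℂ} {hf hg} :
    (mkFun f hf : smoothGerms n U) = mkFun g hg ↔ f =ᶠ[𝓝ˢ (closure (U : Set X))] g := by
  rw [mkFun, mkFun, Subtype.mk.injEq, Germ.coe_eq]

theorem mkForm_eq {U : Opens X} {f g : X → Forms n} {hf hg} :
    (mkForm f hf : formGerms n U) = mkForm g hg ↔ f =ᶠ[𝓝ˢ (closure (U : Set X))] g := by
  rw [mkForm, mkForm, Subtype.mk.injEq, Germ.coe_eq]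

theorem exists_mkFun {U : Opens X} (a : smoothGerms n U) : ∃ f hf, a = mkFun f hf := by
  obtain ⟨_, f, rfl, hf⟩ := a
  exact ⟨f, hf, rfl⟩

theorem exists_mkForm {U : Opens X} (a : formGerms n U) : ∃ f hf, a = mkForm f hf := by
  obtain ⟨_, f, rfl, hf⟩ := a
  exact ⟨f, hf, rfl⟩

theorem tendsto_closure {U V : Opens X} (h : V ≤ U) :
    Tendsto id (𝓝ˢ (closure (V : Set X))) (𝓝ˢ (closure (U : Set X))) :=
  tendsto_id'.2 (nhdsSet_mono (closure_mono h))

/-- Restriction of germs of functions. -/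
def funRes {U V : Opens X} (h : V ≤ U) : smoothGerms n U →+* smoothGerms n V where
  toFun a := ⟨a.1.compTendsto id (tendsto_closure h), by
    obtain ⟨f, hf, rfl⟩ := exists_mkFun a
    exact ⟨f, rfl, tendsto_closure h hf⟩⟩
  map_one' := rfl
  map_zero' := rfl
  map_mul' a b := by
    obtain ⟨f, hf, rfl⟩ := exists_mkFun a
    obtain ⟨g, hg, rfl⟩ := exists_mkFun b
    rfl
  map_add' a b := by
    obtain ⟨f, hf, rfl⟩ := exists_mkFun a
    obtain ⟨g, hg, rfl⟩ := exists_mkFun b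
    rfl

/-- Restriction of germs of forms. -/
def formRes {U V : Opens X} (h : V ≤ U) : formGerms n U →+* formGerms n V where
  toFun a := ⟨a.1.compTendsto id (tendsto_closure h), by
    obtain ⟨f, hf, rfl⟩ := exists_mkForm a
    exact ⟨f, rfl, tendsto_closure h hf⟩⟩
  map_one' := rfl
  map_zero' := rfl
  map_mul' a b := by
    obtain ⟨f, hf, rfl⟩ := exists_mkForm a
    obtain ⟨g, hg, rfl⟩ := exists_mkForm b
    rfl
  map_add' a b := by
    obtain ⟨f, hf, rfl⟩ := exists_mkForm a
    obtain ⟨g, hg, rfl⟩ := exists_mkForm b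
    rfl

/-- Functions as forms of degree zero. -/
noncomputable def funToForm (U : Opens X) : smoothGerms n U →+* formGerms n U where
  toFun a := ⟨a.1.map (algebraMap ℂ (Forms n)), by
    obtain ⟨f, hf, rfl⟩ := exists_mkFun a
    exact ⟨fun x => algebraMap ℂ (Forms n) (f x), rfl, by
      filter_upwards [hf] with x hx using smoothAt_algebraMap n hx⟩⟩
  map_one' := Subtype.ext (congrArg Germ.ofFun (funext fun x => map_one (algebraMap ℂ (Forms n))))
  map_zero' := Subtype.ext (congrArg Germ.ofFun (funext fun x => map_zero (algebraMap ℂ (Forms n))))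
  map_mul' a b := by
    obtain ⟨f, hf, rfl⟩ := exists_mkFun a
    obtain ⟨g, hg, rfl⟩ := exists_mkFun b
    exact Subtype.ext (congrArg Germ.ofFun (funext fun x => map_mul (algebraMap ℂ (Forms n)) _ _))
  map_add' a b := by
    obtain ⟨f, hf, rfl⟩ := exists_mkFun a
    obtain ⟨g, hg, rfl⟩ := exists_mkFun b
    exact Subtype.ext (congrArg Germ.ofFun (funext fun x => map_add (algebraMap ℂ (Forms n)) _ _))

noncomputable instance (U : Opens X) : Algebra (smoothGerms n U) (formGerms n U) :=
  RingHom.toAlgebra' (funToForm U) fun a b => by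
    obtain ⟨f, hf, rfl⟩ := exists_mkFun a
    obtain ⟨g, hg, rfl⟩ := exists_mkForm b
    exact Subtype.ext (congrArg Germ.ofFun (funext fun x => Algebra.commutes (f x) (g x)))

/-- The homogeneous forms of degree `j`. -/
def formDeg (U : Opens X) (j : ℕ) : Submodule (smoothGerms n U) (formGerms n U) where
  carrier := {a | a.1.LiftPred fun b => b ∈ deg n j}
  add_mem' := by
    intro a b ha hb
    obtain ⟨f, hf, rfl⟩ := exists_mkForm a
    obtain ⟨g, hg, rfl⟩ := exists_mkForm b
    have ha : ∀ᶠ x in 𝓝ˢ (closure (U : Set X)), f x ∈ deg n j := ha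
    have hb : ∀ᶠ x in 𝓝ˢ (closure (U : Set X)), g x ∈ deg n j := hb
    change ∀ᶠ x in 𝓝ˢ (closure (U : Set X)), f x + g x ∈ deg n j
    filter_upwards [ha, hb] with x ha hb using Submodule.add_mem _ ha hb
  zero_mem' := by
    change ∀ᶠ x in 𝓝ˢ (closure (U : Set X)), (0 : Forms n) ∈ deg n j
    exact Eventually.of_forall fun x => Submodule.zero_mem _
  smul_mem' := by
    intro a b hb
    obtain ⟨f, hf, rfl⟩ := exists_mkFun a
    obtain ⟨g, hg, rfl⟩ := exists_mkForm b
    have hb : ∀ᶠ x in 𝓝ˢ (closure (U : Set X)), g x ∈ deg n j := hb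
    change ∀ᶠ x in 𝓝ˢ (closure (U : Set X)), algebraMap ℂ (Forms n) (f x) * g x ∈ deg n j
    filter_upwards [hb] with x hb
    rw [← Algebra.smul_def]
    exact Submodule.smul_mem _ _ hb

theorem mkForm_mem_formDeg {U : Opens X} {f : X → Forms n} {hf} {j : ℕ} :
    (mkForm f hf : formGerms n U) ∈ formDeg U j ↔
      ∀ᶠ x in 𝓝ˢ (closure (U : Set X)), f x ∈ deg n j := Iff.rfl

/-- The degree zero component of a form. -/
noncomputable def formConst (U : Opens X) : formGerms n U →ₐ[smoothGerms n U] smoothGerms n U where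
  toFun a := ⟨a.1.map const, by
    obtain ⟨f, hf, rfl⟩ := exists_mkForm a
    exact ⟨fun x => const (f x), rfl, by
      filter_upwards [hf] with x hx using funSmoothAt_const n hx⟩⟩
  map_one' := Subtype.ext (congrArg Germ.ofFun (funext fun x => map_one const))
  map_zero' := Subtype.ext (congrArg Germ.ofFun (funext fun x => map_zero const))
  map_mul' a b := by
    obtain ⟨f, hf, rfl⟩ := exists_mkForm a
    obtain ⟨g, hg, rfl⟩ := exists_mkForm b
    exact Subtype.ext (congrArg Germ.ofFun (funext fun x => map_mul const _ _))
  map_add' a b := by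
    obtain ⟨f, hf, rfl⟩ := exists_mkForm a
    obtain ⟨g, hg, rfl⟩ := exists_mkForm b
    exact Subtype.ext (congrArg Germ.ofFun (funext fun x => map_add const _ _))
  commutes' a := by
    obtain ⟨f, hf, rfl⟩ := exists_mkFun a
    exact Subtype.ext (congrArg Germ.ofFun (funext fun x => AlgHom.commutes const _))

variable [IsManifold 𝓘(ℂ, Cn n) ω X]

/-- The operator `∂̄` on germs of forms. -/
noncomputable def formD (U : Opens X) : formGerms n U →+ formGerms n U :=
  AddMonoidHom.mk' (fun a => ⟨a.1.map' dbar fun f g hfg => by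
      filter_upwards [eventually_near hfg] with x hx using dbar_congr hx, by
    obtain ⟨f, hf, rfl⟩ := exists_mkForm a
    exact ⟨dbar f, rfl, by filter_upwards [eventually_near hf] with x hx using SmoothAt.dbar hx⟩⟩)
  fun a b => by
    obtain ⟨f, hf, rfl⟩ := exists_mkForm a
    obtain ⟨g, hg, rfl⟩ := exists_mkForm b
    refine Subtype.ext (Germ.coe_eq.2 ?_)
    filter_upwards [hf, hg] with x hf hg using dbar_add hf hg

theorem formD_mk {U : Opens X} {f : X → Forms n} {hf} {hd} :
    formD U (mkForm f hf : formGerms n U) = mkForm (dbar f) hd := rfl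

variable (n X)

/-- The presheaf of Dolbeault algebras of a complex manifold: its algebra over `U` is the colimit of
`(A^{0,•}(V), ∂̄)` over the open sets `V` containing the closure of `U`. -/
noncomputable def dolbeault : DGPresheaf.{u} (Opens X) where
  A0 U := smoothGerms n U
  A U := formGerms n U
  gr := formDeg
  d := formD
  ε := formConst
  res0 := funRes
  res := formRes
  mem_gr_zero U a := by
    obtain ⟨f, hf, rfl⟩ := exists_mkForm a
    rw [mkForm_mem_formDeg]
    constructor
    · intro h
      refine ⟨formConst U (mkForm f hf), Subtype.ext (Germ.coe_eq.2 ?_)⟩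
      filter_upwards [h] with x hx using mem_deg_zero.1 hx
    · rintro ⟨r, hr⟩
      obtain ⟨g, hg, rfl⟩ := exists_mkFun r
      have := Germ.coe_eq.1 (congrArg Subtype.val hr)
      filter_upwards [this] with x hx
      rw [← hx, mem_deg_zero]
      exact congrArg _ (AlgHom.commutes const _)
  mul_mem_gr U i j a b ha hb := by
    obtain ⟨f, hf, rfl⟩ := exists_mkForm a
    obtain ⟨g, hg, rfl⟩ := exists_mkForm b
    rw [mkForm_mem_formDeg] at ha hb
    filter_upwards [ha, hb] with x ha hb using mul_mem_deg ha hb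
  d_mem_gr U j a ha := by
    obtain ⟨f, hf, rfl⟩ := exists_mkForm a
    rw [mkForm_mem_formDeg] at ha
    filter_upwards [hf, eventually_near ha] with x hf ha using dbar_deg hf ha
  d_mul U j a b ha := by
    obtain ⟨f, hf, rfl⟩ := exists_mkForm a
    obtain ⟨g, hg, rfl⟩ := exists_mkForm b
    rw [mkForm_mem_formDeg] at ha
    refine Subtype.ext (Germ.coe_eq.2 ?_)
    filter_upwards [hf, hg, ha] with x hf hg ha
    refine (dbar_mul hf hg).trans (congrArg₂ (· + ·) rfl ?_)
    rw [inv_deg ha, smul_mul_assoc]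
    rfl
  d_d U a := by
    obtain ⟨f, hf, rfl⟩ := exists_mkForm a
    refine Subtype.ext (Germ.coe_eq.2 ?_)
    filter_upwards [eventually_near hf] with x hf using dbar_dbar hf
  ε_gr U j a hj ha := by
    obtain ⟨f, hf, rfl⟩ := exists_mkForm a
    rw [mkForm_mem_formDeg] at ha
    refine Subtype.ext (Germ.coe_eq.2 ?_)
    filter_upwards [ha] with x ha using const_deg hj ha
  res0_refl U a := by
    obtain ⟨f, hf, rfl⟩ := exists_mkFun a
    rfl
  res_refl U a := by
    obtain ⟨f, hf, rfl⟩ := exists_mkForm a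
    rfl
  res0_res0 h h' a := by
    obtain ⟨f, hf, rfl⟩ := exists_mkFun a
    rfl
  res_res h h' a := by
    obtain ⟨f, hf, rfl⟩ := exists_mkForm a
    rfl
  res_algebraMap h a := by
    obtain ⟨f, hf, rfl⟩ := exists_mkFun a
    rfl
  res_mem_gr h j a ha := by
    obtain ⟨f, hf, rfl⟩ := exists_mkForm a
    exact tendsto_closure h ha
  res_d h a := by
    obtain ⟨f, hf, rfl⟩ := exists_mkForm a
    rfl
  res_ε h a := by
    obtain ⟨f, hf, rfl⟩ := exists_mkForm a
    rfl

end Dolbeault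

section Frame

open Forms Filter TopologicalSpace

variable {n : ℕ} {X : Type u} [TopologicalSpace X] [ChartedSpace (Cn n) X]

theorem FunSmoothAt.mul {f g : X → ℂ} {x : X} (hf : FunSmoothAt n f x) (hg : FunSmoothAt n g x) :
    FunSmoothAt n (fun y => f y * g y) x := fun c hc hx => (hf c hc hx).mul (hg c hc hx)

variable [IsManifold 𝓘(ℂ, Cn n) ω X]

theorem exists_bump [T2Space X] (x : X) : ∃ β : X → ℝ, (∀ᶠ y in 𝓝 x, β y ≠ 0) ∧
    (∀ y ∈ (chartAt (Cn n) x).source, FunSmoothAt n (fun y => (β y : ℂ)) y) ∧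
    ∀ y ∉ (chartAt (Cn n) x).source, ∀ᶠ y' in 𝓝 y, β y' = 0 := by
  classical
  set c := chartAt (Cn n) x with hc
  have hx : x ∈ c.source := mem_chart_source _ x
  obtain ⟨r, hr, hrc⟩ := Metric.nhds_basis_closedBall.mem_iff.1
    (c.open_target.mem_nhds (c.map_source hx))
  let φ : ContDiffBump (c x) := ⟨r / 2, r, half_pos hr, half_lt_self hr⟩
  let K : Set X := c.symm '' Metric.closedBall (c x) r
  have hK : IsClosed K :=
    ((isCompact_closedBall (c x) r).image_of_continuousOn (c.continuousOn_symm.mono hrc)).isClosed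
  have hKs : K ⊆ c.source := by
    rintro _ ⟨z, hz, rfl⟩
    exact c.map_target (hrc hz)
  let β : X → ℝ := fun y => if y ∈ c.source then φ (c y) else 0
  have hβK : ∀ y, y ∉ K → β y = 0 := by
    intro y hy
    by_cases hys : y ∈ c.source
    · simp only [β, hys, if_true]
      refine φ.zero_of_le_dist ?_
      by_contra hlt
      refine hy ⟨c y, Metric.mem_closedBall.2 (not_le.1 hlt).le, c.left_inv hys⟩
    · simp only [β, hys, if_false]
  refine ⟨β, ?_, ?_, ?_⟩
  · have h1 : ∀ᶠ y in 𝓝 x, c y ∈ Metric.ball (c x) (r / 2) :=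
      (c.continuousAt hx).eventually (Metric.ball_mem_nhds _ (half_pos hr))
    filter_upwards [h1, c.open_source.mem_nhds hx] with y hy hys
    have : φ (c y) = 1 := φ.one_of_mem_closedBall (Metric.ball_subset_closedBall hy)
    simp only [β, hys, if_true, this]
    norm_num
  · intro y hy c' hc' hy'
    have h1 := (trans_contDiffAt hc' (chart_mem_atlas (Cn n) x) hy' hy)
    have h2 : ContDiffAt ℝ ∞ (fun z => (φ (c (c'.symm z)) : ℂ)) (c' y) :=
      (Complex.ofRealCLM.contDiff.contDiffAt.comp _ (φ.contDiffAt (x := c (c'.symm (c' y))))).comp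
        (c' y) ((h1.of_le le_top).restrict_scalars ℝ)
    refine h2.congr_of_eventuallyEq ?_
    filter_upwards [eventually_symm hy' (c.open_source.mem_nhds hy)] with z hz
    have hz2 : c'.symm z ∈ c.source := hz.2
    simp only [β, hz2, if_true]
  · intro y hy
    filter_upwards [hK.isOpen_compl.mem_nhds fun h => hy (hKs h)] with y' hy' using hβK y' hy'

variable (n X) in
/-- A finite system of smooth functions `β k`, each supported in a chart, without common zeros. -/
structure Bumps where
  N : ℕ
  p : Fin N → X
  β : Fin N → X → ℝ
  smooth : ∀ k, ∀ y ∈ (chartAt (Cn n) (p k)).source, FunSmoothAt n (fun y => (β k y : ℂ)) y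
  zero : ∀ k, ∀ y ∉ (chartAt (Cn n) (p k)).source, ∀ᶠ y' in 𝓝 y, β k y' = 0
  exists_ne : ∀ y, ∃ k, β k y ≠ 0

theorem nonempty_bumps [T2Space X] [CompactSpace X] : Nonempty (Bumps n X) := by
  choose β h1 h2 h3 using exists_bump (n := n) (X := X)
  obtain ⟨t, ht⟩ := CompactSpace.elim_nhds_subcover (fun x => {y | β x y ≠ 0}) h1
  refine ⟨t.card, fun k => t.equivFin.symm k, fun k => β (t.equivFin.symm k), fun k => h2 _,
    fun k => h3 _, fun y => ?_⟩
  have hy : y ∈ ⋃ x ∈ t, {y | β x y ≠ 0} := ht ▸ Set.mem_univ y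
  simp only [Set.mem_iUnion] at hy
  obtain ⟨x, hx, hy⟩ := hy
  exact ⟨t.equivFin ⟨x, hx⟩, by simpa using hy⟩

namespace Bumps

variable (B : Bumps n X)

/-- The chart of index `k`. -/
noncomputable def chart (k : Fin B.N) : OpenPartialHomeomorph X (Cn n) := chartAt (Cn n) (B.p k)

theorem chart_mem (k : Fin B.N) : B.chart k ∈ atlas (Cn n) X := chart_mem_atlas _ _

/-- The weights. -/
noncomputable def wt (k : Fin B.N) (y : X) : ℂ := B.β k y * (∑ j, (B.β j y : ℂ) * B.β j y)⁻¹

theorem sum_ne_zero (y : X) : ∑ j, (B.β j y : ℂ) * B.β j y ≠ 0 := by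
  obtain ⟨k, hk⟩ := B.exists_ne y
  have h1 : 0 < ∑ j, B.β j y * B.β j y :=
    Finset.sum_pos' (fun j _ => mul_self_nonneg _) ⟨k, Finset.mem_univ _, mul_self_pos.2 hk⟩
  exact_mod_cast h1.ne'

theorem smooth_all (k : Fin B.N) (y : X) : FunSmoothAt n (fun y => (B.β k y : ℂ)) y := by
  by_cases hy : y ∈ (B.chart k).source
  · exact B.smooth k y hy
  · refine FunSmoothAt.congr (a := fun _ => 0) (fun c hc hx => contDiffAt_const) ?_
    filter_upwards [B.zero k y hy] with y' hy'
    simp [hy']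

theorem wt_smooth (k : Fin B.N) (y : X) : FunSmoothAt n (B.wt k) y := by
  refine FunSmoothAt.mul (B.smooth_all k y) fun c hc hx => ContDiffAt.inv ?_ ?_
  · exact ContDiffAt.sum fun j _ => (B.smooth_all j y c hc hx).mul (B.smooth_all j y c hc hx)
  · exact B.sum_ne_zero _

theorem mul_smooth (k : Fin B.N) {f g : X → ℂ} {y : X} (hf : FunSmoothAt n f y)
    (hf0 : ∀ y, B.β k y = 0 → f y = 0) (hg : y ∈ (B.chart k).source → FunSmoothAt n g y) :
    FunSmoothAt n (fun y => f y * g y) y := by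
  by_cases hy : y ∈ (B.chart k).source
  · exact hf.mul (hg hy)
  · refine FunSmoothAt.congr (a := fun _ => 0) (fun c hc hx => contDiffAt_const) ?_
    filter_upwards [B.zero k y hy] with y' hy'
    simp [hf0 y' hy']

/-- The frame of forms in the chart of index `k`. -/
noncomputable def fr (k : Fin B.N) (s : Finset (Fin n)) (y : X) : Forms n :=
  pull (fderiv ℂ (fun w => B.chart k ((chartAt (Cn n) y).symm w)) (chartAt (Cn n) y y)) (basis n s)

/-- The coordinates of a form in the chart of index `k`. -/
noncomputable def co (k : Fin B.N) (s : Finset (Fin n)) (y : X) (a : Forms n) : ℂ :=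
  (basis n).coord s
    (pull (fderiv ℂ (fun w => chartAt (Cn n) y ((B.chart k).symm w)) (B.chart k y)) a)

theorem co_eq (k : Fin B.N) (s : Finset (Fin n)) {y : X} (hy : y ∈ (B.chart k).source)
    (a : X → Forms n) : B.co k s y (a y) = (basis n).coord s (rep (B.chart k) a (B.chart k y)) := by
  rw [co, rep, (B.chart k).left_inv hy]

theorem sum_co_fr (k : Fin B.N) {y : X} (hy : y ∈ (B.chart k).source) (a : X → Forms n) :
    ∑ s, B.co k s y (a y) • B.fr k s y = a y := by
  have h1 := rep_change (chart_mem_atlas (Cn n) y) (B.chart_mem k) (mem_chart_source _ y) hy a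
  rw [rep_self, pull_eq_sum] at h1
  rw [h1]
  exact Finset.sum_congr rfl fun s _ => by rw [← h1, B.co_eq k s hy]; rfl

theorem rep_fr (k : Fin B.N) (s : Finset (Fin n)) {y : X} (hy : y ∈ (B.chart k).source) :
    rep (B.chart k) (B.fr k s) (B.chart k y) = basis n s := by
  have hy' := mem_chart_source (Cn n) y
  rw [rep, (B.chart k).left_inv hy, fr, ← pull_comp]
  have h1 := trans_contDiffAt (B.chart_mem k) (chart_mem_atlas (Cn n) y) hy hy'
  have h2 := trans_contDiffAt (chart_mem_atlas (Cn n) y) (B.chart_mem k) hy' hy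
  have h3 : (fun w => B.chart k ((chartAt (Cn n) y).symm w)) ∘
      (fun w => chartAt (Cn n) y ((B.chart k).symm w)) =ᶠ[𝓝 (B.chart k y)] id := by
    filter_upwards [eventually_symm hy ((chartAt (Cn n) y).open_source.mem_nhds hy')] with z hz
    simp only [Function.comp_apply, id, (chartAt (Cn n) y).left_inv hz.2, (B.chart k).right_inv hz.1]
  have h4 : chartAt (Cn n) y ((B.chart k).symm (B.chart k y)) = chartAt (Cn n) y y := by
    rw [(B.chart k).left_inv hy]
  have h5 := fderiv_comp (B.chart k y) (g := fun w => B.chart k ((chartAt (Cn n) y).symm w))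
    (f := fun w => chartAt (Cn n) y ((B.chart k).symm w))
    (by rw [h4]; exact h2.differentiableAt (by simp)) (h1.differentiableAt (by simp))
  rw [h4] at h5
  rw [← h5, h3.fderiv_eq, fderiv_id, pull_id]

theorem fr_smooth (k : Fin B.N) (s : Finset (Fin n)) {y : X} (hy : y ∈ (B.chart k).source) :
    SmoothAt (B.fr k s) y := by
  refine smoothAt_of_chart (B.chart_mem k) hy (ContDiffAt.congr_of_eventuallyEq
    (f := fun _ => basis n s) contDiffAt_const ?_)
  filter_upwards [(B.chart k).open_target.mem_nhds ((B.chart k).map_source hy)] with z hz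
  have := B.rep_fr k s ((B.chart k).map_target hz)
  rwa [(B.chart k).right_inv hz] at this

theorem co_smooth (k : Fin B.N) (s : Finset (Fin n)) {y : X} (hy : y ∈ (B.chart k).source)
    {a : X → Forms n} (ha : SmoothAt a y) : FunSmoothAt n (fun y => B.co k s y (a y)) y := by
  intro c hc hx
  have h1 := trans_contDiffAt hc (B.chart_mem k) hx hy
  have h2 := ha _ (B.chart_mem k) hy
  have h3 : ContDiffAt ℝ ∞ (rep (B.chart k) a) (B.chart k (c.symm (c y))) := by
    rwa [c.left_inv hx]
  refine ((coordL s).contDiff.contDiffAt.comp _ (h3.comp (c y)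
    ((h1.of_le le_top).restrict_scalars ℝ))).congr_of_eventuallyEq ?_
  filter_upwards [eventually_symm hx ((B.chart k).open_source.mem_nhds hy)] with z hz
  exact B.co_eq k s hz.2 a

theorem wt_mul (k : Fin B.N) (y : X) (h : B.β k y = 0) : B.wt k y = 0 := by simp [wt, h]

theorem sum_wt (y : X) : ∑ k, B.wt k y * B.β k y = 1 := by
  simp only [wt]
  rw [← mul_inv_cancel₀ (B.sum_ne_zero y), Finset.sum_mul]
  exact Finset.sum_congr rfl fun k _ => by ring

theorem mem_source (k : Fin B.N) (y : X) (h : B.β k y ≠ 0) : y ∈ (B.chart k).source := by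
  by_contra hy
  exact h (B.zero k y hy).self_of_nhds

/-- The frame elements. -/
noncomputable def θ (k : Fin B.N) (s : Finset (Fin n)) (y : X) : Forms n :=
  algebraMap ℂ (Forms n) (B.β k y) * B.fr k s y

theorem θ_smooth (k : Fin B.N) (s : Finset (Fin n)) (y : X) : SmoothAt (B.θ k s) y := by
  by_cases hy : y ∈ (B.chart k).source
  · exact (smoothAt_algebraMap n (B.smooth_all k y)).mul (B.fr_smooth k s hy)
  · refine SmoothAt.congr (a := fun _ => algebraMap ℂ (Forms n) 0)
      (smoothAt_algebraMap n fun c hc hx => contDiffAt_const) ?_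
    filter_upwards [B.zero k y hy] with y' hy'
    simp [hy', θ]

/-- The coordinates with respect to the frame. -/
noncomputable def coefFun (k : Fin B.N) (s : Finset (Fin n)) (a : X → Forms n) (y : X) : ℂ :=
  B.wt k y * B.co k s y (a y)

theorem coefFun_smooth (k : Fin B.N) (s : Finset (Fin n)) {a : X → Forms n} {y : X}
    (ha : SmoothAt a y) : FunSmoothAt n (B.coefFun k s a) y :=
  B.mul_smooth k (B.wt_smooth k y) (B.wt_mul k) fun hy => B.co_smooth k s hy ha

theorem sum_coefFun (a : X → Forms n) (y : X) :
    ∑ ks : Fin B.N × Finset (Fin n), algebraMap ℂ (Forms n) (B.coefFun ks.1 ks.2 a y) *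
      B.θ ks.1 ks.2 y = a y := by
  rw [Fintype.sum_prod_type]
  calc _ = ∑ k, (B.wt k y * B.β k y) • a y := Finset.sum_congr rfl fun k _ => ?_
    _ = a y := by rw [← Finset.sum_smul, B.sum_wt, one_smul]
  by_cases hk : B.β k y = 0
  · simp [θ, hk]
  · conv_rhs => rw [← B.sum_co_fr k (B.mem_source k y hk) a, Finset.smul_sum]
    refine Finset.sum_congr rfl fun s _ => ?_
    rw [θ, coefFun, ← mul_assoc, ← map_mul, ← Algebra.smul_def, smul_smul]
    congr 1; ring

/-- The coordinates of germs of forms. -/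
noncomputable def coef (U : Opens X) (k : Fin B.N) (s : Finset (Fin n)) (a : formGerms n U) :
    smoothGerms n U :=
  ⟨a.1.map' (B.coefFun k s) fun f g hfg => by
      filter_upwards [hfg] with x hx
      simp only [coefFun, hx], by
    obtain ⟨f, hf, rfl⟩ := exists_mkForm a
    exact ⟨B.coefFun k s f, rfl, by filter_upwards [hf] with x hx using B.coefFun_smooth k s hx⟩⟩

theorem coef_mk (U : Opens X) (k : Fin B.N) (s : Finset (Fin n)) (f : X → Forms n) (hf) (hc) :
    B.coef U k s (mkForm f hf) = mkFun (B.coefFun k s f) hc := rfl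

/-- The frame of the Dolbeault algebra defined by a system of bump functions. -/
noncomputable def frame : Frame (dolbeault n X) where
  κ := Fin B.N × Finset (Fin n)
  θ ks := mkForm (B.θ ks.1 ks.2) (Eventually.of_forall fun y => B.θ_smooth _ _ y)
  dg ks := ks.2.card
  coef U ks a := B.coef U ks.1 ks.2 a
  θ_mem ks := by
    refine mkForm_mem_formDeg.2 (Eventually.of_forall fun y => ?_)
    rw [θ, ← Algebra.smul_def]
    exact Submodule.smul_mem _ _ (pull_deg _ (basis_mem _))
  coef_add U ks a b := by
    obtain ⟨f, hf, rfl⟩ := exists_mkForm a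
    obtain ⟨g, hg, rfl⟩ := exists_mkForm b
    refine Subtype.ext (Germ.coe_eq.2 (Eventually.of_forall fun y => ?_))
    change B.coefFun ks.1 ks.2 (f + g) y = B.coefFun ks.1 ks.2 f y + B.coefFun ks.1 ks.2 g y
    simp only [coefFun, co, Pi.add_apply, map_add, mul_add]
  coef_smul U ks r a := by
    obtain ⟨f, hf, rfl⟩ := exists_mkForm a
    obtain ⟨g, hg, rfl⟩ := exists_mkFun r
    refine Subtype.ext (Germ.coe_eq.2 (Eventually.of_forall fun y => ?_))
    change B.coefFun ks.1 ks.2 (fun y => algebraMap ℂ (Forms n) (g y) * f y) y =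
      g y * B.coefFun ks.1 ks.2 f y
    simp only [coefFun, co, ← Algebra.smul_def, map_smul, smul_eq_mul]
    ring
  coef_gr U ks j a ha hj := by
    obtain ⟨f, hf, rfl⟩ := exists_mkForm a
    have ha : ∀ᶠ x in 𝓝ˢ (closure (U : Set X)), f x ∈ deg n j := ha
    refine Subtype.ext (Germ.coe_eq.2 ?_)
    filter_upwards [ha] with y hy
    change B.coefFun ks.1 ks.2 f y = 0
    rw [coefFun, co, Module.Basis.coord_apply, coord_deg (pull_deg _ hy) _ hj.symm, mul_zero]
  coef_res h ks a := by
    obtain ⟨f, hf, rfl⟩ := exists_mkForm a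
    rfl
  sum_coef U a := by
    obtain ⟨f, hf, rfl⟩ := exists_mkForm a
    refine Subtype.ext ((map_sum (formGerms n U).subtype _ _).trans ?_)
    refine (map_sum (Germ.coeRingHom (R := Forms n) (𝓝ˢ (closure (U : Set X))))
      (fun ks : Fin B.N × Finset (Fin n) => fun y =>
        algebraMap ℂ (Forms n) (B.coefFun ks.1 ks.2 f y) * B.θ ks.1 ks.2 y)
        Finset.univ).symm.trans ?_
    refine Germ.coe_eq.2 (Eventually.of_forall fun y => ?_)
    rw [Finset.sum_apply]
    exact B.sum_coefFun f y

end Bumps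

variable (n X) in
/-- A frame of the Dolbeault algebra of a compact manifold. -/
noncomputable def dolbeaultFrame [T2Space X] [CompactSpace X] : Frame (dolbeault n X) :=
  (Classical.choice (nonempty_bumps (n := n) (X := X))).frame

end Frame

end Cohesive

open scoped ContDiff Manifold

namespace Cohesive

section Filtration

variable {α : Type w} [PartialOrder α] [OrderTop α] {𝒜 : DGPresheaf.{u} α} {U U' V W : α}
  {M : GMod.{u, v} 𝒜 U} {M' : GMod.{u, v'} 𝒜 U'} {h : V ≤ U} {h' : V ≤ U'}

/-- The part of `Q ⊗ A(V)` of form degree at least `j`. -/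
noncomputable def Tot.fil (M : GMod.{u, v} 𝒜 U) (h : V ≤ U) (j : ℕ) : AddSubgroup (Tot M h) :=
  AddSubgroup.closure {x | ∃ (n : ℤ) (i : ℕ) (e : M.Q n) (b : 𝒜.A V),
    b ∈ 𝒜.gr V i ∧ j ≤ i ∧ x = Tot.mk h n e b}

namespace Tot

theorem mk_mem_fil {n : ℤ} {i j : ℕ} (e : M.Q n) {b : 𝒜.A V} (hb : b ∈ 𝒜.gr V i) (hj : j ≤ i) :
    mk h n e b ∈ fil M h j :=
  AddSubgroup.subset_closure ⟨n, i, e, b, hb, hj, rfl⟩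

/-- An additive map sends `fil j` into the subgroup `S` if it does so on generators. -/
theorem map_fil {P : Type*} [AddCommGroup P] (f : Tot M h →+ P) {j : ℕ} (S : AddSubgroup P)
    (hmk : ∀ (n : ℤ) (i : ℕ) (e : M.Q n) (b : 𝒜.A V), b ∈ 𝒜.gr V i → j ≤ i →
      f (mk h n e b) ∈ S) {x : Tot M h} (hx : x ∈ fil M h j) : f x ∈ S := by
  refine AddSubgroup.closure_induction (p := fun x _ => f x ∈ S) ?_ ?_ ?_ ?_ hx
  · rintro x ⟨n, i, e, b, hb, hj, rfl⟩
    exact hmk n i e b hb hj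
  · rw [map_zero]; exact S.zero_mem
  · intro x y _ _ hx hy; rw [map_add]; exact S.add_mem hx hy
  · intro x _ hx; rw [map_neg]; exact S.neg_mem hx

theorem fil_anti {j j' : ℕ} (hj : j ≤ j') : fil M h j' ≤ fil M h j := fun x hx =>
  map_fil (AddMonoidHom.id _) (fil M h j) (fun n i e b hb hi => mk_mem_fil e hb (hj.trans hi)) hx

theorem res_mem_fil (h : V ≤ U) (h₁ : W ≤ V) {j : ℕ} {x : Tot M h} (hx : x ∈ fil M h j) :
    res h h₁ x ∈ fil M (h₁.trans h) j :=
  map_fil (res h h₁) _ (fun n i e b hb hi => by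
    rw [res_mk]; exact mk_mem_fil e (𝒜.res_mem_gr h₁ _ _ hb) hi) hx

theorem _root_.Cohesive.Frame.term_mem (fr : Frame 𝒜) (s : fr.κ) (a : 𝒜.A V) :
    𝒜.inc (le_refl V) (fr.coef V s a) * 𝒜.res (le_top : V ≤ ⊤) (fr.θ s) ∈ 𝒜.gr V (fr.dg s) := by
  have := 𝒜.mul_mem_gr V 0 (fr.dg s) _ _ (inc_mem 𝒜 (le_refl V) (fr.coef V s a))
    (𝒜.res_mem_gr le_top _ _ (fr.θ_mem s))
  rwa [zero_add] at this

theorem mk_eq_sum (fr : Frame 𝒜) (n : ℤ) (e : M.Q n) (b : 𝒜.A V) :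
    mk h n e b = ∑ s, mk h n e
      (𝒜.inc (le_refl V) (fr.coef V s b) * 𝒜.res (le_top : V ≤ ⊤) (fr.θ s)) := by
  rw [← mk_sum_right, fr.sum_coef']

theorem induction_hom (fr : Frame 𝒜) {p : Tot M h → Prop} (x : Tot M h) (h0 : p 0)
    (hmk : ∀ n (j : ℕ) e b, b ∈ 𝒜.gr V j → p (mk h n e b))
    (hadd : ∀ x y, p x → p y → p (x + y)) : p x := by
  refine induction x h0 (fun n e b => ?_) hadd
  rw [mk_eq_sum fr]
  exact Finset.sum_induction _ p hadd h0 fun s _ => hmk _ _ _ _ (fr.term_mem s b)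

theorem rmul_mem_fil_add (fr : Frame 𝒜) {i j : ℕ} {b : 𝒜.A V} (hb : b ∈ 𝒜.gr V i) {x : Tot M h}
    (hx : x ∈ fil M h j) : rmul b x ∈ fil M h (j + i) :=
  map_fil (rmul b) _ (fun n k e b' hb' hk => by
    rw [rmul_mk]; exact mk_mem_fil e (𝒜.mul_mem_gr V _ _ _ _ hb' hb) (by omega)) hx

theorem mem_fil_zero (fr : Frame 𝒜) (x : Tot M h) : x ∈ fil M h 0 :=
  induction_hom fr (p := fun x => x ∈ fil M h 0) x (AddSubgroup.zero_mem _)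
    (fun n j e b hb => mk_mem_fil e hb (Nat.zero_le _)) fun x y => AddSubgroup.add_mem _

theorem rmul_mem_fil (fr : Frame 𝒜) {i : ℕ} {b : 𝒜.A V} (hb : b ∈ 𝒜.gr V i) (x : Tot M h) :
    rmul b x ∈ fil M h i := by
  have := rmul_mem_fil_add fr hb (mem_fil_zero fr x)
  rwa [zero_add] at this

theorem rmul_sum {κ : Type*} (s : Finset κ) (b : κ → 𝒜.A V) (x : Tot M h) :
    rmul (∑ k ∈ s, b k) x = ∑ k ∈ s, rmul (b k) x :=
  map_sum (AddMonoidHom.mk' (fun b => rmul b x) fun b b' => rmul_add b b' x) b s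

theorem rmul_zero (x : Tot M h) : rmul (0 : 𝒜.A V) x = 0 :=
  map_zero (AddMonoidHom.mk' (fun b => rmul b x) fun b b' => rmul_add b b' x)

theorem rmul_fil (fr : Frame 𝒜) {j : ℕ} (b : 𝒜.A V) {x : Tot M h} (hx : x ∈ fil M h j) :
    rmul b x ∈ fil M h j := by
  rw [← fr.sum_coef' b, rmul_sum]
  exact AddSubgroup.sum_mem _ fun s _ =>
    fil_anti (Nat.le_add_right _ _) (rmul_mem_fil_add fr (fr.term_mem s b) hx)

/-- A linear map shifts the filtration by `r` if it maps the generators into the `r`-th step. -/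
theorem _root_.Cohesive.IsLin.map_fil_add {f : Tot M h →+ Tot M' h'} (hf : IsLin f) (fr : Frame 𝒜)
    {r : ℕ} (hr : ∀ n e, f (mk h n e 1) ∈ fil M' h' r) {j : ℕ} {x : Tot M h} (hx : x ∈ fil M h j) :
    f x ∈ fil M' h' (j + r) :=
  map_fil f _ (fun n i e b hb hi => by
    have : mk h n e b = rmul b (mk h n e 1) := by rw [rmul_mk, one_mul]
    rw [this, hf]
    exact fil_anti (by omega) (rmul_mem_fil_add fr hb (hr n e))) hx

theorem _root_.Cohesive.IsLin.map_fil {f : Tot M h →+ Tot M' h'} (hf : IsLin f) (fr : Frame 𝒜)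
    {j : ℕ} {x : Tot M h} (hx : x ∈ fil M h j) : f x ∈ fil M' h' j :=
  hf.map_fil_add fr (fun _ _ => mem_fil_zero fr _) hx

theorem _root_.Cohesive.QCoh.connOn_fil (E : QCoh.{u, v} 𝒜 U) (fr : Frame 𝒜) (h : V ≤ U) {j : ℕ}
    {x : Tot E.toGMod h} (hx : x ∈ fil E.toGMod h j) : E.connOn h x ∈ fil E.toGMod h j :=
  Tot.map_fil (E.connOn h) _ (fun n i e b hb hi => by
    rw [E.connOn_mk]
    refine AddSubgroup.add_mem _ (fil_anti hi (rmul_mem_fil fr hb _)) (AddSubgroup.zsmul_mem _ ?_ _)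
    exact mk_mem_fil e (𝒜.d_mem_gr V _ _ hb) (by omega)) hx

theorem fil_eq_bot (fr : Frame 𝒜) {N : ℕ} (hN : ∀ s, fr.dg s < N) {x : Tot M h} (hx : x ∈ fil M h N) : x = 0 := by
  have := map_fil (AddMonoidHom.id (Tot M h)) (⊥ : AddSubgroup (Tot M h)) (fun n i e b hb hi => by
    have : b = 0 := by
      rw [← fr.sum_coef' b]
      refine Finset.sum_eq_zero fun s _ => ?_
      rw [fr.coef_gr V s i b hb (by have := hN s; omega)]
      simp [DGPresheaf.inc]
    rw [AddMonoidHom.id_apply, this, mk_zero_right]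
    exact AddSubgroup.zero_mem _) hx
  exact this

theorem _root_.Cohesive.Frame.exists_bound (fr : Frame 𝒜) : ∃ N : ℕ, ∀ s, fr.dg s < N :=
  ⟨(Finset.univ.sup fr.dg) + 1, fun s => Nat.lt_succ_of_le (Finset.le_sup (Finset.mem_univ s))⟩

theorem sym_mk (n : ℤ) (e : M.Q n) (b : 𝒜.A U) :
    sym M n (mk (le_refl U) n e b) = 𝒜.ε U b • e := by
  unfold sym
  rw [AddMonoidHom.comp_apply, lift_mk]
  exact DirectSum.of_eq_same _ _

theorem sym_mk_ne {n m : ℤ} (hnm : m ≠ n) (e : M.Q n) (b : 𝒜.A U) :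
    sym M m (mk (le_refl U) n e b) = 0 := by
  unfold sym
  rw [AddMonoidHom.comp_apply, lift_mk]
  exact DirectSum.of_eq_of_ne _ _ _ hnm

theorem sym_mk_one (n : ℤ) (e : M.Q n) : sym M n (mk (le_refl U) n e 1) = e := by
  rw [sym_mk, map_one, one_smul]

theorem sym_fil {m : ℤ} {x : Tot M (le_refl U)} (hx : x ∈ fil M (le_refl U) 1) : sym M m x = 0 := by
  have := map_fil (sym M m) ⊥ (fun n i e b hb hi => by
    change _ = 0
    by_cases hm : m = n
    · subst hm; rw [sym_mk, 𝒜.ε_gr U i b hi hb, zero_smul]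
    · exact sym_mk_ne hm e b) hx
  exact this

theorem sub_sym_mem {m : ℤ} {x : Tot M (le_refl U)} (hx : x ∈ deg M (le_refl U) m) :
    x - mk _ m (sym M m x) 1 ∈ fil M (le_refl U) 1 := by
  refine map_deg (AddMonoidHom.id _ - ((mkHom (le_refl U) m).flip 1).comp (sym M m)) _
    (fun n j e b hb hn => ?_) hx
  change mk (le_refl U) n e b - mk (le_refl U) m (sym M m (mk (le_refl U) n e b)) 1 ∈ _
  rcases Nat.eq_zero_or_pos j with rfl | hj
  · obtain rfl : n = m := by simpa using hn
    obtain ⟨r, rfl⟩ := (𝒜.mem_gr_zero U b).1 hb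
    rw [sym_mk, AlgHom.commutes, mk_smul]
    simp only [DGPresheaf.inc, 𝒜.res0_refl, mul_one]
    rw [Algebra.algebraMap_self_apply, sub_self]
    exact AddSubgroup.zero_mem _
  · have h1 : mk (le_refl U) n e b ∈ fil M (le_refl U) 1 := mk_mem_fil e hb hj
    rw [sym_fil h1, mk_zero_left, sub_zero]
    exact h1

theorem sym_deg_ne {m n : ℤ} (hmn : n ≠ m) {x : Tot M (le_refl U)}
    (hx : x ∈ deg M (le_refl U) m) : sym M n x = 0 := by
  have := sym_fil (m := n) (sub_sym_mem hx)
  rwa [map_sub, sym_mk_ne hmn, sub_zero] at this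

theorem sym_rmul (n : ℤ) (b : 𝒜.A U) (x : Tot M (le_refl U)) :
    sym M n (rmul b x) = 𝒜.ε U b • sym M n x :=
  ext_apply (f := (sym M n).comp (rmul b))
    (g := (DistribSMul.toAddMonoidHom (M.Q n) (𝒜.ε U b)).comp (sym M n)) (fun m e b' => by
      change sym M n (rmul b (mk _ m e b')) = 𝒜.ε U b • sym M n (mk _ m e b')
      rw [rmul_mk]
      by_cases hm : n = m
      · subst hm; rw [sym_mk, sym_mk, map_mul, mul_comm, mul_smul]
      · rw [sym_mk_ne hm, sym_mk_ne hm, smul_zero]) x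

theorem mk_congr {n n' : ℤ} (hn : n = n') (g : ∀ m, M.Q m) (b : 𝒜.A V) :
    mk h n (g n) b = mk h n' (g n') b := by subst hn; rfl

end Tot

end Filtration

/-- The softness properties of a presheaf of differential graded algebras that are used: sections
extend, and there is a finite partition of unity subordinate to the family `U`. -/
structure Fine {α : Type w} [SemilatticeInf α] [OrderTop α] {ι : Type w'} (𝒜 : DGPresheaf.{u} α)
    (U : ι → α) where
  surj : ∀ {V W : α} (h : V ≤ W), Function.Surjective (𝒜.res0 h)
  s : Finset ι
  σ : ι → 𝒜.A0 ⊤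
  sum_σ : ∑ k ∈ s, σ k = 1
  kill : ∀ (k : ι) (W : α) (a : 𝒜.A0 W), 𝒜.res0 (inf_le_left : W ⊓ U k ≤ W) a = 0 →
    𝒜.res0 le_top (σ k) * a = 0

namespace Fine

variable {α : Type w} [SemilatticeInf α] [OrderTop α] {ι : Type w'} {𝒜 : DGPresheaf.{u} α}
  {U : ι → α} (fi : Fine 𝒜 U) (fr : Frame 𝒜) {V W V' W' : α}

/-- The restriction of the function `σ k` to `W`. -/
noncomputable def τ (k : ι) (W : α) : 𝒜.A W := 𝒜.inc (le_top : W ≤ ⊤) (fi.σ k)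

theorem τ_mem (k : ι) (W : α) : fi.τ k W ∈ 𝒜.gr W 0 := inc_mem 𝒜 _ _

theorem τ_comm (k : ι) (a : 𝒜.A W) : fi.τ k W * a = a * fi.τ k W := inc_comm 𝒜 _ _ _

theorem res_τ (k : ι) (h : V ≤ W) : 𝒜.res h (fi.τ k W) = fi.τ k V := res_inc 𝒜 _ _ _

theorem res_surj_gr (fi : Fine 𝒜 U) (fr : Frame 𝒜) (h : V ≤ W) {j : ℕ} {b : 𝒜.A V} (hb : b ∈ 𝒜.gr V j) :
    ∃ a ∈ 𝒜.gr W j, 𝒜.res h a = b := by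
  choose g hg using fi.surj h
  refine ⟨∑ s, if fr.dg s = j then 𝒜.inc (le_refl W) (g (fr.coef V s b)) *
    𝒜.res (le_top : W ≤ ⊤) (fr.θ s) else 0, Submodule.sum_mem _ fun s _ => ?_, ?_⟩
  · split_ifs with hs
    · have := 𝒜.mul_mem_gr W 0 (fr.dg s) _ _ (inc_mem 𝒜 (le_refl W) (g (fr.coef V s b)))
        (𝒜.res_mem_gr le_top _ _ (fr.θ_mem s))
      rwa [zero_add, hs] at this
    · exact Submodule.zero_mem _
  · rw [map_sum]
    conv_rhs => rw [← fr.sum_coef' b]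
    refine Finset.sum_congr rfl fun s _ => ?_
    split_ifs with hs
    · rw [map_mul, 𝒜.res_res, res_inc, ← inc_res0 𝒜 h (le_refl V), hg]
    · rw [fr.coef_gr V s j b hb (fun h => hs h.symm), map_zero]
      simp [DGPresheaf.inc]

theorem res_surj (fi : Fine 𝒜 U) (fr : Frame 𝒜) (h : V ≤ W) : Function.Surjective (𝒜.res h) := fun b => by
  choose g hg using fi.surj h
  refine ⟨∑ s, 𝒜.inc (le_refl W) (g (fr.coef V s b)) * 𝒜.res (le_top : W ≤ ⊤) (fr.θ s), ?_⟩
  rw [map_sum]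
  conv_rhs => rw [← fr.sum_coef' b]
  refine Finset.sum_congr rfl fun s _ => ?_
  rw [map_mul, 𝒜.res_res, res_inc, ← inc_res0 𝒜 h (le_refl V), hg]

theorem kill_form (fr : Frame 𝒜) (k : ι) (h : V ≤ W) (hk : W ⊓ U k ≤ V) (a : 𝒜.A W)
    (ha : 𝒜.res h a = 0) :
    fi.τ k W * a = 0 := by
  rw [← fr.sum_coef' a, Finset.mul_sum]
  refine Finset.sum_eq_zero fun s _ => ?_
  have h1 : 𝒜.res0 (le_top : W ≤ ⊤) (fi.σ k) * fr.coef W s a = 0 := by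
    refine fi.kill k W _ ?_
    have h0 : fr.coef V s (0 : 𝒜.A V) = 0 := by
      have := fr.coef_add V s 0 0
      simpa using this
    rw [← 𝒜.res0_res0 h hk, ← fr.coef_res, ha, h0, map_zero]
  rw [← mul_assoc]
  have : fi.τ k W * 𝒜.inc (le_refl W) (fr.coef W s a) =
      algebraMap _ _ (𝒜.res0 (le_top : W ≤ ⊤) (fi.σ k) * fr.coef W s a) := by
    rw [map_mul]; simp [τ, DGPresheaf.inc, 𝒜.res0_refl]
  rw [this, h1, map_zero, zero_mul]

/-- Multiplication by `σ k`, followed by extension by zero from `V` to `W`, for `V ⊇ W ∩ U k`. -/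
noncomputable def extA (k : ι) (h : V ≤ W) (hk : W ⊓ U k ≤ V) : 𝒜.A V →+ 𝒜.A W :=
  AddMonoidHom.mk' (fun b => fi.τ k W * Function.surjInv (fi.res_surj fr h) b) fun b b' => by
    rw [← sub_eq_zero, ← mul_add, ← mul_sub]
    refine fi.kill_form fr k h hk _ ?_
    have := Function.surjInv_eq (fi.res_surj fr h)
    rw [map_sub, map_add, this, this, this, sub_self]

theorem extA_res (k : ι) (h : V ≤ W) (hk : W ⊓ U k ≤ V) (a : 𝒜.A W) :
    fi.extA fr k h hk (𝒜.res h a) = fi.τ k W * a := by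
  change fi.τ k W * _ = _
  rw [← sub_eq_zero, ← mul_sub]
  refine fi.kill_form fr k h hk _ ?_
  rw [map_sub, Function.surjInv_eq (fi.res_surj fr h), sub_self]

theorem extA_res_mul (k : ι) (h : V ≤ W) (hk : W ⊓ U k ≤ V) (b : 𝒜.A V) (a : 𝒜.A W) :
    fi.extA fr k h hk (𝒜.res h a * b) = a * fi.extA fr k h hk b := by
  obtain ⟨b, rfl⟩ := fi.res_surj fr h b
  rw [← map_mul, extA_res, extA_res, ← mul_assoc, ← mul_assoc, τ_comm]

theorem extA_inc_mul {W₀ : α} (k : ι) (h : V ≤ W) (hk : W ⊓ U k ≤ V) (h₀ : W ≤ W₀)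
    (r : 𝒜.A0 W₀) (b : 𝒜.A V) : fi.extA fr k h hk (𝒜.inc (h.trans h₀) r * b) =
      𝒜.inc h₀ r * fi.extA fr k h hk b := by
  rw [← extA_res_mul, res_inc]

theorem extA_mem_gr (k : ι) (h : V ≤ W) (hk : W ⊓ U k ≤ V) {j : ℕ} {b : 𝒜.A V}
    (hb : b ∈ 𝒜.gr V j) : fi.extA fr k h hk b ∈ 𝒜.gr W j := by
  obtain ⟨a, ha, rfl⟩ := fi.res_surj_gr fr h hb
  rw [extA_res]
  have := 𝒜.mul_mem_gr W 0 j _ _ (fi.τ_mem k W) ha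
  rwa [zero_add] at this

section Tot

variable {U₀ : α} {M : GMod.{u, v} 𝒜 U₀}

theorem tot_res_surj (fi : Fine 𝒜 U) (fr : Frame 𝒜) (h₀ : W ≤ U₀) (h : V ≤ W) :
    Function.Surjective (Tot.res (M := M) h₀ h) := fun x =>
  Tot.induction (p := fun x => ∃ y, Tot.res (M := M) h₀ h y = x) x ⟨0, map_zero _⟩ (fun n e b => by
    obtain ⟨a, rfl⟩ := fi.res_surj fr h b
    exact ⟨Tot.mk h₀ n e a, Tot.res_mk ..⟩) (by
    rintro _ _ ⟨x, rfl⟩ ⟨y, rfl⟩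
    exact ⟨x + y, map_add _ _ _⟩)

theorem tot_res_surj_deg (fi : Fine 𝒜 U) (fr : Frame 𝒜) (h₀ : W ≤ U₀) (h : V ≤ W) {m : ℤ}
    {x : Tot M (h.trans h₀)} (hx : x ∈ Tot.deg M (h.trans h₀) m) :
    ∃ y ∈ Tot.deg M h₀ m, Tot.res (M := M) h₀ h y = x :=
  Tot.deg_induction (p := fun x => ∃ y ∈ Tot.deg M h₀ m, Tot.res (M := M) h₀ h y = x) hx
    ⟨0, AddSubgroup.zero_mem _, map_zero _⟩ (by
    rintro _ _ ⟨x, hx, rfl⟩ ⟨y, hy, rfl⟩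
    exact ⟨x + y, AddSubgroup.add_mem _ hx hy, map_add _ _ _⟩) (by
    rintro _ ⟨x, hx, rfl⟩
    exact ⟨-x, AddSubgroup.neg_mem _ hx, map_neg _ _⟩) (fun n j e b hb hn => by
    obtain ⟨a, ha, rfl⟩ := fi.res_surj_gr fr h hb
    exact ⟨Tot.mk h₀ n e a, Tot.mk_mem_deg e ha hn, Tot.res_mk ..⟩)

/-- Multiplication by `σ k`, followed by extension by zero, on total modules. -/
noncomputable def ext (k : ι) (h₀ : W ≤ U₀) (h : V ≤ W) (hk : W ⊓ U k ≤ V) :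
    Tot M (h.trans h₀) →+ Tot M h₀ :=
  Tot.lift (fun n e b => Tot.mk h₀ n e (fi.extA fr k h hk b))
    (fun n e e' b => Tot.mk_add_left ..)
    (fun n e b b' => by rw [map_add, Tot.mk_add_right])
    (fun n r e b => by rw [Tot.mk_smul, extA_inc_mul])

theorem ext_mk (k : ι) (h₀ : W ≤ U₀) (h : V ≤ W) (hk : W ⊓ U k ≤ V) (n : ℤ) (e : M.Q n)
    (b : 𝒜.A V) : fi.ext fr k h₀ h hk (Tot.mk (h.trans h₀) n e b) =
      Tot.mk h₀ n e (fi.extA fr k h hk b) := Tot.lift_mk ..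

theorem ext_res (k : ι) (h₀ : W ≤ U₀) (h : V ≤ W) (hk : W ⊓ U k ≤ V) (x : Tot M h₀) :
    fi.ext fr k h₀ h hk (Tot.res h₀ h x) = Tot.rmul (fi.τ k W) x :=
  Tot.ext_apply (f := (fi.ext fr k h₀ h hk).comp (Tot.res h₀ h)) (g := Tot.rmul (fi.τ k W))
    (fun n e b => by
      rw [AddMonoidHom.comp_apply, Tot.res_mk, ext_mk, extA_res, Tot.rmul_mk, τ_comm]) x

theorem ext_mem_deg (k : ι) (h₀ : W ≤ U₀) (h : V ≤ W) (hk : W ⊓ U k ≤ V) {m : ℤ}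
    {x : Tot M (h.trans h₀)} (hx : x ∈ Tot.deg M (h.trans h₀) m) :
    fi.ext fr k h₀ h hk x ∈ Tot.deg M h₀ m :=
  Tot.map_deg _ _ (fun n j e b hb hn => by
    rw [ext_mk]; exact Tot.mk_mem_deg e (fi.extA_mem_gr fr k h hk hb) hn) hx

theorem ext_rmul (k : ι) (h₀ : W ≤ U₀) (h : V ≤ W) (hk : W ⊓ U k ≤ V) (a : 𝒜.A W)
    (x : Tot M (h.trans h₀)) : fi.ext fr k h₀ h hk (Tot.rmul (𝒜.res h a) x) =
      Tot.rmul a (fi.ext fr k h₀ h hk x) := by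
  obtain ⟨x, rfl⟩ := fi.tot_res_surj fr h₀ h x
  rw [← Tot.res_rmul, ext_res, ext_res, Tot.rmul_rmul, Tot.rmul_rmul, τ_comm]

theorem res_ext (k : ι) (h₀ : W ≤ U₀) (h : V ≤ W) (hk : W ⊓ U k ≤ V) (h' : V' ≤ W')
    (hk' : W' ⊓ U k ≤ V') (hV : V' ≤ V) (hW : W' ≤ W) (x : Tot M (h.trans h₀)) :
    Tot.res h₀ hW (fi.ext fr k h₀ h hk x) =
      fi.ext fr k (hW.trans h₀) h' hk' (Tot.res (h.trans h₀) hV x) := by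
  obtain ⟨x, rfl⟩ := fi.tot_res_surj fr h₀ h x
  rw [ext_res, Tot.res_rmul, res_τ, Tot.res_res, ← Tot.res_res h₀ hW h', ext_res]

/-- A family of linear maps that is compatible with restriction commutes with `ext`. -/
theorem map_ext {U₁ : α} {M' : GMod.{u, v'} 𝒜 U₁} (k : ι) (h₀ : W ≤ U₀) (h₁ : W ≤ U₁) (h : V ≤ W)
    (hk : W ⊓ U k ≤ V) (f : Tot M h₀ →+ Tot M' h₁) (hf : IsLin f)
    (g : Tot M (h.trans h₀) →+ Tot M' (h.trans h₁))
    (hfg : ∀ x, g (Tot.res h₀ h x) = Tot.res h₁ h (f x)) (x : Tot M (h.trans h₀)) :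
    f (fi.ext fr k h₀ h hk x) = fi.ext fr k h₁ h hk (g x) := by
  obtain ⟨x, rfl⟩ := fi.tot_res_surj fr h₀ h x
  rw [ext_res, hf, hfg, ext_res]

/-- Connections commute with `ext` up to terms of positive form degree. -/
theorem connOn_ext (E : QCoh.{u, v} 𝒜 U₀) (k : ι) (h₀ : W ≤ U₀) (h : V ≤ W)
    (hk : W ⊓ U k ≤ V) (x : Tot E.toGMod (h.trans h₀)) :
    E.connOn h₀ (fi.ext fr k h₀ h hk x) - fi.ext fr k h₀ h hk (E.connOn _ x) ∈
      Tot.fil E.toGMod h₀ 1 := by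
  obtain ⟨x, rfl⟩ := fi.tot_res_surj fr h₀ h x
  rw [ext_res, E.connOn_res, ext_res]
  refine Tot.induction_hom fr (p := fun x => E.connOn h₀ (Tot.rmul (fi.τ k W) x) -
    Tot.rmul (fi.τ k W) (E.connOn h₀ x) ∈ Tot.fil E.toGMod h₀ 1) x ?_ (fun n j e b hb => ?_) ?_
  · simp only [map_zero, sub_zero]; exact AddSubgroup.zero_mem _
  · rw [E.connOn_rmul h₀ (n + j) _ (Tot.mk_mem_deg e hb rfl), add_sub_cancel_left]
    exact AddSubgroup.zsmul_mem _ (Tot.rmul_mem_fil fr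
      (𝒜.d_mem_gr W 0 _ (fi.τ_mem k W)) _) _
  · intro x y hx hy
    have := AddSubgroup.add_mem _ hx hy
    simp only [map_add]
    convert this using 1
    abel

end Tot

end Fine

section Lift

variable {α : Type w} [SemilatticeInf α] [OrderTop α] {ι : Type w'} {𝒜 : DGPresheaf.{u} α}
  {U : ι → α} (fr : Frame 𝒜) (F : Tw.{u, v} 𝒜 U) {U₀ V : α} {M : GMod.{u, v'} 𝒜 U₀} {h : V ≤ U₀}

theorem mem_range_shAllHom (fr : Frame 𝒜) (O : Tot M h →+ ShTot F) (d : ℤ)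
    (hO : ∀ m x, x ∈ Tot.deg M h m → (O x).HasDeg (m + d)) (x : Tot M h) :
    ∃ y, shAll F y = O x :=
  Tot.induction_hom fr (p := fun x => ∃ y, shAll F y = O x) x
    ⟨0, by rw [map_zero]; exact map_zero (shAllHom F)⟩
    (fun n j e b hb => ⟨_, shAll_lift fr F _ _ (hO (n + j) _ (Tot.mk_mem_deg e hb rfl))⟩) (by
    rintro x y ⟨x', hx⟩ ⟨y', hy⟩
    exact ⟨x' + y', by rw [shAll_add, hx, hy, map_add]⟩)

/-- A map to the total module of the sheafification, given by its components. -/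
noncomputable def shMap (O : Tot M h →+ ShTot F) (d : ℤ)
    (hO : ∀ m x, x ∈ Tot.deg M h m → (O x).HasDeg (m + d)) :
    Tot M h →+ Tot (shGMod F) (le_refl (⊤ : α)) :=
  AddMonoidHom.mk' (fun x => (mem_range_shAllHom F fr O d hO x).choose) fun x y =>
    shAll_injective F fr (by
      rw [shAll_add, (mem_range_shAllHom F fr O d hO x).choose_spec,
        (mem_range_shAllHom F fr O d hO y).choose_spec,
        (mem_range_shAllHom F fr O d hO (x + y)).choose_spec, map_add])

theorem shAll_shMap (O : Tot M h →+ ShTot F) (d : ℤ)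
    (hO : ∀ m x, x ∈ Tot.deg M h m → (O x).HasDeg (m + d)) (x : Tot M h) :
    shAll F (shMap fr F O d hO x) = O x := (mem_range_shAllHom F fr O d hO x).choose_spec

theorem shMap_mem_deg (O : Tot M h →+ ShTot F) (d : ℤ)
    (hO : ∀ m x, x ∈ Tot.deg M h m → (O x).HasDeg (m + d)) {m : ℤ} {x : Tot M h}
    (hx : x ∈ Tot.deg M h m) : shMap fr F O d hO x ∈ Tot.deg (shGMod F) (le_refl ⊤) (m + d) := by
  have : shMap fr F O d hO x = shLift fr F (m + d) (O x) := shAll_injective F fr (by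
    rw [shAll_shMap, shAll_lift fr F _ _ (hO m x hx)])
  rw [this]
  exact shLift_deg fr F _ _

theorem coef_fil (s : fr.κ) (hs : fr.dg s = 0) (q : ℤ) {x : Tot M h} (hx : x ∈ Tot.fil M h 1) :
    Tot.coef fr M h s q x = 0 := by
  have := Tot.map_fil (Tot.coef fr M h s q) ⊥ (fun n i e b hb hi => by
    change _ = 0
    by_cases hq : q = n
    · subst hq
      rw [Tot.coef_mk, fr.coef_gr V s i b hb (by omega)]
      exact TensorProduct.zero_tmul (R := 𝒜.A0 U₀) (Sec0 𝒜 h) _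
    · exact Tot.coef_mk_ne fr h s n q hq e b) hx
  exact this

/-- A homogeneous element of the sheafification is of positive form degree if its components are. -/
theorem mem_fil_of_shAll (fr : Frame 𝒜) (F : Tw.{u, v} 𝒜 U) {m : ℤ} {x : Tot (shGMod F) (le_refl (⊤ : α))}
    (hx : x ∈ Tot.deg (shGMod F) (le_refl ⊤) m)
    (h1 : ∀ i l, shAll F x i l ∈ Tot.fil (F.gmod i) (cap_le_head U i l) 1) :
    x ∈ Tot.fil (shGMod F) (le_refl ⊤) 1 := by
  have : x = shLift fr F m (shAll F x) := shAll_injective F fr (by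
    rw [shAll_lift fr F _ _ (shAll_deg F m x hx)])
  rw [this]
  refine AddSubgroup.sum_mem _ fun s _ => ?_
  rcases Nat.eq_zero_or_pos (fr.dg s) with hs | hs
  · have h0 : shCoef fr F s (m - fr.dg s) (shAll F x) = 0 := by
      funext i l; exact coef_fil fr s hs _ (h1 i l)
    rw [h0, Tot.mk_zero_left]
    exact AddSubgroup.zero_mem _
  · exact Tot.mk_mem_fil (M := shGMod F) _ (fr.θ_mem s) hs

end Lift

section AbstractHomotopy

variable {J : Type*} {T : J → Type*} [∀ j, AddCommGroup (T j)]

theorem absOp_homotopy (C : ∀ j, T j →+ T j) (A : ∀ i, List J → ∀ x, T x →+ T i)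
    (Y : ∀ j, List J → T j) (k i : J) (l : List J) :
    absOp C A (fun i l => sgn (l.length + 1) • Y i (l ++ [k])) i l +
      sgn (l.length + 1) • absOp C A Y i (l ++ [k]) =
    Y i l - sgn l.length • A i l k (Y k []) := by
  have e1 : sgn ((l.length : ℤ) + 1) * sgn (l.length + 1) = 1 := sgn_mul_self _
  have e3 : sgn ((l.length : ℤ) + 1) = - sgn l.length := by
    rw [sgn_congr_odd ⟨0, by ring⟩]
  have h1 : ssum (fun p x q => sgn (p.length + 1) • sgn ((p ++ q).length + 1) •
      Y i (p ++ q ++ [k])) l + sgn (l.length + 1) • ssum (fun p x q => sgn (p.length + 1) •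
      Y i (p ++ (q ++ [k]))) l = 0 := by
    rw [zsmul_ssum, ← ssum_add, ← ssum_zero l]
    refine ssum_congr fun p x q hl => ?_
    subst hl
    rw [smul_smul, smul_smul, ← sgn_add, ← sgn_add, List.append_assoc, ← add_smul,
      sgn_congr_odd (a := _ + _) (b := ((p ++ x :: q).length + 1 : ℤ) + (p.length + 1))
        ⟨-1, by simp; ring⟩, neg_add_cancel, zero_smul]
  have h3 : ssum (fun p x q => sgn (-(p.length * q.length)) • A i p x (sgn (q.length + 1) •
      Y x (q ++ [k]))) l + sgn (l.length + 1) • ssum (fun p x q =>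
      sgn (-(p.length * (q ++ [k]).length)) • A i p x (Y x (q ++ [k]))) l = 0 := by
    rw [zsmul_ssum, ← ssum_add, ← ssum_zero l]
    refine ssum_congr fun p x q hl => ?_
    subst hl
    rw [map_zsmul, smul_smul, smul_smul, ← sgn_add, ← sgn_add, ← add_smul,
      sgn_congr_odd (a := _ + _) (b := ((p ++ x :: q).length + 1 : ℤ) +
        -(p.length * (q ++ [k]).length))
        ⟨-1, by simp; ring⟩, neg_add_cancel, zero_smul]
  have hx1 : absOp C A Y i (l ++ [k]) =
      ssum (fun p x q => sgn (p.length + 1) • Y i (p ++ (q ++ [k]))) l +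
      sgn (l.length + 1) • Y i l + sgn (l.length + 1) • C i (Y i (l ++ [k])) +
      (ssum (fun p x q => sgn (-(p.length * (q ++ [k]).length)) • A i p x (Y x (q ++ [k]))) l +
        A i l k (Y k [])) := by
    unfold absOp
    rw [ssum_append, ssum_append]
    simp [ssum, sgn_zero]
  rw [hx1]
  unfold absOp
  rw [map_zsmul]
  generalize ssum (fun p x q => sgn (p.length + 1) • sgn ((p ++ q).length + 1) •
      Y i (p ++ q ++ [k])) l = s1 at h1 ⊢
  generalize ssum (fun p x q => sgn (p.length + 1) • Y i (p ++ (q ++ [k]))) l = s2 at h1 ⊢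
  generalize ssum (fun p x q => sgn (-(p.length * q.length)) • A i p x (sgn (q.length + 1) •
      Y x (q ++ [k]))) l = s3 at h3 ⊢
  generalize ssum (fun p x q => sgn (-(p.length * (q ++ [k]).length)) •
    A i p x (Y x (q ++ [k]))) l = s4 at h3 ⊢
  simp only [smul_add, smul_smul, e1]
  rw [← sub_eq_zero, ← add_zero (0 : T i)]
  nth_rewrite 1 [← h1]
  nth_rewrite 1 [← h3]
  rw [e3]
  simp only [neg_smul, one_smul, mul_neg, sgn_mul_self]
  abel

end AbstractHomotopy

section CechHomotopy

variable {α : Type w} [SemilatticeInf α] [OrderTop α] {ι : Type w'} {𝒜 : DGPresheaf.{u} α}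
  {U : ι → α} (fi : Fine 𝒜 U) (fr : Frame 𝒜) (F : Tw.{u, v} 𝒜 U)

theorem cap_append_le (i : ι) (l : List ι) (k : ι) : cap U i (l ++ [k]) ≤ cap U i l :=
  cap_le_cap fun m hm => by
    simp only [List.mem_cons, List.mem_append, List.not_mem_nil, or_false] at hm ⊢; tauto

theorem cap_inf_le (i : ι) (l : List ι) (k : ι) : cap U i l ⊓ U k ≤ cap U i (l ++ [k]) :=
  le_cap.2 fun m hm => by
    simp only [List.mem_cons, List.mem_append, List.not_mem_nil, or_false] at hm
    rcases hm with hm | hm | hm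
    · exact inf_le_left.trans (cap_le_mem (by simp [hm]))
    · exact inf_le_left.trans (cap_le_mem (by simp [hm]))
    · exact inf_le_right.trans (by rw [hm])

/-- The contracting homotopy of the Čech complex given by `σ k`, on cochains. -/
noncomputable def hOp (k : ι) : ShTot F →+ ShTot F :=
  AddMonoidHom.mk' (fun y i l => sgn (l.length + 1) •
    fi.ext fr k (cap_le_head U i l) (cap_append_le i l k) (cap_inf_le i l k) (y i (l ++ [k])))
    fun y y' => by
      funext i l
      simp only [Pi.add_apply, map_add, smul_add]

/-- The map from `F k` to cochains given by the twisting cochain and `σ k`. -/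
noncomputable def muOp (k : ι) : Tot (F.gmod k) (le_refl (U k)) →+ ShTot F :=
  AddMonoidHom.mk' (fun x i l => sgn l.length •
    fi.ext fr k (cap_le_head U i l) (cap_append_le i l k) (cap_inf_le i l k)
      (F.raw.pos i l k _ le_rfl (Tot.res _ (cap_le_last U i l k) x)))
    fun y y' => by
      funext i l
      simp only [Pi.add_apply, map_add, smul_add]

theorem hOp_apply (k : ι) (y : ShTot F) (i : ι) (l : List ι) : hOp fi fr F k y i l =
    sgn (l.length + 1) • fi.ext fr k (cap_le_head U i l) (cap_append_le i l k)
      (cap_inf_le i l k) (y i (l ++ [k])) := rfl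

theorem muOp_apply (k : ι) (x : Tot (F.gmod k) (le_refl (U k))) (i : ι) (l : List ι) :
    muOp fi fr F k x i l = sgn l.length • fi.ext fr k (cap_le_head U i l) (cap_append_le i l k)
      (cap_inf_le i l k) (F.raw.pos i l k _ le_rfl (Tot.res _ (cap_le_last U i l k) x)) := rfl

theorem hOp_hasDeg (k : ι) {m : ℤ} {y : ShTot F} (hy : y.HasDeg m) :
    (hOp fi fr F k y).HasDeg (m + -1) := fun i l => by
  refine AddSubgroup.zsmul_mem _ (fi.ext_mem_deg fr k _ _ _ ?_) _
  have := hy i (l ++ [k])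
  rw [show m + -1 - (l.length : ℤ) = m - ((l ++ [k]).length : ℕ) by simp; ring]
  exact this

theorem muOp_hasDeg (k : ι) {m : ℤ} {x : Tot (F.gmod k) (le_refl (U k))}
    (hx : x ∈ Tot.deg _ _ m) : (muOp fi fr F k x).HasDeg (m + 0) := fun i l => by
  refine AddSubgroup.zsmul_mem _ (fi.ext_mem_deg fr k _ _ _ ?_) _
  have := pos_deg F i l k _ le_rfl _ _ (Tot.res_mem_deg _ (cap_le_last U i l k) hx)
  rw [show m + 0 - (l.length : ℤ) = m + -(l.length : ℤ) by ring]
  exact this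

/-- The contracting homotopy of the sheafification given by `σ k`. -/
noncomputable def hTot (k : ι) :
    Tot (shGMod F) (le_refl (⊤ : α)) →+ Tot (shGMod F) (le_refl (⊤ : α)) :=
  shMap fr F ((hOp fi fr F k).comp (shAllHom F)) (-1) fun m x hx =>
    hOp_hasDeg fi fr F k (shAll_deg F m x hx)

/-- The map from `F k` to the sheafification given by the twisting cochain and `σ k`. -/
noncomputable def muTot (k : ι) :
    Tot (F.gmod k) (le_refl (U k)) →+ Tot (shGMod F) (le_refl (⊤ : α)) :=
  shMap fr F (muOp fi fr F k) 0 fun m x hx => muOp_hasDeg fi fr F k hx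

theorem shAll_hTot (k : ι) (x) : shAll F (hTot fi fr F k x) = hOp fi fr F k (shAll F x) :=
  shAll_shMap ..

theorem shAll_muTot (k : ι) (x) : shAll F (muTot fi fr F k x) = muOp fi fr F k x :=
  shAll_shMap ..

theorem hTot_isLin (k : ι) : IsLin (hTot fi fr F k) := fun b x => shAll_injective F fr (by
  rw [shAll_hTot, shAll_rmul, shAll_rmul, shAll_hTot]
  funext i l
  change hOp fi fr F k (ShTot.rmul b (shAll F x)) i l =
    Tot.rmul (𝒜.res le_top b) (hOp fi fr F k (shAll F x) i l)
  rw [hOp_apply, hOp_apply]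
  unfold ShTot.rmul
  rw [← 𝒜.res_res (le_top : cap U i l ≤ ⊤) (cap_append_le i l k), fi.ext_rmul, map_zsmul])

theorem muTot_rmul (k : ι) (b : 𝒜.A ⊤) (x) : muTot fi fr F k (Tot.rmul (𝒜.res le_top b) x) =
    Tot.rmul b (muTot fi fr F k x) := shAll_injective F fr (by
  rw [shAll_muTot, shAll_rmul, shAll_muTot]
  funext i l
  change _ = Tot.rmul (𝒜.res le_top b) (muOp fi fr F k x i l)
  rw [muOp_apply, muOp_apply, Tot.res_rmul, pos_rmul, 𝒜.res_res,
    ← 𝒜.res_res (le_top : cap U i l ≤ ⊤) (cap_append_le i l k), fi.ext_rmul, map_zsmul])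

theorem hTot_isDeg (k : ι) : IsDeg (-1) (hTot fi fr F k) := fun m x hx =>
  shMap_mem_deg _ _ _ _ _ hx

theorem muTot_mem_deg (k : ι) {m : ℤ} {x} (hx : x ∈ Tot.deg (F.gmod k) (le_refl (U k)) m) :
    muTot fi fr F k x ∈ Tot.deg (shGMod F) (le_refl ⊤) m := by
  have := shMap_mem_deg fr F (muOp fi fr F k) 0 (fun m x hx => muOp_hasDeg fi fr F k hx) hx
  rwa [add_zero] at this

theorem shOp_hOp (W : α) (y : ShTot F) (k i : {j // W ≤ U j}) (l : List {j // W ≤ U j})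
    (hk : cap U i.1 (l.map Subtype.val) ⊓ U k.1 ≤ W) :
    shOp F (hOp fi fr F k.1 y) i.1 (l.map Subtype.val) -
      fi.ext fr k.1 (cap_le_head U i.1 _) (le_cap_map i l) hk
        (absOp (fun j => (F.obj j.1).connOn j.2) (wPos F W)
          (fun i l => sgn (l.length + 1) • wRes F W y i (l ++ [k])) i l) ∈
      Tot.fil (F.gmod i.1) (cap_le_head U i.1 _) 1 := by
  unfold shOp absOp
  rw [map_add, map_add, map_ssum, map_ssum, add_sub_add_comm, add_sub_add_comm]
  have hd : ∀ (p : List {j // W ≤ U j}) (l' : List ι) (hl : l' = p.map Subtype.val)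
      (h : cap U i.1 (l.map Subtype.val) ≤ cap U i.1 l'),
      Tot.res (cap_le_head U i.1 l') h (hOp fi fr F k.1 y i.1 l') =
      fi.ext fr k.1 (cap_le_head U i.1 _) (le_cap_map i l) hk
        (sgn (p.length + 1) • wRes F W y i (p ++ [k])) := by
    intro p l' hl h
    subst hl
    rw [hOp_apply, map_zsmul, map_zsmul, List.length_map]
    congr 1
    have hW : W ≤ cap U i.1 (p.map Subtype.val ++ [k.1]) := le_cap_map' i p k
    rw [fi.res_ext fr k.1 _ _ _ (le_cap_map i l) hk hW h,
      wRes_eq F W y i (p ++ [k]) (by simp) hW]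
  have hd' : ∀ (p : List {j // W ≤ U j}) (x : {j // W ≤ U j}) (q : List {j // W ≤ U j})
      (p' : List ι) (x' : ι) (q' : List ι) (hp : p' = p.map Subtype.val) (hx : x' = x.1)
      (hq : q' = q.map Subtype.val)
      (h : cap U i.1 (l.map Subtype.val) ≤ cap U i.1 (p' ++ [x']))
      (h' : cap U i.1 (l.map Subtype.val) ≤ cap U x' q'),
      F.raw.pos i.1 p' x' _ h (Tot.res (cap_le_head U x' q') h' (hOp fi fr F k.1 y x' q')) =
      fi.ext fr k.1 (cap_le_head U i.1 _) (le_cap_map i l) hk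
        (wPos F W i p x (sgn (q.length + 1) • wRes F W y x (q ++ [k]))) := by
    intro p x q p' x' q' hp hx hq h h'
    subst hp hx hq
    rw [hOp_apply]
    simp only [map_zsmul, List.length_map]
    congr 1
    have hW : W ≤ cap U x.1 (q.map Subtype.val ++ [k.1]) := le_cap_map' x q k
    rw [fi.res_ext fr k.1 _ _ _ (le_cap_map i l) hk hW h',
      wRes_eq F W y x (q ++ [k]) (by simp) hW]
    exact fi.map_ext fr k.1 _ _ (le_cap_map i l) hk _ (fun b z => pos_rmul F _ _ _ _ _ b z) _
      (fun z => pos_res F _ _ _ _ _ _ _ z) _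
  refine AddSubgroup.add_mem _ (AddSubgroup.add_mem _ ?_ ?_) ?_
  · rw [sub_eq_zero_of_eq]
    · exact AddSubgroup.zero_mem _
    refine sum_fin_eq_ssum Subtype.val l _ rfl _ _ ?_
    rintro p x q rfl ⟨m, hm⟩ rfl
    rw [map_zsmul]
    exact congrArg _ (hd (p ++ q) _ (map_erase ..) _)
  · rw [map_zsmul, List.length_map, ← smul_sub]
    refine AddSubgroup.zsmul_mem _ ?_ _
    have h1 := hd l _ rfl le_rfl
    rw [Tot.res_refl] at h1
    rw [h1]
    exact fi.connOn_ext fr _ _ _ _ _ _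
  · rw [sub_eq_zero_of_eq]
    · exact AddSubgroup.zero_mem _
    refine sum_fin_eq_ssum Subtype.val l _ rfl _ _ ?_
    rintro p x q rfl ⟨m, hm⟩ rfl
    rw [map_zsmul]
    refine congrArg₂ (· • ·) ?_ (hd' p x q _ _ _ ?_ ?_ ?_ _ _)
    · congr 1; simp
    · simp
    · simp
    · exact map_drop ..

theorem shOp_homotopy_map (W : α) (y : ShTot F) (k i : {j // W ≤ U j}) (l : List {j // W ≤ U j})
    (hk : cap U i.1 (l.map Subtype.val) ⊓ U k.1 ≤ W) :
    shOp F (hOp fi fr F k.1 y) i.1 (l.map Subtype.val) +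
      hOp fi fr F k.1 (shOp F y) i.1 (l.map Subtype.val) -
      (Tot.rmul (fi.τ k.1 _) (y i.1 (l.map Subtype.val)) -
        muOp fi fr F k.1 (y k.1 []) i.1 (l.map Subtype.val)) ∈
      Tot.fil (F.gmod i.1) (cap_le_head U i.1 (l.map Subtype.val)) 1 := by
  have h1 := shOp_hOp fi fr F W y k i l hk
  have h2 := absOp_homotopy (fun j => (F.obj j.1).connOn j.2) (wPos F W) (wRes F W y) k i l
  have hW : W ≤ cap U i.1 (l.map Subtype.val ++ [k.1]) := le_cap_map' i l k
  have hext : ∀ z : Tot (F.gmod i.1) (cap_le_head U i.1 (l.map Subtype.val ++ [k.1])),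
      fi.ext fr k.1 (cap_le_head U i.1 (l.map Subtype.val)) (cap_append_le i.1 _ k.1)
        (cap_inf_le i.1 _ k.1) z =
      fi.ext fr k.1 (cap_le_head U i.1 _) (le_cap_map i l) hk (Tot.res _ hW z) := fun z => by
    have := fi.res_ext fr k.1 (cap_le_head U i.1 (l.map Subtype.val)) (cap_append_le i.1 _ k.1)
        (cap_inf_le i.1 _ k.1) (le_cap_map i l) hk hW le_rfl z
    rwa [Tot.res_refl] at this
  have h3 : hOp fi fr F k.1 (shOp F y) i.1 (l.map Subtype.val) =
      fi.ext fr k.1 (cap_le_head U i.1 _) (le_cap_map i l) hk (sgn (l.length + 1) •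
        absOp (fun j => (F.obj j.1).connOn j.2) (wPos F W) (wRes F W y) i (l ++ [k])) := by
    rw [hOp_apply, hext, map_zsmul, List.length_map, ← wRes_shOp,
      wRes_eq F W (shOp F y) i (l ++ [k]) (by simp) hW]
  have h4' : ∀ z : Tot (F.gmod k.1) (le_refl (U k.1)),
      muOp fi fr F k.1 z i.1 (l.map Subtype.val) =
      fi.ext fr k.1 (cap_le_head U i.1 _) (le_cap_map i l) hk (sgn l.length •
        wPos F W i l k (Tot.res (le_refl _) k.2 z)) := fun z => by
    rw [muOp_apply, hext, map_zsmul, List.length_map, ← pos_res, Tot.res_res]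
    rfl
  have h4 : muOp fi fr F k.1 (y k.1 []) i.1 (l.map Subtype.val) =
      fi.ext fr k.1 (cap_le_head U i.1 _) (le_cap_map i l) hk (sgn l.length •
        wPos F W i l k (wRes F W y k [])) := h4' _
  have h5 : Tot.rmul (fi.τ k.1 _) (y i.1 (l.map Subtype.val)) =
      fi.ext fr k.1 (cap_le_head U i.1 _) (le_cap_map i l) hk (wRes F W y i l) := by
    rw [← fi.ext_res fr k.1 (cap_le_head U i.1 _) (le_cap_map i l) hk]
    rfl
  rw [h3, h4, h5, ← map_sub, ← h2, map_add]
  convert h1 using 1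
  abel

theorem shOp_homotopy (y : ShTot F) (k i : ι) (l : List ι) :
    shOp F (hOp fi fr F k y) i l + hOp fi fr F k (shOp F y) i l -
      (Tot.rmul (fi.τ k _) (y i l) - muOp fi fr F k (y k []) i l) ∈
      Tot.fil (F.gmod i) (cap_le_head U i l) 1 := by
  let W := cap U i (l ++ [k])
  let l' : List {j // W ≤ U j} := l.pmap Subtype.mk fun j hj =>
    cap_le_mem (List.mem_cons_of_mem _ (List.mem_append_left _ hj))
  have hl : l'.map Subtype.val = l := by simp [l', List.map_pmap]
  have h1 := shOp_homotopy_map fi fr F W y ⟨k, cap_le_last U i l k⟩ ⟨i, cap_le_head U i _⟩ l'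
    (by rw [hl]; exact cap_inf_le i l k)
  rw [hl] at h1
  exact h1

/-- The evaluation of the sheafification at the index `k`. -/
noncomputable def alTot (k : ι) :
    Tot (shGMod F) (le_refl (⊤ : α)) →+ Tot (F.gmod k) (le_refl (U k)) :=
  AddMonoidHom.mk' (fun x => shAll F x k []) fun x y => by rw [shAll_add]; rfl

theorem homotopy_mem (k : ι) (x : Tot (shGMod F) (le_refl (⊤ : α))) :
    shConn fr F (hTot fi fr F k x) + hTot fi fr F k (shConn fr F x) -
      (Tot.rmul (fi.τ k ⊤) x - muTot fi fr F k (alTot F k x)) ∈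
      Tot.fil (shGMod F) (le_refl ⊤) 1 := by
  have hdeg : ∀ m, ∀ x ∈ Tot.deg (shGMod F) (le_refl (⊤ : α)) m,
      shConn fr F (hTot fi fr F k x) + hTot fi fr F k (shConn fr F x) -
      (Tot.rmul (fi.τ k ⊤) x - muTot fi fr F k (alTot F k x)) ∈
      Tot.fil (shGMod F) (le_refl ⊤) 1 := by
    intro m x hx
    refine mem_fil_of_shAll fr F (m := m) ?_ fun i l => ?_
    · refine AddSubgroup.sub_mem _ (AddSubgroup.add_mem _ ?_ ?_) (AddSubgroup.sub_mem _ ?_ ?_)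
      · have := (sheafify fr F).conn_deg _ _ (hTot_isDeg fi fr F k m x hx)
        rwa [neg_add_cancel_right] at this
      · have := hTot_isDeg fi fr F k _ _ ((sheafify fr F).conn_deg m x hx)
        rwa [add_neg_cancel_right] at this
      · exact Tot.rmul_mem_deg (fi.τ_mem k ⊤) (by simp) hx
      · refine muTot_mem_deg fi fr F k ?_
        have := shAll_deg F m x hx k []
        simp only [List.length_nil, Nat.cast_zero, sub_zero] at this
        exact this
    · have h1 := shOp_homotopy fi fr F (shAll F x) k i l
      have h2 : shAll F (shConn fr F (hTot fi fr F k x) + hTot fi fr F k (shConn fr F x) -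
          (Tot.rmul (fi.τ k ⊤) x - muTot fi fr F k (alTot F k x))) =
          shOp F (hOp fi fr F k (shAll F x)) + hOp fi fr F k (shOp F (shAll F x)) -
          (ShTot.rmul (fi.τ k ⊤) (shAll F x) - muOp fi fr F k (shAll F x k [])) := by
        have hs : ∀ a b, shAll F (a - b) = shAll F a - shAll F b := fun a b =>
          map_sub (shAllHom F) a b
        rw [hs, hs, shAll_add, shAll_conn, shAll_hTot, shAll_hTot, shAll_conn, shAll_rmul,
          shAll_muTot]
        rfl
      rw [h2]
      have h3 : ShTot.rmul (fi.τ k ⊤) (shAll F x) i l = Tot.rmul (fi.τ k _) (shAll F x i l) := by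
        unfold ShTot.rmul; rw [fi.res_τ]
      rw [← h3] at h1
      exact h1
  refine Tot.induction_hom fr (p := fun x => shConn fr F (hTot fi fr F k x) +
    hTot fi fr F k (shConn fr F x) - (Tot.rmul (fi.τ k ⊤) x - muTot fi fr F k (alTot F k x)) ∈
      Tot.fil (shGMod F) (le_refl ⊤) 1) x ?_ (fun n j e b hb => ?_) ?_
  · simp only [map_zero, sub_zero, add_zero]; exact AddSubgroup.zero_mem _
  · exact hdeg (n + j) _ (Tot.mk_mem_deg e hb rfl)
  · intro x y hx hy
    have := AddSubgroup.add_mem _ hx hy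
    simp only [map_add]
    convert this using 1
    abel

end CechHomotopy

section Perfect

open CategoryTheory Limits Pretriangulated

variable {R : Type u} [CommRing R]

/-- Finitely generated projective modules. -/
def IsFGProj (M : ModuleCat.{max u w} R) : Prop := Module.Finite R M ∧ Module.Projective R M

theorem IsFGProj.of_retract {M N : ModuleCat.{max u w} R} (hN : IsFGProj N) (i : M ⟶ N) (r : N ⟶ M)
    (h : i ≫ r = 𝟙 M) : IsFGProj M := by
  obtain ⟨h1, h2⟩ := hN
  have h' : ∀ x, r.hom (i.hom x) = x := fun x => by
    have := congrArg (fun f => f.hom x) h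
    simpa using this
  exact ⟨Module.Finite.of_surjective r.hom fun x => ⟨_, h' x⟩,
    Module.Projective.of_split i.hom r.hom (LinearMap.ext h')⟩

theorem IsFGProj.of_isZero {M : ModuleCat.{max u w} R} (h : IsZero M) : IsFGProj M := by
  have := ModuleCat.subsingleton_of_isZero h
  exact ⟨inferInstance, inferInstance⟩

theorem IsFGProj.biprod {M N : ModuleCat.{max u w} R} (hM : IsFGProj M) (hN : IsFGProj N) :
    IsFGProj (M ⊞ N) := by
  have : IsFGProj (ModuleCat.of R (M × N)) := by
    obtain ⟨_, _⟩ := hM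
    obtain ⟨_, _⟩ := hN
    exact ⟨inferInstanceAs (Module.Finite R (M × N)), inferInstanceAs (Module.Projective R (M × N))⟩
  exact this.of_retract (ModuleCat.biprodIsoProd M N).hom (ModuleCat.biprodIsoProd M N).inv
    (Iso.hom_inv_id _)

/-- Complexes of finitely generated projective modules concentrated in degrees `[a, b]`. -/
def IsPerf (a b : ℤ) (Q : CochainComplex (ModuleCat.{max u w} R) ℤ) : Prop :=
  ∀ n, IsFGProj (Q.X n) ∧ (n < a ∨ b < n → IsZero (Q.X n))

/-- The top piece of a complex concentrated in degrees at most `b`. -/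
noncomputable def topHom {b : ℤ} (Q : CochainComplex (ModuleCat.{max u w} R) ℤ)
    (h : IsZero (Q.X (b + 1))) :
    (HomologicalComplex.single (ModuleCat.{max u w} R) (ComplexShape.up ℤ) b).obj (Q.X b) ⟶ Q :=
  HomologicalComplex.mkHomFromSingle (𝟙 _) (by
    rintro k rfl
    exact h.eq_of_tgt _ _)

theorem isIso_topHom_f {b : ℤ} (Q : CochainComplex (ModuleCat.{max u w} R) ℤ)
    (h : IsZero (Q.X (b + 1))) : IsIso ((topHom Q h).f b) := by
  rw [topHom, HomologicalComplex.mkHomFromSingle_f]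
  infer_instance

theorem mono_topHom_f {b : ℤ} (Q : CochainComplex (ModuleCat.{max u w} R) ℤ)
    (h : IsZero (Q.X (b + 1))) (n : ℤ) : Mono ((topHom Q h).f n) := by
  by_cases hn : n = b
  · subst hn
    have := isIso_topHom_f Q h
    infer_instance
  · exact IsZero.mono (HomologicalComplex.isZero_single_obj_X _ _ _ _ hn) _

theorem mono_topHom {b : ℤ} (Q : CochainComplex (ModuleCat.{max u w} R) ℤ)
    (h : IsZero (Q.X (b + 1))) : Mono (topHom Q h) :=
  have := mono_topHom_f Q h
  HomologicalComplex.mono_of_mono_f _ inferInstance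

/-- The short exact sequence splitting off the top piece of a complex. -/
noncomputable def topSeq {b : ℤ} (Q : CochainComplex (ModuleCat.{max u w} R) ℤ)
    (h : IsZero (Q.X (b + 1))) : ShortComplex (CochainComplex (ModuleCat.{max u w} R) ℤ) :=
  ShortComplex.mk (topHom Q h) (cokernel.π _) (cokernel.condition _)

theorem topSeq_shortExact {b : ℤ} (Q : CochainComplex (ModuleCat.{max u w} R) ℤ)
    (h : IsZero (Q.X (b + 1))) : (topSeq Q h).ShortExact where
  exact := ShortComplex.exact_cokernel _
  mono_f := mono_topHom Q h
  epi_g := by dsimp [topSeq]; infer_instance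

theorem topSeq_eval {b : ℤ} (Q : CochainComplex (ModuleCat.{max u w} R) ℤ)
    (h : IsZero (Q.X (b + 1))) (n : ℤ) :
    ((topSeq Q h).map (HomologicalComplex.eval _ _ n)).ShortExact :=
  (topSeq_shortExact Q h).map_of_exact _

theorem isPerf_topSeq {a b : ℤ} {Q : CochainComplex (ModuleCat.{max u w} R) ℤ} (hQ : IsPerf a b Q) 
    (h : IsZero (Q.X (b + 1))) : IsPerf a (b - 1) (topSeq Q h).X₃ := by
  intro n
  have hn := topSeq_eval Q h n
  by_cases hb : n = b
  · subst hb
    have hi := isIso_topHom_f Q h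
    have : IsZero ((topSeq Q h).X₃.X n) := by
      have := hn.epi_g
      have h0 : ((topSeq Q h).map (HomologicalComplex.eval _ _ n)).g = 0 := by
        have : Epi ((topSeq Q h).map (HomologicalComplex.eval _ _ n)).f := by
          change Epi ((topHom Q h).f n)
          infer_instance
        rw [← cancel_epi ((topSeq Q h).map (HomologicalComplex.eval _ _ n)).f]
        rw [ShortComplex.zero, comp_zero]
      exact @IsZero.of_epi_eq_zero _ _ _ _ _ _ this h0
    exact ⟨.of_isZero this, fun _ => this⟩
  · have hz : IsZero ((topSeq Q h).X₁.X n) := HomologicalComplex.isZero_single_obj_X _ _ _ _ hb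
    have hi : IsIso ((topSeq Q h).map (HomologicalComplex.eval _ _ n)).g := by
      have := hn.epi_g
      have : Mono ((topSeq Q h).map (HomologicalComplex.eval _ _ n)).g :=
        (ShortComplex.exact_iff_mono _ (hz.eq_of_src _ _)).1 hn.exact
      exact isIso_of_mono_of_epi _
    let e := asIso ((topSeq Q h).map (HomologicalComplex.eval _ _ n)).g
    refine ⟨(hQ n).1.of_retract e.inv e.hom e.inv_hom_id, fun hh => ?_⟩
    exact ((hQ n).2 (by omega)).of_iso e.symm

theorem IsPerf.biprod {a b : ℤ} {Q Q' : CochainComplex (ModuleCat.{max u w} R) ℤ} (h : IsPerf a b Q)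
    (h' : IsPerf a b Q') : IsPerf a b (Q ⊞ Q') := by
  intro n
  let e : (Q ⊞ Q').X n ≅ Q.X n ⊞ Q'.X n :=
    (HomologicalComplex.eval (ModuleCat.{max u w} R) (ComplexShape.up ℤ) n).mapBiprod Q Q'
  refine ⟨((h n).1.biprod (h' n).1).of_retract e.hom e.inv e.hom_inv_id, fun hn => ?_⟩
  refine IsZero.of_iso ?_ e
  exact biprod_isZero_iff _ _ |>.2 ⟨(h n).2 hn, (h' n).2 hn⟩

theorem IsPerf.cone_shift {a b : ℤ} {Q L : CochainComplex (ModuleCat.{max u w} R) ℤ}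
    (h : IsPerf a (b - 1) Q) (h' : IsPerf (a - 1) (b - 1) L) (f : Q ⟶ L) :
    IsPerf a b ((CochainComplex.mappingCone f)⟦(-1 : ℤ)⟧) := by
  intro n
  let e : ((CochainComplex.mappingCone f)⟦(-1 : ℤ)⟧).X n ≅ Q.X (n + -1 + 1) ⊞ L.X (n + -1) :=
    HomologicalComplex.homotopyCofiber.XIsoBiprod f (n + -1) (n + -1 + 1) (by simp)
  refine ⟨((h _).1.biprod (h' _).1).of_retract e.hom e.inv e.hom_inv_id, fun hn => ?_⟩
  refine IsZero.of_iso ?_ e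
  exact biprod_isZero_iff _ _ |>.2 ⟨(h _).2 (by omega), (h' _).2 (by omega)⟩

theorem IsPerf.single_shift {b : ℤ} {M : ModuleCat.{max u w} R} (h : IsFGProj M) :
    IsPerf (b - 1) (b - 1)
      (((HomologicalComplex.single (ModuleCat.{max u w} R) (ComplexShape.up ℤ) b).obj M)⟦(1 : ℤ)⟧) := by
  intro n
  change IsFGProj (((HomologicalComplex.single (ModuleCat.{max u w} R) (ComplexShape.up ℤ) b).obj M).X
    (n + 1)) ∧ (_ → IsZero (((HomologicalComplex.single (ModuleCat.{max u w} R)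
      (ComplexShape.up ℤ) b).obj M).X (n + 1)))
  by_cases hn : n + 1 = b
  · refine ⟨?_, fun _ => by omega⟩
    let e := HomologicalComplex.singleObjXIsoOfEq (ComplexShape.up ℤ) b M (n + 1) hn
    exact h.of_retract e.hom e.inv e.hom_inv_id
  · have := HomologicalComplex.isZero_single_obj_X (ComplexShape.up ℤ) b M _ hn
    exact ⟨.of_isZero this, fun _ => this⟩

theorem IsPerf.mono {a b a' b' : ℤ} {Q : CochainComplex (ModuleCat.{max u w} R) ℤ}
    (h : IsPerf a b Q) (ha : a' ≤ a) (hb : b ≤ b') : IsPerf a' b' Q := fun n =>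
  ⟨(h n).1, fun hn => (h n).2 (by omega)⟩

local notation "qK" => HomotopyCategory.quotient (ModuleCat _) (ComplexShape.up ℤ)

theorem exists_isPerf_of_retract_base (a : ℤ) (X : HomotopyCategory (ModuleCat.{max u w} R) (ComplexShape.up ℤ))
    (Q : CochainComplex (ModuleCat.{max u w} R) ℤ) (hQ : IsPerf a a Q) (i : X ⟶ (qK).obj Q)
    (r : (qK).obj Q ⟶ X) (h : i ≫ r = 𝟙 X) :
    ∃ E : CochainComplex (ModuleCat.{max u w} R) ℤ, IsPerf a a E ∧ Nonempty ((qK).obj E ≅ X) := by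
  obtain ⟨e, he⟩ := (qK).map_surjective (r ≫ i)
  have hee : (qK).map (e ≫ e) = (qK).map e := by
    rw [Functor.map_comp, he, Category.assoc, reassoc_of% h]
  have hidem : e ≫ e = e := by
    let H := HomotopyCategory.homotopyOfEq _ _ hee
    ext n : 1
    rw [H.comm n]
    have h1 : dNext n H.hom = 0 := by
      rw [dNext_eq _ (show (ComplexShape.up ℤ).Rel n (n + 1) from rfl)]
      by_cases hn : n = a
      · rw [((hQ (n + 1)).2 (by omega)).eq_of_src (H.hom (n + 1) n) 0, comp_zero]
      · exact ((hQ n).2 (by omega)).eq_of_src _ _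
    have h2 : prevD n H.hom = 0 := by
      rw [prevD_eq _ (show (ComplexShape.up ℤ).Rel (n - 1) n by simp)]
      by_cases hn : n = a
      · rw [((hQ (n - 1)).2 (by omega)).eq_of_tgt (H.hom n (n - 1)) 0, zero_comp]
      · exact ((hQ n).2 (by omega)).eq_of_src _ _
    rw [h1, h2]; simp
  obtain ⟨E, j, q, hjq, hqj⟩ := IsIdempotentComplete.idempotents_split Q e hidem
  have hn : ∀ n, j.f n ≫ q.f n = 𝟙 _ := fun n => by
    rw [← HomologicalComplex.comp_f, hjq, HomologicalComplex.id_f]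
  refine ⟨E, fun n => ⟨(hQ n).1.of_retract (j.f n) (q.f n) (hn n), fun hh => ?_⟩, ⟨?_⟩⟩
  · rw [IsZero.iff_id_eq_zero, ← hn n, ((hQ n).2 hh).eq_of_tgt (j.f n) 0, zero_comp]
  · refine ⟨(qK).map j ≫ r, i ≫ (qK).map q, ?_, ?_⟩
    · rw [Category.assoc, ← Category.assoc r, ← he, ← hqj]
      simp only [← Functor.map_comp, Category.assoc]
      rw [hjq, Category.comp_id, hjq, CategoryTheory.Functor.map_id]
    · rw [Category.assoc, ← Category.assoc ((qK).map q), ← Functor.map_comp, hqj, he,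
        Category.assoc, h, Category.comp_id, h]

theorem exists_isPerf_of_retract_step (a b : ℤ) (hab : a < b)
    (ih : ∀ (X : HomotopyCategory (ModuleCat.{max u w} R) (ComplexShape.up ℤ))
      (Q : CochainComplex (ModuleCat.{max u w} R) ℤ), IsPerf a (b - 1) Q → ∀ (i : X ⟶ (qK).obj Q)
      (r : (qK).obj Q ⟶ X), i ≫ r = 𝟙 X →
      ∃ E : CochainComplex (ModuleCat.{max u w} R) ℤ, IsPerf a (b - 1) E ∧
        Nonempty ((qK).obj E ≅ X))
    (X : HomotopyCategory (ModuleCat.{max u w} R) (ComplexShape.up ℤ))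
    (S : ShortComplex (CochainComplex (ModuleCat.{max u w} R) ℤ))
    (σ : ∀ n, (S.map (HomologicalComplex.eval _ _ n)).Splitting)
    (hQ3 : IsPerf a (b - 1) S.X₃) (hL1 : IsPerf (b - 1) (b - 1) (S.X₁⟦(1 : ℤ)⟧))
    (h0 : ∀ g : S.X₁ ⟶ S.X₃, g = 0) (i : X ⟶ (qK).obj S.X₂)
    (r : (qK).obj S.X₂ ⟶ X) (h : i ≫ r = 𝟙 X) :
    ∃ E : CochainComplex (ModuleCat.{max u w} R) ℤ, IsPerf a b E ∧ Nonempty ((qK).obj E ≅ X) := by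
  have hT : CochainComplex.trianglehOfDegreewiseSplit S σ ∈ distTriang _ :=
    (HomotopyCategory.distinguished_iff_iso_trianglehOfDegreewiseSplit _).2 ⟨S, σ, ⟨Iso.refl _⟩⟩
  set f : (qK).obj S.X₁ ⟶ (qK).obj S.X₂ := (qK).map S.f with hf
  set π : (qK).obj S.X₂ ⟶ (qK).obj S.X₃ := (qK).map S.g with hπ
  have hfπ : f ≫ π = 0 := by rw [hf, hπ, ← CategoryTheory.Functor.map_comp, S.zero, Functor.map_zero]
  obtain ⟨X', v, t, hD⟩ := distinguished_cocone_triangle (f ≫ r)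
  have huv : (f ≫ r) ≫ v = 0 := comp_distTriang_mor_zero₁₂ _ hD
  obtain ⟨w, hw⟩ : ∃ w : (qK).obj S.X₃ ⟶ X', r ≫ v = π ≫ w :=
    Triangle.yoneda_exact₂ _ hT (r ≫ v) ((Category.assoc f r v).symm.trans huv)
  have hL : (f ≫ r) ≫ i ≫ π = 0 := by
    obtain ⟨g, hg⟩ := (qK).map_surjective ((f ≫ r) ≫ i ≫ π)
    rw [← hg, h0 g, Functor.map_zero]
  obtain ⟨y, hy⟩ : ∃ y : X' ⟶ (qK).obj S.X₃, i ≫ π = v ≫ y := Triangle.yoneda_exact₂ _ hD _ hL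
  obtain ⟨z, hz'⟩ : ∃ z, 𝟙 X' - y ≫ w = t ≫ z := Triangle.yoneda_exact₃ _ hD (𝟙 X' - y ≫ w) (by
    change v ≫ (𝟙 X' - y ≫ w) = 0
    rw [Preadditive.comp_sub, Category.comp_id, ← reassoc_of% hy, ← hw, reassoc_of% h, sub_self])
  let e1 : ((qK).obj S.X₁)⟦(1 : ℤ)⟧ ≅ (qK).obj (S.X₁⟦(1 : ℤ)⟧) :=
    (((qK : _ ⥤ HomotopyCategory (ModuleCat.{max u w} R) _).commShiftIso (1 : ℤ)).app S.X₁).symm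
  obtain ⟨E', hE', ⟨ε⟩⟩ := ih X' (S.X₃ ⊞ S.X₁⟦(1 : ℤ)⟧) (hQ3.biprod (hL1.mono (by omega) le_rfl))
    (y ≫ (qK).map biprod.inl + (t ≫ e1.hom) ≫ (qK).map biprod.inr)
    ((qK).map biprod.fst ≫ w + (qK).map biprod.snd ≫ e1.inv ≫ z) (by
      have h11 : (qK).map (biprod.inl : S.X₃ ⟶ S.X₃ ⊞ S.X₁⟦(1 : ℤ)⟧) ≫ (qK).map biprod.fst = 𝟙 _ := by
        rw [← CategoryTheory.Functor.map_comp, biprod.inl_fst, CategoryTheory.Functor.map_id]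
      have h12 : (qK).map (biprod.inl : S.X₃ ⟶ S.X₃ ⊞ S.X₁⟦(1 : ℤ)⟧) ≫ (qK).map biprod.snd = 0 := by
        rw [← CategoryTheory.Functor.map_comp, biprod.inl_snd, Functor.map_zero]
      have h21 : (qK).map (biprod.inr : _ ⟶ S.X₃ ⊞ S.X₁⟦(1 : ℤ)⟧) ≫ (qK).map biprod.fst = 0 := by
        rw [← CategoryTheory.Functor.map_comp, biprod.inr_fst, Functor.map_zero]
      have h22 : (qK).map (biprod.inr : _ ⟶ S.X₃ ⊞ S.X₁⟦(1 : ℤ)⟧) ≫ (qK).map biprod.snd = 𝟙 _ := by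
        rw [← CategoryTheory.Functor.map_comp, biprod.inr_snd, CategoryTheory.Functor.map_id]
      simp only [Preadditive.comp_add, Preadditive.add_comp, Category.assoc, reassoc_of% h11,
        reassoc_of% h12, reassoc_of% h21, reassoc_of% h22, zero_comp, comp_zero, add_zero, zero_add,
        Iso.hom_inv_id_assoc]
      rw [← hz']; abel)
  obtain ⟨τ, hτ⟩ := (qK).map_surjective (ε.hom ≫ t ≫ e1.hom)
  have hC := HomotopyCategory.mappingCone_triangleh_distinguished τ
  refine ⟨(CochainComplex.mappingCone τ)⟦(-1 : ℤ)⟧, hE'.cone_shift (hL1.mono (by omega) le_rfl) τ,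
    ⟨?_⟩⟩
  have hD' := rot_of_distTriang _ (rot_of_distTriang _ hD)
  let E3 := (isoTriangleOfIso₁₂ _ _ hC hD' ε e1.symm (by
    change (qK).map τ ≫ e1.inv = ε.hom ≫ t
    rw [hτ]; simp))
  let e3 : (qK).obj (CochainComplex.mappingCone τ) ≅ X⟦(1 : ℤ)⟧ := Triangle.π₃.mapIso E3
  exact (((qK : _ ⥤ HomotopyCategory (ModuleCat.{max u w} R) _).commShiftIso (-1 : ℤ)).app _) ≪≫
    (shiftFunctor _ (-1 : ℤ)).mapIso e3 ≪≫ (shiftFunctorCompIsoId _ (1 : ℤ) (-1) (by simp)).app X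

theorem exists_isPerf_of_retract (N : ℕ) (a : ℤ)
    (X : HomotopyCategory (ModuleCat.{max u w} R) (ComplexShape.up ℤ))
    (Q : CochainComplex (ModuleCat.{max u w} R) ℤ) (hQ : IsPerf a (a + N) Q) (i : X ⟶ (qK).obj Q)
    (r : (qK).obj Q ⟶ X) (h : i ≫ r = 𝟙 X) :
    ∃ E : CochainComplex (ModuleCat.{max u w} R) ℤ, IsPerf a (a + N) E ∧ Nonempty ((qK).obj E ≅ X) := by
  induction N generalizing X Q with
  | zero =>
    simp only [Nat.cast_zero, add_zero] at hQ ⊢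
    exact exists_isPerf_of_retract_base a X Q hQ i r h
  | succ N ih =>
    have hz : IsZero (Q.X (a + ((N + 1 : ℕ) : ℤ) + 1)) := (hQ _).2 (by push_cast; omega)
    have hQ3 := isPerf_topSeq hQ hz
    refine exists_isPerf_of_retract_step a _ (by push_cast; omega) ?_ X (topSeq Q hz)
      (fun n => ?_) hQ3 (IsPerf.single_shift (hQ _).1) (fun g => ?_) i r h
    · have : a + ((N + 1 : ℕ) : ℤ) - 1 = a + N := by push_cast; ring
      rw [this]
      intro X Q hQ i r h
      exact ih X Q hQ i r h
    · have : Projective ((topSeq Q hz).map (HomologicalComplex.eval _ _ n)).X₃ := by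
        have := (hQ3 n).1.2
        exact (IsProjective.iff_projective ((topSeq Q hz).X₃.X n)).1 this
      exact (topSeq_eval Q hz n).splittingOfProjective
    · ext n : 1
      by_cases hn : n = a + ((N + 1 : ℕ) : ℤ)
      · exact ((hQ3 n).2 (by omega)).eq_of_tgt _ _
      · exact IsZero.eq_of_src (HomologicalComplex.isZero_single_obj_X _ _ _ _ hn) _ _

end Perfect

section SymbolComplex

variable {α : Type w} [PartialOrder α] [OrderTop α] {𝒜 : DGPresheaf.{u} α} {U U' : α}
  {M : GMod.{u, v} 𝒜 U} {M' : GMod.{u, v'} 𝒜 U'}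

theorem Tot.sym_map (O : Tot M (le_refl U) →+ Tot M' (le_refl U'))
    (hO : ∀ x ∈ Tot.fil M (le_refl U) 1, O x ∈ Tot.fil M' (le_refl U') 1) {n : ℤ}
    {x : Tot M (le_refl U)} (hx : x ∈ Tot.deg M (le_refl U) n) (k : ℤ) :
    Tot.sym M' k (O (Tot.mk _ n (Tot.sym M n x) 1)) = Tot.sym M' k (O x) := by
  have := Tot.sym_fil (m := k) (hO _ (Tot.sub_sym_mem hx))
  rw [map_sub, map_sub, sub_eq_zero] at this
  exact this.symm

theorem Tot.sym_congr {n : ℤ} {x y : Tot M (le_refl U)} (h : x - y ∈ Tot.fil M (le_refl U) 1) :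
    Tot.sym M n x = Tot.sym M n y := by
  have := Tot.sym_fil (m := n) h
  rwa [map_sub, sub_eq_zero] at this

theorem Tot.mk_one_mem_deg {V : α} (h : V ≤ U) (n : ℤ) (e : M.Q n) :
    Tot.mk h n e 1 ∈ Tot.deg M h n := Tot.mk_mem_deg e (one_mem_gr 𝒜) (by simp)

variable (E : QCoh.{u, v} 𝒜 U)

theorem QCoh.conn_fil (fr : Frame 𝒜) {j : ℕ} {x : Tot E.toGMod (le_refl U)}
    (hx : x ∈ Tot.fil E.toGMod (le_refl U) j) : E.conn x ∈ Tot.fil E.toGMod (le_refl U) j := by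
  rw [← E.connOn_refl]; exact E.connOn_fil fr _ hx

theorem Tot.mk_smul_one {n : ℤ} (r : 𝒜.A0 U) (e : M.Q n) :
    Tot.mk (le_refl U) n (r • e) 1 = Tot.rmul (algebraMap _ _ r) (Tot.mk (le_refl U) n e 1) := by
  rw [Tot.mk_smul, Tot.rmul_mk, mul_one, one_mul]
  simp [DGPresheaf.inc, 𝒜.res0_refl]

theorem IsLin.sym_smul {U' : α} {M' : GMod.{u, v'} 𝒜 U'} {h : U' ≤ U} {m n : ℤ} (r : 𝒜.A0 U)
    (e : M.Q m) (O : Tot M (le_refl U) →+ Tot M' (le_refl U'))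
    (hO : ∀ x, O (Tot.rmul (algebraMap _ _ r) x) = Tot.rmul (𝒜.inc h r) (O x)) :
    Tot.sym M' n (O (Tot.mk _ m (r • e) 1)) =
      𝒜.res0 h r • Tot.sym M' n (O (Tot.mk _ m e 1)) := by
  rw [Tot.mk_smul_one, hO, Tot.sym_rmul]
  simp [DGPresheaf.inc]

theorem QCoh.d0_smul (m n : ℤ) (r : 𝒜.A0 U) (e : E.Q m) :
    E.d0 m n (r • e) = r • E.d0 m n e := by
  unfold QCoh.d0
  rw [Tot.mk_smul, mul_one, E.leibniz, map_add, map_zsmul, Tot.sym_rmul,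
    Tot.sym_fil (Tot.mk_mem_fil e (𝒜.d_mem_gr U 0 _ (inc_mem 𝒜 _ r)) (by simp)), smul_zero, add_zero]
  simp [DGPresheaf.inc, 𝒜.res0_refl]

theorem QCoh.d0_add (m n : ℤ) (e e' : E.Q m) : E.d0 m n (e + e') = E.d0 m n e + E.d0 m n e' := by
  unfold QCoh.d0
  rw [Tot.mk_add_left, map_add, map_add]

/-- The differential of the underlying complex as a linear map. -/
noncomputable def QCoh.d0L (m n : ℤ) : E.Q m →ₗ[𝒜.A0 U] E.Q n where
  toFun := E.d0 m n
  map_add' := E.d0_add m n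
  map_smul' := E.d0_smul m n

theorem QCoh.d0_of_ne {m n : ℤ} (hmn : m + 1 ≠ n) (e : E.Q m) : E.d0 m n e = 0 :=
  Tot.sym_deg_ne (Ne.symm hmn) (E.conn_mk_one_mem m e)

theorem QCoh.d0_d0 (fr : Frame 𝒜) (m n k : ℤ) (e : E.Q m) : E.d0 n k (E.d0 m n e) = 0 := by
  by_cases hmn : m + 1 = n
  · subst hmn
    have := Tot.sym_map E.conn (fun x hx => E.conn_fil fr hx) (E.conn_mk_one_mem m e) k
    rw [E.conn_conn, map_zero] at this
    exact this
  · rw [E.d0_of_ne hmn]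
    exact map_zero (E.d0L n k)

open CategoryTheory in
/-- The underlying complex of a quasi-cohesive module. -/
noncomputable abbrev QCoh.cplx (fr : Frame 𝒜) : CochainComplex (ModuleCat.{v} (𝒜.A0 U)) ℤ where
  X n := ModuleCat.of _ (E.Q n)
  d i j := ModuleCat.ofHom (E.d0L i j)
  shape i j hij := by
    ext e
    exact E.d0_of_ne hij e
  d_comp_d' i j k _ _ := by
    ext e
    exact E.d0_d0 fr i j k e

end SymbolComplex

section MuConn

variable {α : Type w} [SemilatticeInf α] [OrderTop α] {ι : Type w'} {𝒜 : DGPresheaf.{u} α}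
  {U : ι → α} (fi : Fine 𝒜 U) (fr : Frame 𝒜) (F : Tw.{u, v} 𝒜 U)

theorem alTot_conn (k : ι) (c) : alTot F k (shConn fr F c) = (F.obj k).conn (alTot F k c) := by
  have h1 : shAll F (shConn fr F c) k [] = shOp F (shAll F c) k [] := by rw [shAll_conn]
  refine Eq.trans h1 ?_
  have h2 : shOp F (shAll F c) k [] = (F.obj k).connOn (cap_le_head U k []) (shAll F c k []) := by
    simp [shOp, sgn_zero]
  rw [h2]
  exact (F.obj k).connOn_refl _

/-- The cochain with a single nonzero component, at `(k, [])`. -/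
noncomputable def singleOp (k : ι) : Tot (F.gmod k) (cap_le_head U k []) →+ ShTot F := by
  classical
  exact (AddMonoidHom.single (fun i => ∀ l, Tot (F.gmod i) (cap_le_head U i l)) k).comp
    (AddMonoidHom.single (fun l => Tot (F.gmod k) (cap_le_head U k l)) [])

theorem singleOp_same (k : ι) (x) : singleOp F k x k [] = x := by
  classical
  unfold singleOp
  simp [Pi.single_eq_same]

theorem singleOp_ne (k : ι) (x) (i : ι) (l : List ι) (h : ¬ (i = k ∧ l = [])) :
    singleOp F k x i l = 0 := by
  classical
  unfold singleOp
  simp only [AddMonoidHom.comp_apply, AddMonoidHom.single_apply]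
  by_cases hi : i = k
  · subst hi
    rw [Pi.single_eq_same, Pi.single_eq_of_ne fun hl => h ⟨rfl, hl⟩]
  · rw [Pi.single_eq_of_ne hi]
    rfl

theorem singleOp_hasDeg (k : ι) (m : ℤ) (x) (hx : x ∈ Tot.deg (F.gmod k) (cap_le_head U k []) m) :
    (singleOp F k x).HasDeg (m + 0) := by
  intro i l
  by_cases h : i = k ∧ l = []
  · obtain ⟨rfl, rfl⟩ := h
    rw [singleOp_same]
    simpa using hx
  · rw [singleOp_ne _ _ _ _ _ h]
    exact AddSubgroup.zero_mem _

theorem exists_alTot_eq (fr : Frame 𝒜) (k : ι) (x : Tot (F.gmod k) (le_refl (U k))) :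
    ∃ c, alTot F k c = x := by
  have h1 : ∀ x, shAll F (shMap fr F (singleOp F k) 0 (singleOp_hasDeg F k) x) k [] = x := fun x => by
    rw [shAll_shMap, singleOp_same]
  exact ⟨_, h1 x⟩

theorem QCoh.conn_τ (fr : Frame 𝒜) (E : QCoh.{u, v'} 𝒜 (⊤ : α)) (k : ι) (x : Tot E.toGMod (le_refl ⊤)) :
    E.conn (Tot.rmul (fi.τ k ⊤) x) - Tot.rmul (fi.τ k ⊤) (E.conn x) ∈
      Tot.fil E.toGMod (le_refl ⊤) 1 := by
  have h1 := fi.connOn_ext fr E k (le_refl ⊤) (inf_le_left : ⊤ ⊓ U k ≤ ⊤) le_rfl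
    (Tot.res (le_refl ⊤) inf_le_left x)
  rw [fi.ext_res, QCoh.connOn_res, fi.ext_res, QCoh.connOn_refl, QCoh.connOn_refl] at h1
  exact h1

theorem shConn_fil {j : ℕ} {x} (hx : x ∈ Tot.fil (shGMod F) (le_refl ⊤) j) :
    shConn fr F x ∈ Tot.fil (shGMod F) (le_refl ⊤) j := (sheafify fr F).conn_fil fr hx

theorem shConn_τ (k : ι) (x) : shConn fr F (Tot.rmul (fi.τ k ⊤) x) -
    Tot.rmul (fi.τ k ⊤) (shConn fr F x) ∈ Tot.fil (shGMod F) (le_refl ⊤) 1 :=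
  QCoh.conn_τ fi fr (sheafify fr F) k x

theorem muTot_conn (k : ι) (x : Tot (F.gmod k) (le_refl (U k))) :
    shConn fr F (muTot fi fr F k x) - muTot fi fr F k ((F.obj k).conn x) ∈
      Tot.fil (shGMod F) (le_refl ⊤) 1 := by
  obtain ⟨c, rfl⟩ := exists_alTot_eq F fr k x
  have h1 := shConn_fil fr F (homotopy_mem fi fr F k c)
  have h2 := homotopy_mem fi fr F k (shConn fr F c)
  have h3 := shConn_τ fi fr F k c
  have hsq : ∀ y, shConn fr F (shConn fr F y) = 0 := (sheafify fr F).conn_conn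
  rw [alTot_conn] at h2
  simp only [map_sub, map_add, hsq, map_zero, add_zero, zero_add] at h1 h2
  have := AddSubgroup.add_mem _ (AddSubgroup.sub_mem _ h1 h2) h3
  convert this using 1
  abel

end MuConn

section LocalLift

open CategoryTheory Limits
open scoped ZeroObject

theorem exists_dualBasis {R : Type u} [CommRing R] (M : Type v) [AddCommGroup M] [Module R M]
    [Module.Finite R M] [Module.Projective R M] :
    ∃ (m : ℕ) (x : Fin m → M) (l : M →ₗ[R] (Fin m → R)), (∀ e, ∑ i, l e i • x i = e) ∧
      (Subsingleton M → m = 0) := by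
  by_cases hM : Subsingleton M
  · exact ⟨0, Fin.elim0, 0, fun e => Subsingleton.elim _ _, fun _ => rfl⟩
  · obtain ⟨m, f, hf⟩ := Module.Finite.exists_fin' R M
    obtain ⟨g, hg⟩ := Module.projective_lifting_property f LinearMap.id hf
    refine ⟨m, fun i => f (Pi.single i 1), g, fun e => ?_, fun h => (hM h).elim⟩
    have h1 : f (g e) = e := congrArg (fun F => F e) hg
    conv_rhs => rw [← h1, pi_eq_sum_univ' (g e), map_sum]
    exact Finset.sum_congr rfl fun i _ => by rw [map_smul]

variable {R : Type u} [CommRing R] {R' : Type u} [CommRing R']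

theorem exists_factor_of_local (ρ : R →+* R') (σ : R) (ε : R' →+ R)
    (hε : ∀ r a, ε (ρ r * a) = r * ε a) (hεε : ∀ a b, ε a * ε b = σ * ε (a * b))
    (G : ℤ → Type v) [∀ n, AddCommGroup (G n)] [∀ n, Module R' (G n)]
    (d : ∀ m n, G m →ₗ[R'] G n) (hd : ∀ m n k e, d n k (d m n e) = 0)
    (hd' : ∀ m n, m + 1 ≠ n → d m n = 0) (N : ℕ) (hN : ∀ n : ℤ, (N : ℤ) < |n| → Subsingleton (G n))
    (hG : ∀ n, Module.Finite R' (G n) ∧ Module.Projective R' (G n))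
    (X : CochainComplex (ModuleCat.{max u w} R) ℤ) (α : ∀ n, X.X n →+ G n)
    (hα : ∀ n r c, α n (r • c) = ρ r • α n c)
    (hαd : ∀ m n c, α n ((X.d m n).hom c) = d m n (α m c)) (μ : ∀ n, G n →+ X.X n)
    (hμ : ∀ n a e, ε a • μ n e = σ • μ n (a • e))
    (hμd : ∀ m n e, (X.d m n).hom (μ m e) = μ n (d m n e)) :
    ∃ (Q : CochainComplex (ModuleCat.{max u w} R) ℤ) (i : X ⟶ Q) (p : Q ⟶ X),
      IsPerf (-N : ℤ) N Q ∧
      ∀ n c, (p.f n).hom ((i.f n).hom c) = σ ^ (2 * N + 1) • μ n (α n c) := by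
  have hb : ∀ n, ∃ (m : ℕ) (x : Fin m → G n) (l : G n →ₗ[R'] (Fin m → R')),
      (∀ e, ∑ i, l e i • x i = e) ∧ (Subsingleton (G n) → m = 0) := fun n => by
    have := (hG n).1
    have := (hG n).2
    exact exists_dualBasis (G n)
  choose m x l hx hm using hb
  have hlin : ∀ n n' (e : G n), ∑ i, l n e i • l n' (d n n' (x n i)) = l n' (d n n' e) := by
    intro n n' e
    conv_rhs => rw [← hx n e, map_sum, map_sum]
    exact Finset.sum_congr rfl fun i _ => by rw [map_smul, map_smul]
  have hlin' : ∀ n n' (e : G n) j, ∑ i, l n e i * l n' (d n n' (x n i)) j = l n' (d n n' e) j := by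
    intro n n' e j
    rw [← hlin n n' e, Finset.sum_apply]
    rfl
  let dQ : ∀ n n', ULift.{w} (Fin (m n) → R) →ₗ[R] ULift.{w} (Fin (m n') → R) := fun n n' =>
    { toFun := fun v => ⟨fun j => ∑ i, v.down i * ε (l n' (d n n' (x n i)) j)⟩
      map_add' := fun v v' => by
        ext j; simp [add_mul, Finset.sum_add_distrib]
      map_smul' := fun r v => by
        ext j; simp [Finset.mul_sum, mul_assoc] }
  have hQ2 : ∀ n n' n'' v, dQ n' n'' (dQ n n' v) = 0 := by
    intro n n' n'' v
    ext j
    change ∑ i, (∑ i', v.down i' * ε (l n' (d n n' (x n i')) i)) *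
      ε (l n'' (d n' n'' (x n' i)) j) = 0
    simp_rw [Finset.sum_mul]
    rw [Finset.sum_comm]
    refine Finset.sum_eq_zero fun i' _ => ?_
    simp_rw [mul_assoc, hεε]
    rw [← Finset.mul_sum, ← Finset.mul_sum, ← map_sum, hlin', hd]
    simp
  let Q : CochainComplex (ModuleCat.{max u w} R) ℤ :=
    { X := fun n => ModuleCat.of R (ULift.{w} (Fin (m n) → R))
      d := fun n n' => ModuleCat.ofHom (dQ n n')
      shape := fun n n' h => by
        refine ModuleCat.hom_ext (LinearMap.ext fun v => ULift.ext _ _ (funext fun j => ?_))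
        change ∑ i, v.down i * ε (l n' (d n n' (x n i)) j) = 0
        simp [hd' n n' h]
      d_comp_d' := fun n n' n'' _ _ => 
        ModuleCat.hom_ext (LinearMap.ext fun v => hQ2 n n' n'' v) }
  have hz : ∀ n : ℤ, (N : ℤ) < |n| → ∀ e : G n, e = 0 := fun n h e => by
    have := hN n h
    exact Subsingleton.elim _ _
  let iL : ∀ n, X.X n →ₗ[R] ULift.{w} (Fin (m n) → R) := fun n =>
    { toFun := fun c => ⟨fun j => σ ^ (n + N).toNat * ε (l n (α n c) j)⟩
      map_add' := fun c c' => by ext j; simp [mul_add]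
      map_smul' := fun r c => by
        ext j
        simp only [hα, map_smul, Pi.smul_apply, smul_eq_mul, hε, RingHom.id_apply, ULift.smul_down]
        ring }
  let pL : ∀ n, ULift.{w} (Fin (m n) → R) →ₗ[R] X.X n := fun n =>
    { toFun := fun v => σ ^ ((N : ℤ) - n).toNat • ∑ i, v.down i • μ n (x n i)
      map_add' := fun v v' => by simp [add_smul, Finset.sum_add_distrib]
      map_smul' := fun r v => by
        simp only [ULift.smul_down, Pi.smul_apply, smul_eq_mul, mul_smul, ← Finset.smul_sum,
          RingHom.id_apply]
        rw [smul_comm] }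
  have hμx : ∀ n (e : G n), ∑ i, ε (l n e i) • μ n (x n i) = σ • μ n e := by
    intro n e
    simp_rw [hμ]
    rw [← Finset.smul_sum, ← map_sum, hx]
  have hi : ∀ n n' c, n + 1 = n' → dQ n n' (iL n c) = iL n' ((X.d n n').hom c) := by
    intro n n' c hn
    ext j
    change ∑ i, (σ ^ (n + N).toNat * ε (l n (α n c) i)) * ε (l n' (d n n' (x n i)) j) =
      σ ^ (n' + N).toNat * ε (l n' (α n' ((X.d n n').hom c)) j)
    simp_rw [mul_assoc, hεε]
    rw [← Finset.mul_sum, ← Finset.mul_sum, ← map_sum, hlin', hαd]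
    by_cases h : n + N < 0
    · rw [hz n (by rw [abs_of_nonpos (by omega)]; omega) (α n c)]
      simp
    · rw [show (n' + N).toNat = (n + N).toNat + 1 by omega, pow_succ, mul_assoc]
  have hp : ∀ n n' v, n + 1 = n' → (X.d n n').hom (pL n v) = pL n' (dQ n n' v) := by
    intro n n' v hn
    change (X.d n n').hom (σ ^ ((N : ℤ) - n).toNat • ∑ i, v.down i • μ n (x n i)) =
      σ ^ ((N : ℤ) - n').toNat • ∑ j, (∑ i, v.down i * ε (l n' (d n n' (x n i)) j)) • μ n' (x n' j)
    simp_rw [map_smul, map_sum, map_smul, hμd, Finset.sum_smul, mul_smul]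
    rw [Finset.sum_comm]
    simp_rw [← Finset.smul_sum, hμx]
    by_cases h : (N : ℤ) ≤ n
    · have : ∀ i, d n n' (x n i) = 0 := fun i =>
        hz n' (by rw [abs_of_nonneg (by omega)]; omega) _
      simp [this]
    · rw [show ((N : ℤ) - n).toNat = ((N : ℤ) - n').toNat + 1 by omega, pow_succ, mul_smul,
        Finset.smul_sum]
      congr 1
      exact Finset.sum_congr rfl fun i _ => smul_comm _ _ _
  refine ⟨Q, ⟨fun n => ModuleCat.ofHom (iL n), fun n n' h => ?_⟩,
    ⟨fun n => ModuleCat.ofHom (pL n), fun n n' h => ?_⟩, fun n => ⟨⟨?_, ?_⟩, fun h => ?_⟩,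
    fun n c => ?_⟩
  · exact ModuleCat.hom_ext (LinearMap.ext fun c => hi n n' c h)
  · exact ModuleCat.hom_ext (LinearMap.ext fun v => hp n n' v h)
  · exact Module.Finite.equiv (ULift.moduleEquiv (R := R) (M := Fin (m n) → R)).symm
  · exact Module.Projective.of_equiv (ULift.moduleEquiv (R := R) (M := Fin (m n) → R)).symm
  · have h0 : m n = 0 := hm n (hN n (by
      rcases h with h | h
      · rw [abs_of_nonpos (by omega)]; omega
      · rw [abs_of_nonneg (by omega)]; omega))
    have : Subsingleton (ULift.{w} (Fin (m n) → R)) := by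
      have : IsEmpty (Fin (m n)) := by rw [h0]; infer_instance
      infer_instance
    exact ModuleCat.isZero_of_subsingleton (ModuleCat.of R (ULift.{w} (Fin (m n) → R)))
  · change σ ^ ((N : ℤ) - n).toNat • ∑ i, (σ ^ (n + N).toNat * ε (l n (α n c) i)) • μ n (x n i) = _
    simp_rw [mul_smul]
    rw [← Finset.smul_sum, hμx, smul_smul, smul_smul]
    by_cases h : (N : ℤ) < |n|
    · rw [hz n h (α n c)]; simp
    · rw [← pow_add, ← pow_succ]
      congr 2
      rw [not_lt, abs_le] at h
      omega

local notation "qK" => HomotopyCategory.quotient (ModuleCat _) (ComplexShape.up ℤ)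

/-- The scalars that factor, up to homotopy, through a strictly perfect complex. -/
def perfIdeal (X : CochainComplex (ModuleCat.{max u w} R) ℤ) : Ideal R where
  carrier := {r | ∃ (N : ℕ) (Q : CochainComplex (ModuleCat.{max u w} R) ℤ) (i : X ⟶ Q) (p : Q ⟶ X),
    IsPerf (-N : ℤ) N Q ∧ Nonempty (Homotopy (i ≫ p) (r • 𝟙 X))}
  zero_mem' := ⟨0, 0, 0, 0, fun n => by
    have : IsZero ((0 : CochainComplex (ModuleCat.{max u w} R) ℤ).X n) :=
      (HomologicalComplex.eval _ _ n).map_isZero (isZero_zero _)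
    exact ⟨IsFGProj.of_isZero this, fun _ => this⟩, ⟨Homotopy.ofEq (by simp)⟩⟩
  add_mem' := by
    rintro a b ⟨N, Q, i, p, hQ, ⟨h⟩⟩ ⟨N', Q', i', p', hQ', ⟨h'⟩⟩
    refine ⟨max N N', Q ⊞ Q', biprod.lift i i', biprod.desc p p', ?_, ⟨?_⟩⟩
    · exact (hQ.mono (by push_cast; omega) (by push_cast; omega)).biprod
        (hQ'.mono (by push_cast; omega) (by push_cast; omega))
    · exact (Homotopy.ofEq (by rw [biprod.lift_desc])).trans
        ((h.add h').trans (Homotopy.ofEq (by rw [add_smul])))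
  smul_mem' := by
    rintro c r ⟨N, Q, i, p, hQ, ⟨h⟩⟩
    refine ⟨N, Q, i, c • p, hQ, ⟨?_⟩⟩
    exact (Homotopy.ofEq (by rw [Linear.comp_smul])).trans
      ((h.smul c).trans (Homotopy.ofEq (by rw [smul_smul]; rfl)))

theorem exists_homotopyEquiv_of_perfIdeal (X : CochainComplex (ModuleCat.{max u w} R) ℤ)
    (h : perfIdeal X = ⊤) : ∃ (N : ℕ) (E : CochainComplex (ModuleCat.{max u w} R) ℤ),
      IsPerf (-N : ℤ) N E ∧ Nonempty (HomotopyEquiv E X) := by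
  obtain ⟨N, Q, i, p, hQ, ⟨H⟩⟩ := (Ideal.eq_top_iff_one _).1 h
  have e1 : (qK).map i ≫ (qK).map p = 𝟙 _ := by
    rw [← Functor.map_comp, HomotopyCategory.eq_of_homotopy _ _ H, one_smul, CategoryTheory.Functor.map_id]
  have e2 : (-N : ℤ) + (2 * N : ℕ) = N := by push_cast; ring
  obtain ⟨E, hE, ⟨e⟩⟩ := exists_isPerf_of_retract (2 * N) (-N : ℤ) _ Q (by rwa [e2]) _ _ e1
  exact ⟨N, E, by rwa [e2] at hE, ⟨HomotopyCategory.homotopyEquivOfIso e⟩⟩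

theorem perfIdeal_eq_top (X : CochainComplex (ModuleCat.{max u w} R) ℤ) {ι : Type w'} (s : Finset ι)
    (σ : ι → R) (hσ : ∑ k ∈ s, σ k = 1) (h : ∀ k ∈ s, ∃ n, σ k ^ n ∈ perfIdeal X) :
    perfIdeal X = ⊤ := by
  rw [← Ideal.radical_eq_top, Ideal.eq_top_iff_one, ← hσ]
  exact Ideal.sum_mem _ fun k hk => h k hk

end LocalLift

section PerfectSheafify

open CategoryTheory

variable {α : Type w} [SemilatticeInf α] [OrderTop α] {ι : Type w'} {𝒜 : DGPresheaf.{u} α}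
  {U : ι → α} (fi : Fine 𝒜 U) (fr : Frame 𝒜) (F : Tw.{u, v} 𝒜 U)

/-- Extension by zero, after multiplication by `σ k`, of degree zero elements. -/
noncomputable def Fine.ext0 (k : ι) : 𝒜.A0 (U k) →+ 𝒜.A0 ⊤ :=
  ((𝒜.ε ⊤ : 𝒜.A ⊤ →+ 𝒜.A0 ⊤).comp (fi.extA fr k (le_top : U k ≤ ⊤) inf_le_right)).comp
    (algebraMap (𝒜.A0 (U k)) (𝒜.A (U k)) : 𝒜.A0 (U k) →+ 𝒜.A (U k))

theorem Fine.ext0_res (k : ι) (r : 𝒜.A0 ⊤) :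
    fi.ext0 fr k (𝒜.res0 le_top r) = fi.σ k * r := by
  change 𝒜.ε ⊤ (fi.extA fr k _ _ (algebraMap _ _ (𝒜.res0 le_top r))) = _
  rw [← 𝒜.res_algebraMap, fi.extA_res, map_mul]
  simp [Fine.τ, DGPresheaf.inc, 𝒜.res0_refl]

/-- The symbol of an additive map of total modules. -/
noncomputable def sy {U₁ U₂ : α} {M : GMod.{u, v} 𝒜 U₁} {M' : GMod.{u, v'} 𝒜 U₂}
    (O : Tot M (le_refl U₁) →+ Tot M' (le_refl U₂)) (m n : ℤ) : M.Q m →+ M'.Q n :=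
  AddMonoidHom.mk' (fun e => Tot.sym M' n (O (Tot.mk _ m e 1))) fun e e' => by
    rw [Tot.mk_add_left, map_add, map_add]

theorem sy_apply {U₁ U₂ : α} {M : GMod.{u, v} 𝒜 U₁} {M' : GMod.{u, v'} 𝒜 U₂}
    (O : Tot M (le_refl U₁) →+ Tot M' (le_refl U₂)) (m n : ℤ) (e : M.Q m) :
    sy O m n e = Tot.sym M' n (O (Tot.mk _ m e 1)) := rfl

/-- The symbol of a linear map. -/
noncomputable def syL {U₁ : α} {M : GMod.{u, v} 𝒜 U₁} {M' : GMod.{u, v'} 𝒜 U₁}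
    (O : Tot M (le_refl U₁) →+ Tot M' (le_refl U₁)) (hO : IsLin O) (m n : ℤ) :
    M.Q m →ₗ[𝒜.A0 U₁] M'.Q n where
  toFun := sy O m n
  map_add' := map_add _
  map_smul' r e := by
    rw [sy_apply, Tot.mk_smul_one, hO, Tot.sym_rmul]
    simp [sy_apply]

theorem sy_of_ne {U₁ U₂ : α} {M : GMod.{u, v} 𝒜 U₁} {M' : GMod.{u, v'} 𝒜 U₂}
    (O : Tot M (le_refl U₁) →+ Tot M' (le_refl U₂)) {d : ℤ}
    (hO : ∀ m x, x ∈ Tot.deg M (le_refl U₁) m → O x ∈ Tot.deg M' (le_refl U₂) (m + d)) {m n : ℤ}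
    (hmn : m + d ≠ n) (e : M.Q m) : sy O m n e = 0 :=
  Tot.sym_deg_ne (Ne.symm hmn) (hO _ _ (Tot.mk_one_mem_deg _ _ _))

/-- A global module `S` together with projections to the modules of a twisted complex and maps back,
inverse to each other up to homotopy and up to terms of positive form degree, after multiplication
with a partition of unity. -/
structure Atlas (S : QCoh.{u, v'} 𝒜 (⊤ : α)) where
  pr : ∀ k, Mor S.toGMod (F.gmod k) (le_top : U k ≤ ⊤) (le_refl (U k))
  pr_deg : ∀ k, IsDeg 0 (pr k).1
  pr_conn : ∀ k c, (pr k).1 (Tot.res (le_refl ⊤) le_top (S.conn c)) =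
    (F.obj k).conn ((pr k).1 (Tot.res (le_refl ⊤) le_top c))
  pr₂ : ∀ j k, Mor S.toGMod (F.gmod j) (le_top : cap U j [k] ≤ ⊤) (cap_le_head U j [k])
  pr₂_deg : ∀ j k, IsDeg (-1) (pr₂ j k).1
  pr₂_conn : ∀ j k c, (pr₂ j k).1 (Tot.res (le_refl ⊤) le_top (S.conn c)) =
    -Tot.res (le_refl (U j)) (cap_le_head U j [k]) ((pr j).1 (Tot.res (le_refl ⊤) le_top c)) -
      (F.obj j).connOn _ ((pr₂ j k).1 (Tot.res (le_refl ⊤) le_top c)) +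
      F.raw.pos j [] k _ le_rfl
        (Tot.res (le_refl (U k)) (cap_le_last U j [] k) ((pr k).1 (Tot.res (le_refl ⊤) le_top c)))
  mu : ∀ k, Tot (F.gmod k) (le_refl (U k)) →+ Tot S.toGMod (le_refl ⊤)
  mu_rmul : ∀ k (b : 𝒜.A ⊤) x, mu k (Tot.rmul (𝒜.res le_top b) x) = Tot.rmul b (mu k x)
  mu_deg : ∀ k m x, x ∈ Tot.deg (F.gmod k) (le_refl (U k)) m → mu k x ∈ Tot.deg S.toGMod (le_refl ⊤) m
  mu_conn : ∀ k x, S.conn (mu k x) - mu k ((F.obj k).conn x) ∈ Tot.fil S.toGMod (le_refl ⊤) 1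
  pr_mu : ∀ k j x, (pr k).1 (Tot.res (le_refl ⊤) le_top (mu j x)) =
    fi.ext fr j (le_refl (U k)) (cap_le_head U k [j]) (cap_inf_le k [] j)
      (F.raw.pos k [] j _ le_rfl (Tot.res (le_refl (U j)) (cap_le_last U k [] j) x))
  h : ι → Mor S.toGMod S.toGMod (le_refl ⊤) (le_refl ⊤)
  h_deg : ∀ k, IsDeg (-1) (h k).1
  homotopy : ∀ k x, S.conn ((h k).1 x) + (h k).1 (S.conn x) -
    (Tot.rmul (fi.τ k ⊤) x - mu k ((pr k).1 (Tot.res (le_refl ⊤) le_top x))) ∈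
      Tot.fil S.toGMod (le_refl ⊤) 1

/-- The sheafification of a twisted complex, with its projections. -/
noncomputable def sheafifyAtlas : Atlas fi fr F (sheafify fr F) where
  pr k := shProj F k [] (U k) le_rfl
  pr_deg k := by
    have h1 := shProj_isDeg F k [] (U k) le_rfl
    rw [List.length_nil, Nat.cast_zero, neg_zero] at h1
    exact h1
  pr_conn k c := alTot_conn fr F k c
  pr₂ j k := shProj F j [k] _ le_rfl
  pr₂_deg j k := shProj_isDeg F j [k] _ le_rfl
  pr₂_conn j k c := by
    have h1 : ∀ c, shAll F (shConn fr F c) j [k] = shOp F (shAll F c) j [k] := fun c => by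
      rw [shAll_conn]
    refine (h1 c).trans ?_
    have h2 : ∀ y : ShTot F, shOp F y j [k] =
        -Tot.res (cap_le_head U j []) (cap_le_head U j [k]) (y j []) -
        (F.obj j).connOn (cap_le_head U j [k]) (y j [k]) +
        F.raw.pos j [] k _ le_rfl (Tot.res (cap_le_head U k []) (cap_le_last U j [] k) (y k [])) := by
      intro y
      simp [shOp, sgn_one, sgn_zero]
      rw [← sub_eq_add_neg]
      rfl
    exact h2 _
  mu := muTot fi fr F
  mu_rmul := muTot_rmul fi fr F
  mu_deg k m x hx := muTot_mem_deg fi fr F k hx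
  mu_conn := muTot_conn fi fr F
  pr_mu k j x := by
    have h1 : shAll F (muTot fi fr F j x) k [] = muOp fi fr F j x k [] := by rw [shAll_muTot]
    refine h1.trans ?_
    rw [muOp_apply, List.length_nil, Nat.cast_zero, sgn_zero, one_smul]
    rfl
  h k := ⟨hTot fi fr F k, hTot_isLin fi fr F k⟩
  h_deg := hTot_isDeg fi fr F
  homotopy := homotopy_mem fi fr F

namespace Atlas

variable {fi fr F} {S : QCoh.{u, v'} 𝒜 (⊤ : α)} (atl : Atlas fi fr F S)

/-- The projection on global elements. -/
noncomputable def al (k : ι) : Tot S.toGMod (le_refl ⊤) →+ Tot (F.gmod k) (le_refl (U k)) :=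
  (atl.pr k).1.comp (Tot.res (le_refl ⊤) le_top)

theorem al_apply (k : ι) (c) : atl.al k c = (atl.pr k).1 (Tot.res (le_refl ⊤) le_top c) := rfl

theorem al_rmul (k : ι) (b : 𝒜.A ⊤) (c) :
    atl.al k (Tot.rmul b c) = Tot.rmul (𝒜.res le_top b) (atl.al k c) := by
  rw [al_apply, Tot.res_rmul, (atl.pr k).2, al_apply]

theorem al_mem_deg (k : ι) {m : ℤ} {c} (hc : c ∈ Tot.deg S.toGMod (le_refl ⊤) m) :
    atl.al k c ∈ Tot.deg (F.gmod k) (le_refl (U k)) m := by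
  have := atl.pr_deg k m _ (Tot.res_mem_deg _ le_top hc)
  rwa [add_zero] at this

theorem al_fil (k : ι) {j : ℕ} {x} (hx : x ∈ Tot.fil S.toGMod (le_refl ⊤) j) :
    atl.al k x ∈ Tot.fil (F.gmod k) (le_refl (U k)) j :=
  (atl.pr k).2.map_fil fr (Tot.res_mem_fil _ _ hx)

theorem mu_fil (k : ι) {j : ℕ} {x} (hx : x ∈ Tot.fil (F.gmod k) (le_refl (U k)) j) :
    atl.mu k x ∈ Tot.fil S.toGMod (le_refl ⊤) j :=
  Tot.map_fil (atl.mu k) _ (fun n i e b hb hi => by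
    obtain ⟨a, ha, rfl⟩ := fi.res_surj_gr fr (le_top : U k ≤ ⊤) hb
    have : Tot.mk (le_refl (U k)) n e (𝒜.res le_top a) =
        Tot.rmul (𝒜.res le_top a) (Tot.mk (M := F.gmod k) (le_refl (U k)) n e 1) := by
      rw [Tot.rmul_mk, one_mul]
    rw [this, atl.mu_rmul]
    exact Tot.fil_anti hi (Tot.rmul_mem_fil fr ha _)) hx

theorem al_d0 (k : ι) (m n : ℤ) (c : S.Q m) :
    sy (atl.al k) n n (S.d0 m n c) = (F.obj k).d0 m n (sy (atl.al k) m m c) := by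
  by_cases hmn : m + 1 = n
  · subst hmn
    have h1 := Tot.sym_map (atl.al k) (fun x hx => atl.al_fil k hx) (S.conn_mk_one_mem m c) (m + 1)
    have h2 := Tot.sym_map (F.obj k).conn (fun x hx => (F.obj k).conn_fil fr hx)
      (atl.al_mem_deg k (Tot.mk_one_mem_deg (le_refl ⊤) m c)) (m + 1)
    refine h1.trans (Eq.trans ?_ h2.symm)
    exact congrArg _ (atl.pr_conn k _)
  · rw [QCoh.d0_of_ne _ hmn, QCoh.d0_of_ne _ hmn, map_zero]

theorem mu_d0 (k : ι) (m n : ℤ) (e : (F.obj k).Q m) :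
    S.d0 m n (sy (atl.mu k) m m e) = sy (atl.mu k) n n ((F.obj k).d0 m n e) := by
  by_cases hmn : m + 1 = n
  · subst hmn
    have h1 := Tot.sym_map (atl.mu k) (fun x hx => atl.mu_fil k hx)
      ((F.obj k).conn_mk_one_mem m e) (m + 1)
    have h2 := Tot.sym_map S.conn (fun x hx => S.conn_fil fr hx)
      (atl.mu_deg k _ _ (Tot.mk_one_mem_deg (M := F.gmod k) (le_refl (U k)) m e)) (m + 1)
    refine Eq.trans h2 (Eq.trans ?_ h1.symm)
    exact Tot.sym_congr (atl.mu_conn k _)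
  · rw [QCoh.d0_of_ne _ hmn, QCoh.d0_of_ne _ hmn, map_zero]

theorem h_d0 (k : ι) (n : ℤ) (c : S.Q n) :
    S.d0 (n - 1) n (sy (atl.h k).1 n (n - 1) c) + sy (atl.h k).1 (n + 1) n (S.d0 n (n + 1) c) =
      fi.σ k • c - sy (atl.mu k) n n (sy (atl.al k) n n c) := by
  have hd := Tot.mk_one_mem_deg (M := S.toGMod) (le_refl ⊤) n c
  have h1 := Tot.sym_map S.conn (fun x hx => S.conn_fil fr hx) (atl.h_deg k _ _ hd) n
  have h2 := Tot.sym_map (atl.h k).1 (fun x hx => (atl.h k).2.map_fil fr hx)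
    (S.conn_mk_one_mem n c) n
  have h3 := Tot.sym_map (atl.mu k) (fun x hx => atl.mu_fil k hx) (atl.al_mem_deg k hd) n
  have h4 := Tot.sym_congr (n := n) (atl.homotopy k (Tot.mk (le_refl ⊤) n c 1))
  rw [map_add, map_sub, Tot.sym_rmul, Tot.sym_mk_one] at h4
  have h5 : 𝒜.ε ⊤ (fi.τ k ⊤) = fi.σ k := by
    simp [Fine.τ, DGPresheaf.inc, 𝒜.res0_refl]
  rw [h5] at h4
  refine Eq.trans (congrArg₂ (· + ·) h1 h2) (h4.trans ?_)
  exact congrArg (fun z => fi.σ k • c - z) h3.symm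

end Atlas

variable {fi fr F} {S : QCoh.{u, max u v'} 𝒜 (⊤ : α)}

/-- A homotopy from its components. -/
def mkHomotopy {R : Type u} [CommRing R] {C D : CochainComplex (ModuleCat.{v} R) ℤ} (f g : C ⟶ D)
    (s : ∀ i j, C.X i →ₗ[R] D.X j) (h0 : ∀ i j, j + 1 ≠ i → s i j = 0)
    (hs : ∀ n c, (f.f n).hom c = s (n + 1) n ((C.d n (n + 1)).hom c) +
      (D.d (n - 1) n).hom (s n (n - 1) c) + (g.f n).hom c) : Homotopy f g where
  hom i j := ModuleCat.ofHom (s i j)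
  zero i j h := by
    rw [h0 i j h]; rfl
  comm n := by
    rw [dNext_eq _ (show (ComplexShape.up ℤ).Rel n (n + 1) from rfl),
      prevD_eq _ (show (ComplexShape.up ℤ).Rel (n - 1) n from sub_add_cancel n 1)]
    exact ModuleCat.hom_ext (LinearMap.ext fun c => hs n c)

theorem Atlas.pow_mem_perfIdeal (atl : Atlas fi fr F S) (hF : F.IsCohesive) (k : ι) :
    ∃ n, fi.σ k ^ n ∈ perfIdeal.{u, v'} (S.cplx fr) := by
  obtain ⟨⟨N, hN⟩, hfg⟩ := hF k
  have hal : ∀ n (r : 𝒜.A0 ⊤) (c : S.Q n), sy (atl.al k) n n (r • c) =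
      𝒜.res0 (le_top : U k ≤ ⊤) r • sy (atl.al k) n n c := fun n r c =>
    IsLin.sym_smul r c (atl.al k) fun x => by
      rw [al_rmul, 𝒜.res_algebraMap]; rfl
  have hmu : ∀ n (r : 𝒜.A0 ⊤) (e : (F.obj k).Q n), sy (atl.mu k) n n
      (𝒜.res0 (le_top : U k ≤ ⊤) r • e) = r • sy (atl.mu k) n n e := fun n r e => by
    rw [sy_apply, Tot.mk_smul_one, ← 𝒜.res_algebraMap, atl.mu_rmul, Tot.sym_rmul, AlgHom.commutes]
    rfl
  obtain ⟨Q, i, p, hQ, hip⟩ := exists_factor_of_local.{u, v, v'} (𝒜.res0 (le_top : U k ≤ ⊤)) (fi.σ k)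
    (fi.ext0 fr k) (fun r a => by
      obtain ⟨a, rfl⟩ := fi.surj le_top a
      rw [← map_mul, fi.ext0_res, fi.ext0_res]; ring) (fun a b => by
      obtain ⟨a, rfl⟩ := fi.surj le_top a
      obtain ⟨b, rfl⟩ := fi.surj le_top b
      rw [← map_mul (𝒜.res0 _), fi.ext0_res, fi.ext0_res, fi.ext0_res]; ring)
    (F.obj k).Q (F.obj k).d0L ((F.obj k).d0_d0 fr)
    (fun m n h => LinearMap.ext ((F.obj k).d0_of_ne h)) N.toNat
    (fun n hn => hN n (by omega)) hfg (S.cplx fr)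
    (fun n => sy (atl.al k) n n) hal (fun m n c => atl.al_d0 k m n c)
    (fun n => sy (atl.mu k) n n) (fun n a e => by
      obtain ⟨a, rfl⟩ := fi.surj le_top a
      rw [fi.ext0_res]
      exact (mul_smul _ _ _).trans (congrArg _ (hmu n a e).symm)) (fun m n e => atl.mu_d0 k m n e)
  refine ⟨2 * N.toNat + 1 + 1, N.toNat, Q, i, p, hQ, ⟨?_⟩⟩
  set K := 2 * N.toNat + 1
  refine mkHomotopy _ _ (fun m n => -(fi.σ k ^ K • syL (atl.h k).1 (atl.h k).2 m n))
    (fun m n hmn => LinearMap.ext fun c => ?_) fun n c => ?_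
  · change -(fi.σ k ^ K • sy (atl.h k).1 m n c) = 0
    rw [sy_of_ne (atl.h k).1 (atl.h_deg k) (fun h => hmn (by omega)), smul_zero, neg_zero]
  · refine (hip n c).trans ?_
    have h := atl.h_d0 k n c
    change fi.σ k ^ K • sy (atl.mu k) n n (sy (atl.al k) n n c) =
      -(fi.σ k ^ K • sy (atl.h k).1 (n + 1) n (S.d0 n (n + 1) c)) +
      S.d0L (n - 1) n (-(fi.σ k ^ K • sy (atl.h k).1 n (n - 1) c)) +
      fi.σ k ^ (K + 1) • c
    rw [map_neg, map_smul]
    change fi.σ k ^ K • sy (atl.mu k) n n (sy (atl.al k) n n c) =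
      -(fi.σ k ^ K • sy (atl.h k).1 (n + 1) n (S.d0 n (n + 1) c)) +
      -(fi.σ k ^ K • S.d0 (n - 1) n (sy (atl.h k).1 n (n - 1) c)) +
      fi.σ k ^ (K + 1) • c
    rw [pow_succ (fi.σ k) K, mul_smul, ← smul_neg, ← smul_neg, ← smul_add, ← smul_add]
    congr 1
    rw [eq_sub_iff_add_eq] at h
    rw [← h]
    abel

end PerfectSheafify

section Model

open CategoryTheory

variable {α : Type w} [SemilatticeInf α] [OrderTop α] {ι : Type w'} {𝒜 : DGPresheaf.{u} α}

/-- A strictly perfect complex homotopy equivalent to the underlying complex of `S`. -/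
structure PerfModel (S : QCoh.{u, v} 𝒜 (⊤ : α)) where
  E : GMod.{u, u} 𝒜 (⊤ : α)
  bdd : ∃ N : ℤ, ∀ n, N < |n| → Subsingleton (E.Q n)
  fg : ∀ n, Module.Finite (𝒜.A0 ⊤) (E.Q n) ∧ Module.Projective (𝒜.A0 ⊤) (E.Q n)
  d : ∀ m n, E.Q m →ₗ[𝒜.A0 ⊤] E.Q n
  d_d : ∀ m n k e, d n k (d m n e) = 0
  f : ∀ n, E.Q n →ₗ[𝒜.A0 ⊤] S.Q n
  f_d : ∀ m n e, S.d0 m n (f m e) = f n (d m n e)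
  g : ∀ n, S.Q n →ₗ[𝒜.A0 ⊤] E.Q n
  g_d : ∀ m n e, d m n (g m e) = g n (S.d0 m n e)
  s : ∀ m n, E.Q m →ₗ[𝒜.A0 ⊤] E.Q n
  g_f : ∀ n e, g n (f n e) = s (n + 1) n (d n (n + 1) e) + d (n - 1) n (s n (n - 1) e) + e
  t : ∀ m n, S.Q m →ₗ[𝒜.A0 ⊤] S.Q n
  f_g : ∀ n e, f n (g n e) = t (n + 1) n (S.d0 n (n + 1) e) + S.d0 (n - 1) n (t n (n - 1) e) + e

theorem Homotopy.comm_apply {R : Type u} [CommRing R] {C D : CochainComplex (ModuleCat.{v} R) ℤ}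
    {f g : C ⟶ D} (h : Homotopy f g) (n : ℤ) (c : C.X n) :
    (f.f n).hom c = (h.hom (n + 1) n).hom ((C.d n (n + 1)).hom c) +
      (D.d (n - 1) n).hom ((h.hom n (n - 1)).hom c) + (g.f n).hom c := by
  have h1 := h.comm n
  rw [dNext_eq _ (show (ComplexShape.up ℤ).Rel n (n + 1) from rfl),
      prevD_eq _ (show (ComplexShape.up ℤ).Rel (n - 1) n from sub_add_cancel n 1)] at h1
  rw [h1]
  rfl

theorem small_of_isFGProj {R : Type u} [CommRing R] {M : ModuleCat.{max u w} R} (h : IsFGProj M) :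
    Small.{u} M := by
  obtain ⟨h1, -⟩ := h
  obtain ⟨m, f, hf⟩ := Module.Finite.exists_fin' R M
  exact small_of_surjective hf

theorem nonempty_perfModel {U : ι → α} {fi : Fine 𝒜 U} {fr : Frame 𝒜} {F : Tw.{u, v} 𝒜 U}
    {S : QCoh.{u, max u v'} 𝒜 (⊤ : α)} (atl : Atlas fi fr F S) (hF : F.IsCohesive) :
    Nonempty (PerfModel S) := by
  obtain ⟨N, E, hE, ⟨e⟩⟩ := exists_homotopyEquiv_of_perfIdeal.{u, v'} (S.cplx fr)
    (perfIdeal_eq_top _ fi.s fi.σ fi.sum_σ fun k _ => atl.pow_mem_perfIdeal hF k)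
  have hsm : ∀ n, Small.{u} (E.X n) := fun n => small_of_isFGProj.{u, v'} (hE n).1
  let q : ∀ n, Shrink.{u} (E.X n) ≃ₗ[𝒜.A0 ⊤] E.X n := fun n => Shrink.linearEquiv _ _
  let s := e.homotopyHomInvId
  let t := e.homotopyInvHomId
  refine ⟨{
    E := { Q := fun n => Shrink.{u} (E.X n) }
    bdd := ⟨N, fun n hn => ?_⟩
    fg := fun n => ?_
    d := fun m n => (q n).symm.toLinearMap ∘ₗ (E.d m n).hom ∘ₗ (q m).toLinearMap
    d_d := fun m n k x => ?_
    f := fun n => (e.hom.f n).hom ∘ₗ (q n).toLinearMap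
    f_d := fun m n x => ?_
    g := fun n => (q n).symm.toLinearMap ∘ₗ (e.inv.f n).hom
    g_d := fun m n x => ?_
    s := fun m n => (q n).symm.toLinearMap ∘ₗ (s.hom m n).hom ∘ₗ (q m).toLinearMap
    g_f := fun n x => ?_
    t := fun m n => (t.hom m n).hom
    f_g := fun n x => ?_ }⟩
  · have : Subsingleton (E.X n) := by
      refine ModuleCat.subsingleton_of_isZero ((hE n).2 ?_)
      rcases abs_cases n with h | h <;> omega
    exact (q n).toEquiv.subsingleton
  · obtain ⟨h1, h2⟩ := (hE n).1
    exact ⟨Module.Finite.equiv (q n).symm, Module.Projective.of_equiv (q n).symm⟩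
  · have h1 : (E.d n k).hom ((E.d m n).hom (q m x)) = 0 :=
      congrArg (fun z => z.hom (q m x)) (E.d_comp_d m n k)
    simp [h1]
  · have h1 : S.d0 m n ((e.hom.f m).hom (q m x)) = (e.hom.f n).hom ((E.d m n).hom (q m x)) :=
      congrArg (fun z => z.hom (q m x)) (e.hom.comm m n)
    refine h1.trans ?_
    simp
  · have h1 : (E.d m n).hom ((e.inv.f m).hom x) = (e.inv.f n).hom (S.d0 m n x) :=
      congrArg (fun z => z.hom x) (e.inv.comm m n)
    simp [h1]
  · have h1 := Homotopy.comm_apply s n (q n x)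
    have h2 : ((e.hom ≫ e.inv).f n).hom (q n x) = (e.inv.f n).hom ((e.hom.f n).hom (q n x)) := rfl
    have h3 : ((𝟙 E : E ⟶ E).f n).hom (q n x) = q n x := rfl
    rw [h2, h3] at h1
    simp [h1]
  · have h1 := Homotopy.comm_apply t n x
    have h2 : ((e.inv ≫ e.hom).f n).hom x = (e.hom.f n).hom ((e.inv.f n).hom x) := rfl
    refine Eq.trans ?_ (h2.symm.trans h1)
    simp

end Model

section Cone

variable {α : Type w} [PartialOrder α] [OrderTop α] {𝒜 : DGPresheaf.{u} α} {U₁ U₂ V : α}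
  {M : GMod.{u, v} 𝒜 U₁} {M' : GMod.{u, v'} 𝒜 U₂} {h₁ : V ≤ U₁} {h₂ : V ≤ U₂}

/-- Right multiplication on the cone. -/
noncomputable def kr (b : 𝒜.A V) : Tot M h₁ × Tot M' h₂ →+ Tot M h₁ × Tot M' h₂ :=
  (Tot.rmul b).prodMap (Tot.rmul b)

variable (M M' h₁ h₂) in
/-- The grading of the cone. -/
noncomputable def kdeg (m : ℤ) : AddSubgroup (Tot M h₁ × Tot M' h₂) :=
  (Tot.deg M h₁ (m + 1)).prod (Tot.deg M' h₂ m)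

variable (M M' h₁ h₂) in
/-- The filtration of the cone by form degree. -/
noncomputable def kfil (j : ℕ) : AddSubgroup (Tot M h₁ × Tot M' h₂) :=
  (Tot.fil M h₁ j).prod (Tot.fil M' h₂ j)

/-- Linear endomorphisms of the cone. -/
def KLin (u : AddMonoid.End (Tot M h₁ × Tot M' h₂)) : Prop :=
  ∀ b x, u (kr b x) = kr b (u x)

/-- Endomorphisms of the cone of degree `k`. -/
def KDeg (k : ℤ) (u : AddMonoid.End (Tot M h₁ × Tot M' h₂)) : Prop :=
  ∀ m x, x ∈ kdeg M M' h₁ h₂ m → u x ∈ kdeg M M' h₁ h₂ (m + k)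

/-- Endomorphisms of the cone that raise the form degree by `r`. -/
def KOrd (r : ℕ) (u : AddMonoid.End (Tot M h₁ × Tot M' h₂)) : Prop :=
  ∀ j x, x ∈ kfil M M' h₁ h₂ j → u x ∈ kfil M M' h₁ h₂ (j + r)

/-- Endomorphisms of the cone that satisfy the Leibniz rule. -/
def KConn (u : AddMonoid.End (Tot M h₁ × Tot M' h₂)) : Prop :=
  ∀ m x, x ∈ kdeg M M' h₁ h₂ m → ∀ b, u (kr b x) = kr b (u x) + sgn m • kr (𝒜.d V b) x

theorem k_induction (fr : Frame 𝒜) {p : Tot M h₁ × Tot M' h₂ → Prop} (x : Tot M h₁ × Tot M' h₂)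
    (hd : ∀ m x, x ∈ kdeg M M' h₁ h₂ m → p x) (ha : ∀ x y, p x → p y → p (x + y)) : p x := by
  have h0 : p 0 := hd 0 0 (AddSubgroup.zero_mem _)
  have e : x = (x.1, 0) + (0, x.2) := by simp
  rw [e]
  refine ha _ _ ?_ ?_
  · refine Tot.induction_hom fr (p := fun y => p (y, 0)) x.1 h0 (fun n j e b hb => ?_) ?_
    · exact hd (n + j - 1) _ ⟨Tot.mk_mem_deg e hb (by ring), AddSubgroup.zero_mem _⟩
    · intro y z hy hz
      have := ha _ _ hy hz
      rwa [Prod.mk_add_mk, add_zero] at this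
  · refine Tot.induction_hom fr (p := fun y => p (0, y)) x.2 h0 (fun n j e b hb => ?_) ?_
    · exact hd (n + j) _ ⟨AddSubgroup.zero_mem _, Tot.mk_mem_deg e hb rfl⟩
    · intro y z hy hz
      have := ha _ _ hy hz
      rwa [Prod.mk_add_mk, add_zero] at this

section Closure

variable {u₁ u₂ : AddMonoid.End (Tot M h₁ × Tot M' h₂)} {k k' : ℤ} {r r' : ℕ}

theorem KLin.mul (h : KLin u₁) (h' : KLin u₂) : KLin (u₁ * u₂) := fun b x => by
  change u₁ (u₂ (kr b x)) = kr b (u₁ (u₂ x))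
  rw [h', h]

theorem KLin.sub (h : KLin u₁) (h' : KLin u₂) : KLin (u₁ - u₂) := fun b x => by
  change u₁ (kr b x) - u₂ (kr b x) = kr b (u₁ x - u₂ x)
  rw [h', h, map_sub]

theorem KLin.add (h : KLin u₁) (h' : KLin u₂) : KLin (u₁ + u₂) := fun b x => by
  change u₁ (kr b x) + u₂ (kr b x) = kr b (u₁ x + u₂ x)
  rw [h', h, map_add]

theorem KLin.one : KLin (1 : AddMonoid.End (Tot M h₁ × Tot M' h₂)) := fun b x => rfl

theorem KDeg.mul (h : KDeg k u₁) (h' : KDeg k' u₂) : KDeg (k' + k) (u₁ * u₂) := fun m x hx => by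
  have := h _ _ (h' m x hx)
  rwa [add_assoc] at this

theorem KDeg.sub (h : KDeg k u₁) (h' : KDeg k u₂) : KDeg k (u₁ - u₂) := fun m x hx =>
  AddSubgroup.sub_mem _ (h m x hx) (h' m x hx)

theorem KDeg.add (h : KDeg k u₁) (h' : KDeg k u₂) : KDeg k (u₁ + u₂) := fun m x hx =>
  AddSubgroup.add_mem _ (h m x hx) (h' m x hx)

theorem KDeg.one : KDeg 0 (1 : AddMonoid.End (Tot M h₁ × Tot M' h₂)) := fun m x hx => by
  rw [add_zero]; exact hx

theorem KOrd.mul (h : KOrd r u₁) (h' : KOrd r' u₂) : KOrd (r' + r) (u₁ * u₂) := fun m x hx => by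
  have := h _ _ (h' m x hx)
  rwa [add_assoc] at this

theorem KOrd.mul0 (h : KOrd r u₁) (h' : KOrd 0 u₂) : KOrd r (u₁ * u₂) := by
  have := h.mul h'
  rwa [zero_add] at this

theorem KOrd.mono (h : KOrd r' u₁) (hr : r ≤ r') : KOrd r u₁ := fun j x hx =>
  AddSubgroup.prod_mono (Tot.fil_anti (by omega)) (Tot.fil_anti (by omega)) (h j x hx)

theorem KOrd.sub (h : KOrd r u₁) (h' : KOrd r u₂) : KOrd r (u₁ - u₂) := fun m x hx =>
  AddSubgroup.sub_mem _ (h m x hx) (h' m x hx)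

theorem KOrd.add (h : KOrd r u₁) (h' : KOrd r u₂) : KOrd r (u₁ + u₂) := fun m x hx =>
  AddSubgroup.add_mem _ (h m x hx) (h' m x hx)

theorem KOrd.neg (h : KOrd r u₁) : KOrd r (-u₁) := fun m x hx =>
  AddSubgroup.neg_mem _ (h m x hx)

theorem KOrd.eq_zero (fr : Frame 𝒜) {N : ℕ} (hN : ∀ s, fr.dg s < N) (h : KOrd N u₁) : u₁ = 0 := by
  refine AddMonoidHom.ext fun x => ?_
  have h1 := h 0 x ⟨Tot.mem_fil_zero fr _, Tot.mem_fil_zero fr _⟩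
  rw [zero_add] at h1
  exact Prod.ext (Tot.fil_eq_bot fr hN h1.1) (Tot.fil_eq_bot fr hN h1.2)

/-- The square of a connection is linear. -/
theorem KConn.sq (fr : Frame 𝒜) (h : KConn u₁) (hd : KDeg 1 u₁) : KLin (u₁ * u₁) := fun b x =>
  k_induction fr (p := fun x => (u₁ * u₁) (kr b x) = kr b ((u₁ * u₁) x)) x (fun m x hx => by
    change u₁ (u₁ (kr b x)) = kr b (u₁ (u₁ x))
    rw [h m x hx, map_add, map_zsmul, h _ _ (hd m x hx), h m x hx, 𝒜.d_d, sgn_add, sgn_one]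
    have : kr (0 : 𝒜.A V) x = 0 := Prod.ext (Tot.rmul_zero _) (Tot.rmul_zero _)
    rw [this]
    simp) fun x y hx hy => by simp only [map_add, hx, hy]

theorem KConn.sub_lin (h : KConn u₁) (h' : KLin u₂) : KConn (u₁ - u₂) := fun m x hx b => by
  change u₁ (kr b x) - u₂ (kr b x) = kr b (u₁ x - u₂ x) + _
  rw [h m x hx, h', map_sub]
  abel

/-- Anticommutators of connections with linear maps of degree `-1` are linear. -/
theorem KConn.anticomm (fr : Frame 𝒜) (h : KConn u₁) (hl : KLin u₂) (hd : KDeg (-1) u₂) :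
    KLin (u₁ * u₂ + u₂ * u₁) := fun b x =>
  k_induction fr (p := fun x => (u₁ * u₂ + u₂ * u₁) (kr b x) = kr b ((u₁ * u₂ + u₂ * u₁) x)) x
    (fun m x hx => by
      change u₁ (u₂ (kr b x)) + u₂ (u₁ (kr b x)) = kr b (u₁ (u₂ x) + u₂ (u₁ x))
      rw [h m x hx, hl, h _ _ (hd m x hx), map_add, map_zsmul, hl, hl, map_add,
        sgn_congr_odd (a := m + -1) (b := m) ⟨-1, by ring⟩, neg_smul]
      abel) fun x y hx hy => by simp only [map_add, hx, hy]

end Closure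

theorem flat_step_anticomm {R : Type*} [Ring R] (D H : R) :
    (D - H * (D * D)) * H + H * (D - H * (D * D)) - 1 =
      (D * H + H * D - 1) - (H * (D * D) * H + H * (H * (D * D))) := by noncomm_ring

theorem flat_step_sq {R : Type*} [Ring R] (D H : R) :
    (D - H * (D * D)) * (D - H * (D * D)) =
      H * (D * D) * (H * (D * D)) - (D * H + H * D - 1) * (D * D) := by noncomm_ring

theorem commute_of_sq_zero {R : Type*} [Ring R] (D H : R) (h : D * D = 0) :
    D * (1 - (D * H + H * D)) = (1 - (D * H + H * D)) * D := by
  have e1 : D * (1 - (D * H + H * D)) = D - (D * D) * H - D * H * D := by noncomm_ring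
  have e2 : (1 - (D * H + H * D)) * D = D - D * H * D - H * (D * D) := by noncomm_ring
  rw [e1, e2, h]
  simp

theorem contraction_mul {R : Type*} [Ring R] (D H w : R) (h : D * w = w * D) :
    D * (H * w) + H * w * D = (1 - (1 - (D * H + H * D))) * w := by
  rw [mul_assoc H w D, ← h]
  noncomm_ring

/-- One step of the correction of an almost flat connection. -/
theorem exists_flat_step (fr : Frame 𝒜) (D H : AddMonoid.End (Tot M h₁ × Tot M' h₂)) (r : ℕ)
    (hr : 1 ≤ r) (hD0 : KOrd 0 D) (hH0 : KOrd 0 H) (hH : KOrd 1 (D * H + H * D - 1))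
    (hD : KOrd r (D * D)) :
    KOrd r (H * (D * D)) ∧ KOrd 0 (D - H * (D * D)) ∧
      KOrd 1 ((D - H * (D * D)) * H + H * (D - H * (D * D)) - 1) ∧
      KOrd (r + 1) ((D - H * (D * D)) * (D - H * (D * D))) := by
  have h1 : KOrd r (H * (D * D)) := hH0.mul hD
  refine ⟨h1, hD0.sub (h1.mono (Nat.zero_le _)), ?_, ?_⟩
  · rw [flat_step_anticomm]
    refine hH.sub (((h1.mul0 hH0).add (hH0.mul h1)).mono hr)
  · rw [flat_step_sq]
    exact ((h1.mul h1).mono (by omega)).sub (hH.mul hD)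

/-- An almost flat connection with an almost contraction can be corrected to a flat one. -/
theorem exists_flat (fr : Frame 𝒜) (D H : AddMonoid.End (Tot M h₁ × Tot M' h₂))
    (hD0 : KOrd 0 D) (hH0 : KOrd 0 H) (hH : KOrd 1 (D * H + H * D - 1)) (hD : KOrd 1 (D * D))
    (hHl : KLin H) (hHd : KDeg (-1) H) (hDc : KConn D) (hDd : KDeg 1 D)
    (hD2 : ∀ y, (D (0, y)).1 = 0) (hD3 : ∀ y, D (D (0, y)) = 0) :
    ∃ D' : AddMonoid.End (Tot M h₁ × Tot M' h₂), D' * D' = 0 ∧ KConn D' ∧ KDeg 1 D' ∧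
      (∀ y, D' (0, y) = D (0, y)) ∧ KOrd 1 (D' - D) := by
  obtain ⟨N, hN⟩ := fr.exists_bound
  have key : ∀ r : ℕ, ∃ D' : AddMonoid.End (Tot M h₁ × Tot M' h₂), KConn D' ∧ KDeg 1 D' ∧
      (∀ y, D' (0, y) = D (0, y)) ∧ KOrd 1 (D' - D) ∧ KOrd 0 D' ∧
      KOrd 1 (D' * H + H * D' - 1) ∧ KOrd (r + 1) (D' * D') := by
    intro r
    induction r with
    | zero => exact ⟨D, hDc, hDd, fun _ => rfl, by rw [sub_self]; exact fun j x _ => AddSubgroup.zero_mem _,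
        hD0, hH, hD⟩
    | succ r ih =>
      obtain ⟨D', a1, a2, a3, a4, a5, a6, a7⟩ := ih
      obtain ⟨b1, b2, b3, b4⟩ := exists_flat_step fr D' H (r + 1) (by omega) a5 hH0 a6 a7
      refine ⟨D' - H * (D' * D'), a1.sub_lin (hHl.mul (a1.sq fr a2)), ?_, fun y => ?_, ?_, b2, b3, b4⟩
      · have := hHd.mul (a2.mul a2)
        exact a2.sub (by simpa using this)
      · have e : D (0, y) = (0, (D (0, y)).2) := Prod.ext (hD2 y) rfl
        have : D' (D' (0, y)) = 0 := by
          rw [a3 y, e, a3, ← e, hD3]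
        change D' (0, y) - H (D' (D' (0, y))) = _
        rw [this, map_zero, sub_zero, a3]
      · have e : D' - H * (D' * D') - D = (D' - D) - H * (D' * D') := by abel
        rw [e]
        exact a4.sub (b1.mono (by omega))
  obtain ⟨D', a1, a2, a3, a4, a5, a6, a7⟩ := key N
  exact ⟨D', (a7.mono (Nat.le_succ N)).eq_zero fr hN, a1, a2, a3, a4⟩

/-- An almost contraction of a flat connection can be corrected to a contraction. -/
theorem exists_contraction (fr : Frame 𝒜) (D H : AddMonoid.End (Tot M h₁ × Tot M' h₂))
    (hDD : D * D = 0) (hDc : KConn D) (hDd : KDeg 1 D) (hHl : KLin H) (hHd : KDeg (-1) H)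
    (hH : KOrd 1 (D * H + H * D - 1)) :
    ∃ h : AddMonoid.End (Tot M h₁ × Tot M' h₂), KLin h ∧ KDeg (-1) h ∧ D * h + h * D = 1 := by
  obtain ⟨N, hN⟩ := fr.exists_bound
  set ν := 1 - (D * H + H * D) with hν
  have hνo : KOrd 1 ν := by
    have : ν = -(D * H + H * D - 1) := by rw [hν]; abel
    rw [this]
    exact hH.neg
  have hνl : KLin ν := KLin.one.sub (hDc.anticomm fr hHl hHd)
  have hνd : KDeg 0 ν := by
    have a := hDd.mul hHd
    have b := hHd.mul hDd
    rw [neg_add_cancel] at a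
    rw [add_neg_cancel] at b
    exact KDeg.one.sub (a.add b)
  have hcomm : D * ν = ν * D := commute_of_sq_zero D H hDD
  have hpow : ∀ n, KLin (ν ^ n) ∧ KDeg 0 (ν ^ n) ∧ KOrd n (ν ^ n) := by
    intro n
    induction n with
    | zero => exact ⟨KLin.one, KDeg.one, fun j x hx => hx⟩
    | succ n ih =>
      obtain ⟨a, b, c⟩ := ih
      rw [pow_succ]
      refine ⟨a.mul hνl, ?_, ?_⟩
      · have := b.mul hνd
        rwa [add_zero] at this
      · have := c.mul hνo
        rwa [add_comm 1 n] at this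
  have hz : ν ^ N = 0 := (hpow N).2.2.eq_zero fr hN
  set w := ∑ n ∈ Finset.range N, ν ^ n with hw
  have hw1 : (1 - ν) * w = 1 := by
    rw [hw, mul_neg_geom_sum, hz, sub_zero]
  have hwl : KLin w ∧ KDeg 0 w := by
    rw [hw]
    refine Finset.sum_induction _ (fun z => KLin z ∧ KDeg 0 z) ?_ ?_ fun n _ => ⟨(hpow n).1, (hpow n).2.1⟩
    · exact fun a b ha hb => ⟨ha.1.add hb.1, ha.2.add hb.2⟩
    · exact ⟨fun b x => (map_zero (kr b)).symm, fun m x _ => AddSubgroup.zero_mem _⟩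
  have hwc : D * w = w * D := by
    have : Commute D w := by
      rw [hw]
      exact Commute.sum_right _ _ _ fun n _ => (show Commute D ν from hcomm).pow_right n
    exact this
  refine ⟨H * w, hHl.mul hwl.1, ?_, ?_⟩
  · have := hHd.mul hwl.2
    rwa [zero_add] at this
  · exact (contraction_mul D H w hwc).trans hw1

end Cone

section FilteredOrder

variable {α : Type w} [PartialOrder α] [OrderTop α] {𝒜 : DGPresheaf.{u} α} {U₁ U₂ U₃ V : α}
  {M : GMod.{u, v} 𝒜 U₁} {M' : GMod.{u, v'} 𝒜 U₂} {M'' : GMod.{u, w'} 𝒜 U₃}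
  {h₁ : V ≤ U₁} {h₂ : V ≤ U₂} {h₃ : V ≤ U₃}

/-- Maps of total modules that raise the form degree by `r`. -/
def TOrd (r : ℕ) (O : Tot M h₁ →+ Tot M' h₂) : Prop :=
  ∀ j x, x ∈ Tot.fil M h₁ j → O x ∈ Tot.fil M' h₂ (j + r)

theorem TOrd.add {r : ℕ} {O O' : Tot M h₁ →+ Tot M' h₂} (h : TOrd r O) (h' : TOrd r O') :
    TOrd r (O + O') := fun j x hx => AddSubgroup.add_mem _ (h j x hx) (h' j x hx)

theorem TOrd.sub {r : ℕ} {O O' : Tot M h₁ →+ Tot M' h₂} (h : TOrd r O) (h' : TOrd r O') :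
    TOrd r (O - O') := fun j x hx => AddSubgroup.sub_mem _ (h j x hx) (h' j x hx)

theorem TOrd.zero {r : ℕ} : TOrd r (0 : Tot M h₁ →+ Tot M' h₂) :=
  fun j x hx => AddSubgroup.zero_mem _

theorem TOrd.mono {r r' : ℕ} (hr : r ≤ r') {O : Tot M h₁ →+ Tot M' h₂} (h : TOrd r' O) :
    TOrd r O := fun j x hx => Tot.fil_anti (by omega) (h j x hx)

theorem TOrd.comp {r r' : ℕ} {O : Tot M h₁ →+ Tot M' h₂} {O' : Tot M' h₂ →+ Tot M'' h₃}
    (h' : TOrd r' O') (h : TOrd r O) : TOrd (r + r') (O'.comp O) := fun j x hx => by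
  have := h' _ _ (h j x hx)
  rwa [add_assoc] at this

theorem IsLin.tOrd (fr : Frame 𝒜) {O : Tot M h₁ →+ Tot M' h₂} (h : IsLin O) : TOrd 0 O :=
  fun j x hx => h.map_fil fr hx

theorem IsLin.tOrd_of {fr : Frame 𝒜} {r : ℕ} {O : Tot M h₁ →+ Tot M' h₂} (h : IsLin O)
    (hr : ∀ n e, O (Tot.mk h₁ n e 1) ∈ Tot.fil M' h₂ r) : TOrd r O :=
  fun j x hx => h.map_fil_add fr hr hx

theorem TOrd.of_sub {O O' : Tot M h₁ →+ Tot M' h₂} (h : TOrd 1 (O - O')) (h' : TOrd 0 O') :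
    TOrd 0 O := by
  have := (h.mono (Nat.zero_le 1)).add h'
  rwa [sub_add_cancel] at this

/-- Compositions of maps that agree up to terms of higher form degree. -/
theorem TOrd.comp_congr {O O₁ : Tot M h₁ →+ Tot M' h₂} {O' O₁' : Tot M' h₂ →+ Tot M'' h₃}
    (h : TOrd 1 (O - O₁)) (h' : TOrd 1 (O' - O₁')) (h0 : TOrd 0 O₁) (h0' : TOrd 0 O') :
    TOrd 1 (O'.comp O - O₁'.comp O₁) := by
  have e : O'.comp O - O₁'.comp O₁ = O'.comp (O - O₁) + (O' - O₁').comp O₁ := by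
    ext x; simp
  rw [e]
  have a := h0'.comp h
  have b := h'.comp h0
  rw [zero_add] at b
  exact TOrd.add a b

/-- The connection of the cone. -/
noncomputable def coneD (D : Tot M h₁ →+ Tot M h₁) (D' : Tot M' h₂ →+ Tot M' h₂)
    (f : Tot M h₁ →+ Tot M' h₂) : AddMonoid.End (Tot M h₁ × Tot M' h₂) :=
  AddMonoidHom.prod ((-D).comp (AddMonoidHom.fst _ _)) (AddMonoidHom.coprod f D')

/-- The contraction of the cone of a homotopy equivalence. -/
noncomputable def coneH (f : Tot M h₁ →+ Tot M' h₂) (g : Tot M' h₂ →+ Tot M h₁)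
    (s : Tot M h₁ →+ Tot M h₁) (t : Tot M' h₂ →+ Tot M' h₂) :
    AddMonoid.End (Tot M h₁ × Tot M' h₂) :=
  AddMonoidHom.prod (AddMonoidHom.coprod (s - g.comp (f.comp s - t.comp f)) g)
    (AddMonoidHom.coprod (t.comp (f.comp s - t.comp f)) (-t))

theorem coneD_apply (D : Tot M h₁ →+ Tot M h₁) (D' : Tot M' h₂ →+ Tot M' h₂)
    (f : Tot M h₁ →+ Tot M' h₂) (z : Tot M h₁ × Tot M' h₂) :
    coneD D D' f z = (-D z.1, f z.1 + D' z.2) := rfl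

theorem coneH_apply (f : Tot M h₁ →+ Tot M' h₂) (g : Tot M' h₂ →+ Tot M h₁)
    (s : Tot M h₁ →+ Tot M h₁) (t : Tot M' h₂ →+ Tot M' h₂) (z : Tot M h₁ × Tot M' h₂) :
    coneH f g s t z = (s z.1 - g (f (s z.1) - t (f z.1)) + g z.2,
      t (f (s z.1) - t (f z.1)) + -t z.2) := rfl

theorem cone_contraction_mod {D : Tot M h₁ →+ Tot M h₁} {D' : Tot M' h₂ →+ Tot M' h₂}
    {f : Tot M h₁ →+ Tot M' h₂} {g : Tot M' h₂ →+ Tot M h₁}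
    {s : Tot M h₁ →+ Tot M h₁} {t : Tot M' h₂ →+ Tot M' h₂}
    (hf : TOrd 0 f) (hg : TOrd 0 g) (hs : TOrd 0 s) (ht : TOrd 0 t)
    (hfD : TOrd 1 (D'.comp f - f.comp D)) (hgD : TOrd 1 (D.comp g - g.comp D'))
    (hgf : TOrd 1 (g.comp f - AddMonoidHom.id _ - (D.comp s + s.comp D)))
    (hfg : TOrd 1 (f.comp g - AddMonoidHom.id _ - (D'.comp t + t.comp D'))) :
    KOrd 1 (coneD D D' f * coneH f g s t + coneH f g s t * coneD D D' f - 1) := by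
  rintro j ⟨x, y⟩ ⟨hx, hy⟩
  have ef : ∀ j x, x ∈ Tot.fil M h₁ j → D' (f x) - f (D x) ∈ Tot.fil M' h₂ (j + 1) := hfD
  have eg : ∀ j y, y ∈ Tot.fil M' h₂ j → D (g y) - g (D' y) ∈ Tot.fil M h₁ (j + 1) := hgD
  have es : ∀ j x, x ∈ Tot.fil M h₁ j → g (f x) - x - (D (s x) + s (D x)) ∈
    Tot.fil M h₁ (j + 1) := hgf
  have et : ∀ j y, y ∈ Tot.fil M' h₂ j → f (g y) - y - (D' (t y) + t (D' y)) ∈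
    Tot.fil M' h₂ (j + 1) := hfg
  have hc : f (s x) - t (f x) ∈ Tot.fil M' h₂ j :=
    AddSubgroup.sub_mem _ (hf _ _ (hs _ _ hx)) (ht _ _ (hf _ _ hx))
  have hE : D' (f (s x) - t (f x)) + (f (s (D x)) - t (f (D x))) ∈ Tot.fil M' h₂ (j + 1) := by
    have h1 := hf _ _ (es j x hx)
    have h2 := et j (f x) (hf _ _ hx)
    have h3 := ef j (s x) (hs _ _ hx)
    have h4 := ht _ _ (ef j x hx)
    have := AddSubgroup.add_mem _ (AddSubgroup.sub_mem _ (AddSubgroup.add_mem _ h2 h3) h1) h4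
    convert this using 1
    simp only [map_sub, map_add]
    abel
  constructor
  · have h1 := es j x hx
    have h2 := eg j y hy
    have h3 := eg j _ hc
    have h4 := hg _ _ hE
    have := AddSubgroup.add_mem _ (AddSubgroup.add_mem _ (AddSubgroup.sub_mem _ h1 h2) h3) h4
    change -D (s x - g (f (s x) - t (f x)) + g y) + (s (-D x) - g (f (s (-D x)) - t (f (-D x))) +
      g (f x + D' y)) - x ∈ Tot.fil M h₁ (j + 1)
    convert this using 1
    simp only [map_sub, map_add, map_neg]
    abel
  · have h1 := et j y hy
    have h2 := et j _ hc
    have h4 := ht _ _ hE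
    have := AddSubgroup.sub_mem _ (AddSubgroup.sub_mem _ h1 h2) h4
    change (f (s x - g (f (s x) - t (f x)) + g y) + D' (t (f (s x) - t (f x)) + -t y)) +
      (t (f (s (-D x)) - t (f (-D x))) + -t (f x + D' y)) - y ∈ Tot.fil M' h₂ (j + 1)
    convert this using 1
    simp only [map_sub, map_add, map_neg]
    abel

theorem coneH_lin {f : Tot M h₁ →+ Tot M' h₂} {g : Tot M' h₂ →+ Tot M h₁}
    {s : Tot M h₁ →+ Tot M h₁} {t : Tot M' h₂ →+ Tot M' h₂} (hf : IsLin f) (hg : IsLin g)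
    (hs : IsLin s) (ht : IsLin t) : KLin (coneH f g s t) := fun b z => by
  rw [coneH_apply, coneH_apply]
  refine Prod.ext ?_ ?_
  · change s (Tot.rmul b z.1) - g (f (s (Tot.rmul b z.1)) - t (f (Tot.rmul b z.1))) +
      g (Tot.rmul b z.2) = Tot.rmul b (_ - _ + _)
    simp only [hs b, hf b, ht b, hg b, map_sub, map_add]
  · change t (f (s (Tot.rmul b z.1)) - t (f (Tot.rmul b z.1))) + -t (Tot.rmul b z.2) =
      Tot.rmul b (_ + _)
    simp only [hs b, hf b, ht b, map_sub, map_add, map_neg]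

theorem coneH_deg {f : Tot M h₁ →+ Tot M' h₂} {g : Tot M' h₂ →+ Tot M h₁}
    {s : Tot M h₁ →+ Tot M h₁} {t : Tot M' h₂ →+ Tot M' h₂} (hf : IsDeg 0 f) (hg : IsDeg 0 g)
    (hs : IsDeg (-1) s) (ht : IsDeg (-1) t) : KDeg (-1) (coneH f g s t) := by
  rintro m ⟨x, y⟩ ⟨hx, hy⟩
  replace hx : x ∈ Tot.deg M h₁ (m + 1) := hx
  replace hy : y ∈ Tot.deg M' h₂ m := hy
  have h1 : f (s x) - t (f x) ∈ Tot.deg M' h₂ m := by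
    have a := hf _ _ (hs _ _ hx)
    have b := ht _ _ (hf _ _ hx)
    rw [add_zero, add_neg_cancel_right] at a b
    exact AddSubgroup.sub_mem _ a b
  have h2 := hs _ _ hx
  have h3 := hg _ _ h1
  have h4 := hg _ _ hy
  have e : m + 1 + -1 = m + -1 + 1 := by ring
  rw [e] at h2
  rw [show m + 0 = m + -1 + 1 by ring] at h3 h4
  exact ⟨AddSubgroup.add_mem _ (AddSubgroup.sub_mem _ h2 h3) h4,
    AddSubgroup.add_mem _ (ht _ _ h1) (AddSubgroup.neg_mem _ (ht _ _ hy))⟩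

theorem coneD_deg {D : Tot M h₁ →+ Tot M h₁} {D' : Tot M' h₂ →+ Tot M' h₂}
    {f : Tot M h₁ →+ Tot M' h₂} (hD : IsDeg 1 D) (hD' : IsDeg 1 D') (hf : IsDeg 0 f) :
    KDeg 1 (coneD D D' f) := by
  rintro m ⟨x, y⟩ ⟨hx, hy⟩
  replace hx : x ∈ Tot.deg M h₁ (m + 1) := hx
  replace hy : y ∈ Tot.deg M' h₂ m := hy
  have h1 := hf _ _ hx
  rw [add_zero] at h1
  exact ⟨AddSubgroup.neg_mem _ (hD _ _ hx), AddSubgroup.add_mem _ h1 (hD' _ _ hy)⟩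

/-- The Leibniz rule. -/
def IsConn (D : Tot M h₁ →+ Tot M h₁) : Prop :=
  ∀ m x, x ∈ Tot.deg M h₁ m → ∀ b, D (Tot.rmul b x) = Tot.rmul b (D x) + sgn m • Tot.rmul (𝒜.d V b) x

theorem QCoh.connOn_isConn (E : QCoh.{u, v} 𝒜 U₁) (h : V ≤ U₁) : IsConn (E.connOn h) :=
  fun m x hx b => E.connOn_rmul h m x hx b

theorem coneD_conn {D : Tot M h₁ →+ Tot M h₁} {D' : Tot M' h₂ →+ Tot M' h₂}
    {f : Tot M h₁ →+ Tot M' h₂} (hD : IsConn D) (hD' : IsConn D') (hf : IsLin f) :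
    KConn (coneD D D' f) := by
  rintro m ⟨x, y⟩ ⟨hx, hy⟩ b
  rw [coneD_apply, coneD_apply]
  refine Prod.ext ?_ ?_
  · change -D (Tot.rmul b x) = Tot.rmul b (-D x) + sgn m • Tot.rmul (𝒜.d V b) x
    rw [hD _ x hx, sgn_congr_odd (a := m + 1) (b := m) ⟨0, by ring⟩, neg_smul, map_neg]
    abel
  · change f (Tot.rmul b x) + D' (Tot.rmul b y) = Tot.rmul b (f x + D' y) +
      sgn m • Tot.rmul (𝒜.d V b) y
    rw [hf, hD' _ y hy, map_add, add_assoc]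

end FilteredOrder

section ZeroOrder

variable {α : Type w} [PartialOrder α] [OrderTop α] {𝒜 : DGPresheaf.{u} α} {U V : α}
  {M : GMod.{u, v} 𝒜 U} {M' : GMod.{u, v'} 𝒜 U} {h : V ≤ U}

variable (h) in
/-- The morphism of total modules given by linear maps of the underlying modules. -/
noncomputable def lin0 (r : ℤ → ℤ) (g : ∀ n, M.Q n →ₗ[𝒜.A0 U] M'.Q (r n)) : Mor M M' h h where
  val := Tot.lift (fun n e b => Tot.mk h (r n) (g n e) b)
    (fun n e e' b => by rw [map_add, Tot.mk_add_left])
    (fun n e b b' => by rw [Tot.mk_add_right])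
    (fun n c e b => by rw [map_smul, Tot.mk_smul])
  lin := Tot.lift_lin _ _ _ _ fun n e b b' => by rw [Tot.rmul_mk]

theorem lin0_mk (r : ℤ → ℤ) (g : ∀ n, M.Q n →ₗ[𝒜.A0 U] M'.Q (r n)) (n : ℤ) (e : M.Q n) (b : 𝒜.A V) :
    (lin0 h r g).1 (Tot.mk h n e b) = Tot.mk h (r n) (g n e) b := by
  simp only [lin0, Tot.lift_mk]

theorem lin0_isDeg (r : ℤ → ℤ) (g : ∀ n, M.Q n →ₗ[𝒜.A0 U] M'.Q (r n)) (k : ℤ)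
    (hr : ∀ n, r n = n + k) : IsDeg k (lin0 h r g).1 :=
  Mor.isDeg_of_mk _ fun n e => by
    rw [lin0_mk]
    exact Tot.mk_mem_deg _ (one_mem_gr 𝒜) (by rw [hr]; simp)

theorem QCoh.conn_sub_lin0 (E : QCoh.{u, v} 𝒜 U) (fr : Frame 𝒜) :
    TOrd 1 (E.conn - (lin0 (le_refl U) (· + 1) fun n => E.d0L n (n + 1)).1) := by
  intro j x hx
  refine Tot.map_fil (E.conn - (lin0 (le_refl U) (· + 1) fun n => E.d0L n (n + 1)).1) _
    (fun n i e b hb hi => ?_) hx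
  rw [AddMonoidHom.sub_apply, lin0_mk, E.leibniz]
  have h1 := Tot.rmul_mem_fil_add fr hb (Tot.sub_sym_mem (E.conn_mk_one_mem n e))
  rw [map_sub, Tot.rmul_mk, one_mul] at h1
  have h2 : Tot.mk (M := E.toGMod) (le_refl U) n e (𝒜.d U b) ∈ Tot.fil E.toGMod (le_refl U) (j + 1) :=
    Tot.mk_mem_fil e (𝒜.d_mem_gr U _ _ hb) (by omega)
  have := AddSubgroup.add_mem _ (Tot.fil_anti (by omega : j + 1 ≤ 1 + i) h1)
    (AddSubgroup.zsmul_mem _ h2 (sgn n))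
  convert this using 1
  change _ + _ - Tot.mk (le_refl U) (n + 1) (E.d0 n (n + 1) e) b = _
  unfold QCoh.d0
  abel

theorem exists_conn (fr : Frame 𝒜) (M : GMod.{u, v} 𝒜 U)
    (hM : ∀ n, Module.Finite (𝒜.A0 U) (M.Q n) ∧ Module.Projective (𝒜.A0 U) (M.Q n)) :
    ∃ D : Tot M (le_refl U) →+ Tot M (le_refl U), IsConn D ∧ IsDeg 1 D ∧ TOrd 1 D := by
  have hb : ∀ n, ∃ (m : ℕ) (x : Fin m → M.Q n) (l : M.Q n →ₗ[𝒜.A0 U] (Fin m → 𝒜.A0 U)),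
      (∀ e, ∑ i, l e i • x i = e) := fun n => by
    have := (hM n).1
    have := (hM n).2
    obtain ⟨m, x, l, hx, -⟩ := exists_dualBasis (R := 𝒜.A0 U) (M.Q n)
    exact ⟨m, x, l, hx⟩
  choose m x l hx using hb
  let D : Tot M (le_refl U) →+ Tot M (le_refl U) :=
    Tot.lift (fun n e b => sgn n • ∑ i, Tot.mk (le_refl U) n (x n i)
        (𝒜.d U (𝒜.inc (le_refl U) (l n e i) * b)))
      (fun n e e' b => by
        rw [← smul_add, ← Finset.sum_add_distrib]
        congr 1
        refine Finset.sum_congr rfl fun i _ => ?_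
        rw [← Tot.mk_add_right, ← map_add, ← add_mul, ← inc_add, map_add, Pi.add_apply])
      (fun n e b b' => by
        rw [← smul_add, ← Finset.sum_add_distrib]
        congr 1
        refine Finset.sum_congr rfl fun i _ => ?_
        rw [← Tot.mk_add_right, ← map_add, ← mul_add])
      (fun n r e b => by
        congr 1
        refine Finset.sum_congr rfl fun i _ => ?_
        rw [map_smul, Pi.smul_apply, smul_eq_mul, inc_mul, inc_comm, mul_assoc,
          inc_comm 𝒜 _ _ b, ← mul_assoc])
  have hDm : ∀ n e b, D (Tot.mk _ n e b) = sgn n • ∑ i, Tot.mk (le_refl U) n (x n i)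
        (𝒜.d U (𝒜.inc (le_refl U) (l n e i) * b)) := fun n e b => Tot.lift_mk ..
  refine ⟨D, fun k z hz b => ?_, fun k z hz => ?_, fun j z hz => ?_⟩
  · refine Tot.deg_induction (p := fun z => D (Tot.rmul b z) =
      Tot.rmul b (D z) + sgn k • Tot.rmul (𝒜.d U b) z) hz (by simp) ?_ ?_ ?_
    · intro x y hx hy
      simp only [map_add, hx, hy, smul_add]; abel
    · intro x hx
      simp only [map_neg, hx, smul_neg]; abel
    · intro n j e b' hb' hn
      rw [Tot.rmul_mk, hDm, hDm, Tot.rmul_mk, map_zsmul, map_sum, ← hn, sgn_add, mul_smul, ← smul_add]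
      congr 1
      conv_rhs => rw [← hx n e]
      have h3 : Tot.mk (le_refl U) n (∑ i, l n e i • x n i) (b' * 𝒜.d U b) =
          ∑ i, Tot.mk (le_refl U) n (l n e i • x n i) (b' * 𝒜.d U b) :=
        map_sum ((Tot.mkHom (M := M) (le_refl U) n).flip (b' * 𝒜.d U b)) _ _
      rw [h3, hx, Finset.smul_sum, ← Finset.sum_add_distrib]
      refine Finset.sum_congr rfl fun i _ => ?_
      have h4 := 𝒜.mul_mem_gr U 0 j _ _ (inc_mem 𝒜 (le_refl U) (l n e i)) hb'
      rw [zero_add] at h4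
      rw [Tot.rmul_mk, ← mul_assoc, 𝒜.d_mul U j _ _ h4, Tot.mk_add_right, Tot.mk_zsmul_right,
        Tot.mk_smul, mul_assoc]
  · refine Tot.map_deg D _ (fun n j e b hb hn => ?_) hz
    rw [hDm]
    refine AddSubgroup.zsmul_mem _ (AddSubgroup.sum_mem _ fun i _ => ?_) _
    have h4 := 𝒜.mul_mem_gr U 0 j _ _ (inc_mem 𝒜 (le_refl U) (l n e i)) hb
    rw [zero_add] at h4
    exact Tot.mk_mem_deg _ (𝒜.d_mem_gr U _ _ h4) (by push_cast; omega)
  · refine Tot.map_fil D _ (fun n i e b hb hn => ?_) hz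
    rw [hDm]
    refine AddSubgroup.zsmul_mem _ (AddSubgroup.sum_mem _ fun k _ => ?_) _
    have h4 := 𝒜.mul_mem_gr U 0 i _ _ (inc_mem 𝒜 (le_refl U) (l n e k)) hb
    rw [zero_add] at h4
    exact Tot.mk_mem_fil _ (𝒜.d_mem_gr U _ _ h4) (by omega)

end ZeroOrder

section Resolution

variable {α : Type w} [SemilatticeInf α] [OrderTop α] {𝒜 : DGPresheaf.{u} α}

/-- A cohesive module with a closed morphism to `S` that is a homotopy equivalence up to terms of
positive form degree. -/
structure Resolution (S : QCoh.{u, v} 𝒜 (⊤ : α)) where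
  E : QCoh.{u, u} 𝒜 (⊤ : α)
  coh : E.IsCohesive
  φ : Mor E.toGMod S.toGMod (le_refl ⊤) (le_refl ⊤)
  φ_deg : IsDeg 0 φ.1
  φ_conn : S.conn.comp φ.1 = φ.1.comp E.conn
  ψ : Mor S.toGMod E.toGMod (le_refl ⊤) (le_refl ⊤)
  ψ_deg : IsDeg 0 ψ.1
  ψ_conn : TOrd 1 (E.conn.comp ψ.1 - ψ.1.comp S.conn)
  s : Mor E.toGMod E.toGMod (le_refl ⊤) (le_refl ⊤)
  s_deg : IsDeg (-1) s.1
  ψφ : TOrd 1 (ψ.1.comp φ.1 - AddMonoidHom.id _ - (E.conn.comp s.1 + s.1.comp E.conn))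
  t : Mor S.toGMod S.toGMod (le_refl ⊤) (le_refl ⊤)
  t_deg : IsDeg (-1) t.1
  φψ : TOrd 1 (φ.1.comp ψ.1 - AddMonoidHom.id _ - (S.conn.comp t.1 + t.1.comp S.conn))

section LinZero

variable {S : QCoh.{u, v} 𝒜 (⊤ : α)} (P : PerfModel S)

theorem PerfModel.lin_f_d (x) :
    (lin0 (le_refl ⊤) (· + 1) fun n => S.d0L n (n + 1)).1 ((lin0 (le_refl ⊤) id P.f).1 x) =
    (lin0 (le_refl ⊤) id P.f).1 ((lin0 (le_refl ⊤) (· + 1) fun n => P.d n (n + 1)).1 x) :=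
  Tot.ext_apply (f := (lin0 (le_refl ⊤) (· + 1) fun n => S.d0L n (n + 1)).1.comp
    (lin0 (le_refl ⊤) id P.f).1) (g := (lin0 (le_refl ⊤) id P.f).1.comp
    (lin0 (le_refl ⊤) (· + 1) fun n => P.d n (n + 1)).1) (fun n e b => by
      simp only [AddMonoidHom.comp_apply, lin0_mk, id]
      exact congrArg (fun z => Tot.mk (le_refl ⊤) (n + 1) z b) (P.f_d n (n + 1) e)) x

theorem PerfModel.lin_g_d (x) :
    (lin0 (le_refl ⊤) (· + 1) fun n => P.d n (n + 1)).1 ((lin0 (le_refl ⊤) id P.g).1 x) =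
    (lin0 (le_refl ⊤) id P.g).1 ((lin0 (le_refl ⊤) (· + 1) fun n => S.d0L n (n + 1)).1 x) :=
  Tot.ext_apply (f := (lin0 (le_refl ⊤) (· + 1) fun n => P.d n (n + 1)).1.comp
    (lin0 (le_refl ⊤) id P.g).1) (g := (lin0 (le_refl ⊤) id P.g).1.comp
    (lin0 (le_refl ⊤) (· + 1) fun n => S.d0L n (n + 1)).1) (fun n e b => by
      simp only [AddMonoidHom.comp_apply, lin0_mk, id]
      exact congrArg (fun z => Tot.mk (le_refl ⊤) (n + 1) z b) (P.g_d n (n + 1) e)) x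

theorem PerfModel.lin_d_d (x) :
    (lin0 (le_refl ⊤) (· + 1) fun n => P.d n (n + 1)).1
      ((lin0 (le_refl ⊤) (· + 1) fun n => P.d n (n + 1)).1 x) = 0 :=
  Tot.ext_apply (f := (lin0 (le_refl ⊤) (· + 1) fun n => P.d n (n + 1)).1.comp
    (lin0 (le_refl ⊤) (· + 1) fun n => P.d n (n + 1)).1) (g := 0) (fun n e b => by
      simp only [AddMonoidHom.comp_apply, lin0_mk, P.d_d, Tot.mk_zero_left,
        AddMonoidHom.zero_apply]) x

theorem PerfModel.lin_g_f (x) :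
    (lin0 (le_refl ⊤) id P.g).1 ((lin0 (le_refl ⊤) id P.f).1 x) - x =
    (lin0 (le_refl ⊤) (· + 1) fun n => P.d n (n + 1)).1
      ((lin0 (le_refl ⊤) (· - 1) fun n => P.s n (n - 1)).1 x) +
    (lin0 (le_refl ⊤) (· - 1) fun n => P.s n (n - 1)).1
      ((lin0 (le_refl ⊤) (· + 1) fun n => P.d n (n + 1)).1 x) :=
  Tot.ext_apply (f := (lin0 (le_refl ⊤) id P.g).1.comp (lin0 (le_refl ⊤) id P.f).1 -
      AddMonoidHom.id _)
    (g := (lin0 (le_refl ⊤) (· + 1) fun n => P.d n (n + 1)).1.comp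
      (lin0 (le_refl ⊤) (· - 1) fun n => P.s n (n - 1)).1 +
      (lin0 (le_refl ⊤) (· - 1) fun n => P.s n (n - 1)).1.comp
      (lin0 (le_refl ⊤) (· + 1) fun n => P.d n (n + 1)).1) (fun n e b => by
      simp only [AddMonoidHom.comp_apply, AddMonoidHom.sub_apply, AddMonoidHom.add_apply,
        AddMonoidHom.id_apply, lin0_mk, id]
      have h1 := Tot.mk_congr (M := P.E) (h := le_refl ⊤) (sub_add_cancel n 1)
        (fun m => P.d (n - 1) m (P.s n (n - 1) e)) b
      have h2 := Tot.mk_congr (M := P.E) (h := le_refl ⊤) (add_sub_cancel_right n 1)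
        (fun m => P.s (n + 1) m (P.d n (n + 1) e)) b
      rw [h1, h2, P.g_f, Tot.mk_add_left, Tot.mk_add_left]
      abel) x

theorem PerfModel.lin_f_g (x) :
    (lin0 (le_refl ⊤) id P.f).1 ((lin0 (le_refl ⊤) id P.g).1 x) - x =
    (lin0 (le_refl ⊤) (· + 1) fun n => S.d0L n (n + 1)).1
      ((lin0 (le_refl ⊤) (· - 1) fun n => P.t n (n - 1)).1 x) +
    (lin0 (le_refl ⊤) (· - 1) fun n => P.t n (n - 1)).1
      ((lin0 (le_refl ⊤) (· + 1) fun n => S.d0L n (n + 1)).1 x) :=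
  Tot.ext_apply (f := (lin0 (le_refl ⊤) id P.f).1.comp (lin0 (le_refl ⊤) id P.g).1 -
      AddMonoidHom.id _)
    (g := (lin0 (le_refl ⊤) (· + 1) fun n => S.d0L n (n + 1)).1.comp
      (lin0 (le_refl ⊤) (· - 1) fun n => P.t n (n - 1)).1 +
      (lin0 (le_refl ⊤) (· - 1) fun n => P.t n (n - 1)).1.comp
      (lin0 (le_refl ⊤) (· + 1) fun n => S.d0L n (n + 1)).1) (fun n e b => by
      simp only [AddMonoidHom.comp_apply, AddMonoidHom.sub_apply, AddMonoidHom.add_apply,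
        AddMonoidHom.id_apply, lin0_mk, id]
      have h1 := Tot.mk_congr (M := S.toGMod) (h := le_refl ⊤) (sub_add_cancel n 1)
        (fun m => S.d0L (n - 1) m (P.t n (n - 1) e)) b
      have h2 := Tot.mk_congr (M := S.toGMod) (h := le_refl ⊤) (add_sub_cancel_right n 1)
        (fun m => P.t (n + 1) m (S.d0L n (n + 1) e)) b
      have h3 : P.f n (P.g n e) = P.t (n + 1) n (S.d0L n (n + 1) e) +
        S.d0L (n - 1) n (P.t n (n - 1) e) + e := P.f_g n e
      rw [h1, h2, h3, Tot.mk_add_left, Tot.mk_add_left]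
      abel) x

end LinZero

/-- Replacing maps by maps that agree up to higher form degree in a homotopy relation. -/
theorem TOrd.homotopy_congr {U₁ V : α} {M : GMod.{u, v} 𝒜 U₁} {h₁ : V ≤ U₁}
    {a D D₁ s : Tot M h₁ →+ Tot M h₁} (hD : TOrd 1 (D - D₁)) (hs : TOrd 0 s)
    (h : TOrd 1 (a - (D₁.comp s + s.comp D₁))) : TOrd 1 (a - (D.comp s + s.comp D)) := by
  have e : a - (D.comp s + s.comp D) = a - (D₁.comp s + s.comp D₁) -
      ((D - D₁).comp s + s.comp (D - D₁)) := by
    ext x; simp; abel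
  rw [e]
  exact h.sub ((hD.comp hs).add (hs.comp hD))

theorem nonempty_resolution (fr : Frame 𝒜) {S : QCoh.{u, v} 𝒜 (⊤ : α)} (P : PerfModel S) :
    Nonempty (Resolution S) := by
  obtain ⟨D₁, hD₁c, hD₁d, hD₁o⟩ := exists_conn fr P.E P.fg
  let dl := lin0 (M := P.E) (M' := P.E) (le_refl ⊤) (· + 1) fun n => P.d n (n + 1)
  let dS := lin0 (M := S.toGMod) (M' := S.toGMod) (le_refl ⊤) (· + 1) fun n => S.d0L n (n + 1)
  let f := lin0 (M := P.E) (M' := S.toGMod) (le_refl ⊤) id P.f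
  let g := lin0 (M := S.toGMod) (M' := P.E) (le_refl ⊤) id P.g
  let s := lin0 (M := P.E) (M' := P.E) (le_refl ⊤) (· - 1) fun n => P.s n (n - 1)
  let t := lin0 (M := S.toGMod) (M' := S.toGMod) (le_refl ⊤) (· - 1) fun n => P.t n (n - 1)
  have hfd : IsDeg 0 f.1 := lin0_isDeg _ _ 0 (by simp)
  have hgd : IsDeg 0 g.1 := lin0_isDeg _ _ 0 (by simp)
  have hsd : IsDeg (-1) s.1 := lin0_isDeg _ _ _ (fun n => sub_eq_add_neg n 1)
  have htd : IsDeg (-1) t.1 := lin0_isDeg _ _ _ (fun n => sub_eq_add_neg n 1)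
  have hld : IsDeg 1 dl.1 := lin0_isDeg _ _ _ (fun n => rfl)
  have hSo := S.conn_sub_lin0 fr
  have f0 : TOrd 0 f.1 := f.2.tOrd fr
  have g0 : TOrd 0 g.1 := g.2.tOrd fr
  have s0 : TOrd 0 s.1 := s.2.tOrd fr
  have t0 : TOrd 0 t.1 := t.2.tOrd fr
  have dl0 : TOrd 0 dl.1 := dl.2.tOrd fr
  have dS0 : TOrd 0 dS.1 := dS.2.tOrd fr
  have S0 : TOrd 0 S.conn := hSo.of_sub dS0
  -- relations for every operator that agrees with `dl` up to higher form degree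
  have rf : ∀ D : Tot P.E (le_refl ⊤) →+ Tot P.E (le_refl ⊤), TOrd 1 (D - dl.1) →
      TOrd 1 (S.conn.comp f.1 - f.1.comp D) := fun D hD => by
    have e : S.conn.comp f.1 - f.1.comp D = (S.conn - dS.1).comp f.1 - f.1.comp (D - dl.1) := by
      ext x
      have : dS.1 (f.1 x) = f.1 (dl.1 x) := P.lin_f_d x
      simp [this]
    rw [e]
    exact (hSo.comp f0).sub (f0.comp hD)
  have rg : ∀ D : Tot P.E (le_refl ⊤) →+ Tot P.E (le_refl ⊤), TOrd 1 (D - dl.1) →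
      TOrd 1 (D.comp g.1 - g.1.comp S.conn) := fun D hD => by
    have e : D.comp g.1 - g.1.comp S.conn = (D - dl.1).comp g.1 - g.1.comp (S.conn - dS.1) := by
      ext x
      have : dl.1 (g.1 x) = g.1 (dS.1 x) := P.lin_g_d x
      simp [this]
    rw [e]
    exact (hD.comp g0).sub (g0.comp hSo)
  have rs : ∀ D : Tot P.E (le_refl ⊤) →+ Tot P.E (le_refl ⊤), TOrd 1 (D - dl.1) →
      TOrd 1 (g.1.comp f.1 - AddMonoidHom.id _ - (D.comp s.1 + s.1.comp D)) := fun D hD => by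
    refine TOrd.homotopy_congr hD s0 ?_
    have e : g.1.comp f.1 - AddMonoidHom.id _ - (dl.1.comp s.1 + s.1.comp dl.1) = 0 := by
      refine AddMonoidHom.ext fun x => sub_eq_zero.2 (P.lin_g_f x)
    rw [e]
    exact TOrd.zero
  have rt : TOrd 1 (f.1.comp g.1 - AddMonoidHom.id _ - (S.conn.comp t.1 + t.1.comp S.conn)) := by
    refine TOrd.homotopy_congr hSo t0 ?_
    have e : f.1.comp g.1 - AddMonoidHom.id _ - (dS.1.comp t.1 + t.1.comp dS.1) = 0 := by
      refine AddMonoidHom.ext fun x => sub_eq_zero.2 (P.lin_f_g x)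
    rw [e]
    exact TOrd.zero
  let D₀ := dl.1 + D₁
  have hD₀ : TOrd 1 (D₀ - dl.1) := by
    rw [show D₀ - dl.1 = D₁ by simp [D₀]]
    exact hD₁o
  have D0 : TOrd 0 D₀ := hD₀.of_sub dl0
  have hD₀c : IsConn D₀ := fun m x hx b => by
    change dl.1 (Tot.rmul b x) + D₁ (Tot.rmul b x) = Tot.rmul b (dl.1 x + D₁ x) + _
    rw [dl.2, hD₁c m x hx, map_add, add_assoc]
  have hD₀d : IsDeg 1 D₀ := fun m x hx => AddSubgroup.add_mem _ (hld m x hx) (hD₁d m x hx)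
  have hSc : IsConn S.conn := fun m x hx b => by
    rw [← S.connOn_refl, ← S.connOn_refl]; exact S.connOn_rmul _ m x hx b
  have hSd : IsDeg 1 S.conn := fun m x hx => S.conn_deg m x hx
  have hDD : TOrd 1 (D₀.comp D₀) := by
    have h1 := TOrd.comp_congr hD₀ hD₀ dl0 D0
    have e : dl.1.comp dl.1 = 0 := AddMonoidHom.ext fun x => P.lin_d_d x
    rwa [e, sub_zero] at h1
  obtain ⟨D, hD2, hDc, hDd, hDS, hDo⟩ := exists_flat fr (coneD D₀ S.conn f.1) (coneH f.1 g.1 s.1 t.1)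
    (fun j z hz => ⟨AddSubgroup.neg_mem _ (D0 j _ hz.1),
      AddSubgroup.add_mem _ (f0 j _ hz.1) (S0 j _ hz.2)⟩)
    (fun j z hz => by
      have hc := AddSubgroup.sub_mem _ (f0 _ _ (s0 _ _ hz.1)) (t0 _ _ (f0 _ _ hz.1))
      exact ⟨AddSubgroup.add_mem _ (AddSubgroup.sub_mem _ (s0 _ _ hz.1) (g0 _ _ hc)) (g0 _ _ hz.2),
        AddSubgroup.add_mem _ (t0 _ _ hc) (AddSubgroup.neg_mem _ (t0 _ _ hz.2))⟩)
    (cone_contraction_mod f0 g0 s0 t0 (rf D₀ hD₀) (rg D₀ hD₀) (rs D₀ hD₀) rt)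
    (fun j z hz => by
      have h1 := hDD j _ hz.1
      have h2 := rf D₀ hD₀ j _ hz.1
      change (-D₀ (-D₀ z.1), f.1 (-D₀ z.1) + S.conn (f.1 z.1 + S.conn z.2)) ∈ _
      refine ⟨?_, ?_⟩
      · change -D₀ (-D₀ z.1) ∈ Tot.fil P.E (le_refl ⊤) (j + 1)
        rw [map_neg, neg_neg]
        exact h1
      · change f.1 (-D₀ z.1) + S.conn (f.1 z.1 + S.conn z.2) ∈ Tot.fil S.toGMod (le_refl ⊤) (j + 1)
        rw [map_neg, map_add, S.conn_conn, add_zero, neg_add_eq_sub]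
        exact h2)
    (coneH_lin f.2 g.2 s.2 t.2) (coneH_deg hfd hgd hsd htd) (coneD_conn hD₀c hSc f.2)
    (coneD_deg hD₀d hSd hfd) (fun y => by simp [coneD_apply])
    (fun y => by simp [coneD_apply, S.conn_conn])
  have hDS' : ∀ y, D (0, y) = (0, S.conn y) := fun y => by rw [hDS, coneD_apply]; simp
  let dE : Tot P.E (le_refl ⊤) →+ Tot P.E (le_refl ⊤) :=
    -((AddMonoidHom.fst _ _).comp (AddMonoidHom.comp D (AddMonoidHom.inl _ _)))
  let ph : Tot P.E (le_refl ⊤) →+ Tot S.toGMod (le_refl ⊤) :=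
    (AddMonoidHom.snd _ _).comp (AddMonoidHom.comp D (AddMonoidHom.inl _ _))
  have hD0 : ∀ x, D (x, 0) = (-dE x, ph x) := fun x => Prod.ext (neg_neg _).symm rfl
  have hDxy : ∀ x y, D (x, y) = (-dE x, ph x + S.conn y) := fun x y => by
    have : (x, y) = (x, 0) + (0, y) := by simp
    rw [this, map_add, hD0, hDS']
    simp
  have hflat : ∀ x, D (D (x, 0)) = 0 := fun x => congrArg (fun z => z (x, 0)) hD2
  have hdE : TOrd 1 (dE - dl.1) := by
    have e : dE - dl.1 = (dE - D₀) + (D₀ - dl.1) := by abel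
    rw [e]
    refine TOrd.add (fun j x hx => ?_) hD₀
    have := (hDo j (x, 0) ⟨hx, AddSubgroup.zero_mem _⟩).1
    change (D (x, 0)).1 - (coneD D₀ S.conn f.1 (x, 0)).1 ∈ Tot.fil P.E (le_refl ⊤) (j + 1) at this
    rw [hD0, coneD_apply] at this
    have h3 := AddSubgroup.neg_mem _ this
    convert h3 using 1
    simp [sub_eq_add_neg, add_comm]
  have hph : TOrd 1 (ph - f.1) := fun j x hx => by
    have := (hDo j (x, 0) ⟨hx, AddSubgroup.zero_mem _⟩).2
    change (D (x, 0)).2 - (coneD D₀ S.conn f.1 (x, 0)).2 ∈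
      Tot.fil S.toGMod (le_refl ⊤) (j + 1) at this
    rw [hD0, coneD_apply] at this
    simpa using this
  have hxdeg : ∀ m x, x ∈ Tot.deg P.E (le_refl ⊤) m →
      (x, (0 : Tot S.toGMod (le_refl ⊤))) ∈ kdeg P.E S.toGMod (le_refl ⊤) (le_refl ⊤) (m - 1) :=
    fun m x hx => ⟨by rw [sub_add_cancel]; exact hx, AddSubgroup.zero_mem _⟩
  have hkr : ∀ m x, x ∈ Tot.deg P.E (le_refl ⊤) m → ∀ b,
      dE (Tot.rmul b x) = Tot.rmul b (dE x) + sgn m • Tot.rmul (𝒜.d ⊤ b) x ∧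
      ph (Tot.rmul b x) = Tot.rmul b (ph x) := by
    intro m x hx b
    have h1 := hDc (m - 1) _ (hxdeg m x hx) b
    have h2 : ∀ b, kr b (x, (0 : Tot S.toGMod (le_refl ⊤))) = (Tot.rmul b x, 0) := fun b =>
      Prod.ext rfl (map_zero (Tot.rmul b))
    rw [h2, h2, hD0, hD0] at h1
    have h3 := congrArg Prod.fst h1
    have h4 := congrArg Prod.snd h1
    change -dE (Tot.rmul b x) = Tot.rmul b (-dE x) + sgn (m - 1) • Tot.rmul (𝒜.d ⊤ b) x at h3
    change ph (Tot.rmul b x) = Tot.rmul b (ph x) + sgn (m - 1) • 0 at h4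
    rw [smul_zero, add_zero] at h4
    refine ⟨?_, h4⟩
    rw [sgn_congr_odd (a := m - 1) (b := m) ⟨-1, by ring⟩, neg_smul, map_neg, ← neg_add, neg_inj] at h3
    exact h3
  have hphl : IsLin ph := fun b x => Tot.induction_hom fr (p := fun x => ph (Tot.rmul b x) =
    Tot.rmul b (ph x)) x (by simp) (fun n j e b' hb' => (hkr _ _ (Tot.mk_mem_deg e hb' rfl) b).2)
    fun x y hx hy => by simp only [map_add, hx, hy]
  have hdeg : ∀ m x, x ∈ Tot.deg P.E (le_refl ⊤) m → dE x ∈ Tot.deg P.E (le_refl ⊤) (m + 1) ∧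
      ph x ∈ Tot.deg S.toGMod (le_refl ⊤) (m + 0) := by
    intro m x hx
    have h1 := hDd _ _ (hxdeg m x hx)
    rw [hD0, sub_add_cancel] at h1
    refine ⟨?_, by rw [add_zero]; exact h1.2⟩
    have := AddSubgroup.neg_mem _ h1.1
    rwa [neg_neg] at this
  have hfl : ∀ x, dE (dE x) = 0 ∧ S.conn (ph x) = ph (dE x) := by
    intro x
    have h1 := hflat x
    rw [hD0, hDxy] at h1
    have h2 := congrArg Prod.fst h1
    have h3 := congrArg Prod.snd h1
    simp only [map_neg, neg_neg, Prod.fst_zero, Prod.snd_zero] at h2 h3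
    exact ⟨h2, (eq_of_sub_eq_zero (by rw [← h3]; abel))⟩
  let E : QCoh.{u, u} 𝒜 (⊤ : α) :=
    { toGMod := P.E
      conn := dE
      leibniz := fun n e b => by
        have := (hkr n _ (Tot.mk_one_mem_deg (le_refl ⊤) n e) b).1
        rw [Tot.rmul_mk, one_mul, Tot.rmul_mk, one_mul] at this
        exact this
      conn_deg := fun m x hx => (hdeg m x hx).1
      conn_conn := fun x => (hfl x).1 }
  refine ⟨{ E := E, coh := ⟨P.bdd, P.fg⟩, φ := ⟨ph, hphl⟩, φ_deg := fun m x hx => (hdeg m x hx).2,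
            φ_conn := AddMonoidHom.ext fun x => (hfl x).2, ψ := g, ψ_deg := hgd, ψ_conn := rg dE hdE,
            s := s, s_deg := hsd, ψφ := ?_, t := t, t_deg := htd, φψ := ?_ }⟩
  · have h1 := rs dE hdE
    have h2 := g0.comp hph
    have h3 := h1.add h2
    convert h3 using 1
    ext x
    change g.1 (ph x) - x - (dE (s.1 x) + s.1 (dE x)) =
      g.1 (f.1 x) - x - (dE (s.1 x) + s.1 (dE x)) + g.1 (ph x - f.1 x)
    rw [map_sub]
    abel
  · have h2 := hph.comp g0
    have h3 := rt.add h2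
    convert h3 using 1
    ext x
    change ph (g.1 x) - x - (S.conn (t.1 x) + t.1 (S.conn x)) =
      f.1 (g.1 x) - x - (S.conn (t.1 x) + t.1 (S.conn x)) + (ph (g.1 x) - f.1 (g.1 x))
    abel

end Resolution

section QuasiIso

variable {α : Type w} [SemilatticeInf α] [OrderTop α] {𝒜 : DGPresheaf.{u} α}

theorem sy_sy {M : GMod.{u, v} 𝒜 (⊤ : α)} {M' : GMod.{u, v'} 𝒜 (⊤ : α)} {M'' : GMod.{u, v''} 𝒜 (⊤ : α)}
    {O' : Tot M' (le_refl ⊤) →+ Tot M'' (le_refl ⊤)} {O : Tot M (le_refl ⊤) →+ Tot M' (le_refl ⊤)}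
    (hO' : TOrd 0 O') {d m k : ℤ} (hO : IsDeg d O) (hk : m + d = k) (n : ℤ) (e : M.Q m) :
    sy O' k n (sy O m k e) = Tot.sym M'' n (O' (O (Tot.mk _ m e 1))) := by
  subst hk
  exact Tot.sym_map O' (fun x hx => hO' 1 x hx) (hO m _ (Tot.mk_one_mem_deg _ _ _)) n

theorem Resolution.isQuasiIso (fr : Frame 𝒜) {S : QCoh.{u, v} 𝒜 (⊤ : α)} (R : Resolution S) :
    QCoh.IsQuasiIso (E := R.E) (F := S) R.φ := by
  have hE : TOrd 0 R.E.conn := fun j x hx => R.E.conn_fil fr hx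
  have hS : TOrd 0 S.conn := fun j x hx => S.conn_fil fr hx
  have hE1 : IsDeg 1 R.E.conn := R.E.conn_deg
  have hS1 : IsDeg 1 S.conn := S.conn_deg
  have hφ := R.φ.2.tOrd fr
  have hψ := R.ψ.2.tOrd fr
  have hs := R.s.2.tOrd fr
  have ht := R.t.2.tOrd fr
  refine ⟨R.φ_deg, ?_, fun n e he => ?_, fun n y hy => ?_⟩
  · ext x
    have := DFunLike.congr_fun R.φ_conn x
    simp only [AddMonoidHom.comp_apply] at this
    simp [QCoh.dMor, QCoh.connOn_refl, sgn_zero, this]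
  · rintro ⟨y, hy⟩
    refine ⟨sy R.ψ.1 (n - 1) (n - 1) y - sy R.s.1 n (n - 1) e, ?_⟩
    have h1 : sy R.E.conn (n - 1) n (sy R.ψ.1 (n - 1) (n - 1) y) =
        sy R.ψ.1 n n (sy S.conn (n - 1) n y) := by
      rw [sy_sy hE R.ψ_deg (by ring), sy_sy hψ hS1 (by ring)]
      exact Tot.sym_congr (Tot.fil_anti (by omega) (R.ψ_conn 0 _ (Tot.mem_fil_zero fr _)))
    have h2 : sy R.ψ.1 n n (sy R.φ.1 n n e) - e - (sy R.E.conn (n - 1) n (sy R.s.1 n (n - 1) e) +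
        sy R.s.1 (n + 1) n (sy R.E.conn n (n + 1) e)) = 0 := by
      rw [sy_sy hE R.s_deg (by ring), sy_sy hs hE1 (by ring), sy_sy hψ R.φ_deg (by ring)]
      have := Tot.sym_fil (m := n) (Tot.fil_anti (by omega) (R.ψφ 0 _
        (Tot.mem_fil_zero fr (Tot.mk (le_refl ⊤) n e 1))))
      simpa only [AddMonoidHom.sub_apply, AddMonoidHom.add_apply, AddMonoidHom.comp_apply,
        AddMonoidHom.id_apply, map_sub, map_add, Tot.sym_mk_one] using this
    have h3 : sy R.E.conn n (n + 1) e = 0 := he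
    have h4 : sy S.conn (n - 1) n y = sy R.φ.1 n n e := hy
    change sy R.E.conn (n - 1) n _ = e
    rw [map_sub, h1, h4]
    rw [h3, map_zero, add_zero] at h2
    rw [← sub_eq_zero, ← h2]
    abel
  · have h3 : sy S.conn n (n + 1) y = 0 := hy
    refine ⟨sy R.ψ.1 n n y, ?_, -sy R.t.1 n (n - 1) y, ?_⟩
    · have h1 : sy R.E.conn n (n + 1) (sy R.ψ.1 n n y) =
          sy R.ψ.1 (n + 1) (n + 1) (sy S.conn n (n + 1) y) := by
        rw [sy_sy hE R.ψ_deg (by ring), sy_sy hψ hS1 (by ring)]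
        exact Tot.sym_congr (Tot.fil_anti (by omega) (R.ψ_conn 0 _ (Tot.mem_fil_zero fr _)))
      rw [h3, map_zero] at h1
      exact h1
    · have h2 : sy R.φ.1 n n (sy R.ψ.1 n n y) - y - (sy S.conn (n - 1) n (sy R.t.1 n (n - 1) y) +
          sy R.t.1 (n + 1) n (sy S.conn n (n + 1) y)) = 0 := by
        rw [sy_sy hS R.t_deg (by ring), sy_sy ht hS1 (by ring), sy_sy hφ R.ψ_deg (by ring)]
        have := Tot.sym_fil (m := n) (Tot.fil_anti (by omega) (R.φψ 0 _
          (Tot.mem_fil_zero fr (Tot.mk (le_refl ⊤) n y 1))))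
        simpa only [AddMonoidHom.sub_apply, AddMonoidHom.add_apply, AddMonoidHom.comp_apply,
          AddMonoidHom.id_apply, map_sub, map_add, Tot.sym_mk_one] using this
      rw [h3, map_zero, add_zero] at h2
      change sy S.conn (n - 1) n _ = y - sy R.φ.1 n n _
      rw [map_neg, ← sub_eq_zero, ← h2]
      abel

end QuasiIso

section LocalEquivalence

variable {α : Type w} [PartialOrder α] [OrderTop α] {𝒜 : DGPresheaf.{u} α} {U₁ U₂ U₃ V : α}
  {h₁ : V ≤ U₁} {h₂ : V ≤ U₂} {h₃ : V ≤ U₃}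

theorem IsLin.sub {M : GMod.{u, v} 𝒜 U₁} {M' : GMod.{u, v'} 𝒜 U₂} {f g : Tot M h₁ →+ Tot M' h₂}
    (hf : IsLin f) (hg : IsLin g) : IsLin (f - g) := fun b x => by simp [hf b x, hg b x]

theorem IsDeg.add {M : GMod.{u, v} 𝒜 U₁} {M' : GMod.{u, v'} 𝒜 U₂} {k : ℤ}
    {f g : Tot M h₁ →+ Tot M' h₂} (hf : IsDeg k f) (hg : IsDeg k g) : IsDeg k (f + g) :=
  fun m x hx => AddSubgroup.add_mem _ (hf m x hx) (hg m x hx)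

theorem IsDeg.sub {M : GMod.{u, v} 𝒜 U₁} {M' : GMod.{u, v'} 𝒜 U₂} {k : ℤ}
    {f g : Tot M h₁ →+ Tot M' h₂} (hf : IsDeg k f) (hg : IsDeg k g) : IsDeg k (f - g) :=
  fun m x hx => AddSubgroup.sub_mem _ (hf m x hx) (hg m x hx)

theorem IsDeg.sum {M : GMod.{u, v} 𝒜 U₁} {M' : GMod.{u, v'} 𝒜 U₂} {k : ℤ} {κ : Type*}
    (s : Finset κ) {f : κ → Tot M h₁ →+ Tot M' h₂} (hf : ∀ i, IsDeg k (f i)) :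
    IsDeg k (∑ i ∈ s, f i) := fun m x hx => by
  rw [AddMonoidHom.finsetSum_apply]
  exact AddSubgroup.sum_mem _ fun i _ => hf i m x hx

/-- Two homomorphisms that agree on homogeneous elements are equal. -/
theorem Tot.eq_of_deg (fr : Frame 𝒜) {M : GMod.{u, v} 𝒜 U₁} {P : Type*} [AddCommGroup P]
    {f g : Tot M h₁ →+ P} (h : ∀ m x, x ∈ Tot.deg M h₁ m → f x = g x) (x : Tot M h₁) : f x = g x :=
  Tot.induction_hom fr (p := fun x => f x = g x) x (by rw [map_zero, map_zero])
    (fun n j e b hb => h _ _ (Tot.mk_mem_deg e hb rfl))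
    fun x y hx hy => by rw [map_add, map_add, hx, hy]

/-- The commutator of a linear map with connections is linear. -/
theorem IsLin.commutator (fr : Frame 𝒜) {M : GMod.{u, v} 𝒜 U₁} {M' : GMod.{u, v'} 𝒜 U₂}
    {D : Tot M h₁ →+ Tot M h₁} {D' : Tot M' h₂ →+ Tot M' h₂} (hD : IsConn D) (hD' : IsConn D')
    {O : Tot M h₁ →+ Tot M' h₂} (hO : IsLin O) {k : ℤ} (hk : IsDeg k O) :
    IsLin (D'.comp O - sgn k • O.comp D) := fun b x => by
  refine Tot.eq_of_deg fr (f := (D'.comp O - sgn k • O.comp D).comp (Tot.rmul b))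
    (g := (Tot.rmul b).comp (D'.comp O - sgn k • O.comp D)) (fun m x hx => ?_) x
  simp only [AddMonoidHom.comp_apply, AddMonoidHom.sub_apply, AddMonoidHom.smul_apply]
  rw [hO, hD' _ _ (hk _ _ hx), hD _ _ hx, map_add, map_zsmul, hO, hO, map_sub, map_zsmul, smul_add,
    smul_smul, ← sgn_add, add_comm k m]
  abel

/-- A linear map with values of positive form degree raises the form degree. -/
theorem IsLin.tOrd_one (fr : Frame 𝒜) {M : GMod.{u, v} 𝒜 U₁} {M' : GMod.{u, v'} 𝒜 U₂}
    {O : Tot M h₁ →+ Tot M' h₂} (hO : IsLin O) (h : ∀ x, O x ∈ Tot.fil M' h₂ 1) : TOrd 1 O :=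
  hO.tOrd_of (fr := fr) fun n e => h _

/-- An inverse up to homotopy and up to terms of positive form degree of a closed morphism `f`
over `V`. -/
structure LocEquiv (E : QCoh.{u, v} 𝒜 U₁) (E' : QCoh.{u, v'} 𝒜 U₂)
    (f : Tot E.toGMod h₁ →+ Tot E'.toGMod h₂) where
  lin : IsLin f
  deg : IsDeg 0 f
  closed : ∀ x, E'.connOn h₂ (f x) = f (E.connOn h₁ x)
  g : Tot E'.toGMod h₂ →+ Tot E.toGMod h₁
  g_lin : IsLin g
  g_deg : IsDeg 0 g
  g_closed : ∀ y, E.connOn h₁ (g y) - g (E'.connOn h₂ y) ∈ Tot.fil E.toGMod h₁ 1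
  s : Tot E.toGMod h₁ →+ Tot E.toGMod h₁
  s_lin : IsLin s
  s_deg : IsDeg (-1) s
  g_f : ∀ x, g (f x) - x - (E.connOn h₁ (s x) + s (E.connOn h₁ x)) ∈ Tot.fil E.toGMod h₁ 1
  t : Tot E'.toGMod h₂ →+ Tot E'.toGMod h₂
  t_lin : IsLin t
  t_deg : IsDeg (-1) t
  f_g : ∀ y, f (g y) - y - (E'.connOn h₂ (t y) + t (E'.connOn h₂ y)) ∈ Tot.fil E'.toGMod h₂ 1

namespace LocEquiv

variable {E : QCoh.{u, v} 𝒜 U₁} {E' : QCoh.{u, v'} 𝒜 U₂} {E'' : QCoh.{u, v''} 𝒜 U₃}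
  {f : Tot E.toGMod h₁ →+ Tot E'.toGMod h₂} {f' : Tot E'.toGMod h₂ →+ Tot E''.toGMod h₃}

/-- Composition of equivalences. -/
noncomputable def comp (fr : Frame 𝒜) (e' : LocEquiv (h₁ := h₂) (h₂ := h₃) E' E'' f')
    (e : LocEquiv (h₁ := h₁) (h₂ := h₂) E E' f) : LocEquiv (h₁ := h₁) (h₂ := h₃) E E'' (f'.comp f) where
  lin := e'.lin.comp e.lin
  deg := by simpa only [add_zero] using IsDeg.comp e'.deg e.deg
  closed x := by
    simp only [AddMonoidHom.comp_apply]
    rw [e'.closed, e.closed]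
  g := e.g.comp e'.g
  g_lin := e.g_lin.comp e'.g_lin
  g_deg := by simpa only [add_zero] using IsDeg.comp e.g_deg e'.g_deg
  g_closed y := by
    have h1 := e.g_closed (e'.g y)
    have h2 := e.g_lin.map_fil fr (e'.g_closed y)
    have := AddSubgroup.add_mem _ h1 h2
    rw [map_sub] at this
    convert this using 1
    simp only [AddMonoidHom.comp_apply]
    abel
  s := e.s + (e.g.comp e'.s).comp f
  s_lin := e.s_lin.add ((e.g_lin.comp e'.s_lin).comp e.lin)
  s_deg := e.s_deg.add (by
    simpa only [add_zero, zero_add] using IsDeg.comp (IsDeg.comp e.g_deg e'.s_deg) e.deg)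
  g_f x := by
    have h1 := e.g_f x
    have h2 := e.g_lin.map_fil fr (e'.g_f (f x))
    have h3 := e.g_closed (e'.s (f x))
    have := AddSubgroup.sub_mem _ (AddSubgroup.add_mem _ h1 h2) h3
    convert this using 1
    simp only [AddMonoidHom.comp_apply, AddMonoidHom.add_apply, map_add, map_sub, e.closed]
    abel
  t := e'.t + (f'.comp e.t).comp e'.g
  t_lin := e'.t_lin.add ((e'.lin.comp e.t_lin).comp e'.g_lin)
  t_deg := e'.t_deg.add (by
    simpa only [add_zero, zero_add] using IsDeg.comp (IsDeg.comp e'.deg e.t_deg) e'.g_deg)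
  f_g y := by
    have h1 := e'.f_g y
    have h2 := e'.lin.map_fil fr (e.f_g (e'.g y))
    have h3 := e'.lin.map_fil fr (e.t_lin.map_fil fr (e'.g_closed y))
    have := AddSubgroup.add_mem _ (AddSubgroup.add_mem _ h1 h2) h3
    convert this using 1
    simp only [AddMonoidHom.comp_apply, AddMonoidHom.add_apply, map_add, map_sub, e'.closed]
    abel

/-- The cone of an equivalence is contractible. -/
theorem exists_cone_contraction (fr : Frame 𝒜) (e : LocEquiv (h₁ := h₁) (h₂ := h₂) E E' f) :
    ∃ h : AddMonoid.End (Tot E.toGMod h₁ × Tot E'.toGMod h₂), KLin h ∧ KDeg (-1) h ∧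
      coneD (E.connOn h₁) (E'.connOn h₂) f * h + h * coneD (E.connOn h₁) (E'.connOn h₂) f = 1 := by
  have c := E.connOn_isConn h₁
  have c' := E'.connOn_isConn h₂
  have hD : IsDeg 1 (E.connOn h₁) := E.connOn_deg h₁
  have hD' : IsDeg 1 (E'.connOn h₂) := E'.connOn_deg h₂
  refine exists_contraction fr _ (coneH f e.g e.s e.t) ?_ (coneD_conn c c' e.lin)
    (coneD_deg hD hD' e.deg) (coneH_lin e.lin e.g_lin e.s_lin e.t_lin)
    (coneH_deg e.deg e.g_deg e.s_deg e.t_deg)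
    (cone_contraction_mod (e.lin.tOrd fr) (e.g_lin.tOrd fr) (e.s_lin.tOrd fr) (e.t_lin.tOrd fr)
      ?_ ?_ ?_ ?_)
  · refine AddMonoidHom.ext fun z => ?_
    change coneD _ _ _ (coneD _ _ _ z) = 0
    rw [coneD_apply, coneD_apply]
    refine Prod.ext ?_ ?_
    · simp [E.connOn_connOn]
    · simp [e.closed, E'.connOn_connOn]
  · have : (E'.connOn h₂).comp f - f.comp (E.connOn h₁) = 0 := by
      ext x; simp [e.closed]
    rw [this]; exact TOrd.zero
  · have := IsLin.commutator fr c' c e.g_lin e.g_deg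
    rw [sgn_zero, one_smul] at this
    exact this.tOrd_one fr e.g_closed
  · have := IsLin.commutator fr c c e.s_lin e.s_deg
    rw [sgn_congr_odd (a := -1) (b := 0) ⟨-1, by ring⟩, sgn_zero, neg_one_smul, sub_neg_eq_add] at this
    exact (((e.g_lin.comp e.lin).sub (fun b x => rfl)).sub this).tOrd_one fr e.g_f
  · have := IsLin.commutator fr c' c' e.t_lin e.t_deg
    rw [sgn_congr_odd (a := -1) (b := 0) ⟨-1, by ring⟩, sgn_zero, neg_one_smul, sub_neg_eq_add] at this
    exact (((e.lin.comp e.g_lin).sub (fun b x => rfl)).sub this).tOrd_one fr e.f_g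

end LocEquiv

end LocalEquivalence

section LocalInverse

variable {α : Type w} [SemilatticeInf α] [OrderTop α] {ι : Type w'} {𝒜 : DGPresheaf.{u} α}
  {U : ι → α}

theorem Fine.exists_weights (fi : Fine 𝒜 U) : ∃ c : ι → 𝒜.A0 ⊤, ∑ j ∈ fi.s, c j * fi.σ j ^ 2 = 1 := by
  have h1 : Ideal.span (fi.σ '' fi.s) = ⊤ := by
    rw [Ideal.eq_top_iff_one, ← fi.sum_σ]
    exact Ideal.sum_mem _ fun k hk => Ideal.subset_span ⟨k, hk, rfl⟩
  have h2 := Ideal.span_pow_eq_top _ h1 2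
  rw [Set.image_image, Ideal.eq_top_iff_one] at h2
  obtain ⟨c, hc⟩ := (Submodule.mem_span_image_finset_iff_exists_fun' _).1 h2
  exact ⟨c, hc⟩

theorem QCoh.connOn_rmul_zero (fr : Frame 𝒜) {U₀ V : α} (E : QCoh.{u, v} 𝒜 U₀) (h : V ≤ U₀) {b : 𝒜.A V}
    (hb : b ∈ 𝒜.gr V 0) (x) : E.connOn h (Tot.rmul b x) - Tot.rmul b (E.connOn h x) ∈
      Tot.fil E.toGMod h 1 := by
  refine Tot.induction_hom fr (p := fun x => E.connOn h (Tot.rmul b x) -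
    Tot.rmul b (E.connOn h x) ∈ Tot.fil E.toGMod h 1) x ?_ (fun n j e b' hb' => ?_) ?_
  · simp only [map_zero, sub_zero]; exact AddSubgroup.zero_mem _
  · rw [E.connOn_rmul h (n + j) _ (Tot.mk_mem_deg e hb' rfl), add_sub_cancel_left]
    exact AddSubgroup.zsmul_mem _ (Tot.rmul_mem_fil fr (𝒜.d_mem_gr V 0 _ hb) _) _
  · intro x y hx hy
    have := AddSubgroup.add_mem _ hx hy
    simp only [map_add]
    convert this using 1
    abel

theorem Tot.rmul_isDeg {U₀ V : α} {M : GMod.{u, v} 𝒜 U₀} {h : V ≤ U₀} {b : 𝒜.A V}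
    (hb : b ∈ 𝒜.gr V 0) : IsDeg 0 (Tot.rmul (M := M) (h := h) b) :=
  fun m x hx => Tot.rmul_mem_deg hb (by simp) hx

theorem Tot.rmul_isLin {U₀ V : α} {M : GMod.{u, v} 𝒜 U₀} {h : V ≤ U₀} {r : 𝒜.A0 ⊤} :
    IsLin (Tot.rmul (M := M) (h := h) (𝒜.inc (le_top : V ≤ ⊤) r)) := fun b x => by
  rw [Tot.rmul_rmul, Tot.rmul_rmul, inc_comm]

variable {fi : Fine 𝒜 U} {fr : Frame 𝒜} {F : Tw.{u, v} 𝒜 U} {S : QCoh.{u, v'} 𝒜 (⊤ : α)}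
  (atl : Atlas fi fr F S)

namespace Atlas

theorem cap_pair_le (U : ι → α) (j k : ι) : U k ⊓ U j ≤ cap U j [k] :=
  le_inf inf_le_right inf_le_left

/-- The extension to `U j ∩ U k` of the map `mu j`, followed by restriction to `U k`, multiplied
by `σ j`. -/
noncomputable def lam (j k : ι) :
    Tot (F.gmod j) (cap_le_head U j [k]) →+ Tot S.toGMod (le_top : U k ≤ ⊤) :=
  Tot.lift (fun n e b => Tot.rmul (fi.extA fr j (cap_le_last U j [] k) (cap_pair_le U j k) b)
      (Tot.res (le_refl ⊤) le_top (atl.mu j (Tot.mk (le_refl (U j)) n e 1))))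
    (fun n e e' b => by rw [Tot.mk_add_left, map_add, map_add, map_add])
    (fun n e b b' => by rw [map_add, Tot.rmul_add])
    (fun n r e b => by
      obtain ⟨r, rfl⟩ := fi.surj (le_top : U j ≤ ⊤) r
      have h1 : Tot.mk (le_refl (U j)) n (𝒜.res0 (le_top : U j ≤ ⊤) r • e) 1 =
          Tot.rmul (𝒜.res le_top (𝒜.inc (le_refl ⊤) r)) (Tot.mk (M := F.gmod j) (le_refl (U j)) n e 1) := by
        rw [Tot.mk_smul, Tot.rmul_mk, mul_one, one_mul, res_inc, inc_res0]
      rw [h1, atl.mu_rmul, Tot.res_rmul, Tot.rmul_rmul, res_inc, inc_res0]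
      congr 2
      exact (fi.extA_inc_mul fr j (cap_le_last U j [] k) (cap_pair_le U j k) (le_top : U k ≤ ⊤) r b).symm)

theorem lam_mk (j k : ι) (n : ℤ) (e : (F.gmod j).Q n) (b : 𝒜.A (cap U j [k])) :
    atl.lam j k (Tot.mk _ n e b) =
      Tot.rmul (fi.extA fr j (cap_le_last U j [] k) (cap_pair_le U j k) b)
      (Tot.res (le_refl ⊤) le_top (atl.mu j (Tot.mk (le_refl (U j)) n e 1))) := Tot.lift_mk ..

theorem lam_res (j k : ι) (x : Tot (F.gmod j) (le_refl (U j))) :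
    atl.lam j k (Tot.res (le_refl (U j)) (cap_le_head U j [k]) x) =
      Tot.rmul (fi.τ j (U k)) (Tot.res (le_refl ⊤) le_top (atl.mu j x)) :=
  Tot.ext_apply (f := (atl.lam j k).comp (Tot.res (le_refl (U j)) (cap_le_head U j [k])))
    (g := ((Tot.rmul (fi.τ j (U k))).comp (Tot.res (le_refl ⊤) le_top)).comp (atl.mu j))
    (fun n e b => by
      obtain ⟨b, rfl⟩ := fi.res_surj fr (le_top : U j ≤ ⊤) b
      have h1 : Tot.mk (le_refl (U j)) n e (𝒜.res (le_top : U j ≤ ⊤) b) =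
          Tot.rmul (𝒜.res le_top b) (Tot.mk (M := F.gmod j) (le_refl (U j)) n e 1) := by
        rw [Tot.rmul_mk, one_mul]
      have h2 := fi.extA_res fr j (cap_le_last U j [] k) (cap_pair_le U j k) (𝒜.res le_top b)
      simp only [AddMonoidHom.comp_apply]
      rw [Tot.res_mk, h1, atl.mu_rmul, Tot.res_rmul, Tot.rmul_rmul, ← fi.τ_comm, lam_mk, 𝒜.res_res, ← h2,
        𝒜.res_res]) x

theorem lam_rmul (j k : ι) (b : 𝒜.A (U k)) (y) :
    atl.lam j k (Tot.rmul (𝒜.res (cap_le_last U j [] k) b) y) = Tot.rmul b (atl.lam j k y) := by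
  obtain ⟨b, rfl⟩ := fi.res_surj fr (le_top : U k ≤ ⊤) b
  obtain ⟨x, rfl⟩ := fi.tot_res_surj fr (le_refl (U j)) (cap_le_head U j [k]) y
  have h1 : 𝒜.res (cap_le_last U j [] k) (𝒜.res (le_top : U k ≤ ⊤) b) =
      𝒜.res (cap_le_head U j [k]) (𝒜.res (le_top : U j ≤ ⊤) b) := by
    rw [𝒜.res_res, 𝒜.res_res]
  rw [h1, ← Tot.res_rmul, lam_res, atl.mu_rmul, Tot.res_rmul, lam_res, Tot.rmul_rmul, Tot.rmul_rmul,
    fi.τ_comm]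

theorem lam_mem_deg (j k : ι) {m : ℤ} {y} (hy : y ∈ Tot.deg (F.gmod j) (cap_le_head U j [k]) m) :
    atl.lam j k y ∈ Tot.deg S.toGMod (le_top : U k ≤ ⊤) m := by
  obtain ⟨x, hx, rfl⟩ := fi.tot_res_surj_deg fr (le_refl (U j)) (cap_le_head U j [k]) hy
  rw [lam_res]
  exact Tot.rmul_mem_deg (fi.τ_mem _ _) (by simp) (Tot.res_mem_deg _ _ (atl.mu_deg _ _ _ hx))

theorem lam_conn (j k : ι) (y) : S.connOn le_top (atl.lam j k y) -
    atl.lam j k ((F.obj j).connOn _ y) ∈ Tot.fil S.toGMod (le_top : U k ≤ ⊤) 1 := by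
  obtain ⟨x, rfl⟩ := fi.tot_res_surj fr (le_refl (U j)) (cap_le_head U j [k]) y
  rw [QCoh.connOn_res, lam_res, lam_res, QCoh.connOn_refl]
  have h1 := S.connOn_rmul_zero fr (le_top : U k ≤ ⊤) (fi.τ_mem j (U k))
    (Tot.res (le_refl ⊤) le_top (atl.mu j x))
  rw [S.connOn_res, S.connOn_refl] at h1
  have h2 := Tot.rmul_fil fr (fi.τ j (U k)) (Tot.res_mem_fil (le_refl ⊤) (le_top : U k ≤ ⊤)
    (atl.mu_conn j x))
  rw [map_sub, map_sub] at h2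
  have := AddSubgroup.add_mem _ h1 h2
  convert this using 1
  abel

end Atlas

end LocalInverse

section LocalInverse

variable {α : Type w} [SemilatticeInf α] [OrderTop α] {ι : Type w'} {𝒜 : DGPresheaf.{u} α}
  {U : ι → α}

theorem pos_nil_conn (F : Tw.{u, v} 𝒜 U) (j k : ι) (W : α) (h : W ≤ cap U j ([] ++ [k])) (z) :
    (F.obj j).connOn _ (F.raw.pos j [] k W h z) = F.raw.pos j [] k W h ((F.obj k).connOn _ z) := by
  have h1 := mcVal_eq_zero F j [] k W h z
  simp only [mcVal, List.length_nil, Nat.cast_zero, zero_add, sgn_one, Finset.univ_eq_empty,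
    Finset.sum_empty, add_zero, neg_smul, one_smul] at h1
  exact (neg_add_eq_zero.1 h1)

theorem pos_pos_eq (F : Tw.{u, v} 𝒜 U) (i j k : ι) (W : α) (h : W ≤ cap U i ([j] ++ [k]))
    (h₁ : W ≤ cap U i ([] ++ [j])) (h₂ : W ≤ cap U j ([] ++ [k])) (h₃ : W ≤ cap U i ([] ++ [k])) (z) :
    F.raw.pos i [] j W h₁ (F.raw.pos j [] k W h₂ z) = F.raw.pos i [] k W h₃ z -
      ((F.obj i).connOn _ (F.raw.pos i [j] k W h z) +
        F.raw.pos i [j] k W h ((F.obj k).connOn _ z)) := by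
  have h1 : -F.raw.pos i [] k W h₃ z + ((F.obj i).connOn _ (F.raw.pos i [j] k W h z) +
        F.raw.pos i [j] k W h ((F.obj k).connOn _ z) +
        F.raw.pos i [] j W h₁ (F.raw.pos j [] k W h₂ z)) = 0 := by
    refine Eq.trans ?_ (mcVal_eq_zero F i [j] k W h z)
    unfold mcVal
    have : Subsingleton (Fin [j].length) := inferInstanceAs (Subsingleton (Fin 1))
    rw [Fintype.sum_subsingleton _ (0 : Fin [j].length),
      Fintype.sum_subsingleton _ (0 : Fin [j].length)]
    refine congrArg₂ (· + ·) ?_ (congrArg₂ (· + ·) (congrArg₂ (· + ·) ?_ rfl) ?_)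
    · change _ = sgn (0 + 1) • F.raw.pos i [] k W h₃ z
      rw [zero_add, sgn_one, neg_one_smul]
    · change _ = sgn (1 + 1) • _
      rw [sgn_congr (a := 1 + 1) (b := 0) ⟨1, by ring⟩, sgn_zero, one_smul]
    · change _ = sgn ((1 - (0 + 1)) * (1 - 0)) • F.raw.pos i [] j W h₁ (F.raw.pos j [] k W h₂ z)
      rw [zero_add, sub_self, zero_mul, sgn_zero, one_smul]
  rw [← sub_eq_zero, ← h1]
  abel

theorem le_cap_same (U : ι → α) (k : ι) : U k ≤ cap U k ([] ++ [k]) := le_inf le_rfl le_rfl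

/-- The operator `a_{kk}` is homotopic to the identity. -/
theorem exists_pos_same_homotopy (F : Tw.{u, v} 𝒜 U) (k : ι) :
    ∃ K : Tot (F.gmod k) (le_refl (U k)) →+ Tot (F.gmod k) (le_refl (U k)), IsLin K ∧ IsDeg (-1) K ∧
      ∀ x, F.raw.pos k [] k (U k) (le_cap_same U k) x - x = (F.obj k).connOn _ (K x) +
        K ((F.obj k).connOn _ x) := by
  have hW : cap U k ([] ++ [k]) = U k := le_antisymm (cap_le_head U k _) (le_inf le_rfl le_rfl)
  have key : ∀ (W : α) (h : W ≤ cap U k ([] ++ [k])) (hk : W ≤ U k), W = cap U k ([] ++ [k]) →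
      ∃ g s : Tot (F.gmod k) hk →+ Tot (F.gmod k) hk, IsLin g ∧ IsDeg 0 g ∧ IsLin s ∧ IsDeg (-1) s ∧
        (∀ x, (F.obj k).connOn hk (g x) = g ((F.obj k).connOn hk x)) ∧
        ∀ x, g (F.raw.pos k [] k W h x) - x = (F.obj k).connOn hk (s x) + s ((F.obj k).connOn hk x) := by
    rintro W h hk rfl
    obtain ⟨g, hg, hgc, ⟨s, hs, hgs⟩, -⟩ := F.inv k
    have e : (F.raw.pos k [] k _ h) = (F.a k [] k).1 := Mor.restrict_refl _
    refine ⟨g.1, s.1, g.2, hg, s.2, hs, fun x => ?_, fun x => ?_⟩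
    · have := DFunLike.congr_fun hgc x
      simp only [QCoh.dMor, sgn_zero, one_smul, AddMonoidHom.sub_apply, AddMonoidHom.comp_apply,
        AddMonoidHom.zero_apply] at this
      exact sub_eq_zero.1 this
    · have := DFunLike.congr_fun hgs x
      rw [e]
      simp only [QCoh.dMor, sgn_congr_odd (a := -1) (b := 0) ⟨-1, by ring⟩, sgn_zero, neg_one_smul,
        AddMonoidHom.sub_apply, AddMonoidHom.comp_apply, AddMonoidHom.id_apply, sub_neg_eq_add,
        AddMonoidHom.add_apply] at this
      exact this
  obtain ⟨g, s, hg, hg0, hs, hs1, hgc, hgs⟩ := key (U k) (le_inf le_rfl le_rfl) le_rfl hW.symm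
  have hk3 : U k ≤ cap U k ([k] ++ [k]) := le_inf le_rfl (le_inf le_rfl le_rfl)
  set b := F.raw.pos k [k] k (U k) hk3 with hb
  have hb1 : IsDeg (-1) b := pos_deg F k [k] k (U k) hk3
  have hb2 : IsLin b := fun c z => pos_rmul F k [k] k (U k) hk3 c z
  have hbb : ∀ z, F.raw.pos k [] k (U k) (le_inf le_rfl le_rfl)
      (F.raw.pos k [] k (U k) (le_inf le_rfl le_rfl) z) =
      F.raw.pos k [] k (U k) (le_inf le_rfl le_rfl) z - ((F.obj k).connOn le_rfl (b z) +
        b ((F.obj k).connOn le_rfl z)) := fun z => pos_pos_eq F k k k (U k) hk3 _ _ _ z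
  set a := F.raw.pos k [] k (U k) (le_inf le_rfl le_rfl) with ha
  have hac : ∀ z, (F.obj k).connOn le_rfl (a z) = a ((F.obj k).connOn le_rfl z) :=
    fun z => pos_nil_conn F k k (U k) _ z
  have hal : IsLin a := fun c z => pos_rmul F k [] k (U k) _ c z
  have had : IsDeg 0 a := by
    have := pos_deg F k [] k (U k) (le_inf le_rfl le_rfl)
    rwa [List.length_nil, Nat.cast_zero, neg_zero] at this
  refine ⟨s - s.comp a - g.comp b, (hs.sub (hs.comp hal)).sub (hg.comp hb2), ?_, fun x => ?_⟩
  · refine (hs1.sub ?_).sub ?_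
    · simpa only [add_zero] using IsDeg.comp hs1 had
    · simpa only [zero_add] using IsDeg.comp hg0 hb1
  · have h1 := hgs x
    have h2 := hgs (a x)
    have h3 := congrArg g (hbb x)
    simp only [AddMonoidHom.sub_apply, AddMonoidHom.comp_apply, map_sub, map_add, hgc, hac] at h1 h2 h3 ⊢
    rw [h3] at h2
    rw [sub_eq_iff_eq_add] at h1 h2
    rw [h1] at h2
    rw [← sub_eq_zero]
    rw [← sub_eq_zero] at h2
    rw [← neg_eq_zero] at h2
    refine Eq.trans ?_ h2
    abel

end LocalInverse

section LocalInverse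

variable {α : Type w} [SemilatticeInf α] [OrderTop α] {ι : Type w'} {𝒜 : DGPresheaf.{u} α}
  {U : ι → α} {fi : Fine 𝒜 U} {fr : Frame 𝒜} {F : Tw.{u, v} 𝒜 U} {S : QCoh.{u, v'} 𝒜 (⊤ : α)}
  (atl : Atlas fi fr F S)

namespace Atlas

/-- The transition operator from `F_k` to `F_j` over `U j ∩ U k`. -/
noncomputable def tr (F : Tw.{u, v} 𝒜 U) (j k : ι) :
    Tot (F.gmod k) (le_refl (U k)) →+ Tot (F.gmod j) (cap_le_head U j [k]) :=
  (F.raw.pos j [] k (cap U j [k]) le_rfl).comp (Tot.res (le_refl (U k)) (cap_le_last U j [] k))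

theorem tr_apply (j k : ι) (x) : tr F j k x = F.raw.pos j [] k (cap U j [k]) le_rfl
    (Tot.res (le_refl (U k)) (cap_le_last U j [] k) x) := rfl

theorem tr_rmul (j k : ι) (b : 𝒜.A (U k)) (x) :
    tr F j k (Tot.rmul b x) = Tot.rmul (𝒜.res (cap_le_last U j [] k) b) (tr F j k x) := by
  rw [tr_apply, Tot.res_rmul]
  exact pos_rmul F j [] k _ le_rfl _ _

theorem tr_conn (j k : ι) (x) :
    (F.obj j).connOn _ (tr F j k x) = tr F j k ((F.obj k).connOn _ x) := by
  rw [tr_apply, tr_apply, ← QCoh.connOn_res]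
  exact pos_nil_conn F j k _ le_rfl _

theorem tr_mem_deg (j k : ι) {m : ℤ} {x} (hx : x ∈ Tot.deg (F.gmod k) (le_refl (U k)) m) :
    tr F j k x ∈ Tot.deg (F.gmod j) (cap_le_head U j [k]) m := by
  have := pos_deg F j [] k _ le_rfl m _ (Tot.res_mem_deg _ (cap_le_last U j [] k) hx)
  rwa [List.length_nil, Nat.cast_zero, neg_zero, add_zero] at this

/-- The contribution of `U j` to the inverse of the projection to `F_k`. -/
noncomputable def th (j k : ι) : Tot (F.gmod k) (le_refl (U k)) →+ Tot S.toGMod (le_top : U k ≤ ⊤) :=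
  (atl.lam j k).comp (tr F j k)

theorem th_lin (j k : ι) : IsLin (atl.th j k) := fun b x => by
  simp only [th, AddMonoidHom.comp_apply]
  rw [tr_rmul, lam_rmul]

theorem th_deg (j k : ι) : IsDeg 0 (atl.th j k) := fun m x hx => by
  rw [add_zero]
  exact atl.lam_mem_deg j k (tr_mem_deg j k hx)

theorem th_conn (j k : ι) (x) : S.connOn le_top (atl.th j k x) -
    atl.th j k ((F.obj k).connOn _ x) ∈ Tot.fil S.toGMod (le_top : U k ≤ ⊤) 1 := by
  have := atl.lam_conn j k (tr F j k x)
  rwa [tr_conn] at this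

theorem pr_connOn (k : ι) (z) :
    (F.obj k).connOn (le_refl (U k)) ((atl.pr k).1 z) = (atl.pr k).1 (S.connOn le_top z) := by
  obtain ⟨c, rfl⟩ := fi.tot_res_surj fr (le_refl ⊤) (le_top : U k ≤ ⊤) z
  rw [S.connOn_res, S.connOn_refl, atl.pr_conn, QCoh.connOn_refl]

theorem inf_le_three (U : ι → α) (j k : ι) : U k ⊓ U j ≤ cap U k ([j] ++ [k]) :=
  le_cap.2 fun i hi => by
    simp only [List.cons_append, List.nil_append, List.mem_cons, List.not_mem_nil, or_false] at hi
    rcases hi with rfl | rfl | rfl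
    · exact inf_le_left
    · exact inf_le_right
    · exact inf_le_left

theorem inf_le_pair (U : ι → α) (j k : ι) : U k ⊓ U j ≤ cap U k ([] ++ [j]) := le_rfl

theorem inf_le_pair' (U : ι → α) (j k : ι) : U k ⊓ U j ≤ cap U j ([] ++ [k]) :=
  le_inf inf_le_right inf_le_left

theorem pr_lam (j k : ι) (y) : (atl.pr k).1 (atl.lam j k y) = Tot.rmul (fi.τ j (U k))
    (fi.ext fr j (le_refl (U k)) inf_le_left le_rfl
      (F.raw.pos k [] j (U k ⊓ U j) (inf_le_pair U j k)
        (Tot.res (cap_le_head U j [k]) (inf_le_pair' U j k) y))) := by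
  obtain ⟨x, rfl⟩ := fi.tot_res_surj fr (le_refl (U j)) (cap_le_head U j [k]) y
  rw [lam_res, (atl.pr k).2]
  have h1 : (atl.pr k).1 (Tot.res (le_refl ⊤) le_top (atl.mu j x)) =
      fi.ext fr j (le_refl (U k)) inf_le_left le_rfl
      (F.raw.pos k [] j (U k ⊓ U j) (inf_le_pair U j k)
        (Tot.res (le_refl (U j)) inf_le_right x)) := atl.pr_mu k j x
  rw [h1]
  refine congrArg (fun z => Tot.rmul (fi.τ j (U k)) (fi.ext fr j (le_refl (U k)) inf_le_left le_rfl
    (F.raw.pos k [] j (U k ⊓ U j) (inf_le_pair U j k) z))) ?_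
  exact (Tot.res_res (le_refl (U j)) (cap_le_head U j [k]) (inf_le_pair' U j k) x).symm

/-- The homotopy for the composition of `th` with the projection. -/
noncomputable def thT (fi : Fine 𝒜 U) (fr : Frame 𝒜) (F : Tw.{u, v} 𝒜 U) (j k : ι) :
    Tot (F.gmod k) (le_refl (U k)) →+ Tot (F.gmod k) (le_refl (U k)) :=
  (Tot.rmul (fi.τ j (U k))).comp ((fi.ext fr j (le_refl (U k)) inf_le_left le_rfl).comp
    ((F.raw.pos k [j] k (U k ⊓ U j) (inf_le_three U j k)).comp
    (Tot.res (le_refl (U k)) inf_le_left)))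

theorem thT_apply (j k : ι) (x) : thT fi fr F j k x = Tot.rmul (fi.τ j (U k))
    (fi.ext fr j (le_refl (U k)) inf_le_left le_rfl
    (F.raw.pos k [j] k (U k ⊓ U j) (inf_le_three U j k)
    (Tot.res (le_refl (U k)) inf_le_left x))) := rfl

theorem thT_lin (j k : ι) : IsLin (thT fi fr F j k) := fun b x => by
  rw [thT_apply, Tot.res_rmul, pos_rmul, fi.ext_rmul, Tot.rmul_rmul, ← fi.τ_comm, ← Tot.rmul_rmul,
    thT_apply]

theorem thT_deg (j k : ι) : IsDeg (-1) (thT fi fr F j k) := fun m x hx => by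
  have h1 := pos_deg F k [j] k (U k ⊓ U j) (inf_le_three U j k) m _
    (Tot.res_mem_deg (le_refl (U k)) inf_le_left hx)
  exact Tot.rmul_mem_deg (fi.τ_mem _ _) (by simp) (fi.ext_mem_deg fr j _ _ _ h1)

theorem pr_th (j k : ι) (x) : (atl.pr k).1 (atl.th j k x) -
    (Tot.rmul (fi.τ j (U k)) (Tot.rmul (fi.τ j (U k))
      (F.raw.pos k [] k (U k) (le_cap_same U k) x)) -
      ((F.obj k).connOn _ (thT fi fr F j k x) + thT fi fr F j k ((F.obj k).connOn _ x))) ∈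
      Tot.fil (F.gmod k) (le_refl (U k)) 1 := by
  have hkW : U k ⊓ U j ≤ U k := inf_le_left
  have hkk : U k ⊓ U j ≤ cap U k ([] ++ [k]) := hkW.trans (le_cap_same U k)
  have h1 : Tot.res (cap_le_head U j [k]) (inf_le_pair' U j k) (tr F j k x) =
      F.raw.pos j [] k _ (inf_le_pair' U j k) (Tot.res (le_refl (U k)) hkW x) := by
    have h0 : ∀ (h : cap U j ([] ++ [k]) ≤ U k) (h' : U k ⊓ U j ≤ cap U j ([] ++ [k])),
        F.raw.pos j [] k _ h' (Tot.res (le_refl (U k)) hkW x) =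
        Tot.res (cap_le_head U j ([] ++ [k])) h' (F.raw.pos j [] k _ le_rfl
          (Tot.res (le_refl (U k)) h x)) := fun h h' => by
      have h3 := pos_res F j [] k _ _ le_rfl h' (Tot.res (le_refl (U k)) h x)
      exact (congrArg _ (Tot.res_res (le_refl (U k)) h h' x).symm).trans h3
    exact (h0 (cap_le_last U j [] k) (inf_le_pair' U j k)).symm
  have h2 := pos_pos_eq F k j k _ (inf_le_three U j k) (inf_le_pair U j k) (inf_le_pair' U j k) hkk
    (Tot.res (le_refl (U k)) hkW x)
  have h3 : F.raw.pos k [] k _ hkk (Tot.res (le_refl (U k)) hkW x) =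
      Tot.res (le_refl (U k)) hkW (F.raw.pos k [] k (U k) (le_cap_same U k) x) :=
    pos_res F k [] k _ _ (le_cap_same U k) hkW x
  have h4 : (atl.pr k).1 (atl.th j k x) = _ := atl.pr_lam j k (tr F j k x)
  rw [h4, h1, h2, h3, map_sub, map_sub, fi.ext_res, sub_sub_sub_cancel_left, map_add, map_add,
    thT_apply, thT_apply, ← QCoh.connOn_res]
  have e1 := (F.obj k).connOn_rmul_zero fr (le_refl (U k)) (fi.τ_mem j (U k))
    (fi.ext fr j (le_refl (U k)) hkW le_rfl
      (F.raw.pos k [j] k _ (inf_le_three U j k) (Tot.res (le_refl (U k)) hkW x)))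
  have e2 := Tot.rmul_fil fr (fi.τ j (U k)) (fi.connOn_ext fr (F.obj k) j (le_refl (U k)) hkW
    le_rfl (F.raw.pos k [j] k _ (inf_le_three U j k) (Tot.res (le_refl (U k)) hkW x)))
  rw [map_sub] at e2
  have := AddSubgroup.add_mem _ e1 e2
  convert this using 1
  abel

/-- The homotopy for the composition of the projection with `th`. -/
noncomputable def thS (j k : ι) :
    Tot S.toGMod (le_top : U k ≤ ⊤) →+ Tot S.toGMod (le_top : U k ≤ ⊤) :=
  ((atl.lam j k).comp (atl.pr₂ j k).1).comp (Tot.res (le_top : U k ≤ ⊤) (cap_le_last U j [] k)) -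
    (Tot.rmul (fi.τ j (U k))).comp ((atl.h j).restrict le_top).1

theorem thS_apply (j k : ι) (z) : atl.thS j k z = atl.lam j k ((atl.pr₂ j k).1
    (Tot.res (le_top : U k ≤ ⊤) (cap_le_last U j [] k) z)) -
      Tot.rmul (fi.τ j (U k)) (((atl.h j).restrict le_top).1 z) := rfl

theorem thS_res (j k : ι) (c) : atl.thS j k (Tot.res (le_refl ⊤) le_top c) =
    atl.lam j k ((atl.pr₂ j k).1 (Tot.res (le_refl ⊤) le_top c)) -
      Tot.rmul (fi.τ j (U k)) (Tot.res (le_refl ⊤) le_top ((atl.h j).1 c)) := by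
  rw [thS_apply, Mor.restrict_res, Tot.res_res]

theorem thS_lin (j k : ι) : IsLin (atl.thS j k) := fun b z => by
  rw [thS_apply, Tot.res_rmul, (atl.pr₂ j k).2, ((atl.h j).restrict le_top).2, thS_apply, map_sub,
    Tot.rmul_rmul, Tot.rmul_rmul, fi.τ_comm]
  congr 1
  exact atl.lam_rmul j k b _

theorem thS_deg (j k : ι) : IsDeg (-1) (atl.thS j k) := fun m z hz =>
  AddSubgroup.sub_mem _
    (atl.lam_mem_deg j k (atl.pr₂_deg j k _ _ (Tot.res_mem_deg _ (cap_le_last U j [] k) hz)))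
    (Tot.rmul_mem_deg (fi.τ_mem _ _) (by simp) (Mor.restrict_isDeg _ (atl.h_deg j) le_top _ _ hz))

theorem th_pr (j k : ι) (z) : atl.th j k ((atl.pr k).1 z) -
    (Tot.rmul (fi.τ j (U k)) (Tot.rmul (fi.τ j (U k)) z) +
      (S.connOn _ (atl.thS j k z) + atl.thS j k (S.connOn _ z))) ∈
      Tot.fil S.toGMod (le_top : U k ≤ ⊤) 1 := by
  obtain ⟨c, rfl⟩ := fi.tot_res_surj fr (le_refl ⊤) (le_top : U k ≤ ⊤) z
  have h1 : tr F j k ((atl.pr k).1 (Tot.res (le_refl ⊤) le_top c)) =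
      (atl.pr₂ j k).1 (Tot.res (le_refl ⊤) le_top (S.conn c)) +
      Tot.res (le_refl (U j)) (cap_le_head U j [k]) (atl.al j c) +
      (F.obj j).connOn _ ((atl.pr₂ j k).1 (Tot.res (le_refl ⊤) le_top c)) := by
    have := atl.pr₂_conn j k c
    refine Eq.trans ?_ (congrArg (fun z => z + Tot.res (le_refl (U j)) (cap_le_head U j [k]) (atl.al j c) +
      (F.obj j).connOn _ ((atl.pr₂ j k).1 (Tot.res (le_refl ⊤) le_top c))) this.symm)
    rw [al_apply]
    change tr F j k ((atl.pr k).1 (Tot.res (le_refl ⊤) le_top c)) = _ - _ +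
      tr F j k ((atl.pr k).1 (Tot.res (le_refl ⊤) le_top c)) + _ + _
    abel
  have h2 : atl.th j k ((atl.pr k).1 (Tot.res (le_refl ⊤) le_top c)) = _ :=
    congrArg (atl.lam j k) h1
  rw [h2, map_add, map_add, lam_res, S.connOn_res, S.connOn_refl, thS_res, thS_res]
  have e1 := atl.lam_conn j k ((atl.pr₂ j k).1 (Tot.res (le_refl ⊤) le_top c))
  have e2 := Tot.rmul_fil fr (fi.τ j (U k)) (Tot.res_mem_fil (le_refl ⊤) (le_top : U k ≤ ⊤)
    (atl.homotopy j c))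
  have e3 := S.connOn_rmul_zero fr (le_top : U k ≤ ⊤) (fi.τ_mem j (U k))
    (Tot.res (le_refl ⊤) le_top ((atl.h j).1 c))
  rw [S.connOn_res, S.connOn_refl] at e3
  simp only [map_sub, map_add, Tot.res_rmul, fi.res_τ] at e2
  rw [map_sub, al_apply]
  have := AddSubgroup.add_mem _ (AddSubgroup.sub_mem _ e2 e1) e3
  convert this using 1
  abel

/-- The projection to `F_k` is an equivalence over `U k`. -/
theorem nonempty_locEquiv (k : ι) :
    Nonempty (LocEquiv (h₁ := (le_top : U k ≤ ⊤)) (h₂ := le_refl (U k)) S (F.obj k) (atl.pr k).1) := by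
  obtain ⟨c, hc⟩ := fi.exists_weights
  obtain ⟨K, hK, hK1, hKK⟩ := exists_pos_same_homotopy F k
  set ω' : ι → 𝒜.A (U k) := fun j => 𝒜.inc (le_top : U k ≤ ⊤) (c j) with hω
  have hω0 : ∀ j, ω' j ∈ 𝒜.gr (U k) 0 := fun j => inc_mem 𝒜 _ _
  have hone : ∑ j ∈ fi.s, fi.τ j (U k) * fi.τ j (U k) * ω' j = 1 := by
    rw [← inc_one 𝒜 (le_top : U k ≤ ⊤), ← hc]
    have : ∀ r, 𝒜.inc (le_top : U k ≤ ⊤) r = ((algebraMap (𝒜.A0 (U k)) (𝒜.A (U k))).comp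
      (𝒜.res0 (le_top : U k ≤ ⊤))) r := fun r => rfl
    rw [this, map_sum]
    refine Finset.sum_congr rfl fun j _ => ?_
    simp only [← this, hω, Fine.τ, ← inc_mul]
    congr 1; ring
  have hS : ∀ z : Tot S.toGMod (le_top : U k ≤ ⊤), ∑ j ∈ fi.s, Tot.rmul (ω' j)
      (Tot.rmul (fi.τ j (U k)) (Tot.rmul (fi.τ j (U k)) z)) = z := fun z => by
    simp only [Tot.rmul_rmul]
    rw [← Tot.rmul_sum, hone, Tot.rmul_one]
  have hF : ∀ z : Tot (F.gmod k) (le_refl (U k)), ∑ j ∈ fi.s, Tot.rmul (ω' j)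
      (Tot.rmul (fi.τ j (U k)) (Tot.rmul (fi.τ j (U k)) z)) = z := fun z => by
    simp only [Tot.rmul_rmul]
    rw [← Tot.rmul_sum, hone, Tot.rmul_one]
  refine ⟨⟨(atl.pr k).2, atl.pr_deg k, atl.pr_connOn k,
    ∑ j ∈ fi.s, (Tot.rmul (ω' j)).comp (atl.th j k),
    IsLin.sum _ _ fun j => Tot.rmul_isLin.comp (atl.th_lin j k),
    IsDeg.sum _ fun j => by simpa only [add_zero] using (Tot.rmul_isDeg (hω0 j)).comp (atl.th_deg j k),
    fun y => ?_,
    ∑ j ∈ fi.s, (Tot.rmul (ω' j)).comp (atl.thS j k),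
    IsLin.sum _ _ fun j => Tot.rmul_isLin.comp (atl.thS_lin j k),
    IsDeg.sum _ fun j => by simpa only [zero_add] using (Tot.rmul_isDeg (hω0 j)).comp (atl.thS_deg j k),
    fun x => ?_,
    K - ∑ j ∈ fi.s, (Tot.rmul (ω' j)).comp (thT fi fr F j k),
    hK.sub (IsLin.sum _ _ fun j => Tot.rmul_isLin.comp (thT_lin j k)),
    hK1.sub (IsDeg.sum _ fun j => by
      simpa only [zero_add] using (Tot.rmul_isDeg (hω0 j)).comp (thT_deg j k)),
    fun y => ?_⟩⟩
  · have h1 := fun j => AddSubgroup.add_mem _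
      (S.connOn_rmul_zero fr (le_top : U k ≤ ⊤) (hω0 j) (atl.th j k y))
      (Tot.rmul_fil fr (ω' j) (atl.th_conn j k y))
    have := AddSubgroup.sum_mem _ fun j (_ : j ∈ fi.s) => h1 j
    simp only [AddMonoidHom.finsetSum_apply, AddMonoidHom.comp_apply, map_sum]
    rw [← Finset.sum_sub_distrib]
    convert this using 2
    rw [map_sub]
    abel
  · have h1 := fun j => AddSubgroup.sub_mem _
      (Tot.rmul_fil fr (ω' j) (atl.th_pr j k x))
      (S.connOn_rmul_zero fr (le_top : U k ≤ ⊤) (hω0 j) (atl.thS j k x))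
    have := AddSubgroup.sum_mem _ fun j (_ : j ∈ fi.s) => h1 j
    simp only [AddMonoidHom.finsetSum_apply, AddMonoidHom.comp_apply, map_sum]
    simp only [map_sub, map_add, Finset.sum_sub_distrib, Finset.sum_add_distrib, hS] at this
    convert this using 1
    abel
  · have h1 := fun j => AddSubgroup.add_mem _
      (Tot.rmul_fil fr (ω' j) (atl.pr_th j k y))
      ((F.obj k).connOn_rmul_zero fr (le_refl (U k)) (hω0 j) (thT fi fr F j k y))
    have := AddSubgroup.sum_mem _ fun j (_ : j ∈ fi.s) => h1 j
    have h2 := hKK y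
    simp only [map_sub, map_add, Finset.sum_sub_distrib, Finset.sum_add_distrib, hF] at this
    rw [sub_eq_iff_eq_add] at h2
    rw [h2] at this
    simp only [AddMonoidHom.finsetSum_apply, AddMonoidHom.comp_apply, map_sum, AddMonoidHom.sub_apply,
      map_sub, (atl.pr k).2 _ _]
    convert this using 1
    abel

end Atlas

end LocalInverse

section RestrictResolution

variable {α : Type w} [SemilatticeInf α] [OrderTop α] {ι : Type w'} {𝒜 : DGPresheaf.{u} α}
  {U : ι → α}

/-- A resolution restricts to an equivalence. -/
theorem Resolution.nonempty_locEquiv (fi : Fine 𝒜 U) (fr : Frame 𝒜) {S : QCoh.{u, v} 𝒜 (⊤ : α)}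
    (R : Resolution S) (V : α) :
    Nonempty (LocEquiv (h₁ := le_refl V) (h₂ := (le_top : V ≤ ⊤)) (R.E.restrict le_top) S
      ((R.φ.restrict (le_top : V ≤ ⊤)).1.comp (Tot.down R.E.toGMod le_top (le_refl V)).1)) := by
  have hc : ∀ x, (R.E.restrict (le_top : V ≤ ⊤)).connOn (le_refl V) x =
      (Tot.up R.E.toGMod le_top (le_refl V)).1 (R.E.connOn le_top
        ((Tot.down R.E.toGMod le_top (le_refl V)).1 x)) := fun x => R.E.restrict_connOn le_top _ x
  have hdu : ∀ x : Tot R.E.toGMod (le_top : V ≤ ⊤), (Tot.down R.E.toGMod le_top (le_refl V)).1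
      ((Tot.up R.E.toGMod le_top (le_refl V)).1 x) = x := fun x => Tot.down_up _ x
  have hud : ∀ x, (Tot.up R.E.toGMod le_top (le_refl V)).1
      ((Tot.down R.E.toGMod (le_top : V ≤ ⊤) (le_refl V)).1 x) = x := fun x => Tot.up_down _ x
  have surE := fi.tot_res_surj fr (M := R.E.toGMod) (le_refl ⊤) (le_top : V ≤ ⊤)
  have surS := fi.tot_res_surj fr (M := S.toGMod) (le_refl ⊤) (le_top : V ≤ ⊤)
  have hφ : ∀ y, S.connOn le_top ((R.φ.restrict (le_top : V ≤ ⊤)).1 y) =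
      (R.φ.restrict le_top).1 (R.E.connOn le_top y) := fun y => by
    obtain ⟨c, rfl⟩ := surE y
    rw [R.E.connOn_res, R.E.connOn_refl, Mor.restrict_res, Mor.restrict_res, S.connOn_res,
      S.connOn_refl]
    exact congrArg _ (DFunLike.congr_fun R.φ_conn c)
  have hψ : ∀ y, R.E.connOn le_top ((R.ψ.restrict (le_top : V ≤ ⊤)).1 y) -
      (R.ψ.restrict le_top).1 (S.connOn le_top y) ∈ Tot.fil R.E.toGMod le_top 1 := fun y => by
    obtain ⟨c, rfl⟩ := surS y
    rw [S.connOn_res, S.connOn_refl, Mor.restrict_res, Mor.restrict_res, R.E.connOn_res,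
      R.E.connOn_refl, ← map_sub]
    exact Tot.res_mem_fil _ _ (R.ψ_conn 0 c (Tot.mem_fil_zero fr c))
  have hs : ∀ y, (R.ψ.restrict (le_top : V ≤ ⊤)).1 ((R.φ.restrict (le_top : V ≤ ⊤)).1 y) - y -
      (R.E.connOn le_top ((R.s.restrict le_top).1 y) + (R.s.restrict le_top).1 (R.E.connOn le_top y)) ∈
        Tot.fil R.E.toGMod le_top 1 := fun y => by
    obtain ⟨c, rfl⟩ := surE y
    simp only [R.E.connOn_res, R.E.connOn_refl, Mor.restrict_res, ← map_sub, ← map_add]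
    exact Tot.res_mem_fil _ _ (R.ψφ 0 c (Tot.mem_fil_zero fr c))
  have ht : ∀ y, (R.φ.restrict (le_top : V ≤ ⊤)).1 ((R.ψ.restrict (le_top : V ≤ ⊤)).1 y) - y -
      (S.connOn le_top ((R.t.restrict le_top).1 y) + (R.t.restrict le_top).1 (S.connOn le_top y)) ∈
        Tot.fil S.toGMod le_top 1 := fun y => by
    obtain ⟨c, rfl⟩ := surS y
    simp only [S.connOn_res, S.connOn_refl, Mor.restrict_res, ← map_sub, ← map_add]
    exact Tot.res_mem_fil _ _ (R.φψ 0 c (Tot.mem_fil_zero fr c))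
  have up := Tot.up R.E.toGMod (le_top : V ≤ ⊤) (le_refl V)
  have dn := Tot.down R.E.toGMod (le_top : V ≤ ⊤) (le_refl V)
  have hup := Tot.up_isDeg (M := R.E.toGMod) (h := (le_top : V ≤ ⊤)) (le_refl V)
  have hdn := Tot.down_isDeg (M := R.E.toGMod) (h := (le_top : V ≤ ⊤)) (le_refl V)
  have ulin := (Tot.up R.E.toGMod (le_top : V ≤ ⊤) (le_refl V)).2
  have dlin := (Tot.down R.E.toGMod (le_top : V ≤ ⊤) (le_refl V)).2
  refine ⟨⟨(R.φ.restrict le_top).2.comp dlin, ?_, fun x => ?_,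
    (Tot.up R.E.toGMod le_top (le_refl V)).1.comp (R.ψ.restrict le_top).1,
    ulin.comp (R.ψ.restrict le_top).2, ?_, fun y => ?_,
    ((Tot.up R.E.toGMod le_top (le_refl V)).1.comp (R.s.restrict le_top).1).comp
      (Tot.down R.E.toGMod le_top (le_refl V)).1,
    (ulin.comp (R.s.restrict le_top).2).comp dlin, ?_, fun x => ?_,
    (R.t.restrict le_top).1, (R.t.restrict le_top).2, Mor.restrict_isDeg _ R.t_deg _, fun y => ?_⟩⟩
  · simpa only [add_zero] using IsDeg.comp (Mor.restrict_isDeg _ R.φ_deg le_top) hdn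
  · simp only [AddMonoidHom.comp_apply]
    rw [hc, hdu, hφ]
  · simpa only [add_zero] using IsDeg.comp hup (Mor.restrict_isDeg _ R.ψ_deg le_top)
  · simp only [AddMonoidHom.comp_apply]
    rw [hc, hdu, ← map_sub]
    exact ulin.map_fil fr (hψ y)
  · simpa only [add_zero, zero_add] using IsDeg.comp (IsDeg.comp hup
      (Mor.restrict_isDeg _ R.s_deg le_top)) hdn
  · simp only [AddMonoidHom.comp_apply]
    rw [hc, hc, hdu, hdu]
    have := ulin.map_fil fr (hs ((Tot.down R.E.toGMod le_top (le_refl V)).1 x))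
    simp only [map_sub, map_add, hud] at this
    exact this
  · simp only [AddMonoidHom.comp_apply]
    rw [hdu]
    exact ht y

/-- The components of Čech degree zero of the comparison map have contractible cones. -/
theorem exists_counit_contraction (fi : Fine 𝒜 U) (fr : Frame 𝒜) (F : Tw.{u, v} 𝒜 U)
    (R : Resolution (sheafify fr F)) (k : ι) :
    ∃ h : AddMonoid.End (Tot ((twist U R.E).gmod k) (le_refl (U k)) × Tot (F.gmod k) (le_refl (U k))),
      KLin h ∧ KDeg (-1) h ∧
      coneD (((twist U R.E).obj k).connOn (le_refl (U k))) ((F.obj k).connOn (le_refl (U k)))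
        (((counit F).comp 0 (twistMap U R.φ)).zero k).1 * h +
      h * coneD (((twist U R.E).obj k).connOn (le_refl (U k))) ((F.obj k).connOn (le_refl (U k)))
        (((counit F).comp 0 (twistMap U R.φ)).zero k).1 = 1 := by
  obtain ⟨e₁⟩ := R.nonempty_locEquiv fi fr (U k)
  obtain ⟨e₂⟩ := (sheafifyAtlas fi fr F).nonempty_locEquiv k
  have e := (e₂.comp fr e₁).exists_cone_contraction fr
  have h1 : (((counit F).comp 0 (twistMap U R.φ)).zero k).1 =
      ((sheafifyAtlas fi fr F).pr k).1.comp ((R.φ.restrict (le_top : U k ≤ ⊤)).1.comp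
        (Tot.down R.E.toGMod le_top (le_refl (U k))).1) := by
    have h2 := Mor.restrict_refl ((counit F).zero k)
    have h3 := Mor.restrict_refl ((twistMap U R.φ).zero k)
    refine AddMonoidHom.ext fun x => ?_
    change (((counit F).zero k).restrict (le_refl (U k))).1
      ((((twistMap U R.φ).zero k).restrict (le_refl (U k))).1 x) = _
    rw [h2, h3]
    exact congrArg (shProj F k [] (U k) le_rfl).1 (Tot.down_up (M := shGMod F) (le_refl (U k)) _)
  rw [h1]
  exact e

end RestrictResolution

section AbstractAction

variable {J : Type*} {T T' T'' : J → Type*} [∀ j, AddCommGroup (T j)] [∀ j, AddCommGroup (T' j)]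
  [∀ j, AddCommGroup (T'' j)]

/-- The action on cochains of a cochain of operators of total degree `m`, over a fixed open set. -/
def absAct (m : ℤ) (Z : ∀ j, T j →+ T' j) (Q : ∀ i, List J → ∀ x, T x →+ T' i) :
    (∀ j, List J → T j) →+ (∀ j, List J → T' j) where
  toFun Y i l := sgn (m * l.length) • Z i (Y i l) +
    ssum (fun p x q => sgn ((m - (p.length + 1)) * q.length) • Q i p x (Y x q)) l
  map_zero' := by
    funext i l
    simp only [Pi.zero_apply, map_zero, smul_zero, ssum_zero, add_zero]
  map_add' Y Y' := by
    funext i l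
    simp only [Pi.add_apply, map_add, smul_add, ssum_add]
    abel

theorem absAct_apply (m : ℤ) (Z : ∀ j, T j →+ T' j) (Q : ∀ i, List J → ∀ x, T x →+ T' i)
    (Y : ∀ j, List J → T j) (i : J) (l : List J) : absAct m Z Q Y i l =
      sgn (m * l.length) • Z i (Y i l) +
      ssum (fun p x q => sgn ((m - (p.length + 1)) * q.length) • Q i p x (Y x q)) l := rfl

/-- The Čech differential on cochains, over a fixed open set. -/
def absDelta : (∀ j, List J → T j) →+ (∀ j, List J → T j) where
  toFun Y i l := ssum (fun p _ q => sgn (p.length + 1) • Y i (p ++ q)) l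
  map_zero' := by
    funext i l
    simp only [Pi.zero_apply, smul_zero, ssum_zero]
  map_add' Y Y' := by
    funext i l
    simp only [Pi.add_apply, smul_add, ssum_add]

theorem absDelta_apply (Y : ∀ j, List J → T j) (i : J) (l : List J) :
    absDelta Y i l = ssum (fun p _ q => sgn (p.length + 1) • Y i (p ++ q)) l := rfl

theorem absAct_absAct (m n : ℤ) (Z : ∀ j, T' j →+ T'' j) (Q : ∀ i, List J → ∀ x, T' x →+ T'' i)
    (Z' : ∀ j, T j →+ T' j) (Q' : ∀ i, List J → ∀ x, T x →+ T' i)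
    (R : ∀ i, List J → ∀ x, T x →+ T'' i)
    (hR : ∀ i p x z, R i p x z = sgn (m * (p.length + 1)) • Z i (Q' i p x z) + Q i p x (Z' x z) +
      ssum (fun p₁ y p₂ => sgn ((m - (p₁.length + 1)) * (p₂.length + 1)) •
        Q i p₁ y (Q' y p₂ x z)) p) (Y : ∀ j, List J → T j) :
    absAct m Z Q (absAct n Z' Q' Y) = absAct (m + n) (fun j => (Z j).comp (Z' j)) R Y := by
  funext i l
  simp only [absAct_apply, hR, map_add, map_zsmul, smul_add, ssum_add, map_ssum, zsmul_ssum,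
    AddMonoidHom.comp_apply, smul_smul, ← sgn_add]
  rw [add_assoc, add_assoc (ssum _ l)]
  refine congrArg₂ (· + ·) (by congr 2; ring) (congrArg₂ (· + ·) ?_ (congrArg₂ (· + ·) ?_ ?_))
  · refine ssum_congr fun p x q hl => ?_
    subst hl
    congr 2
    push_cast [List.length_append, List.length_cons]
    ring
  · refine ssum_congr fun p x q hl => ?_
    congr 2
    ring
  · refine Eq.trans (ssum_congr fun p x q _ => ssum_congr fun p₁ y p₂ hp => ?_)
      ((ssum_assoc (fun p x q y r => sgn ((m + n - (p.length + q.length + 2)) * r.length +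
        (m - (p.length + 1)) * (q.length + 1)) • Q i p x (Q' x q y (Y y r))) l).trans
        (ssum_congr fun p x q _ => ssum_congr fun p₁ y p₂ hp => ?_))
    · subst hp
      congr 2
      push_cast [List.length_append, List.length_cons]
      ring
    · subst hp
      congr 2
      push_cast [List.length_append, List.length_cons]
      ring

theorem absDelta_absAct (m : ℤ) (Z : ∀ j, T j →+ T' j) (Q : ∀ i, List J → ∀ x, T x →+ T' i)
    (R : ∀ i, List J → ∀ x, T x →+ T' i)
    (hR : ∀ i p x z, R i p x z = ssum (fun p₁ _ p₂ => sgn (p₁.length + 1) • Q i (p₁ ++ p₂) x z) p)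
    (Y : ∀ j, List J → T j) :
    absDelta (absAct m Z Q Y) = sgn m • absAct m Z Q (absDelta Y) + absAct (m + 1) 0 R Y := by
  funext i l
  simp only [Pi.add_apply, Pi.smul_apply, absAct_apply, absDelta_apply, hR, map_zsmul,
    smul_add, ssum_add, map_ssum, zsmul_ssum, ssum_append, smul_smul, ← sgn_add,
    Pi.zero_apply, AddMonoidHom.zero_apply, smul_zero, zero_add]
  have h1 : ssum (fun p x q => sgn (p.length + 1 + m * (p ++ q).length) • Z i (Y i (p ++ q))) l =
      ssum (fun p x q => sgn (m + (m * l.length + (p.length + 1))) • Z i (Y i (p ++ q))) l := by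
    refine ssum_congr fun p x q hl => ?_
    subst hl
    congr 1
    refine sgn_congr ⟨-m, ?_⟩
    push_cast [List.length_append, List.length_cons]
    ring
  have h2 : ssum (fun p x q => ssum (fun p₁ y q₁ =>
      sgn (p.length + 1 + (m - (p₁.length + 1)) * (q₁ ++ q).length) • Q i p₁ y (Y y (q₁ ++ q))) p) l =
      ssum (fun p x q => ssum (fun q₁ y q₂ =>
        sgn (m + ((m - (p.length + 1)) * q.length + (q₁.length + 1))) •
          Q i p x (Y x (q₁ ++ q₂))) q) l := by
    refine Eq.trans (ssum_congr fun p x q _ => ssum_congr fun p₁ y p₂ hp => ?_)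
      ((ssum_assoc (fun p x q _ r => sgn (p.length + q.length + 2 +
        (m - (p.length + 1)) * (q.length + r.length)) • Q i p x (Y x (q ++ r))) l).symm.trans
        (ssum_congr fun p x q _ => ssum_congr fun p₁ y p₂ hp => ?_))
    · subst hp
      congr 2
      push_cast [List.length_append, List.length_cons]
      ring
    · subst hp
      congr 1
      refine sgn_congr ⟨p.length + 1 - m, ?_⟩
      push_cast [List.length_append, List.length_cons]
      ring
  have h3 : ssum (fun p x q => ssum (fun q₁ y q₂ =>
      sgn (p.length + 1 + (m - ((p ++ q₁).length + 1)) * q₂.length) • Q i (p ++ q₁) y (Y y q₂)) q) l =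
      ssum (fun p x q => ssum (fun p₁ y p₂ =>
        sgn ((m + 1 - (p.length + 1)) * q.length + (p₁.length + 1)) •
          Q i (p₁ ++ p₂) x (Y x q)) p) l := by
    refine (ssum_assoc (fun p _ q x r => sgn (p.length + 1 + (m - ((p ++ q).length + 1)) * r.length) •
      Q i (p ++ q) x (Y x r)) l).trans ?_
    refine ssum_congr fun p x q _ => ssum_congr fun p₁ y p₂ hp => ?_
    subst hp
    congr 1
    refine sgn_congr ⟨0, ?_⟩
    push_cast [List.length_append, List.length_cons]
    ring
  rw [h1, h2, h3]
  abel

open Classical in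
/-- The cochain which is `z` at the index `j` and zero elsewhere. -/
noncomputable def absSingle (j : J) (z : T j) : ∀ i, List J → T i
  | i, [] => if h : i = j then h ▸ z else 0
  | _, _ :: _ => 0

theorem absSingle_nil (j : J) (z : T j) : absSingle j z j [] = z := by simp [absSingle]

theorem absSingle_append (j : J) (z : T j) (i x : J) (l : List J) :
    absSingle j z i (l ++ [x]) = 0 := by
  cases l <;> rfl

theorem absAct_single_nil (m : ℤ) (Z : ∀ j, T j →+ T' j) (Q : ∀ i, List J → ∀ x, T x →+ T' i)
    (j : J) (z : T j) : absAct m Z Q (absSingle j z) j [] = Z j z := by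
  rw [absAct_apply, absSingle_nil, ssum]
  simp [sgn_zero]

theorem absAct_single_append (m : ℤ) (Z : ∀ j, T j →+ T' j)
    (Q : ∀ i, List J → ∀ x, T x →+ T' i) (i j : J) (l : List J) (z : T j) :
    absAct m Z Q (absSingle j z) i (l ++ [j]) = Q i l j z := by
  rw [absAct_apply, absSingle_append, ssum_append]
  simp only [absSingle_append, map_zero, smul_zero, ssum_zero, ssum, List.append_nil, zero_add,
    absSingle_nil, List.length_nil, Nat.cast_zero, mul_zero, sgn_zero, one_smul, add_zero]

end AbstractAction

section RawAction

variable {α : Type w} [SemilatticeInf α] [OrderTop α] {ι : Type w'} {𝒜 : DGPresheaf.{u} α}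
  {U : ι → α} {E : ∀ i, GMod.{u, v} 𝒜 (U i)} {F : ∀ i, GMod.{u, v'} 𝒜 (U i)}
  {G : ∀ i, GMod.{u, v''} 𝒜 (U i)}

namespace Raw

theorem ext_components {f g : Raw U E F} (h0 : ∀ i W h z, f.zero i W h z = g.zero i W h z)
    (h1 : ∀ i l j W h z, f.pos i l j W h z = g.pos i l j W h z) : f = g := by
  obtain ⟨a, b⟩ := f
  obtain ⟨c, d⟩ := g
  obtain rfl : a = c := by
    funext i W h
    exact AddMonoidHom.ext (h0 i W h)
  obtain rfl : b = d := by
    funext i l j W h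
    exact AddMonoidHom.ext (h1 i l j W h)
  rfl

/-- The components over `W` of a cochain of operators in positive Čech degree. -/
def posOn (f : Raw U E F) (W : α) (i : {j // W ≤ U j}) (p : List {j // W ≤ U j})
    (x : {j // W ≤ U j}) : Tot (E x.1) x.2 →+ Tot (F i.1) i.2 :=
  f.pos i.1 (p.map Subtype.val) x.1 W (le_cap_map' i p x)

/-- The action over `W` of a cochain of operators of total degree `m`. -/
noncomputable def act (f : Raw U E F) (W : α) (m : ℤ) :
    (∀ j : {j // W ≤ U j}, List {j // W ≤ U j} → Tot (E j.1) j.2) →+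
      (∀ j : {j // W ≤ U j}, List {j // W ≤ U j} → Tot (F j.1) j.2) :=
  absAct (T := fun j : {j // W ≤ U j} => Tot (E j.1) j.2)
    (T' := fun j : {j // W ≤ U j} => Tot (F j.1) j.2) m (fun j => f.zero j.1 W j.2) (f.posOn W)

theorem act_apply (f : Raw U E F) (W : α) (m : ℤ) (Y) (i : {j // W ≤ U j})
    (l : List {j // W ≤ U j}) : f.act W m Y i l = sgn (m * l.length) • f.zero i.1 W i.2 (Y i l) +
      ssum (fun p x q => sgn ((m - (p.length + 1)) * q.length) • f.posOn W i p x (Y x q)) l := rfl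

theorem posOn_eq (f : Raw U E F) (W : α) (i : {j // W ≤ U j}) (p : List {j // W ≤ U j})
    (x : {j // W ≤ U j}) {p' : List ι} (hp : p' = p.map Subtype.val)
    (h : W ≤ cap U i.1 (p' ++ [x.1])) (z : Tot (E x.1) x.2) :
    f.pos i.1 p' x.1 W h z = f.posOn W i p x z := by
  subst hp; rfl

theorem posOn_posOn_eq (f : Raw U F G) (g : Raw U E F) (W : α) (i : {j // W ≤ U j})
    (p : List {j // W ≤ U j}) (x : {j // W ≤ U j}) (q : List {j // W ≤ U j}) (j : {j // W ≤ U j})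
    (z : Tot (E j.1) j.2) {p' q' : List ι}
    {x' : ι} (hp : p' = p.map Subtype.val) (hx : x' = x.1) (hq : q' = q.map Subtype.val)
    (h : W ≤ cap U i.1 (p' ++ [x'])) (h' : W ≤ cap U x' (q' ++ [j.1])) :
    f.pos i.1 p' x' W h (g.pos x' q' j.1 W h' z) = f.posOn W i p x (g.posOn W x q j z) := by
  subst hp hx hq; rfl

theorem posOn_mul (m : ℤ) (f : Raw U F G) (g : Raw U E F) (W : α) (i : {j // W ≤ U j})
    (p : List {j // W ≤ U j}) (x : {j // W ≤ U j}) (z : Tot (E x.1) x.2) :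
    (f.mul m g).posOn W i p x z = sgn (m * (p.length + 1)) • f.zero i.1 W i.2 (g.posOn W i p x z) +
      f.posOn W i p x (g.zero x.1 W x.2 z) +
      ssum (fun p₁ y p₂ => sgn ((m - (p₁.length + 1)) * (p₂.length + 1)) •
        f.posOn W i p₁ y (g.posOn W y p₂ x z)) p := by
  refine (Raw.mul_apply m f g i.1 (p.map Subtype.val) x.1 W (le_cap_map' i p x) z).trans ?_
  refine congrArg₂ (· + ·) (congrArg₂ (· + ·) ?_ rfl) ?_
  · rw [List.length_map]; rfl
  · refine sum_fin_eq_ssum Subtype.val p _ rfl _ _ ?_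
    rintro p₁ m p₂ rfl ⟨k, hk⟩ rfl
    refine congrArg₂ (· • ·) ?_ (posOn_posOn_eq f g W i p₁ m p₂ x z ?_ ?_ ?_ _ _)
    · congr 2
      simp
    · simp
    · simp
    · exact map_drop ..

theorem posOn_delta (f : Raw U E F) (W : α) (i : {j // W ≤ U j})
    (p : List {j // W ≤ U j}) (x : {j // W ≤ U j}) (z : Tot (E x.1) x.2) :
    f.delta.posOn W i p x z =
      ssum (fun p₁ _ p₂ => sgn (p₁.length + 1) • f.posOn W i (p₁ ++ p₂) x z) p := by
  refine (Raw.delta_apply f i.1 (p.map Subtype.val) x.1 W (le_cap_map' i p x) z).trans ?_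
  refine sum_fin_eq_ssum Subtype.val p _ rfl _ _ ?_
  rintro p₁ m p₂ rfl ⟨k, hk⟩ rfl
  exact congrArg _ (posOn_eq f W i (p₁ ++ p₂) x (map_erase ..) _ z)

theorem act_mul (m n : ℤ) (f : Raw U F G) (g : Raw U E F) (W : α) :
    (f.mul m g).act W (m + n) = (f.act W m).comp (g.act W n) :=
  AddMonoidHom.ext fun Y => (absAct_absAct
    (T := fun j : {j // W ≤ U j} => Tot (E j.1) j.2)
    (T' := fun j : {j // W ≤ U j} => Tot (F j.1) j.2)
    (T'' := fun j : {j // W ≤ U j} => Tot (G j.1) j.2) m n (fun j => f.zero j.1 W j.2) (f.posOn W)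
    (fun j => g.zero j.1 W j.2) (g.posOn W) ((f.mul m g).posOn W)
    (fun i p x z => posOn_mul m f g W i p x z) Y).symm

/-- The Čech differential on cochains over `W`. -/
noncomputable def deltaOn (E : ∀ i, GMod.{u, v} 𝒜 (U i)) (W : α) :
    (∀ j : {j // W ≤ U j}, List {j // W ≤ U j} → Tot (E j.1) j.2) →+
      (∀ j : {j // W ≤ U j}, List {j // W ≤ U j} → Tot (E j.1) j.2) :=
  absDelta (T := fun j : {j // W ≤ U j} => Tot (E j.1) j.2)

theorem act_delta (m : ℤ) (f : Raw U E F) (W : α) :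
    f.delta.act W (m + 1) =
      (deltaOn F W).comp (f.act W m) - sgn m • (f.act W m).comp (deltaOn E W) := by
  refine AddMonoidHom.ext fun Y => eq_sub_of_add_eq' ((absDelta_absAct
    (T := fun j : {j // W ≤ U j} => Tot (E j.1) j.2)
    (T' := fun j : {j // W ≤ U j} => Tot (F j.1) j.2) m (fun j => f.zero j.1 W j.2) (f.posOn W)
    (f.delta.posOn W) (posOn_delta f W) Y).symm)

theorem act_add (m : ℤ) (f g : Raw U E F) (W : α) :
    (f.add g).act W m = f.act W m + g.act W m := by
  refine AddMonoidHom.ext fun Y => ?_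
  funext i l
  change (f.add g).act W m Y i l = f.act W m Y i l + g.act W m Y i l
  simp only [act_apply]
  have : ∀ p x q, (f.add g).posOn W i p x (Y x q) = f.posOn W i p x (Y x q) +
    g.posOn W i p x (Y x q) := fun p x q => rfl
  simp only [this]
  simp only [smul_add, ssum_add, Raw.add, AddMonoidHom.add_apply]
  abel

theorem act_zsmul (m k : ℤ) (f : Raw U E F) (W : α) :
    (f.zsmul k).act W m = k • f.act W m := by
  refine AddMonoidHom.ext fun Y => ?_
  funext i l
  change (f.zsmul k).act W m Y i l = k • f.act W m Y i l
  simp only [act_apply]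
  have : ∀ p x q, (f.zsmul k).posOn W i p x (Y x q) = k • f.posOn W i p x (Y x q) :=
    fun p x q => rfl
  simp only [this]
  simp only [smul_add, zsmul_ssum, Raw.zsmul, AddMonoidHom.smul_apply, smul_smul, mul_comm]

theorem act_id (E : ∀ i, GMod.{u, v} 𝒜 (U i)) (W : α) :
    (Coch.id E).raw.act W 0 = AddMonoidHom.id _ := by
  refine AddMonoidHom.ext fun Y => ?_
  funext i l
  refine (absAct_apply ..).trans ?_
  have h1 : ∀ z, (Coch.id E).raw.zero i.1 W i.2 z = z := fun z =>
    DFunLike.congr_fun (Mor.restrict_eq (Mor.id (E i.1) (le_refl (U i.1))) i.2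
      (AddMonoidHom.id _) (fun _ _ => rfl) fun _ => rfl) z
  have h2 : ∀ p x z, (Coch.id E).raw.posOn W i p x z = 0 := fun p x z =>
    DFunLike.congr_fun (Mor.zero_restrict (M := E x.1) (M' := E i.1) _) z
  simp only [h1, h2, smul_zero, ssum_zero, add_zero, zero_mul, sgn_zero, one_smul,
    AddMonoidHom.id_apply]

/-- A cochain of operators is determined by its actions. -/
theorem ext_act (m : ℤ) {f g : Raw U E F} (h : ∀ W, f.act W m = g.act W m) : f = g := by
  refine ext_components (fun i W hi z => ?_) fun i l j W hl z => ?_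
  · let i' : {j // W ≤ U j} := ⟨i, hi⟩
    have h0 : ∀ f : Raw U E F, f.act W m (absSingle i' z) i' [] = f.zero i W hi z := fun f =>
      absAct_single_nil (T := fun j : {j // W ≤ U j} => Tot (E j.1) j.2) ..
    rw [← h0 f, ← h0 g, h W]
  · let i' : {j // W ≤ U j} := ⟨i, hl.trans (cap_le_head U i _)⟩
    let j' : {j // W ≤ U j} := ⟨j, hl.trans (cap_le_last U i l j)⟩
    let l' : List {j // W ≤ U j} := l.pmap Subtype.mk fun k hk =>
      hl.trans (cap_le_mem (List.mem_cons_of_mem _ (List.mem_append_left _ hk)))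
    have hl' : l = l'.map Subtype.val := by simp [l', List.map_pmap]
    have h0 : ∀ f : Raw U E F,
        f.act W m (absSingle j' z) i' (l' ++ [j']) = f.pos i l j W hl z := fun f =>
      (absAct_single_append (T := fun j : {j // W ≤ U j} => Tot (E j.1) j.2) ..).trans
        (posOn_eq f W i' l' j' hl' hl z).symm
    rw [← h0 f, ← h0 g, h W]

/-- Compatibility of the components with restriction to smaller open sets. -/
structure IsNat (f : Raw U E F) : Prop where
  zero : ∀ i V W (h : V ≤ U i) (h' : W ≤ V) z,
    f.zero i W (h'.trans h) (Tot.res h h' z) = Tot.res h h' (f.zero i V h z)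
  pos : ∀ i l j V W (h : V ≤ cap U i (l ++ [j])) (h' : W ≤ V) z,
    f.pos i l j W (h'.trans h) (Tot.res (h.trans (cap_le_last U i l j)) h' z) =
      Tot.res (h.trans (cap_le_head U i (l ++ [j]))) h' (f.pos i l j V h z)

/-- All components are linear. -/
structure IsLinear (f : Raw U E F) : Prop where
  zero : ∀ i W h, IsLin (f.zero i W h)
  pos : ∀ i l j W h, IsLin (f.pos i l j W h)

/-- The components are those of a cochain of total degree `n`. -/
structure HasDeg (n : ℤ) (f : Raw U E F) : Prop where
  zero : ∀ i W h, IsDeg n (f.zero i W h)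
  pos : ∀ i l j W h, IsDeg (n - (l.length + 1)) (f.pos i l j W h)

theorem IsNat.mul {f : Raw U F G} {g : Raw U E F} (hf : f.IsNat) (hg : g.IsNat) (m : ℤ) :
    (f.mul m g).IsNat where
  zero i V W h h' z := (congrArg _ (hg.zero i V W h h' z)).trans (hf.zero i V W h h' _)
  pos i l j V W h h' z := by
    rw [Raw.mul_apply, Raw.mul_apply, map_add, map_add, map_sum, map_zsmul]
    refine congrArg₂ (· + ·) (congrArg₂ (· + ·) (congrArg _ ?_) ?_)
      (Finset.sum_congr rfl fun k _ => ?_)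
    · exact (congrArg _ (hg.pos i l j V W h h' z)).trans (hf.zero i V W _ h' _)
    · exact (congrArg _ (hg.zero j V W _ h' z)).trans (hf.pos i l j V W h h' _)
    · rw [map_zsmul]
      exact congrArg _ ((congrArg _ (hg.pos _ _ j V W (h.trans (cap_drop' U i l j k)) h' z)).trans
        (hf.pos i _ _ V W (h.trans (cap_take' U i l j k)) h' _))

theorem IsNat.delta {f : Raw U E F} (hf : f.IsNat) : f.delta.IsNat where
  zero i V W h h' z := (map_zero _).symm
  pos i l j V W h h' z := by
    rw [Raw.delta_apply, Raw.delta_apply, map_sum]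
    refine Finset.sum_congr rfl fun k _ => ?_
    rw [map_zsmul]
    exact congrArg _ (hf.pos i _ j V W (h.trans (cap_erase' U i l j k)) h' z)

theorem IsNat.add {f g : Raw U E F} (hf : f.IsNat) (hg : g.IsNat) : (f.add g).IsNat where
  zero i V W h h' z := (congrArg₂ (· + ·) (hf.zero i V W h h' z) (hg.zero i V W h h' z)).trans
    (map_add _ _ _).symm
  pos i l j V W h h' z := (congrArg₂ (· + ·) (hf.pos i l j V W h h' z)
    (hg.pos i l j V W h h' z)).trans (map_add _ _ _).symm

theorem IsNat.zsmul {f : Raw U E F} (hf : f.IsNat) (k : ℤ) : (f.zsmul k).IsNat where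
  zero i V W h h' z := (congrArg (k • ·) (hf.zero i V W h h' z)).trans (map_zsmul _ _ _).symm
  pos i l j V W h h' z := (congrArg (k • ·) (hf.pos i l j V W h h' z)).trans
    (map_zsmul _ _ _).symm

theorem IsLinear.mul {f : Raw U F G} {g : Raw U E F} (hf : f.IsLinear) (hg : g.IsLinear) (m : ℤ) :
    (f.mul m g).IsLinear where
  zero i W h := (hf.zero i W h).comp (hg.zero i W h)
  pos i l j W h := by
    refine IsLin.add (IsLin.add (IsLin.zsmul (IsLin.comp (hf.zero _ _ _) (hg.pos _ _ _ _ _)) _)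
      (IsLin.comp (hf.pos _ _ _ _ _) (hg.zero _ _ _)))
      (IsLin.sum _ _ fun k => IsLin.zsmul (IsLin.comp (hf.pos _ _ _ _ _) (hg.pos _ _ _ _ _)) _)

theorem IsLinear.add {f g : Raw U E F} (hf : f.IsLinear) (hg : g.IsLinear) : (f.add g).IsLinear where
  zero i W h := (hf.zero i W h).add (hg.zero i W h)
  pos i l j W h := (hf.pos i l j W h).add (hg.pos i l j W h)

theorem IsLinear.zsmul {f : Raw U E F} (hf : f.IsLinear) (k : ℤ) : (f.zsmul k).IsLinear where
  zero i W h := (hf.zero i W h).zsmul k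
  pos i l j W h := (hf.pos i l j W h).zsmul k

theorem HasDeg.mul {f : Raw U F G} {g : Raw U E F} {m n k : ℤ} (hf : f.HasDeg m) (hg : g.HasDeg n)
    (hk : m + n = k) : (f.mul m g).HasDeg k where
  zero i W h a x hx := by
    have := ((hf.zero i W h).comp (hg.zero i W h)) a x hx
    rwa [hk] at this
  pos i l j W h a x hx := by
    rw [Raw.mul_apply]
    refine add_mem (add_mem (zsmul_mem ?_ _) ?_) (sum_mem fun r _ => zsmul_mem ?_ _)
    · have := ((hf.zero i W (h.trans (cap_le_head U i _))).comp (hg.pos i l j W h)) a x hx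
      rwa [show a + (m + (n - (l.length + 1))) = a + (k - (l.length + 1)) by omega] at this
    · have := ((hf.pos i l j W h).comp (hg.zero j W (h.trans (cap_le_last U i l j)))) a x hx
      rwa [show a + (m - (l.length + 1) + n) = a + (k - (l.length + 1)) by omega] at this
    · have := ((hf.pos i (l.take r) (l.get r) W (h.trans (cap_take' U i l j r))).comp
        (hg.pos (l.get r) (l.drop (r + 1)) j W (h.trans (cap_drop' U i l j r)))) a x hx
      have hr := r.2
      have e : a + (m - ((l.take r).length + 1) + (n - ((l.drop (r + 1)).length + 1))) =
          a + (k - (l.length + 1)) := by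
        rw [List.length_take, List.length_drop, min_eq_left hr.le]
        omega
      rwa [e] at this

theorem HasDeg.add {f g : Raw U E F} {n : ℤ} (hf : f.HasDeg n) (hg : g.HasDeg n) :
    (f.add g).HasDeg n where
  zero i W h a x hx := add_mem (hf.zero i W h a x hx) (hg.zero i W h a x hx)
  pos i l j W h a x hx := add_mem (hf.pos i l j W h a x hx) (hg.pos i l j W h a x hx)

theorem HasDeg.zsmul {f : Raw U E F} {n : ℤ} (hf : f.HasDeg n) (k : ℤ) : (f.zsmul k).HasDeg n where
  zero i W h a x hx := zsmul_mem (hf.zero i W h a x hx) k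
  pos i l j W h a x hx := zsmul_mem (hf.pos i l j W h a x hx) k

theorem HasDeg.delta {f : Raw U E F} {n : ℤ} (hf : f.HasDeg n) : f.delta.HasDeg (n + 1) where
  zero i W h a x hx := zero_mem _
  pos i l j W h a x hx := by
    rw [Raw.delta_apply]
    refine sum_mem fun r _ => zsmul_mem ?_ _
    have := hf.pos i (l.eraseIdx r) j W (h.trans (cap_erase' U i l j r)) a x hx
    have hr := r.2
    have e : a + (n - ((l.eraseIdx r).length + 1)) = a + (n + 1 - (l.length + 1)) := by
      rw [List.length_eraseIdx_of_lt hr]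
      omega
    rwa [e] at this

/-- The cochain of morphisms with given operators. -/
def toCoch (f : Raw U E F) (hf : f.IsLinear) : Coch U E F where
  zero i := ⟨f.zero i (U i) le_rfl, hf.zero _ _ _⟩
  pos i l j := ⟨f.pos i l j _ le_rfl, hf.pos _ _ _ _ _⟩

theorem toCoch_raw (f : Raw U E F) (hf : f.IsLinear) (hn : f.IsNat) : (f.toCoch hf).raw = f :=
  ext_components
    (fun i W h z => DFunLike.congr_fun (Mor.restrict_eq ((f.toCoch hf).zero i) h _ (hf.zero i W h)
      fun x => hn.zero i (U i) W le_rfl h x) z)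
    fun i l j W h z => DFunLike.congr_fun (Mor.restrict_eq ((f.toCoch hf).pos i l j) h _
      (hf.pos i l j W h) fun x => hn.pos i l j _ W le_rfl h x) z

theorem _root_.Cohesive.Coch.raw_isLinear (f : Coch U E F) : f.raw.IsLinear :=
  ⟨fun _ _ _ => Mor.lin _, fun _ _ _ _ _ => Mor.lin _⟩

theorem _root_.Cohesive.Coch.raw_isNat (f : Coch U E F) : f.raw.IsNat where
  zero i V W h h' z := by
    have := Mor.restrict_res ((f.zero i).restrict h) h' z
    rw [Mor.restrict_restrict] at this
    exact this
  pos i l j V W h h' z := by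
    have := Mor.restrict_res ((f.pos i l j).restrict h) h' z
    rw [Mor.restrict_restrict] at this
    exact this

theorem _root_.Cohesive.Coch.raw_hasDeg {f : Coch U E F} {n : ℤ} (hf : f.HasDeg n) :
    f.raw.HasDeg n :=
  ⟨fun i _ _ => Mor.restrict_isDeg _ (hf.1 i) _, fun i l j _ _ => Mor.restrict_isDeg _ (hf.2 i l j) _⟩

theorem _root_.Cohesive.Coch.comp_raw (m : ℤ) (f : Coch U F G) (g : Coch U E F) :
    (f.comp m g).raw = f.raw.mul m g.raw :=
  toCoch_raw (f.raw.mul m g.raw) (f.raw_isLinear.mul g.raw_isLinear m)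
    (f.raw_isNat.mul g.raw_isNat m)

/-- Linear cochains of operators that agree over the largest open sets agree. -/
theorem eq_of_largest {f g : Raw U E F} (hf : f.IsLinear) (hf' : f.IsNat) (hg : g.IsLinear)
    (hg' : g.IsNat) (h0 : ∀ i, f.zero i (U i) le_rfl = g.zero i (U i) le_rfl)
    (h1 : ∀ i l j, f.pos i l j _ le_rfl = g.pos i l j _ le_rfl) : f = g := by
  rw [← f.toCoch_raw hf hf', ← g.toCoch_raw hg hg']
  congr 1
  simp only [toCoch, h0, h1]

end Raw

end RawAction

section ConeAction

variable {α : Type w} [SemilatticeInf α] [OrderTop α] {ι : Type w'} {𝒜 : DGPresheaf.{u} α}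
  {U : ι → α} {E : ∀ i, GMod.{u, v} 𝒜 (U i)} {F : ∀ i, GMod.{u, v'} 𝒜 (U i)}
  {G : ∀ i, GMod.{u, v''} 𝒜 (U i)}

namespace Raw

/-- Agreement of cochains of operators up to Čech degree `n`. -/
def Agree (n : ℕ) (f g : Raw U E F) : Prop :=
  (∀ i W h, f.zero i W h = g.zero i W h) ∧
    ∀ i l j W h, l.length < n → f.pos i l j W h = g.pos i l j W h

theorem Agree.refl (n : ℕ) (f : Raw U E F) : Agree n f f := ⟨fun _ _ _ => rfl, fun _ _ _ _ _ _ => rfl⟩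

theorem Agree.trans {n : ℕ} {f g k : Raw U E F} (h : Agree n f g) (h' : Agree n g k) :
    Agree n f k :=
  ⟨fun i W hi => (h.1 i W hi).trans (h'.1 i W hi),
    fun i l j W hl hn => (h.2 i l j W hl hn).trans (h'.2 i l j W hl hn)⟩

theorem Agree.mono {n m : ℕ} {f g : Raw U E F} (h : Agree n f g) (hm : m ≤ n) : Agree m f g :=
  ⟨h.1, fun i l j W hl hn => h.2 i l j W hl (hn.trans_le hm)⟩

theorem Agree.add {n : ℕ} {f g f' g' : Raw U E F} (h : Agree n f g) (h' : Agree n f' g') :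
    Agree n (f.add f') (g.add g') :=
  ⟨fun i W hi => congrArg₂ (· + ·) (h.1 i W hi) (h'.1 i W hi),
    fun i l j W hl hn => congrArg₂ (· + ·) (h.2 i l j W hl hn) (h'.2 i l j W hl hn)⟩

theorem Agree.zsmul {n : ℕ} {f g : Raw U E F} (h : Agree n f g) (k : ℤ) :
    Agree n (f.zsmul k) (g.zsmul k) :=
  ⟨fun i W hi => congrArg (k • ·) (h.1 i W hi),
    fun i l j W hl hn => congrArg (k • ·) (h.2 i l j W hl hn)⟩

theorem Agree.delta {n : ℕ} {f g : Raw U E F} (h : Agree n f g) : Agree n f.delta g.delta :=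
  ⟨fun i W hi => rfl, fun i l j W hl hn => AddMonoidHom.ext fun z => by
    rw [Raw.delta_apply, Raw.delta_apply]
    refine Finset.sum_congr rfl fun k _ => ?_
    rw [h.2 i _ j W _ (by rw [List.length_eraseIdx_of_lt k.2]; omega)]⟩

theorem Agree.mul {n : ℕ} {f f' : Raw U F G} {g g' : Raw U E F} (hf : Agree n f f')
    (hg : Agree n g g') (m : ℤ) : Agree n (f.mul m g) (f'.mul m g') := by
  refine ⟨fun i W hi => congrArg₂ AddMonoidHom.comp (hf.1 i W hi) (hg.1 i W hi),
    fun i l j W hl hn => congrArg₂ (· + ·) (congrArg₂ (· + ·)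
      (congrArg _ (congrArg₂ AddMonoidHom.comp (hf.1 ..) (hg.2 i l j W hl hn)))
      (congrArg₂ AddMonoidHom.comp (hf.2 i l j W hl hn) (hg.1 ..)))
      (Finset.sum_congr rfl fun k _ => congrArg _ (congrArg₂ AddMonoidHom.comp
        (hf.2 i _ _ W _ ?_) (hg.2 _ _ j W _ ?_)))⟩
  · have := k.2
    rw [List.length_take]
    omega
  · rw [List.length_drop]
    omega

/-- Multiplication by a cochain without component of Čech degree zero improves agreement. -/
theorem Agree.mul_of_zero {n : ℕ} {f : Raw U F G} {g g' : Raw U E F}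
    (hf : ∀ i W h, f.zero i W h = 0) (hg : Agree n g g') (m : ℤ) :
    Agree (n + 1) (f.mul m g) (f.mul m g') := by
  refine ⟨fun i W hi => congrArg₂ AddMonoidHom.comp rfl (hg.1 i W hi),
    fun i l j W hl hn => congrArg₂ (· + ·) (congrArg₂ (· + ·) (congrArg _ ?_)
      (congrArg₂ AddMonoidHom.comp rfl (hg.1 ..)))
      (Finset.sum_congr rfl fun k _ => congrArg _ (congrArg₂ AddMonoidHom.comp
        rfl (hg.2 _ _ j W _ ?_)))⟩
  · rw [hf, AddMonoidHom.zero_comp, AddMonoidHom.zero_comp]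
  · have := k.2
    rw [List.length_drop]
    omega

theorem eq_of_agree {f g : Raw U E F} (h : ∀ n, Agree n f g) : f = g :=
  ext_components (fun i W hi z => DFunLike.congr_fun ((h 0).1 i W hi) z)
    fun i l j W hl z => DFunLike.congr_fun ((h (l.length + 1)).2 i l j W hl (Nat.lt_succ_self _)) z

/-- The limit of a sequence of cochains of operators. -/
def diag (f : ℕ → Raw U E F) : Raw U E F where
  zero := (f 0).zero
  pos i l j := (f (l.length + 1)).pos i l j

theorem diag_agree {f : ℕ → Raw U E F} (h : ∀ n, Agree n (f n) (f (n + 1))) (n : ℕ) :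
    Agree n (diag f) (f n) := by
  have h' : ∀ a b, Agree a (f a) (f (a + b)) := fun a b => by
    induction b with
    | zero => exact Agree.refl _ _
    | succ b ih => exact ih.trans ((h (a + b)).mono (by omega))
  refine ⟨fun i W hi => ?_, fun i l j W hl hn => ?_⟩
  · have := (h' 0 n).1 i W hi
    rwa [zero_add] at this
  · obtain ⟨b, rfl⟩ := Nat.exists_eq_add_of_lt hn
    exact (h' (l.length + 1) b).2 i l j W hl (Nat.lt_succ_self _) |>.trans (by
      rw [show l.length + 1 + b = l.length + b + 1 by omega])

theorem diag_isLinear {f : ℕ → Raw U E F} (h : ∀ n, (f n).IsLinear) : (diag f).IsLinear :=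
  ⟨(h 0).zero, fun i l j => (h _).pos i l j⟩

theorem diag_isNat {f : ℕ → Raw U E F} (h : ∀ n, (f n).IsNat) : (diag f).IsNat :=
  ⟨(h 0).zero, fun i l j => (h _).pos i l j⟩

theorem diag_hasDeg {f : ℕ → Raw U E F} {k : ℤ} (h : ∀ n, (f n).HasDeg k) : (diag f).HasDeg k :=
  ⟨(h 0).zero, fun i l j => (h _).pos i l j⟩

end Raw

variable (E F) in
/-- Two by two matrices of cochains of operators between `E` and `F`. -/
structure Blk where
  a : Raw U E E
  b : Raw U F E
  c : Raw U E F
  d : Raw U F F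

namespace Blk

theorem ext_blocks {x y : Blk E F} (ha : x.a = y.a) (hb : x.b = y.b) (hc : x.c = y.c)
    (hd : x.d = y.d) : x = y := by
  cases x; cases y; simp_all

/-- The product of matrices, the first one being of total degree `m`; the family `E` is shifted. -/
noncomputable def mul (m : ℤ) (x y : Blk E F) : Blk E F where
  a := (x.a.mul m y.a).add (x.b.mul (m + 1) y.c)
  b := (x.a.mul m y.b).add (x.b.mul (m + 1) y.d)
  c := (x.c.mul (m - 1) y.a).add (x.d.mul m y.c)
  d := (x.c.mul (m - 1) y.b).add (x.d.mul m y.d)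

/-- Sums of matrices. -/
noncomputable def add (x y : Blk E F) : Blk E F :=
  ⟨x.a.add y.a, x.b.add y.b, x.c.add y.c, x.d.add y.d⟩

/-- Integer multiples of matrices. -/
noncomputable def zsmul (k : ℤ) (x : Blk E F) : Blk E F :=
  ⟨x.a.zsmul k, x.b.zsmul k, x.c.zsmul k, x.d.zsmul k⟩

variable (E F) in
/-- The cochain of operators zero. -/
noncomputable def _root_.Cohesive.Raw.zeroRaw : Raw U E F := ⟨fun _ _ _ => 0, fun _ _ _ _ _ => 0⟩

variable (E F) in
/-- The identity matrix. -/
noncomputable def one : Blk E F :=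
  ⟨(Coch.id E).raw, Raw.zeroRaw F E, Raw.zeroRaw E F, (Coch.id F).raw⟩

theorem _root_.Cohesive.Raw.act_zeroRaw (W : α) (m : ℤ) : (Raw.zeroRaw E F).act W m = 0 := by
  have : Raw.zeroRaw E F = (Raw.zeroRaw E F).zsmul 0 :=
    Raw.ext_components (fun _ _ _ _ => (zero_smul ℤ _).symm) fun _ _ _ _ _ _ => (zero_smul ℤ _).symm
  rw [this, Raw.act_zsmul]
  exact zero_zsmul _

/-- The cochains over `W`. -/
abbrev _root_.Cohesive.CochOn (E : ∀ i, GMod.{u, v} 𝒜 (U i)) (W : α) : Type _ :=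
  ∀ j : {j // W ≤ U j}, List {j // W ≤ U j} → Tot (E j.1) j.2

/-- The action over `W` of a matrix of total degree `m`. -/
noncomputable def op (x : Blk E F) (W : α) (m : ℤ) : AddMonoid.End (CochOn E W × CochOn F W) :=
  AddMonoidHom.prod (AddMonoidHom.coprod (x.a.act W m) (x.b.act W (m + 1)))
    (AddMonoidHom.coprod (x.c.act W (m - 1)) (x.d.act W m))

theorem op_apply (x : Blk E F) (W : α) (m : ℤ) (z : CochOn E W × CochOn F W) : x.op W m z =
    (x.a.act W m z.1 + x.b.act W (m + 1) z.2, x.c.act W (m - 1) z.1 + x.d.act W m z.2) := rfl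

theorem op_mul (x y : Blk E F) (W : α) (m n : ℤ) :
    (mul m x y).op W (m + n) = x.op W m * y.op W n := by
  refine DFunLike.ext _ _ fun z => ?_
  have h1 := Raw.act_mul m n x.a y.a W
  have h2 := Raw.act_mul (m + 1) (n - 1) x.b y.c W
  have h3 := Raw.act_mul m (n + 1) x.a y.b W
  have h4 := Raw.act_mul (m + 1) n x.b y.d W
  have h5 := Raw.act_mul (m - 1) n x.c y.a W
  have h6 := Raw.act_mul m (n - 1) x.d y.c W
  have h7 := Raw.act_mul (m - 1) (n + 1) x.c y.b W
  have h8 := Raw.act_mul m n x.d y.d W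
  rw [show m + 1 + (n - 1) = m + n by ring] at h2
  rw [show m + (n + 1) = m + n + 1 by ring] at h3
  rw [show m + 1 + n = m + n + 1 by ring] at h4
  rw [show m - 1 + n = m + n - 1 by ring] at h5
  rw [show m + (n - 1) = m + n - 1 by ring] at h6
  rw [show m - 1 + (n + 1) = m + n by ring] at h7
  change (mul m x y).op W (m + n) z = x.op W m (y.op W n z)
  rw [op_apply, op_apply, op_apply]
  simp only [mul, Raw.act_add, h1, h2, h3, h4, h5, h6, h7, h8, AddMonoidHom.add_apply,
    AddMonoidHom.comp_apply, map_add]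
  refine Prod.ext ?_ ?_ <;> simp only [] <;> abel

theorem op_add (x y : Blk E F) (W : α) (m : ℤ) : (x.add y).op W m = x.op W m + y.op W m := by
  refine DFunLike.ext _ _ fun z => ?_
  change (x.add y).op W m z = x.op W m z + y.op W m z
  rw [op_apply, op_apply, op_apply]
  simp only [add, Raw.act_add, AddMonoidHom.add_apply]
  refine Prod.ext ?_ ?_ <;> simp only [Prod.fst_add, Prod.snd_add] <;> abel

theorem op_zsmul (k : ℤ) (x : Blk E F) (W : α) (m : ℤ) : (x.zsmul k).op W m = k • x.op W m := by
  refine DFunLike.ext _ _ fun z => ?_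
  change (x.zsmul k).op W m z = k • x.op W m z
  rw [op_apply, op_apply]
  simp only [zsmul, Raw.act_zsmul, AddMonoidHom.smul_apply]
  refine Prod.ext ?_ ?_ <;> simp only [Prod.smul_fst, Prod.smul_snd, smul_add]

theorem op_one (W : α) : (one E F).op W 0 = 1 := by
  refine DFunLike.ext _ _ fun z => ?_
  rw [op_apply]
  simp only [one, Raw.act_id, Raw.act_zeroRaw, AddMonoidHom.zero_apply, AddMonoidHom.id_apply,
    add_zero, zero_add]
  rfl

/-- A matrix is determined by its actions. -/
theorem ext_op {x y : Blk E F} (m : ℤ) (h : ∀ W, x.op W m = y.op W m) : x = y := by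
  have h1 : ∀ W Y, x.op W m (Y, 0) = y.op W m (Y, 0) := fun W Y => by rw [h]
  have h2 : ∀ W Y, x.op W m (0, Y) = y.op W m (0, Y) := fun W Y => by rw [h]
  simp only [op_apply, map_zero, add_zero, zero_add, Prod.mk.injEq] at h1 h2
  exact ext_blocks (Raw.ext_act _ fun W => AddMonoidHom.ext fun Y => (h1 W Y).1)
    (Raw.ext_act _ fun W => AddMonoidHom.ext fun Y => (h2 W Y).1)
    (Raw.ext_act _ fun W => AddMonoidHom.ext fun Y => (h1 W Y).2)
    (Raw.ext_act _ fun W => AddMonoidHom.ext fun Y => (h2 W Y).2)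

/-- Agreement of matrices up to Čech degree `n`. -/
structure Agree (n : ℕ) (x y : Blk E F) : Prop where
  a : Raw.Agree n x.a y.a
  b : Raw.Agree n x.b y.b
  c : Raw.Agree n x.c y.c
  d : Raw.Agree n x.d y.d

/-- The matrix consists of linear cochains compatible with restriction, of total degree `m`. -/
structure Good (m : ℤ) (x : Blk E F) : Prop where
  a : x.a.IsLinear ∧ x.a.IsNat ∧ x.a.HasDeg m
  b : x.b.IsLinear ∧ x.b.IsNat ∧ x.b.HasDeg (m + 1)
  c : x.c.IsLinear ∧ x.c.IsNat ∧ x.c.HasDeg (m - 1)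
  d : x.d.IsLinear ∧ x.d.IsNat ∧ x.d.HasDeg m

theorem good_mul_aux {m n k : ℤ} {f : Raw U F G} {g : Raw U E F}
    (hf : f.IsLinear ∧ f.IsNat ∧ f.HasDeg m) (hg : g.IsLinear ∧ g.IsNat ∧ g.HasDeg n)
    (hk : m + n = k) : (f.mul m g).IsLinear ∧ (f.mul m g).IsNat ∧ (f.mul m g).HasDeg k :=
  ⟨hf.1.mul hg.1 m, hf.2.1.mul hg.2.1 m, hf.2.2.mul hg.2.2 hk⟩

theorem good_add_aux {n : ℤ} {f g : Raw U E F}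
    (hf : f.IsLinear ∧ f.IsNat ∧ f.HasDeg n) (hg : g.IsLinear ∧ g.IsNat ∧ g.HasDeg n) :
    (f.add g).IsLinear ∧ (f.add g).IsNat ∧ (f.add g).HasDeg n :=
  ⟨hf.1.add hg.1, hf.2.1.add hg.2.1, hf.2.2.add hg.2.2⟩

theorem good_zsmul_aux {n : ℤ} {f : Raw U E F}
    (hf : f.IsLinear ∧ f.IsNat ∧ f.HasDeg n) (k : ℤ) :
    (f.zsmul k).IsLinear ∧ (f.zsmul k).IsNat ∧ (f.zsmul k).HasDeg n :=
  ⟨hf.1.zsmul k, hf.2.1.zsmul k, hf.2.2.zsmul k⟩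

theorem good_zero_aux (n : ℤ) : (Raw.zeroRaw E F).IsLinear ∧ (Raw.zeroRaw E F).IsNat ∧
    (Raw.zeroRaw E F).HasDeg n :=
  ⟨⟨fun _ _ _ => IsLin.zero, fun _ _ _ _ _ => IsLin.zero⟩,
    ⟨fun _ _ _ _ _ _ => (map_zero _).symm, fun _ _ _ _ _ _ _ _ => (map_zero _).symm⟩,
    ⟨fun _ _ _ _ _ _ => zero_mem _, fun _ _ _ _ _ _ _ _ => zero_mem _⟩⟩

theorem good_id_aux : (Coch.id E).raw.IsLinear ∧ (Coch.id E).raw.IsNat ∧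
    (Coch.id E).raw.HasDeg 0 :=
  ⟨Coch.raw_isLinear _, Coch.raw_isNat _, Coch.raw_hasDeg
    ⟨fun i m x hx => by rw [add_zero]; exact hx, fun i l j m x hx => zero_mem _⟩⟩

theorem Good.mul {m n k : ℤ} {x y : Blk E F} (hx : x.Good m) (hy : y.Good n) (hk : m + n = k) :
    (Blk.mul m x y).Good k where
  a := good_add_aux (good_mul_aux hx.a hy.a hk) (good_mul_aux hx.b hy.c (by omega))
  b := good_add_aux (good_mul_aux hx.a hy.b (by omega)) (good_mul_aux hx.b hy.d (by omega))
  c := good_add_aux (good_mul_aux hx.c hy.a (by omega)) (good_mul_aux hx.d hy.c (by omega))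
  d := good_add_aux (good_mul_aux hx.c hy.b (by omega)) (good_mul_aux hx.d hy.d hk)

theorem Good.add {m : ℤ} {x y : Blk E F} (hx : x.Good m) (hy : y.Good m) : (x.add y).Good m :=
  ⟨good_add_aux hx.a hy.a, good_add_aux hx.b hy.b, good_add_aux hx.c hy.c, good_add_aux hx.d hy.d⟩

theorem Good.zsmul {m : ℤ} {x : Blk E F} (hx : x.Good m) (k : ℤ) : (x.zsmul k).Good m :=
  ⟨good_zsmul_aux hx.a k, good_zsmul_aux hx.b k, good_zsmul_aux hx.c k, good_zsmul_aux hx.d k⟩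

variable (E F) in
theorem good_one : (one E F).Good 0 :=
  ⟨good_id_aux, good_zero_aux _, good_zero_aux _, good_id_aux⟩

/-- The partial sums of the Neumann series of `1 + x`. -/
noncomputable def neumann (x : Blk E F) : ℕ → Blk E F
  | 0 => one E F
  | n + 1 => (one E F).add ((mul 0 x (neumann x n)).zsmul (-1))

theorem neumann_good {x : Blk E F} (hx : x.Good 0) (n : ℕ) : (x.neumann n).Good 0 := by
  induction n with
  | zero => exact good_one E F
  | succ n ih => exact (good_one E F).add ((hx.mul ih (add_zero 0)).zsmul _)

theorem neumann_op (x : Blk E F) (n : ℕ) (W : α) :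
    (x.neumann (n + 1)).op W 0 = 1 - x.op W 0 * (x.neumann n).op W 0 := by
  have := op_mul x (x.neumann n) W 0 0
  rw [add_zero] at this
  rw [neumann, op_add, op_zsmul, op_one, this, neg_one_zsmul, sub_eq_add_neg]

/-- The matrix has no component in Čech degree zero. -/
structure NoZero (x : Blk E F) : Prop where
  a : ∀ i W h, x.a.zero i W h = 0
  b : ∀ i W h, x.b.zero i W h = 0
  c : ∀ i W h, x.c.zero i W h = 0
  d : ∀ i W h, x.d.zero i W h = 0

theorem neumann_agree {x : Blk E F} (hx : x.NoZero) (n : ℕ) :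
    Agree n (x.neumann n) (x.neumann (n + 1)) := by
  induction n with
  | zero =>
    refine ⟨⟨fun i W h => ?_, fun _ _ _ _ _ h => absurd h (Nat.not_lt_zero _)⟩,
      ⟨fun i W h => ?_, fun _ _ _ _ _ h => absurd h (Nat.not_lt_zero _)⟩,
      ⟨fun i W h => ?_, fun _ _ _ _ _ h => absurd h (Nat.not_lt_zero _)⟩,
      ⟨fun i W h => ?_, fun _ _ _ _ _ h => absurd h (Nat.not_lt_zero _)⟩⟩
    all_goals
      simp only [neumann, add, zsmul, mul, Raw.add, Raw.zsmul, Raw.mul, hx.a, hx.b, hx.c, hx.d,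
        AddMonoidHom.zero_comp, add_zero, smul_zero]
  | succ n ih =>
    exact ⟨(Raw.Agree.refl _ _).add (((ih.a.mul_of_zero hx.a _).add (ih.c.mul_of_zero hx.b _)).zsmul _),
      (Raw.Agree.refl _ _).add (((ih.b.mul_of_zero hx.a _).add (ih.d.mul_of_zero hx.b _)).zsmul _),
      (Raw.Agree.refl _ _).add (((ih.a.mul_of_zero hx.c _).add (ih.c.mul_of_zero hx.d _)).zsmul _),
      (Raw.Agree.refl _ _).add (((ih.b.mul_of_zero hx.c _).add (ih.d.mul_of_zero hx.d _)).zsmul _)⟩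

end Blk

end ConeAction

section ConeContraction

variable {α : Type w} [SemilatticeInf α] [OrderTop α] {ι : Type w'} {𝒜 : DGPresheaf.{u} α}
  {U : ι → α}

theorem absDelta_absDelta {J : Type*} {T : J → Type*} [∀ j, AddCommGroup (T j)]
    (Y : ∀ j, List J → T j) : absDelta (absDelta Y) = 0 := by
  have e : ∀ Y : ∀ j, List J → T j, absDelta Y = absOp (fun _ => 0) (fun _ _ _ => 0) Y := fun Y => by
    funext i l
    simp only [absDelta_apply, absOp, AddMonoidHom.zero_apply, smul_zero, ssum_zero, add_zero]
  funext i l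
  rw [e, e]
  refine absOp_absOp _ _ (fun _ _ => rfl) (fun i p x z => ?_) Y i l
  simp only [AddMonoidHom.zero_apply, smul_zero, ssum_zero, add_zero]

namespace Tw

theorem raw_isNat (E : Tw.{u, v} 𝒜 U) : E.raw.IsNat where
  zero i V W h h' z := (E.obj i).connOn_res h h' z
  pos i l j V W h h' z := pos_res E i l j V W h h' z

theorem raw_hasDeg (E : Tw.{u, v} 𝒜 U) : E.raw.HasDeg 1 where
  zero i W h m x hx := (E.obj i).connOn_deg h m x hx
  pos i l j W h m x hx := by
    have := pos_deg E i l j W h m x hx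
    rwa [show m + -(l.length : ℤ) = m + (1 - (l.length + 1)) by ring] at this

/-- The differential of a cochain of operators of total degree `n`. -/
noncomputable def dRaw (E : Tw.{u, v} 𝒜 U) (F : Tw.{u, v'} 𝒜 U) (n : ℤ)
    (f : Raw U E.gmod F.gmod) : Raw U E.gmod F.gmod :=
  (f.delta.add (F.raw.mul 1 f)).add ((f.mul n E.raw).zsmul (-sgn n))

theorem dRaw_isNat (E : Tw.{u, v} 𝒜 U) (F : Tw.{u, v'} 𝒜 U) (n : ℤ)
    {f : Raw U E.gmod F.gmod} (hf : f.IsNat) : (dRaw E F n f).IsNat :=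
  (hf.delta.add (F.raw_isNat.mul hf 1)).add ((hf.mul E.raw_isNat n).zsmul _)

theorem dRaw_hasDeg (E : Tw.{u, v} 𝒜 U) (F : Tw.{u, v'} 𝒜 U) {n : ℤ}
    {f : Raw U E.gmod F.gmod} (hf : f.HasDeg n) : (dRaw E F n f).HasDeg (n + 1) :=
  (hf.delta.add (F.raw_hasDeg.mul hf (add_comm 1 n))).add ((hf.mul E.raw_hasDeg rfl).zsmul _)

theorem dRaw_agree (E : Tw.{u, v} 𝒜 U) (F : Tw.{u, v'} 𝒜 U) (n : ℤ) {k : ℕ}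
    {f g : Raw U E.gmod F.gmod} (h : Raw.Agree k f g) :
    Raw.Agree k (dRaw E F n f) (dRaw E F n g) :=
  (h.delta.add ((Raw.Agree.refl _ _).mul h 1)).add ((h.mul (Raw.Agree.refl _ _) n).zsmul _)

theorem dRaw_isLinear (fr : Frame 𝒜) (E : Tw.{u, v} 𝒜 U) (F : Tw.{u, v'} 𝒜 U) {n : ℤ}
    {f : Raw U E.gmod F.gmod} (hf : f.IsLinear) (hn : f.HasDeg n) : (dRaw E F n f).IsLinear where
  zero i W h := by
    have := IsLin.commutator fr ((E.obj i).connOn_isConn h) ((F.obj i).connOn_isConn h)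
      (hf.zero i W h) (hn.zero i W h)
    intro b x
    have h1 : ∀ y, (dRaw E F n f).zero i W h y = (((F.obj i).connOn h).comp (f.zero i W h) -
        sgn n • (f.zero i W h).comp ((E.obj i).connOn h)) y := fun y => by
      change 0 + (F.obj i).connOn h (f.zero i W h y) +
        -sgn n • f.zero i W h ((E.obj i).connOn h y) = (F.obj i).connOn h (f.zero i W h y) -
        sgn n • f.zero i W h ((E.obj i).connOn h y)
      rw [zero_add, neg_smul, sub_eq_add_neg]
    rw [h1, h1, this]
  pos i l j W h := by
    have hj := h.trans (cap_le_last U i l j)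
    have hi := h.trans (cap_le_head U i (l ++ [j]))
    have hc := IsLin.commutator fr ((E.obj j).connOn_isConn hj) ((F.obj i).connOn_isConn hi)
      (hf.pos i l j W h) (hn.pos i l j W h)
    intro b x
    have h1 : ∀ y, (dRaw E F n f).pos i l j W h y =
        sgn (l.length + 1) • (((F.obj i).connOn hi).comp (f.pos i l j W h) -
          sgn (n - (l.length + 1)) • (f.pos i l j W h).comp ((E.obj j).connOn hj)) y +
        (f.delta.pos i l j W h y + F.raw.pos i l j W h (f.zero j W hj y) +
        ∑ k : Fin l.length, sgn ((1 - (k + 1)) * (l.length - k)) •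
          F.raw.pos i (l.take k) (l.get k) W (h.trans (cap_take' U i l j k))
            (f.pos (l.get k) (l.drop (k + 1)) j W (h.trans (cap_drop' U i l j k)) y) +
        -sgn n • (sgn (n * (l.length + 1)) • f.zero i W hi (E.raw.pos i l j W h y) +
        ∑ k : Fin l.length, sgn ((n - (k + 1)) * (l.length - k)) •
          f.pos i (l.take k) (l.get k) W (h.trans (cap_take' U i l j k))
            (E.raw.pos (l.get k) (l.drop (k + 1)) j W (h.trans (cap_drop' U i l j k)) y))) :=
      fun y => by
        refine Eq.trans (congrArg₂ (· + ·) (congrArg₂ (· + ·) rfl (Raw.mul_apply ..))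
          (congrArg (-sgn n • ·) (Raw.mul_apply ..))) ?_
        change f.delta.pos i l j W h y + (sgn (1 * (l.length + 1)) •
          (F.obj i).connOn hi (f.pos i l j W h y) + _ + _) + -sgn n • (_ +
          f.pos i l j W h ((E.obj j).connOn hj y) + _) = sgn (l.length + 1) •
          ((F.obj i).connOn hi (f.pos i l j W h y) - sgn (n - (l.length + 1)) •
          f.pos i l j W h ((E.obj j).connOn hj y)) + _
        rw [smul_sub, smul_smul, ← sgn_add, one_mul, show (l.length : ℤ) + 1 + (n - (l.length + 1)) = n
          by ring]
        simp only [smul_add, neg_smul]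
        abel
    rw [h1, h1, hc]
    simp only [map_add, map_sum, map_zsmul]
    refine congrArg₂ (· + ·) rfl (congrArg₂ (· + ·) (congrArg₂ (· + ·) (congrArg₂ (· + ·) ?_ ?_)
      (Finset.sum_congr rfl fun k _ => congrArg _ ?_)) (congrArg _ (congrArg₂ (· + ·)
      (congrArg _ ?_) (Finset.sum_congr rfl fun k _ => congrArg _ ?_))))
    · rw [Raw.delta_apply, Raw.delta_apply, map_sum]
      refine Finset.sum_congr rfl fun k _ => ?_
      rw [map_zsmul]
      exact congrArg _ (hf.pos i _ j W _ b x)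
    · exact (congrArg _ (hf.zero j W hj b x)).trans (pos_rmul F i l j W h b _)
    · exact (congrArg _ (hf.pos _ _ j W _ b x)).trans (pos_rmul F i _ _ W _ b _)
    · exact (congrArg _ (pos_rmul E i l j W h b x)).trans (hf.zero i W hi b _)
    · exact (congrArg _ (pos_rmul E _ _ j W _ b x)).trans (hf.pos i _ _ W _ b _)

/-- The differential on the cochains over `W`. -/
noncomputable def opOn (E : Tw.{u, v} 𝒜 U) (W : α) : CochOn E.gmod W →+ CochOn E.gmod W :=
  Raw.deltaOn E.gmod W + E.raw.act W 1

theorem act_dRaw (E : Tw.{u, v} 𝒜 U) (F : Tw.{u, v'} 𝒜 U) (n : ℤ) (f : Raw U E.gmod F.gmod)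
    (W : α) : (dRaw E F n f).act W (n + 1) =
      (F.opOn W).comp (f.act W n) - sgn n • (f.act W n).comp (E.opOn W) := by
  have h1 := Raw.act_mul 1 n F.raw f W
  rw [add_comm 1 n] at h1
  rw [dRaw, Raw.act_add, Raw.act_add, Raw.act_zsmul, Raw.act_delta, h1, Raw.act_mul]
  refine AddMonoidHom.ext fun Y => ?_
  simp only [AddMonoidHom.add_apply, AddMonoidHom.sub_apply, AddMonoidHom.smul_apply,
    AddMonoidHom.comp_apply, AddMonoidHom.neg_apply, opOn, map_add, neg_smul, smul_add]
  abel

theorem opOn_opOn (E : Tw.{u, v} 𝒜 U) (W : α) (Y : CochOn E.gmod W) :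
    E.opOn W (E.opOn W Y) = 0 := by
  have h0 : E.raw.delta.add (E.raw.mul 1 E.raw) = Raw.zeroRaw E.gmod E.gmod := by
    refine Raw.ext_components (fun i W h z => ?_) fun i l j W h z => ?_
    · exact (zero_add _).trans ((E.obj i).connOn_connOn h z)
    · refine Eq.trans (congrArg₂ (· + ·) (Raw.delta_apply ..) (Raw.mul_apply ..)) ?_
      rw [one_mul]
      exact mcVal_eq_zero E i l j W h z
  have h1 := congrArg (fun f : Raw U E.gmod E.gmod => f.act W (1 + 1) Y) h0
  simp only [Raw.act_zeroRaw, Raw.act_add, Raw.act_delta, Raw.act_mul] at h1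
  simp only [AddMonoidHom.add_apply, AddMonoidHom.comp_apply, sgn_one, neg_smul, one_smul,
    sub_neg_eq_add, AddMonoidHom.zero_apply] at h1
  have h2 : Raw.deltaOn E.gmod W (Raw.deltaOn E.gmod W Y) = 0 := absDelta_absDelta _
  simp only [opOn, AddMonoidHom.add_apply, map_add, h2, zero_add]
  rw [← h1]
  abel

end Tw

/-- The differential of a matrix of total degree `-1` of cochains of endomorphisms of the cone
of `f`. -/
noncomputable def Blk.dCone (T : Tw.{u, v} 𝒜 U) (F : Tw.{u, v'} 𝒜 U) (f : Raw U T.gmod F.gmod)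
    (x : Blk T.gmod F.gmod) : Blk T.gmod F.gmod where
  a := ((Tw.dRaw T T (-1) x.a).zsmul (-1)).add (x.b.mul 0 f)
  b := (Tw.dRaw F T 0 x.b).zsmul (-1)
  c := ((f.mul 0 x.a).add (x.d.mul (-1) f)).add (Tw.dRaw T F (-2) x.c)
  d := (f.mul 0 x.b).add (Tw.dRaw F F (-1) x.d)

/-- The differential of the cone of `f` on cochains over `W`. -/
noncomputable def Blk.coneOp (T : Tw.{u, v} 𝒜 U) (F : Tw.{u, v'} 𝒜 U) (f : Raw U T.gmod F.gmod)
    (W : α) : AddMonoid.End (CochOn T.gmod W × CochOn F.gmod W) :=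
  AddMonoidHom.prod ((-T.opOn W).comp (AddMonoidHom.fst _ _))
    (AddMonoidHom.coprod (f.act W 0) (F.opOn W))

theorem Blk.coneOp_apply (T : Tw.{u, v} 𝒜 U) (F : Tw.{u, v'} 𝒜 U) (f : Raw U T.gmod F.gmod)
    (W : α) (z) : coneOp T F f W z = (-T.opOn W z.1, f.act W 0 z.1 + F.opOn W z.2) := rfl

theorem Blk.dCone_op (T : Tw.{u, v} 𝒜 U) (F : Tw.{u, v'} 𝒜 U) (f : Raw U T.gmod F.gmod)
    (x : Blk T.gmod F.gmod) (W : α) :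
    (dCone T F f x).op W 0 = coneOp T F f W * x.op W (-1) + x.op W (-1) * coneOp T F f W := by
  refine DFunLike.ext _ _ fun z => ?_
  change (dCone T F f x).op W 0 z = coneOp T F f W (x.op W (-1) z) + x.op W (-1) (coneOp T F f W z)
  have h1 := Tw.act_dRaw T T (-1) x.a W
  have h2 := Tw.act_dRaw F T 0 x.b W
  have h3 := Tw.act_dRaw T F (-2) x.c W
  have h4 := Tw.act_dRaw F F (-1) x.d W
  have h5 := Raw.act_mul 0 0 x.b f W
  have h6 := Raw.act_mul 0 (-1) f x.a W
  have h7 := Raw.act_mul (-1) 0 x.d f W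
  have h8 := Raw.act_mul 0 0 f x.b W
  have hs : sgn (-1) = -1 := by rw [sgn_congr_odd (a := -1) (b := 0) ⟨-1, by ring⟩, sgn_zero]
  have hs' : sgn (-2) = 1 := by rw [sgn_congr (a := -2) (b := 0) ⟨-1, by ring⟩, sgn_zero]
  norm_num only [hs, hs', sgn_zero] at h1 h2 h3 h4 h5 h6 h7 h8
  rw [op_apply, op_apply, coneOp_apply, coneOp_apply, op_apply]
  norm_num only
  simp only [dCone, Raw.act_add, Raw.act_zsmul, h1, h2, h3, h4, h5, h6, h7, h8,
    AddMonoidHom.add_apply, AddMonoidHom.sub_apply, AddMonoidHom.comp_apply,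
    AddMonoidHom.neg_apply, map_add, map_neg, neg_smul, one_smul, Prod.mk_add_mk]
  refine Prod.ext ?_ ?_ <;> simp only [] <;> abel

end ConeContraction

section HomotopyEquiv

variable {α : Type w} [SemilatticeInf α] [OrderTop α] {ι : Type w'} {𝒜 : DGPresheaf.{u} α}
  {U : ι → α}

namespace Blk

variable {T : Tw.{u, v} 𝒜 U} {F : Tw.{u, v'} 𝒜 U}

theorem dCone_good (fr : Frame 𝒜) (f : Coch U T.gmod F.gmod) (hf : f.HasDeg 0)
    {x : Blk T.gmod F.gmod} (hx : x.Good (-1)) : (dCone T F f.raw x).Good 0 := by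
  have hf' : f.raw.IsLinear ∧ f.raw.IsNat ∧ f.raw.HasDeg 0 :=
    ⟨f.raw_isLinear, f.raw_isNat, Coch.raw_hasDeg hf⟩
  have hd : ∀ {n : ℤ} {g : Raw U T.gmod T.gmod}, (g.IsLinear ∧ g.IsNat ∧ g.HasDeg n) →
      (Tw.dRaw T T n g).IsLinear ∧ (Tw.dRaw T T n g).IsNat ∧ (Tw.dRaw T T n g).HasDeg (n + 1) :=
    fun h => ⟨Tw.dRaw_isLinear fr T T h.1 h.2.2, Tw.dRaw_isNat T T _ h.2.1, Tw.dRaw_hasDeg T T h.2.2⟩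
  refine ⟨good_add_aux (good_zsmul_aux (hd hx.a) _) (good_mul_aux hx.b hf' rfl),
    good_zsmul_aux ⟨Tw.dRaw_isLinear fr F T hx.b.1 hx.b.2.2, Tw.dRaw_isNat F T _ hx.b.2.1,
      Tw.dRaw_hasDeg F T hx.b.2.2⟩ _,
    good_add_aux (good_add_aux (good_mul_aux hf' hx.a rfl) (good_mul_aux hx.d hf' rfl))
      ⟨Tw.dRaw_isLinear fr T F hx.c.1 hx.c.2.2, Tw.dRaw_isNat T F _ hx.c.2.1,
      Tw.dRaw_hasDeg T F hx.c.2.2⟩,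
    good_add_aux (good_mul_aux hf' hx.b rfl) ⟨Tw.dRaw_isLinear fr F F hx.d.1 hx.d.2.2,
      Tw.dRaw_isNat F F _ hx.d.2.1, Tw.dRaw_hasDeg F F hx.d.2.2⟩⟩

theorem dCone_agree (f : Raw U T.gmod F.gmod) {n : ℕ} {x y : Blk T.gmod F.gmod}
    (h : Agree n x y) : Agree n (dCone T F f x) (dCone T F f y) :=
  ⟨((Tw.dRaw_agree T T _ h.a).zsmul _).add (h.b.mul (Raw.Agree.refl _ _) _),
    (Tw.dRaw_agree F T _ h.b).zsmul _,
    (((Raw.Agree.refl _ _).mul h.a _).add (h.d.mul (Raw.Agree.refl _ _) _)).add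
      (Tw.dRaw_agree T F _ h.c),
    ((Raw.Agree.refl _ _).mul h.b _).add (Tw.dRaw_agree F F _ h.d)⟩

theorem coneOp_sq (f : Raw U T.gmod F.gmod) (hf : Tw.dRaw T F 0 f = Raw.zeroRaw _ _) (W : α) :
    coneOp T F f W * coneOp T F f W = 0 := by
  refine DFunLike.ext _ _ fun z => ?_
  change coneOp T F f W (coneOp T F f W z) = 0
  have h := Tw.act_dRaw T F 0 f W
  rw [hf, Raw.act_zeroRaw, sgn_zero, one_smul] at h
  have h' := DFunLike.congr_fun h z.1
  simp only [AddMonoidHom.zero_apply, AddMonoidHom.sub_apply, AddMonoidHom.comp_apply] at h'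
  rw [coneOp_apply, coneOp_apply]
  simp only [map_neg, map_add, Tw.opOn_opOn, neg_zero, add_zero]
  refine Prod.ext rfl ?_
  change -f.act W 0 (T.opOn W z.1) + F.opOn W (f.act W 0 z.1) = 0
  rw [eq_comm, sub_eq_add_neg, add_comm] at h'
  exact h'

theorem neumann_ring {R : Type*} [Ring R] (D H N : R) (w : ℕ → R) (hD : D * D = 0)
    (hN : N = D * H + H * D - 1) (h0 : w 0 = 1) (hw : ∀ n, w (n + 1) = 1 - N * w n) (n : ℕ) :
    D * (H * w n) + H * w n * D = 1 + (w n - w (n + 1)) := by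
  have hc : ∀ n, w n * D = D * w n := fun n => by
    induction n with
    | zero => rw [h0, one_mul, mul_one]
    | succ n ih =>
      have e : N * D = D * N := by
        rw [hN]
        have : D * H * D + H * (D * D) = D * D * H + D * H * D := by
          rw [hD, mul_zero, zero_mul, add_zero, zero_add]
        linear_combination (norm := noncomm_ring) this
      rw [hw, sub_mul, mul_assoc, ih, ← mul_assoc, e]
      noncomm_ring
  rw [mul_assoc, hc, hw, hN]
  noncomm_ring

theorem agree_add_sub {E : ∀ i, GMod.{u, v} 𝒜 (U i)} {F : ∀ i, GMod.{u, v'} 𝒜 (U i)} {n : ℕ}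
    {p q : Raw U E F} (r : Raw U E F) (h : Raw.Agree n p q) :
    Raw.Agree n (r.add (p.add (q.zsmul (-1)))) r := by
  refine ⟨fun i W hi => ?_, fun i l j W hl hn => ?_⟩
  · simp only [Raw.add, Raw.zsmul, h.1, neg_smul, one_smul, add_neg_cancel, add_zero]
  · simp only [Raw.add, Raw.zsmul, h.2 i l j W hl hn, neg_smul, one_smul, add_neg_cancel, add_zero]

/-- A matrix which contracts the cone of `f` in Čech degree zero can be completed to a contraction
of the cone. -/
theorem exists_dCone_eq_one (fr : Frame 𝒜) (f : Coch U T.gmod F.gmod) (hf : f.HasDeg 0)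
    (hcl : Tw.dRaw T F 0 f.raw = Raw.zeroRaw _ _) (x : Blk T.gmod F.gmod) (hx : x.Good (-1))
    (h0 : ((dCone T F f.raw x).add ((one _ _).zsmul (-1))).NoZero) :
    ∃ y : Blk T.gmod F.gmod, y.Good (-1) ∧ dCone T F f.raw y = one _ _ := by
  set N := (dCone T F f.raw x).add ((one _ _).zsmul (-1)) with hNdef
  have hN : N.Good 0 := (dCone_good fr f hf hx).add ((good_one _ _).zsmul _)
  have hg : ∀ n, (mul (-1) x (N.neumann n)).Good (-1) := fun n =>
    hx.mul (neumann_good hN n) (add_zero _)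
  have ha : ∀ n, Agree n (mul (-1) x (N.neumann n)) (mul (-1) x (N.neumann (n + 1))) := fun n => by
    have h := neumann_agree h0 n
    exact ⟨((Raw.Agree.refl n _).mul h.a _).add ((Raw.Agree.refl n _).mul h.c _),
      ((Raw.Agree.refl n _).mul h.b _).add ((Raw.Agree.refl n _).mul h.d _),
      ((Raw.Agree.refl n _).mul h.a _).add ((Raw.Agree.refl n _).mul h.c _),
      ((Raw.Agree.refl n _).mul h.b _).add ((Raw.Agree.refl n _).mul h.d _)⟩
  have hop : ∀ n, dCone T F f.raw (mul (-1) x (N.neumann n)) =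
      (one _ _).add ((N.neumann n).add ((N.neumann (n + 1)).zsmul (-1))) := fun n => by
    refine ext_op 0 fun W => ?_
    have h1 := op_mul x (N.neumann n) W (-1) 0
    rw [add_zero] at h1
    rw [dCone_op, h1, op_add, op_add, op_zsmul, op_one, neg_one_zsmul, ← sub_eq_add_neg]
    refine neumann_ring (coneOp T F f.raw W) (x.op W (-1)) (N.op W 0) (fun n => (N.neumann n).op W 0)
      (coneOp_sq f.raw hcl W) ?_ (op_one W) (fun n => neumann_op N n W) n
    rw [hNdef, op_add, dCone_op, op_zsmul, op_one, neg_one_zsmul, sub_eq_add_neg]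
  let y : Blk T.gmod F.gmod := ⟨Raw.diag fun n => (mul (-1) x (N.neumann n)).a,
    Raw.diag fun n => (mul (-1) x (N.neumann n)).b, Raw.diag fun n => (mul (-1) x (N.neumann n)).c,
    Raw.diag fun n => (mul (-1) x (N.neumann n)).d⟩
  have hy : ∀ n, Agree n y (mul (-1) x (N.neumann n)) := fun n =>
    ⟨Raw.diag_agree (fun n => (ha n).a) n, Raw.diag_agree (fun n => (ha n).b) n,
      Raw.diag_agree (fun n => (ha n).c) n, Raw.diag_agree (fun n => (ha n).d) n⟩
  have hone : ∀ n, Agree n (dCone T F f.raw y) (one _ _) := fun n => by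
    have h1 := dCone_agree f.raw (hy n)
    rw [hop] at h1
    have h2 := neumann_agree h0 n
    exact ⟨h1.a.trans (agree_add_sub _ h2.a), h1.b.trans (agree_add_sub _ h2.b),
      h1.c.trans (agree_add_sub _ h2.c), h1.d.trans (agree_add_sub _ h2.d)⟩
  refine ⟨y, ⟨⟨?_, ?_, ?_⟩, ⟨?_, ?_, ?_⟩, ⟨?_, ?_, ?_⟩, ⟨?_, ?_, ?_⟩⟩, ext_blocks
    (Raw.eq_of_agree fun n => (hone n).a) (Raw.eq_of_agree fun n => (hone n).b)
    (Raw.eq_of_agree fun n => (hone n).c) (Raw.eq_of_agree fun n => (hone n).d)⟩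
  · exact Raw.diag_isLinear fun n => (hg n).a.1
  · exact Raw.diag_isNat fun n => (hg n).a.2.1
  · exact Raw.diag_hasDeg fun n => (hg n).a.2.2
  · exact Raw.diag_isLinear fun n => (hg n).b.1
  · exact Raw.diag_isNat fun n => (hg n).b.2.1
  · exact Raw.diag_hasDeg fun n => (hg n).b.2.2
  · exact Raw.diag_isLinear fun n => (hg n).c.1
  · exact Raw.diag_isNat fun n => (hg n).c.2.1
  · exact Raw.diag_hasDeg fun n => (hg n).c.2.2
  · exact Raw.diag_isLinear fun n => (hg n).d.1
  · exact Raw.diag_isNat fun n => (hg n).d.2.1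
  · exact Raw.diag_hasDeg fun n => (hg n).d.2.2

end Blk

theorem Raw.zero_eq_zero {E : ∀ i, GMod.{u, v} 𝒜 (U i)} {F : ∀ i, GMod.{u, v'} 𝒜 (U i)}
    {f : Raw U E F} (hl : f.IsLinear) (hn : f.IsNat) (i : ι)
    (h0 : ∀ z, f.zero i (U i) le_rfl z = 0) (W : α) (h : W ≤ U i) : f.zero i W h = 0 :=
  Tot.hom_ext fun n e b => by
    have h1 : Tot.mk (M := E i) h n e b = Tot.rmul b (Tot.res (le_refl (U i)) h (Tot.mk _ n e 1)) := by
      rw [Tot.res_mk, Tot.rmul_mk, map_one, one_mul]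
    rw [h1, hl.zero]
    refine (congrArg _ (hn.zero i (U i) W le_rfl h _)).trans ?_
    rw [h0, map_zero, map_zero]
    rfl

/-- A closed morphism of degree zero of twisted complexes, whose components of Čech degree zero
have contractible cones, is a homotopy equivalence. -/
theorem Tw.isHomotopyEquiv_of_contractible (fr : Frame 𝒜) {T : Tw.{u, v} 𝒜 U} {F : Tw.{u, v'} 𝒜 U}
    (f : Coch U T.gmod F.gmod) (hf : Tw.IsClosed (E := T) (F := F) f)
    (hc : ∀ k, ∃ h : AddMonoid.End (Tot (T.gmod k) (le_refl (U k)) × Tot (F.gmod k) (le_refl (U k))),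
      KLin h ∧ KDeg (-1) h ∧
      coneD ((T.obj k).connOn (le_refl (U k))) ((F.obj k).connOn (le_refl (U k))) (f.zero k).1 * h +
      h * coneD ((T.obj k).connOn (le_refl (U k))) ((F.obj k).connOn (le_refl (U k))) (f.zero k).1 = 1) :
    Tw.IsHomotopyEquiv (E := T) (F := F) f := by
  have hcl : Tw.dRaw T F 0 f.raw = Raw.zeroRaw _ _ := by
    have hz := Blk.good_zero_aux (E := T.gmod) (F := F.gmod) 0
    exact Raw.eq_of_largest (Tw.dRaw_isLinear fr T F f.raw_isLinear (Coch.raw_hasDeg hf.1))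
      (Tw.dRaw_isNat T F 0 f.raw_isNat) hz.1 hz.2.1 hf.2.1 hf.2.2
  choose h hlin hdeg hh using hc
  let xa : Coch U T.gmod T.gmod := ⟨fun k => ⟨((AddMonoidHom.fst _ _).comp (h k)).comp
      (AddMonoidHom.inl _ _), fun b z => congrArg Prod.fst ((congrArg (h k) (Prod.ext rfl
        (map_zero (Tot.rmul b)).symm)).trans (hlin k b (z, 0)))⟩, fun i l j => Mor.zero ..⟩
  let xb : Coch U F.gmod T.gmod := ⟨fun k => ⟨((AddMonoidHom.fst _ _).comp (h k)).comp
      (AddMonoidHom.inr _ _), fun b z => congrArg Prod.fst ((congrArg (h k) (Prod.ext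
        (map_zero (Tot.rmul b)).symm rfl)).trans (hlin k b (0, z)))⟩, fun i l j => Mor.zero ..⟩
  let xc : Coch U T.gmod F.gmod := ⟨fun k => ⟨((AddMonoidHom.snd _ _).comp (h k)).comp
      (AddMonoidHom.inl _ _), fun b z => congrArg Prod.snd ((congrArg (h k) (Prod.ext rfl
        (map_zero (Tot.rmul b)).symm)).trans (hlin k b (z, 0)))⟩, fun i l j => Mor.zero ..⟩
  let xd : Coch U F.gmod F.gmod := ⟨fun k => ⟨((AddMonoidHom.snd _ _).comp (h k)).comp
      (AddMonoidHom.inr _ _), fun b z => congrArg Prod.snd ((congrArg (h k) (Prod.ext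
        (map_zero (Tot.rmul b)).symm rfl)).trans (hlin k b (0, z)))⟩, fun i l j => Mor.zero ..⟩
  have da : xa.HasDeg (-1) := ⟨fun k m z hz => by
    have := (hdeg k (m - 1) (z, 0) ⟨by rwa [sub_add_cancel], zero_mem _⟩).1
    rwa [show m - 1 + -1 + 1 = m + -1 by ring] at this, fun i l j m z hz => zero_mem _⟩
  have db : xb.HasDeg (-1 + 1) := ⟨fun k m z hz => by
    have := (hdeg k m (0, z) ⟨zero_mem _, hz⟩).1
    rwa [add_assoc] at this, fun i l j m z hz => zero_mem _⟩
  have dc : xc.HasDeg (-1 - 1) := ⟨fun k m z hz => by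
    have := (hdeg k (m - 1) (z, 0) ⟨by rwa [sub_add_cancel], zero_mem _⟩).2
    rwa [show m - 1 + -1 = m + (-1 - 1) by ring] at this, fun i l j m z hz => zero_mem _⟩
  have dd : xd.HasDeg (-1) := ⟨fun k m z hz => (hdeg k m (0, z) ⟨zero_mem _, hz⟩).2,
    fun i l j m z hz => zero_mem _⟩
  let x : Blk T.gmod F.gmod := ⟨xa.raw, xb.raw, xc.raw, xd.raw⟩
  have hx : x.Good (-1) :=
    ⟨⟨xa.raw_isLinear, xa.raw_isNat, Coch.raw_hasDeg da⟩, ⟨xb.raw_isLinear, xb.raw_isNat, Coch.raw_hasDeg db⟩,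
    ⟨xc.raw_isLinear, xc.raw_isNat, Coch.raw_hasDeg dc⟩, ⟨xd.raw_isLinear, xd.raw_isNat, Coch.raw_hasDeg dd⟩⟩
  have hN := (Blk.dCone_good fr f hf.1 hx).add ((Blk.good_one T.gmod F.gmod).zsmul (-1))
  have ef : ∀ k z, f.raw.zero k (U k) le_rfl z = (f.zero k).1 z := fun k z =>
    DFunLike.congr_fun (Mor.restrict_refl (f.zero k)) z
  have ea : ∀ k z, xa.raw.zero k (U k) le_rfl z = (h k (z, 0)).1 := fun k z =>
    DFunLike.congr_fun (Mor.restrict_refl (xa.zero k)) z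
  have eb : ∀ k z, xb.raw.zero k (U k) le_rfl z = (h k (0, z)).1 := fun k z =>
    DFunLike.congr_fun (Mor.restrict_refl (xb.zero k)) z
  have ec : ∀ k z, xc.raw.zero k (U k) le_rfl z = (h k (z, 0)).2 := fun k z =>
    DFunLike.congr_fun (Mor.restrict_refl (xc.zero k)) z
  have ed : ∀ k z, xd.raw.zero k (U k) le_rfl z = (h k (0, z)).2 := fun k z =>
    DFunLike.congr_fun (Mor.restrict_refl (xd.zero k)) z
  have ei : ∀ k z, (Coch.id T.gmod).raw.zero k (U k) le_rfl z = z := fun k z =>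
    DFunLike.congr_fun (Mor.restrict_refl ((Coch.id T.gmod).zero k)) z
  have ei' : ∀ k z, (Coch.id F.gmod).raw.zero k (U k) le_rfl z = z := fun k z =>
    DFunLike.congr_fun (Mor.restrict_refl ((Coch.id F.gmod).zero k)) z
  have hsp : ∀ k a b, h k (a, b) = h k (a, 0) + h k (0, b) := fun k a b => by
    rw [← map_add, Prod.mk_add_mk, add_zero, zero_add]
  have hng : ∀ k a, h k (-a, 0) = -h k (a, 0) := fun k a => by
    rw [← map_neg, Prod.neg_mk, neg_zero]
  have k1 : ∀ k z, (-(T.obj k).connOn _ (h k (z, 0)).1, (f.zero k).1 (h k (z, 0)).1 +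
      (F.obj k).connOn _ (h k (z, 0)).2) + (-h k ((T.obj k).connOn _ z, 0) +
      h k (0, (f.zero k).1 z)) = (z, 0) := fun k z => by
    have := DFunLike.congr_fun (hh k) (z, 0)
    refine Eq.trans (congrArg₂ (· + ·) rfl ?_) this
    change _ = h k (coneD _ _ _ (z, 0))
    simp only [coneD_apply, map_zero, add_zero]
    exact ((hsp k _ _).trans (congrArg₂ (· + ·) (hng k _) rfl)).symm
  have k2 : ∀ k z, (-(T.obj k).connOn _ (h k (0, z)).1, (f.zero k).1 (h k (0, z)).1 +
      (F.obj k).connOn _ (h k (0, z)).2) + h k (0, (F.obj k).connOn _ z) = (0, z) := fun k z => by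
    have := DFunLike.congr_fun (hh k) (0, z)
    refine Eq.trans (congrArg₂ (· + ·) rfl ?_) this
    change _ = h k (coneD _ _ _ (0, z))
    rw [coneD_apply, map_zero, map_zero, neg_zero, zero_add]
  have hs : sgn (-1) = -1 := by rw [sgn_congr_odd (a := -1) (b := 0) ⟨-1, by ring⟩, sgn_zero]
  have hs' : sgn (-2) = 1 := by rw [sgn_congr (a := -2) (b := 0) ⟨-1, by ring⟩, sgn_zero]
  have hN0 : ((Blk.dCone T F f.raw x).add ((Blk.one _ _).zsmul (-1))).NoZero := by
    refine ⟨fun k => Raw.zero_eq_zero hN.a.1 hN.a.2.1 k fun z => ?_,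
      fun k => Raw.zero_eq_zero hN.b.1 hN.b.2.1 k fun z => ?_,
      fun k => Raw.zero_eq_zero hN.c.1 hN.c.2.1 k fun z => ?_,
      fun k => Raw.zero_eq_zero hN.d.1 hN.d.2.1 k fun z => ?_⟩
    · change (-1 : ℤ) • ((0 + (T.obj k).connOn _ (xa.raw.zero k (U k) le_rfl z)) +
        -sgn (-1) • xa.raw.zero k (U k) le_rfl ((T.obj k).connOn _ z)) +
        xb.raw.zero k (U k) le_rfl (f.raw.zero k (U k) le_rfl z) +
        (-1 : ℤ) • (Coch.id T.gmod).raw.zero k (U k) le_rfl z = 0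
      rw [ea, ea, eb, ef, ei, hs]
      refine Eq.trans ?_ (sub_eq_zero.2 (congrArg Prod.fst (k1 k z)))
      simp only [Prod.fst_add, Prod.fst_neg, neg_neg, neg_smul, one_smul, zero_add, neg_add]
      abel
    · change (-1 : ℤ) • ((0 + (T.obj k).connOn _ (xb.raw.zero k (U k) le_rfl z)) +
        -sgn 0 • xb.raw.zero k (U k) le_rfl ((F.obj k).connOn _ z)) +
        (-1 : ℤ) • (0 : Tot (T.gmod k) (le_refl (U k))) = 0
      rw [eb, eb, sgn_zero]
      refine Eq.trans ?_ (congrArg Prod.fst (k2 k z))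
      simp only [Prod.fst_add, neg_neg, neg_smul, one_smul, zero_add, neg_add, smul_zero]
      abel
    · change f.raw.zero k (U k) le_rfl (xa.raw.zero k (U k) le_rfl z) +
        xd.raw.zero k (U k) le_rfl (f.raw.zero k (U k) le_rfl z) +
        ((0 + (F.obj k).connOn _ (xc.raw.zero k (U k) le_rfl z)) +
        -sgn (-2) • xc.raw.zero k (U k) le_rfl ((T.obj k).connOn _ z)) +
        (-1 : ℤ) • (0 : Tot (F.gmod k) (le_refl (U k))) = 0
      rw [ef, ef, ea, ed, ec, ec, hs']
      refine Eq.trans ?_ (congrArg Prod.snd (k1 k z))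
      simp only [Prod.snd_add, Prod.snd_neg, neg_smul, one_smul, zero_add, smul_zero]
      abel
    · change f.raw.zero k (U k) le_rfl (xb.raw.zero k (U k) le_rfl z) +
        ((0 + (F.obj k).connOn _ (xd.raw.zero k (U k) le_rfl z)) +
        -sgn (-1) • xd.raw.zero k (U k) le_rfl ((F.obj k).connOn _ z)) +
        (-1 : ℤ) • (Coch.id F.gmod).raw.zero k (U k) le_rfl z = 0
      rw [ef, eb, ed, ed, ei', hs]
      refine Eq.trans ?_ (sub_eq_zero.2 (congrArg Prod.snd (k2 k z)))
      simp only [Prod.snd_add, neg_neg, neg_smul, one_smul, zero_add]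
      abel
  obtain ⟨y, hy, hy1⟩ := Blk.exists_dCone_eq_one fr f hf.1 hcl x hx hN0
  let g := y.b.toCoch hy.b.1
  let s := y.a.toCoch hy.a.1
  let t := (y.d.zsmul (-1)).toCoch (hy.d.1.zsmul _)
  have hg : g.raw = y.b := Raw.toCoch_raw _ _ hy.b.2.1
  have hsr : s.raw = y.a := Raw.toCoch_raw _ _ hy.a.2.1
  have htr : t.raw = y.d.zsmul (-1) := Raw.toCoch_raw _ _ (hy.d.2.1.zsmul _)
  have ha1 := congrArg Blk.a hy1
  have hb1 := congrArg Blk.b hy1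
  have hd1 := congrArg Blk.d hy1
  have t2 : Tw.dRaw F F (-1) (y.d.zsmul (-1)) = (Tw.dRaw F F (-1) y.d).zsmul (-1) := by
    refine Raw.ext_act (-1 + 1) fun W => ?_
    rw [Tw.act_dRaw, Raw.act_zsmul, Raw.act_zsmul, Tw.act_dRaw]
    refine AddMonoidHom.ext fun Y => ?_
    simp only [neg_one_zsmul, AddMonoidHom.neg_apply, AddMonoidHom.sub_apply,
      AddMonoidHom.comp_apply, AddMonoidHom.smul_apply, map_neg, smul_neg]
    abel
  refine ⟨hf, g, ⟨⟨fun i => hy.b.2.2.zero i _ _, fun i l j => hy.b.2.2.pos i l j _ _⟩, ?_⟩,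
    ⟨s, ⟨fun i => hy.a.2.2.zero i _ _, fun i l j => hy.a.2.2.pos i l j _ _⟩, ?_⟩,
    ⟨t, ⟨fun i => (hy.d.2.2.zsmul (-1)).zero i _ _, fun i l j => (hy.d.2.2.zsmul (-1)).pos i l j _ _⟩, ?_⟩⟩
  · have e : Tw.dHom F T 0 g = Raw.zeroRaw _ _ := by
      change Tw.dRaw F T 0 g.raw = _
      rw [hg]
      refine Raw.ext_act (0 + 1) fun W => ?_
      have := congrArg (fun r : Raw U F.gmod T.gmod => r.act W (0 + 1)) hb1
      simp only [Blk.dCone, Blk.one, Raw.act_zsmul, Raw.act_zeroRaw] at this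
      rw [Raw.act_zeroRaw]
      rw [neg_one_zsmul, neg_eq_zero] at this
      exact this
    rw [e]
    exact ⟨fun _ => rfl, fun _ _ _ => rfl⟩
  · have e : ((g.comp 0 f).raw.add ((Coch.id T.gmod).raw.zsmul (-1))).add
        ((Tw.dHom T T (-1) s).zsmul (-1)) = Raw.zeroRaw _ _ := by
      change (_ : Raw U T.gmod T.gmod).add ((Tw.dRaw T T (-1) s.raw).zsmul (-1)) = _
      rw [hsr, Coch.comp_raw, hg]
      refine Raw.ext_act 0 fun W => ?_
      have := congrArg (fun r : Raw U T.gmod T.gmod => r.act W 0) ha1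
      simp only [Blk.dCone, Blk.one, Raw.act_zsmul, Raw.act_add] at this
      rw [Raw.act_add, Raw.act_add, Raw.act_zsmul, Raw.act_zsmul, Raw.act_zeroRaw, ← this,
        neg_one_zsmul, neg_one_zsmul]
      abel
    rw [e]
    exact ⟨fun _ => rfl, fun _ _ _ => rfl⟩
  · have e : ((f.comp 0 g).raw.add ((Coch.id F.gmod).raw.zsmul (-1))).add
        ((Tw.dHom F F (-1) t).zsmul (-1)) = Raw.zeroRaw _ _ := by
      change (_ : Raw U F.gmod F.gmod).add ((Tw.dRaw F F (-1) t.raw).zsmul (-1)) = _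
      rw [htr, Coch.comp_raw, hg, t2]
      refine Raw.ext_act 0 fun W => ?_
      have := congrArg (fun r : Raw U F.gmod F.gmod => r.act W 0) hd1
      simp only [Blk.dCone, Blk.one, Raw.act_add] at this
      rw [Raw.act_add, Raw.act_add, Raw.act_zsmul, Raw.act_zsmul, Raw.act_zsmul, Raw.act_zeroRaw,
        ← this, neg_one_zsmul, neg_one_zsmul, neg_one_zsmul]
      abel
    rw [e]
    exact ⟨fun _ => rfl, fun _ _ _ => rfl⟩

end HomotopyEquiv

section CounitClosed

variable {α : Type w} [SemilatticeInf α] [OrderTop α] {ι : Type w'} {𝒜 : DGPresheaf.{u} α}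
  {U : ι → α}

variable (U) in
/-- The cochain of Čech degree zero of the restrictions of a global element. -/
noncomputable def constOn (M : GMod.{u, v} 𝒜 (⊤ : α)) (x : Tot M (le_refl ⊤)) (W : α) :
    CochOn (U := U) (fun i => M.restrict (le_top : U i ≤ ⊤)) W
  | i, [] => (Tot.up M le_top i.2).1 (Tot.res (le_refl ⊤) le_top x)
  | _, _ :: _ => 0

theorem constOn_append (M : GMod.{u, v} 𝒜 (⊤ : α)) (x : Tot M (le_refl ⊤)) (W : α)
    (i a : {j // W ≤ U j}) (l : List {j // W ≤ U j}) : constOn U M x W i (l ++ [a]) = 0 := by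
  cases l <;> rfl

section

variable {E : ∀ i, GMod.{u, v} 𝒜 (U i)} {F : ∀ i, GMod.{u, v'} 𝒜 (U i)}

theorem Raw.act_nil (f : Raw U E F) (W : α) (m : ℤ) (Y : CochOn E W) (i : {j // W ≤ U j}) :
    f.act W m Y i [] = f.zero i.1 W i.2 (Y i []) := by
  rw [Raw.act_apply, ssum]
  simp [sgn_zero]

theorem Raw.act_append (f : Raw U E F) (W : α) (m : ℤ) (Y : CochOn E W)
    (hY : ∀ i l a, Y i (l ++ [a]) = 0) (i j : {j // W ≤ U j}) (l : List {j // W ≤ U j}) :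
    f.act W m Y i (l ++ [j]) = f.posOn W i l j (Y j []) := by
  rw [Raw.act_apply, hY, ssum_append]
  simp only [hY, map_zero, smul_zero, ssum_zero, ssum, List.append_nil, zero_add,
    List.length_nil, Nat.cast_zero, mul_zero, sgn_zero, one_smul, add_zero]

end

theorem act_twistMap_constOn {M : GMod.{u, v} 𝒜 (⊤ : α)} {M' : GMod.{u, v'} 𝒜 (⊤ : α)}
    (φ : Mor M M' (le_refl ⊤) (le_refl ⊤)) (x : Tot M (le_refl ⊤)) (W : α) :
    (twistMap U φ).raw.act W 0 (constOn U M x W) = constOn U M' (φ.1 x) W := by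
  funext i l
  rcases List.eq_nil_or_concat l with rfl | ⟨l, j, rfl⟩
  · rw [Raw.act_nil]
    have h1 : (((twistMap U φ).zero i.1).restrict i.2).1 = (Tot.up M' le_top i.2).1.comp
        ((φ.restrict le_top).1.comp (Tot.down M le_top i.2).1) := by
      refine (Mor.comp_restrict ..).trans (congrArg₂ AddMonoidHom.comp (Tot.up_restrict ..)
        ((Mor.comp_restrict ..).trans (congrArg₂ AddMonoidHom.comp ?_ (Tot.down_restrict ..))))
      refine AddMonoidHom.ext fun z => Mor.restrict_restrict ..
    refine (DFunLike.congr_fun h1 _).trans ?_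
    refine congrArg (Tot.up M' le_top i.2).1 ?_
    refine (congrArg (φ.restrict le_top).1 (Tot.down_up i.2 _)).trans ?_
    exact Mor.restrict_res φ le_top x
  · rw [List.concat_eq_append, constOn_append,
      Raw.act_append _ _ _ _ (fun i l a => constOn_append M x W i a l)]
    exact DFunLike.congr_fun (Mor.zero_restrict ..) _

theorem shProj_restrict (F : Tw.{u, v} 𝒜 U) (i : ι) (l : List ι) (V W : α) (h : V ≤ cap U i l)
    (h' : W ≤ V) : ((shProj F i l V h).restrict h').1 = (shProj F i l W (h'.trans h)).1 :=
  Tot.hom_ext fun n c b => by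
    rw [Mor.restrict_mk, shProj_mk, shProj_mk, Tot.collapse_res, map_one, ← Tot.collapse_rmul,
      one_mul]

theorem act_counit_constOn (F : Tw.{u, v} 𝒜 U) (y : Tot (shGMod F) (le_refl ⊤)) (W : α) :
    (counit F).raw.act W 0 (constOn U (shGMod F) y W) = wRes F W (shAll F y) := by
  have key : ∀ (i : ι) (l : List ι) (h : W ≤ cap U i l),
      (shProj F i l W h).1 (Tot.res (le_refl ⊤) le_top y) =
        Tot.res (cap_le_head U i l) h (shAll F y i l) := fun i l h => by
    rw [shAll, ← Mor.restrict_res, shProj_restrict, Tot.res_res]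
  funext i l
  rcases List.eq_nil_or_concat l with rfl | ⟨l, j, rfl⟩
  · rw [Raw.act_nil]
    refine Eq.trans ?_ (key i.1 [] i.2)
    refine (DFunLike.congr_fun (Mor.comp_restrict ..) _).trans ?_
    refine (DFunLike.congr_fun (shProj_restrict F i.1 [] (U i.1) W le_rfl i.2) _).trans ?_
    refine congrArg (shProj F i.1 [] W i.2).1 ?_
    exact (DFunLike.congr_fun (Tot.down_restrict ..) _).trans (Tot.down_up i.2 _)
  · rw [List.concat_eq_append, Raw.act_append _ _ _ _ (fun i l a => constOn_append _ y W i a l)]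
    refine Eq.trans ?_ ((key i.1 (l.map Subtype.val ++ [j.1]) (le_cap_map' i l j)).trans
      (wRes_eq F W (shAll F y) i (l ++ [j]) (by simp) _))
    refine (DFunLike.congr_fun (Mor.comp_restrict ..) _).trans ?_
    refine (DFunLike.congr_fun (shProj_restrict F i.1 (l.map Subtype.val ++ [j.1]) _ W le_rfl
      (le_cap_map' i l j)) _).trans ?_
    refine congrArg (shProj F i.1 (l.map Subtype.val ++ [j.1]) W (le_cap_map' i l j)).1 ?_
    exact (DFunLike.congr_fun (Tot.down_restrict ..) _).trans (Tot.down_up j.2 _)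

theorem opOn_constOn (E : QCoh.{u, v} 𝒜 (⊤ : α)) (x : Tot E.toGMod (le_refl ⊤)) (W : α) :
    (twist U E).opOn W (constOn U E.toGMod x W) = constOn U E.toGMod (E.conn x) W := by
  funext i l
  change Raw.deltaOn _ W (constOn U E.toGMod x W) i l +
    (twist U E).raw.act W 1 (constOn U E.toGMod x W) i l = _
  have hd : ∀ l, Raw.deltaOn (twist U E).gmod W (constOn U E.toGMod x W) i l =
      ssum (fun p _ q => sgn (p.length + 1) • constOn U E.toGMod x W i (p ++ q)) l := fun l => rfl
  rcases List.eq_nil_or_concat l with rfl | ⟨l, j, rfl⟩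
  · have h0 : Raw.deltaOn (twist U E).gmod W (constOn U E.toGMod x W) i [] = 0 := rfl
    refine (congrArg₂ (· + ·) h0 (Raw.act_nil ..)).trans ((zero_add _).trans ?_)
    refine (QCoh.restrict_connOn E le_top i.2 _).trans ?_
    refine congrArg (Tot.up E.toGMod le_top i.2).1 ?_
    refine (congrArg (E.connOn _) (Tot.down_up i.2 _)).trans ?_
    rw [E.connOn_res, E.connOn_refl]
  · rw [List.concat_eq_append, constOn_append, hd, ssum_append]
    have e : ssum (fun p (_ : {j // W ≤ U j}) q => sgn (p.length + 1) •
          constOn U E.toGMod x W i (p ++ (q ++ [j]))) l +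
        ssum (fun p (_ : {j // W ≤ U j}) q => sgn ((l ++ p).length + 1) •
          constOn U E.toGMod x W i (l ++ p ++ q)) [j] =
        sgn (l.length + 1) • constOn U E.toGMod x W i l := by
      have : ∀ p q : List {j // W ≤ U j}, constOn U E.toGMod x W i (p ++ (q ++ [j])) = 0 :=
        fun p q => by rw [← List.append_assoc, constOn_append]
      simp only [this, smul_zero, ssum_zero, zero_add, ssum, add_zero, List.append_nil]
    refine (congrArg₂ (fun a b : Tot (E.restrict (le_top : U i.1 ≤ ⊤)).toGMod i.2 => a + b) e
      (Raw.act_append (twist U E).raw W 1 (constOn U E.toGMod x W)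
        (fun i l a => constOn_append _ x W i a l) i j l)).trans ?_
    cases l with
      | nil =>
        have h1 := twistCochain_nil U E.toGMod i.1 j.1 (W := W) (le_cap_map' i [] j)
        have h2 := DFunLike.congr_fun h1 (constOn U E.toGMod x W j [])
        refine (congrArg₂ (· + ·) rfl h2).trans ?_
        have h3 : (Tot.down E.toGMod le_top j.2).1 (constOn U E.toGMod x W j []) =
          Tot.res (le_refl ⊤) le_top x := Tot.down_up j.2 _
        refine (congrArg₂ (· + ·) rfl (congrArg (Tot.up E.toGMod le_top i.2).1 h3)).trans ?_
        change sgn (0 + 1) • (Tot.up E.toGMod le_top i.2).1 (Tot.res (le_refl ⊤) le_top x) +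
          (Tot.up E.toGMod le_top i.2).1 (Tot.res (le_refl ⊤) le_top x) = 0
        rw [zero_add, sgn_one, neg_one_zsmul, neg_add_cancel]
      | cons a l =>
        have h1 := twistCochain_ne_nil U E.toGMod i.1 j.1 ((a :: l).map Subtype.val) (by simp)
          (le_cap_map' i (a :: l) j)
        refine (congrArg₂ (· + ·) (smul_zero _) (DFunLike.congr_fun h1 _)).trans (add_zero _)

theorem opOn_wRes (F : Tw.{u, v} 𝒜 U) (Y : ShTot F) (W : α) :
    F.opOn W (wRes F W Y) = wRes F W (shOp F Y) := by
  funext i l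
  rw [wRes_shOp]
  have h1 : Raw.deltaOn F.gmod W (wRes F W Y) i l =
    ssum (fun p _ q => sgn (p.length + 1) • wRes F W Y i (p ++ q)) l := rfl
  change Raw.deltaOn F.gmod W (wRes F W Y) i l + F.raw.act W 1 (wRes F W Y) i l = _
  rw [h1, Raw.act_apply, one_mul, absOp, add_assoc]
  refine congrArg₂ (· + ·) rfl (congrArg₂ (· + ·) rfl (ssum_congr fun p x q _ => ?_))
  refine congrArg₂ (· • ·) ?_ rfl
  congr 1
  ring

/-- A linear map out of a restricted module which vanishes on global elements is zero. -/
theorem IsLin.eq_zero_of_up_res {V V' W : α} {M : GMod.{u, v} 𝒜 (⊤ : α)} {M' : GMod.{u, v'} 𝒜 V'}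
    {h : W ≤ V} {h' : W ≤ V'} {O : Tot (M.restrict (le_top : V ≤ ⊤)) h →+ Tot M' h'} (hO : IsLin O)
    (h0 : ∀ x, O ((Tot.up M le_top h).1 (Tot.res (le_refl ⊤) le_top x)) = 0) : O = 0 := by
  have h1 : O.comp (Tot.up M le_top h).1 = 0 := Tot.hom_ext fun n e b => by
    have e1 : Tot.mk (M := M) (le_top : W ≤ ⊤) n e b =
        Tot.rmul b (Tot.res (le_refl ⊤) le_top (Tot.mk _ n e 1)) := by
      rw [Tot.res_mk, Tot.rmul_mk, map_one, one_mul]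
    refine (congrArg _ e1).trans ?_
    rw [AddMonoidHom.comp_apply, (Tot.up M le_top h).2, hO, h0, map_zero]
    rfl
  refine AddMonoidHom.ext fun z => ?_
  rw [← Tot.up_down h z]
  exact DFunLike.congr_fun h1 _

theorem Raw.isZero_of_constOn {M : GMod.{u, v} 𝒜 (⊤ : α)} {F : ∀ i, GMod.{u, v'} 𝒜 (U i)}
    {R : Raw U (fun i => M.restrict (le_top : U i ≤ ⊤)) F} (hlin : R.IsLinear) {m : ℤ}
    (hzero : ∀ x W, R.act W m (constOn U M x W) = 0) : R.IsZero := by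
  refine ⟨fun i => ?_, fun i l j => ?_⟩
  · refine IsLin.eq_zero_of_up_res (hlin.zero i (U i) le_rfl) fun x => ?_
    refine (Raw.act_nil R (U i) m (constOn U M x (U i))
      ⟨i, le_rfl⟩).symm.trans ?_
    exact congrFun (congrFun (hzero x _) _) _
  · refine IsLin.eq_zero_of_up_res (hlin.pos i l j _ le_rfl) fun x => ?_
    let W := cap U i (l ++ [j])
    let i' : {j // W ≤ U j} := ⟨i, cap_le_head U i _⟩
    let j' : {j // W ≤ U j} := ⟨j, cap_le_last U i l j⟩
    let l' : List {j // W ≤ U j} := l.pmap Subtype.mk fun k hk =>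
      cap_le_mem (List.mem_cons_of_mem _ (List.mem_append_left _ hk))
    have hl' : l = l'.map Subtype.val := by simp [l', List.map_pmap]
    refine (Raw.posOn_eq R W i' l' j' hl' le_rfl
      (constOn U M x W j' [])).trans ?_
    refine (Raw.act_append R W m (constOn U M x W)
      (fun i l a => constOn_append _ x W i a l) i' j' l').symm.trans ?_
    exact congrFun (congrFun (hzero x _) _) _

theorem twistMap_hasDeg {M : GMod.{u, v} 𝒜 (⊤ : α)} {M' : GMod.{u, v'} 𝒜 (⊤ : α)}
    (φ : Mor M M' (le_refl ⊤) (le_refl ⊤)) {n : ℤ} (hd : IsDeg n φ.1) : (twistMap U φ).HasDeg n :=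
  ⟨fun i => by
    have := (Tot.up_isDeg (M := M') (h := le_top) (le_refl (U i))).comp
      ((Mor.restrict_isDeg φ hd le_top).comp
        (Tot.down_isDeg (M := M) (h := le_top) (le_refl (U i))))
    simp only [add_zero, zero_add] at this
    exact this, fun i l j m x _ => zero_mem _⟩

theorem counit_hasDeg (F : Tw.{u, v} 𝒜 U) : (counit F).HasDeg 0 :=
  ⟨fun i => by
    have := (shProj_isDeg F i [] (U i) le_rfl).comp
      (Tot.down_isDeg (M := shGMod F) (h := le_top) (le_refl (U i)))
    simp only [List.length_nil, Nat.cast_zero, neg_zero, add_zero] at this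
    exact this, fun i l j => by
    have := (shProj_isDeg F i (l ++ [j]) _ le_rfl).comp
      (Tot.down_isDeg (M := shGMod F) (h := le_top) (cap_le_last U i l j))
    rw [show -((l ++ [j]).length : ℤ) + 0 = 0 - (l.length + 1) by
      rw [List.length_append, List.length_singleton]; push_cast; ring] at this
    exact this⟩

theorem counit_comp_hasDeg (F : Tw.{u, v} 𝒜 U) {M : GMod.{u, v'} 𝒜 (⊤ : α)}
    (φ : Mor M (shGMod F) (le_refl ⊤) (le_refl ⊤)) (hd : IsDeg 0 φ.1) :
    ((counit F).comp 0 (twistMap U φ)).HasDeg 0 := by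
  have hdeg := (Coch.raw_hasDeg (counit_hasDeg F)).mul (Coch.raw_hasDeg (twistMap_hasDeg (U := U) φ hd))
    (add_zero 0)
  exact ⟨fun i => hdeg.zero i _ _, fun i l j => hdeg.pos i l j _ _⟩

theorem act_counit_comp_constOn (F : Tw.{u, v} 𝒜 U) {M : GMod.{u, v'} 𝒜 (⊤ : α)}
    (φ : Mor M (shGMod F) (le_refl ⊤) (le_refl ⊤)) (x : Tot M (le_refl ⊤)) (W : α) :
    ((counit F).comp 0 (twistMap U φ)).raw.act W 0 (constOn U M x W) =
      wRes F W (shAll F (φ.1 x)) := by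
  have h1 := Raw.act_mul 0 0 (counit F).raw (twistMap U φ).raw W
  rw [add_zero] at h1
  rw [Coch.comp_raw]
  refine (DFunLike.congr_fun h1 _).trans ?_
  rw [AddMonoidHom.comp_apply, act_twistMap_constOn, act_counit_constOn]

theorem act_dRaw_constOn (F : Tw.{u, v} 𝒜 U) (E : QCoh.{u, v'} 𝒜 (⊤ : α))
    (f : Raw U (fun i => E.toGMod.restrict (le_top : U i ≤ ⊤)) F.gmod) (W : α) (x : Tot E.toGMod (le_refl ⊤))
    (h : F.opOn W (f.act W 0 (constOn U E.toGMod x W)) = f.act W 0 (constOn U E.toGMod (E.conn x) W)) :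
    Raw.act (E := fun i => E.toGMod.restrict (le_top : U i ≤ ⊤)) (F := F.gmod)
      (Tw.dRaw (twist U E) F 0 f) W (0 + 1) (constOn U E.toGMod x W) = 0 := by
  refine (DFunLike.congr_fun (Tw.act_dRaw (twist U E) F 0 f W) _).trans ?_
  rw [sgn_zero, one_smul]
  refine sub_eq_zero.2 (h.trans ?_)
  exact (congrArg (f.act W 0) (opOn_constOn E x W)).symm

/-- The morphism of twisted complexes corresponding to a closed morphism of degree zero into the
sheafification is closed. -/
theorem isClosed_counit_comp (fr : Frame 𝒜) (F : Tw.{u, v} 𝒜 U) (E : QCoh.{u, v'} 𝒜 (⊤ : α))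
    (φ : Mor E.toGMod (shGMod F) (le_refl ⊤) (le_refl ⊤)) (hd : IsDeg 0 φ.1)
    (hφ : ∀ x, shConn fr F (φ.1 x) = φ.1 (E.conn x)) :
    Tw.IsClosed (E := twist U E) (F := F) ((counit F).comp 0 (twistMap U φ)) := by
  have hD := counit_comp_hasDeg (U := U) F φ hd
  have hlin := Tw.dRaw_isLinear fr (twist U E) F
    (Coch.raw_isLinear ((counit F).comp 0 (twistMap U φ))) (Coch.raw_hasDeg hD)
  have hz := Raw.isZero_of_constOn (M := E.toGMod) (m := 0 + 1) hlin fun x W => by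
    have h3 := opOn_wRes F (shAll F (φ.1 x)) W
    rw [← shAll_conn fr, hφ] at h3
    exact act_dRaw_constOn F E ((counit F).comp 0 (twistMap U φ)).raw W x
      ((congrArg (F.opOn W) (act_counit_comp_constOn F φ x W)).trans
        (h3.trans (act_counit_comp_constOn F φ (E.conn x) W).symm))
  exact ⟨hD, hz⟩

end CounitClosed

section DolbeaultFine

open Forms Filter TopologicalSpace
open scoped Topology

variable {n : ℕ} {X : Type u} [TopologicalSpace X] [ChartedSpace (Cn n) X]

theorem FunSmoothAt.sum {κ : Type*} (t : Finset κ) {f : κ → X → ℂ} {x : X}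
    (hf : ∀ k ∈ t, FunSmoothAt n (f k) x) : FunSmoothAt n (fun y => ∑ k ∈ t, f k y) x :=
  fun c hc hx => ContDiffAt.sum fun k hk => hf k hk c hc hx

theorem funSmoothAt_zero_of_eventually {f : X → ℂ} {x : X} (h : ∀ᶠ y in 𝓝 x, f y = 0) :
    FunSmoothAt n f x :=
  FunSmoothAt.congr (a := fun _ => 0) (fun c hc hx => contDiffAt_const) (by
    filter_upwards [h] with y hy using hy.symm)

variable [IsManifold 𝓘(ℂ, Cn n) ω X]

/-- Bump functions with support in a given neighbourhood. -/
theorem exists_bump_subset [T2Space X] {x : X} {O : Set X} (hO : O ∈ 𝓝 x) :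
    ∃ β : X → ℝ, (∀ᶠ y in 𝓝 x, β y ≠ 0) ∧
      (∀ y, FunSmoothAt n (fun y => (β y : ℂ)) y) ∧ ∀ y ∉ O, ∀ᶠ y' in 𝓝 y, β y' = 0 := by
  classical
  set c := chartAt (Cn n) x with hc
  have hx : x ∈ c.source := mem_chart_source _ x
  have hO' : c.symm ⁻¹' O ∈ 𝓝 (c x) :=
    (c.symm.continuousAt (c.map_source hx)).preimage_mem_nhds (by
      rw [c.left_inv hx]; exact hO)
  obtain ⟨r, hr, hrc⟩ := Metric.nhds_basis_closedBall.mem_iff.1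
    (inter_mem (c.open_target.mem_nhds (c.map_source hx)) hO')
  let φ : ContDiffBump (c x) := ⟨r / 2, r, half_pos hr, half_lt_self hr⟩
  let K : Set X := c.symm '' Metric.closedBall (c x) r
  have hK : IsClosed K :=
    ((isCompact_closedBall (c x) r).image_of_continuousOn
      (c.continuousOn_symm.mono fun z hz => (hrc hz).1)).isClosed
  have hKs : K ⊆ c.source := by
    rintro _ ⟨z, hz, rfl⟩
    exact c.map_target (hrc hz).1
  have hKO : K ⊆ O := by
    rintro _ ⟨z, hz, rfl⟩
    exact (hrc hz).2
  let β : X → ℝ := fun y => if y ∈ c.source then φ (c y) else 0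
  have hβK : ∀ y, y ∉ K → β y = 0 := by
    intro y hy
    by_cases hys : y ∈ c.source
    · simp only [β, hys, if_true]
      refine φ.zero_of_le_dist ?_
      by_contra hlt
      refine hy ⟨c y, Metric.mem_closedBall.2 (not_le.1 hlt).le, c.left_inv hys⟩
    · simp only [β, hys, if_false]
  have hβ0 : ∀ y, y ∉ K → ∀ᶠ y' in 𝓝 y, β y' = 0 := fun y hy => by
    filter_upwards [hK.isOpen_compl.mem_nhds hy] with y' hy' using hβK y' hy'
  refine ⟨β, ?_, fun y => ?_, fun y hy => hβ0 y fun h => hy (hKO h)⟩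
  · have h1 : ∀ᶠ y in 𝓝 x, c y ∈ Metric.ball (c x) (r / 2) :=
      (c.continuousAt hx).eventually (Metric.ball_mem_nhds _ (half_pos hr))
    filter_upwards [h1, c.open_source.mem_nhds hx] with y hy hys
    have : φ (c y) = 1 := φ.one_of_mem_closedBall (Metric.ball_subset_closedBall hy)
    simp only [β, hys, if_true, this]
    norm_num
  · by_cases hy : y ∈ c.source
    · intro c' hc' hy'
      have h1 := (trans_contDiffAt hc' (chart_mem_atlas (Cn n) x) hy' hy)
      have h2 : ContDiffAt ℝ ∞ (fun z => (φ (c (c'.symm z)) : ℂ)) (c' y) :=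
        (Complex.ofRealCLM.contDiff.contDiffAt.comp _ (φ.contDiffAt (x := c (c'.symm (c' y))))).comp
          (c' y) ((h1.of_le le_top).restrict_scalars ℝ)
      refine h2.congr_of_eventuallyEq ?_
      filter_upwards [eventually_symm hy' (c.open_source.mem_nhds hy)] with z hz
      have hz2 : c'.symm z ∈ c.source := hz.2
      simp only [β, hz2, if_true]
    · refine funSmoothAt_zero_of_eventually ?_
      filter_upwards [hβ0 y fun h => hy (hKs h)] with y' hy'
      simp [hy']

/-- Smooth partitions of unity on a compact manifold. -/
theorem exists_partition [T2Space X] [CompactSpace X] {κ : Type*} (O : κ → Set X)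
    (hO : ∀ k, IsOpen (O k)) (hc : ∀ x, ∃ k, x ∈ O k) :
    ∃ (s : Finset κ) (σ : κ → X → ℂ), (∀ k y, FunSmoothAt n (σ k) y) ∧
      (∀ y, ∑ k ∈ s, σ k y = 1) ∧ ∀ k, ∀ y ∉ O k, ∀ᶠ y' in 𝓝 y, σ k y' = 0 := by
  classical
  choose k hk using hc
  choose β h1 h2 h3 using fun x => exists_bump_subset (n := n) ((hO (k x)).mem_nhds (hk x))
  obtain ⟨t, ht⟩ := CompactSpace.elim_nhds_subcover (fun x => {y | β x y ≠ 0}) h1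
  have hne : ∀ y, ∑ x ∈ t, (β x y : ℂ) * β x y ≠ 0 := by
    intro y
    have hy : y ∈ ⋃ x ∈ t, {y | β x y ≠ 0} := ht ▸ Set.mem_univ y
    simp only [Set.mem_iUnion] at hy
    obtain ⟨x, hx, hy⟩ := hy
    have h1 : 0 < ∑ x ∈ t, β x y * β x y :=
      Finset.sum_pos' (fun j _ => mul_self_nonneg _) ⟨x, hx, mul_self_pos.2 hy⟩
    exact_mod_cast h1.ne'
  refine ⟨t.image k, fun j y => (∑ x ∈ t with k x = j, (β x y : ℂ) * β x y) *
    (∑ x ∈ t, (β x y : ℂ) * β x y)⁻¹, fun j y => ?_, fun y => ?_, fun j y hy => ?_⟩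
  · refine FunSmoothAt.mul (FunSmoothAt.sum _ fun x _ => (h2 x y).mul (h2 x y)) fun c hc hx => ?_
    refine ContDiffAt.inv (FunSmoothAt.sum t (fun x _ => (h2 x y).mul (h2 x y)) c hc hx) ?_
    rw [c.left_inv hx]
    exact hne y
  · rw [← Finset.sum_mul, Finset.sum_fiberwise_of_maps_to fun x hx => Finset.mem_image_of_mem k hx]
    exact mul_inv_cancel₀ (hne y)
  · have h : ∀ᶠ y' in 𝓝 y, ∀ x ∈ t.filter (k · = j), β x y' = 0 := by
      rw [Finset.eventually_all]
      intro x hx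
      exact h3 x y (by rw [(Finset.mem_filter.1 hx).2]; exact hy)
    filter_upwards [h] with y' hy'
    rw [Finset.sum_eq_zero fun x hx => by rw [hy' x hx]; simp, zero_mul]

theorem funRes_surjective [T2Space X] [CompactSpace X] {V W : Opens X} (h : V ≤ W) :
    Function.Surjective (funRes (n := n) h) := by
  intro a
  obtain ⟨f, hf, rfl⟩ := exists_mkFun a
  obtain ⟨O, hO, hVO, hfO⟩ := mem_nhdsSet_iff_exists.1 hf
  obtain ⟨s, σ, hσ, hs, h0⟩ := exists_partition (n := n)
    (fun b : Bool => if b then O else (closure (V : Set X))ᶜ)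
    (by rintro (_ | _); exacts [isClosed_closure.isOpen_compl, hO])
    (fun x => by
      by_cases hx : x ∈ closure (V : Set X)
      · exact ⟨true, hVO hx⟩
      · exact ⟨false, hx⟩)
  let χ : X → ℂ := fun y => ∑ b ∈ s, if b then σ b y else 0
  have hχ : ∀ y, FunSmoothAt n χ y := fun y => FunSmoothAt.sum s fun b _ => by
    cases b
    · exact funSmoothAt_zero_of_eventually (Eventually.of_forall fun _ => rfl)
    · exact hσ true y
  have hsm : ∀ y, FunSmoothAt n (fun y => χ y * f y) y := by
    intro y
    by_cases hy : y ∈ O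
    · exact (hχ y).mul (hfO hy)
    · refine funSmoothAt_zero_of_eventually ?_
      filter_upwards [h0 true y hy] with y' hy'
      have : χ y' = 0 := Finset.sum_eq_zero fun b _ => by cases b <;> simp [hy']
      rw [this, zero_mul]
  refine ⟨mkFun (fun y => χ y * f y) (Eventually.of_forall hsm),
    Subtype.ext (Germ.coe_eq.2 ?_)⟩
  refine eventually_nhdsSet_iff_forall.2 fun x hx => ?_
  filter_upwards [h0 false x (fun h => h hx)] with y hy
  have : χ y = 1 := by
    rw [← hs y]
    exact Finset.sum_congr rfl fun b _ => by cases b <;> simp [hy]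
  change χ y * f y = f y
  rw [this, one_mul]

theorem nonempty_fine_dolbeault [T2Space X] [CompactSpace X] {ι : Type w} (U : ι → Opens X)
    (hU : ⨆ i, U i = ⊤) : Nonempty (Fine (dolbeault n X) U) := by
  obtain ⟨s, σ, hσ, hs, h0⟩ := exists_partition (n := n) (fun i => (U i : Set X))
    (fun i => (U i).isOpen) fun x => Opens.mem_iSup.1 (hU ▸ Opens.mem_top x)
  refine ⟨⟨fun h => funRes_surjective h, s, fun k => mkFun (σ k) (Eventually.of_forall (hσ k)),
    ?_, ?_⟩⟩
  · have h1 : ∑ k ∈ s, (mkFun (σ k) (Eventually.of_forall (hσ k)) : smoothGerms n (⊤ : Opens X)) =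
        mkFun (fun y => ∑ k ∈ s, σ k y)
          (Eventually.of_forall fun y => FunSmoothAt.sum s fun k _ => hσ k y) := by
      clear hs
      classical
      induction s using Finset.induction_on with
      | empty => exact Subtype.ext (Germ.coe_eq.2 (Eventually.of_forall fun y => rfl))
      | insert a s ha ih =>
        rw [Finset.sum_insert ha, ih]
        exact Subtype.ext (Germ.coe_eq.2 (Eventually.of_forall fun y =>
          (Finset.sum_insert (f := fun k => σ k y) ha).symm))
    exact h1.trans (Subtype.ext (Germ.coe_eq.2 (Eventually.of_forall hs)))
  · intro k W a ha
    obtain ⟨f, hf, rfl⟩ := exists_mkFun (n := n) a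
    have ha : ∀ᶠ y in 𝓝ˢ (closure ((W ⊓ U k : Opens X) : Set X)), f y = 0 :=
      Germ.coe_eq.1 (congrArg Subtype.val ha)
    refine Subtype.ext (Germ.coe_eq.2 ?_)
    refine eventually_nhdsSet_iff_forall.2 fun x hx => ?_
    by_cases hxk : x ∈ U k
    · have hx' : x ∈ closure ((W ⊓ U k : Opens X) : Set X) := by
        have := (U k).isOpen.inter_closure ⟨hxk, hx⟩
        rwa [Set.inter_comm] at this
      filter_upwards [eventually_nhdsSet_iff_forall.1 ha x hx'] with y hy
      exact (congrArg (σ k y * ·) hy).trans (mul_zero _)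
    · filter_upwards [h0 k x hxk] with y hy
      exact (congrArg (· * f y) hy).trans (zero_mul _)

end DolbeaultFine

end Cohesive

theorem proposition5p1 {n : ℕ} {X : Type u} [TopologicalSpace X] [T2Space X] [CompactSpace X]
    [ChartedSpace (EuclideanSpace ℂ (Fin n)) X]
    [IsManifold 𝓘(ℂ, EuclideanSpace ℂ (Fin n)) ω X]
    {ι : Type w} (U : ι → TopologicalSpace.Opens X) (hU : ⨆ i, U i = ⊤)
    (hlf : LocallyFinite fun i => (U i : Set X))
    (F : Cohesive.Tw.{u, v} (Cohesive.dolbeault n X) U) (hF : F.IsCohesive) :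
    ∃ (E : Cohesive.QCoh.{u, u} (Cohesive.dolbeault n X) ⊤)
      (φ : Cohesive.Mor E.toGMod
        (Cohesive.sheafify (Cohesive.dolbeaultFrame n X) F).toGMod le_rfl le_rfl),
      E.IsCohesive ∧
      Cohesive.QCoh.IsQuasiIso (E := E)
        (F := Cohesive.sheafify (Cohesive.dolbeaultFrame n X) F) φ ∧
      Cohesive.Tw.IsHomotopyEquiv (E := Cohesive.twist U E) (F := F)
        ((Cohesive.counit F).comp 0 (Cohesive.twistMap U φ)) := by
  obtain ⟨fi⟩ := Cohesive.nonempty_fine_dolbeault (n := n) U hU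
  let fr := Cohesive.dolbeaultFrame n X
  obtain ⟨P⟩ := Cohesive.nonempty_perfModel.{u, v, u, max v w, w} (Cohesive.sheafifyAtlas fi fr F) hF
  obtain ⟨R⟩ := Cohesive.nonempty_resolution fr P
  have hcl := Cohesive.isClosed_counit_comp fr F R.E R.φ R.φ_deg
    fun x => DFunLike.congr_fun R.φ_conn x
  have hq := R.isQuasiIso fr
  have hc := Cohesive.exists_counit_contraction fi fr F R
  exact ⟨R.E, R.φ, R.coh, hq, Cohesive.Tw.isHomotopyEquiv_of_contractible fr _ hcl hc⟩
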